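/- \textbf{Setting.} Let $\Theta\subset\mathbb{R}^{p}$ be open and, for each $\theta\in\Theta$, let $Y_\theta$ be a random (column) vector in $\mathbb{R}^{m}$. For row vectors $s$ put $M_0(s;\theta)=\mathbb{E}(e^{sY_\theta})$ and $K_0(s;\theta)=\log M_0(s;\theta)$ on $\mathcal{S}=\{(s,\theta):\theta\in\Theta,\ \mathbb{E}(e^{sY_\theta})<\infty\}$, and let $M_0(s+\mathrm{i}\phi;\theta)=\mathbb{E}(e^{(s+\mathrm{i}\phi)Y_\theta})$ for $(s,\theta)\in\mathcal{S}$, $\phi\in\mathbb{R}^{1\times m}$. Primes denote gradients and Hessians in $s$, and $\nabla_s\nabla_\theta K_0$ is the $m\times p$ matrix with entries $\partial^2K_0/\partial s_i\partial\theta_j$. Assume: (a) (decay) there is a continuous $\delta:\operatorname{int}\mathcal{S}\to(0,\infty)$ such that $$\left|\frac{M_0(s+\mathrm{i}\phi;\theta)}{M_0(s;\theta)}\right|\le\bigl(1+\delta(s,\theta)|\phi|^2\bigr)^{-\delta(s,\theta)}\quad\text{for all }\phi\in\mathbb{R}^{1\times m},\ (s,\theta)\in\operatorname{int}\mathcal{S};$$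 (b) (growth) there is a continuous $\gamma:\operatorname{int}\mathcal{S}\to(0,\infty)$ such that, for $k\in\{0,1\}$, $1\le k+\ell\le 6$ and for $k=2$, $0\le\ell\le 2$, and for all choices of indices, the partial derivatives $\frac{\partial^{k+\ell}M_0}{\partial\theta_{i_1}\cdots\partial\theta_{i_k}\partial s_{j_1}\cdots\partial s_{j_\ell}}(s+\mathrm{i}\phi;\theta)$ exist for all $(s,\theta)\in\operatorname{int}\mathcal{S}$ and $\phi\in\mathbb{R}^{1\times m}$, are continuous in $(s,\phi,\theta)$, and are bounded in absolute value by $\gamma(s,\theta)(1+|\phi|)^{\gamma(s,\theta)}$. For $n\in\mathbb{N}$ let $X$ be the sum of $n$ i.i.d. copies of $Y_\theta$, with cumulant generating function $K=nK_0$. The likelihood $L(\theta;x)$ is the value at $x$ of the continuous density of $X$, and the saddlepoint likelihood is $$\hat L(\theta;x)=\frac{\exp\bigl(K(\hat s;\theta)-\hat s x\bigr)}{\sqrt{\det\bigl(2\pi K''(\hat s;\theta)\bigr)}},$$ where $\hat s=\hat s(\theta;x)$, the saddlepoint, is the solution of $K'(\hat s;\theta)=x$. (Both functions depend on $n$.)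 \textbf{Theorem (MLE error bound, fully identifiable case).} Let $(s_0,\theta_0)\in\operatorname{int}\mathcal{S}$ and $y_0=K_0'(s_0;\theta_0)$. Suppose that $\nabla_\theta K_0(s_0;\theta_0)=0$ and that $$H=\nabla_\theta^T\nabla_\theta K_0-(\nabla_s\nabla_\theta K_0)^T(K_0'')^{-1}(\nabla_s\nabla_\theta K_0)\quad\text{at }(s_0,\theta_0)$$ is negative definite. Then there are $n_0\in\mathbb{N}$, open neighbourhoods $U\subset\Theta$ of $\theta_0$ and $V\subset\mathbb{R}^{m}$ of $y_0$, and a constant $C$ such that for all $n\ge n_0$ and $y\in V$, with $x=ny$: for every $\theta\in U$ the continuous density of $X$ exists, and the saddlepoint $\hat s=\hat s(\theta;x)$ exists, is unique, and satisfies $(\hat s,\theta)\in\operatorname{int}\mathcal{S}$ with $K''(\hat s;\theta)$ positive definite, so that $L(\theta;x)$ and $\hat L(\theta;x)$ are defined; each of the functions $\theta\mapsto\hat L(\theta;x)$ and $\theta\mapsto L(\theta;x)$ has a unique local maximiser in $U$; and, writing these as $\hat\theta(x)$ and $\theta(x)$, $$|\hat\theta(x)-\theta(x)|\le\frac{C}{n^2}.$$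 -/

import Mathlib

open MeasureTheory Filter Topology

noncomputable section

namespace Saddlepoint

/-- Column vectors `x` and (row) dual vectors `s` of dimension `m` are both represented by
Euclidean vectors, and the scalar `s x` by their inner product. -/
abbrev Vec (m : ℕ) : Type := EuclideanSpace ℝ (Fin m)

/-! ### Generating functions, saddlepoint, likelihood and saddlepoint likelihood of a law `ν` -/

/-- The set of real `s` with `E(exp(s X)) < ∞`, where `X` has law `ν`. -/
def mgfDomain {m : ℕ} (ν : Measure (Vec m)) : Set (Vec m) :=
  {s | Integrable (fun x => Real.exp (inner ℝ s x)) ν}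

/-- The moment generating function `M(s + i φ) = E(exp((s + i φ) X))` at a complex argument. -/
def complexMgf {m : ℕ} (ν : Measure (Vec m)) (s φ : Vec m) : ℂ :=
  ∫ x, Complex.exp ((inner ℝ s x : ℝ) + (inner ℝ φ x : ℝ) * Complex.I) ∂ν

/-- The moment generating function `M(s) = E(exp(s X))`. -/
def mgf {m : ℕ} (ν : Measure (Vec m)) (s : Vec m) : ℝ :=
  ∫ x, Real.exp (inner ℝ s x) ∂ν

/-- The cumulant generating function `K = log M`. -/
def cgf {m : ℕ} (ν : Measure (Vec m)) (s : Vec m) : ℝ :=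
  Real.log (mgf ν s)

/-- The `i`-th partial derivative. -/
def partialDeriv {d : ℕ} (i : Fin d) (f : Vec d → ℝ) (x : Vec d) : ℝ :=
  lineDeriv ℝ f x (EuclideanSpace.single i 1)

/-- The Hessian matrix, with entries `∂²f / ∂xᵢ ∂xⱼ`. -/
def hessian {d : ℕ} (f : Vec d → ℝ) (x : Vec d) : Matrix (Fin d) (Fin d) ℝ :=
  Matrix.of fun i j => partialDeriv i (fun z => partialDeriv j f z) x

/-- `s` solves the saddlepoint equation `K'(s) = x`, `s` in the domain of `K`. At boundary points
of the domain the derivative is taken relative to the domain. -/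
def IsSaddlepoint {m : ℕ} (ν : Measure (Vec m)) (x s : Vec m) : Prop :=
  s ∈ mgfDomain ν ∧ HasGradientWithinAt (cgf ν) x (mgfDomain ν) s

open Classical in
/-- The saddlepoint `ŝ(x)`, with the value `0` if the saddlepoint equation has no solution. -/
def saddlepoint {m : ℕ} (ν : Measure (Vec m)) (x : Vec m) : Vec m :=
  if h : ∃ s, IsSaddlepoint ν x s then h.choose else 0

/-- The saddlepoint approximation
`exp(K(ŝ) - ŝ x) / √(det(2π K''(ŝ)))`, `ŝ = ŝ(x)`, to the density of `ν` at `x`. -/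
def saddlepointDensity {m : ℕ} (ν : Measure (Vec m)) (x : Vec m) : ℝ :=
  Real.exp (cgf ν (saddlepoint ν x) - inner ℝ (saddlepoint ν x) x) /
    Real.sqrt (((2 * Real.pi) • hessian (cgf ν) (saddlepoint ν x)).det)

/-- `f` is a continuous density of `ν` with respect to Lebesgue measure. -/
def IsContDensity {m : ℕ} (ν : Measure (Vec m)) (f : Vec m → ℝ) : Prop :=
  Continuous f ∧ (∀ x, 0 ≤ f x) ∧ ν = volume.withDensity (fun x => ENNReal.ofReal (f x))

open Classical in
/-- The continuous density of `ν`, with the value `0` if there is none. -/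
def contDensity {m : ℕ} (ν : Measure (Vec m)) : Vec m → ℝ :=
  if h : ∃ f, IsContDensity ν f then h.choose else 0

/-- A continuous density is unique. -/
theorem IsContDensity.eq_contDensity {m : ℕ} {ν : Measure (Vec m)} {f : Vec m → ℝ}
    (hf : IsContDensity ν f) : contDensity ν = f := by
  have h : ∃ f, IsContDensity ν f := ⟨f, hf⟩
  have hg : IsContDensity ν (contDensity ν) := by
    unfold contDensity
    rw [dif_pos h]
    exact h.choose_spec
  have hmeas : ∀ g : Vec m → ℝ, Continuous g → Measurable fun x => ENNReal.ofReal (g x) :=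
    fun g hc => hc.measurable.ennreal_ofReal
  have hae : (fun x => ENNReal.ofReal (contDensity ν x)) =ᵐ[volume]
      fun x => ENNReal.ofReal (f x) :=
    (withDensity_eq_iff_of_sigmaFinite (hmeas _ hg.1).aemeasurable
      (hmeas _ hf.1).aemeasurable).1 (hg.2.2.symm.trans hf.2.2)
  have hae' : contDensity ν =ᵐ[volume] f := by
    filter_upwards [hae] with x hx
    exact (ENNReal.ofReal_eq_ofReal_iff (hg.2.1 x) (hf.2.1 x)).1 hx
  exact Continuous.ae_eq_iff_eq volume hg.1 hf.1 |>.1 hae'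

/-- The law of `Y⁽¹⁾ + ⋯ + Y⁽ⁿ⁾`, where the summands are i.i.d. with law `μ`. -/
def sumLaw {m : ℕ} (μ : Measure (Vec m)) (n : ℕ) : Measure (Vec m) :=
  (Measure.pi fun _ : Fin n => μ).map fun w => ∑ i, w i

/-! ### The parametric model

`Θ ⊆ ℝᵖ` is the parameter domain and `μ θ` is the law of `Y_θ` for `θ ∈ Θ`. -/

/-- The set `𝒮` of pairs `(s, θ)` with `θ ∈ Θ` and `E(exp(s Y_θ)) < ∞`. -/
def modelDomain {m p : ℕ} (Θ : Set (Vec p)) (μ : Vec p → Measure (Vec m)) :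
    Set (Vec m × Vec p) :=
  {z | z.2 ∈ Θ ∧ z.1 ∈ mgfDomain (μ z.2)}

/-- The likelihood `L(θ; x)` of the sum of `n` i.i.d. copies of `Y_θ`. -/
def likelihood {m p : ℕ} (μ : Vec p → Measure (Vec m)) (n : ℕ) (x : Vec m) (θ : Vec p) : ℝ :=
  contDensity (sumLaw (μ θ) n) x

/-- The saddlepoint likelihood `L̂(θ; x)` of the sum of `n` i.i.d. copies of `Y_θ`. -/
def saddlepointLikelihood {m p : ℕ} (μ : Vec p → Measure (Vec m)) (n : ℕ) (x : Vec m)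
    (θ : Vec p) : ℝ :=
  saddlepointDensity (sumLaw (μ θ) n) x

/-- The decay bound on `M₀`. -/
def DecayBound {m p : ℕ} (Θ : Set (Vec p)) (μ : Vec p → Measure (Vec m)) : Prop :=
  ∃ δ : Vec m × Vec p → ℝ,
    ContinuousOn δ (interior (modelDomain Θ μ)) ∧
    ∀ z ∈ interior (modelDomain Θ μ), 0 < δ z ∧
      ∀ φ : Vec m, ‖complexMgf (μ z.2) z.1 φ / (mgf (μ z.2) z.1 : ℂ)‖ ≤
        (1 + δ z * ‖φ‖ ^ 2) ^ (-(δ z))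

/-- Iterated directional derivatives; the last vector of the list is applied first. -/
def iterLineDeriv {E : Type*} [NormedAddCommGroup E] [NormedSpace ℝ E] (F : E → ℂ) :
    List E → E → ℂ
  | [] => F
  | v :: vs => fun z => lineDeriv ℝ (iterLineDeriv F vs) z v

/-- Existence at `z` of the iterated directional derivatives computed by `iterLineDeriv`. -/
def IterLineDifferentiableAt {E : Type*} [NormedAddCommGroup E] [NormedSpace ℝ E] (F : E → ℂ) :
    List E → E → Prop
  | [], _ => True
  | v :: vs, z =>
      IterLineDifferentiableAt F vs z ∧ LineDifferentiableAt ℝ (iterLineDeriv F vs) z v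

/-- The function `(s, φ, θ) ↦ M₀(s + i φ; θ)`. -/
def modelMgf {m p : ℕ} (μ : Vec p → Measure (Vec m)) : Vec m × Vec m × Vec p → ℂ :=
  fun z => complexMgf (μ z.2.2) z.1 z.2.1

/-- The directions of the partial derivatives
`∂^(k+ℓ) / ∂θ_{i₁} ⋯ ∂θ_{i_k} ∂s_{j₁} ⋯ ∂s_{j_ℓ}`. As `M₀` is holomorphic in `s + i φ`, its
derivative with respect to the complex variable `s_j` is the derivative in the real direction. -/
def directions {m p : ℕ} (is : List (Fin p)) (js : List (Fin m)) :
    List (Vec m × Vec m × Vec p) :=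
  is.map (fun i => (0, 0, EuclideanSpace.single i 1)) ++
    js.map (fun j => (EuclideanSpace.single j 1, 0, 0))

/-- The growth bound on the partial derivatives of `M₀`, with `k` derivatives in `θ` and `ℓ`
derivatives in `s`, where `k ∈ {0, 1}`, `1 ≤ k + ℓ ≤ 6`, or `k = 2`, `0 ≤ ℓ ≤ 2`: they exist,
are continuous in all variables, and grow at most polynomially in `φ`. -/
def GrowthBound {m p : ℕ} (Θ : Set (Vec p)) (μ : Vec p → Measure (Vec m)) : Prop :=
  ∃ γ : Vec m × Vec p → ℝ,
    ContinuousOn γ (interior (modelDomain Θ μ)) ∧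
    (∀ z ∈ interior (modelDomain Θ μ), 0 < γ z) ∧
    ∀ (is : List (Fin p)) (js : List (Fin m)),
      ((is.length ≤ 1 ∧ 1 ≤ is.length + js.length ∧ is.length + js.length ≤ 6) ∨
        (is.length = 2 ∧ js.length ≤ 2)) →
      (∀ s φ θ, (s, θ) ∈ interior (modelDomain Θ μ) →
        IterLineDifferentiableAt (modelMgf μ) (directions is js) (s, φ, θ) ∧
        ‖iterLineDeriv (modelMgf μ) (directions is js) (s, φ, θ)‖ ≤
          γ (s, θ) * (1 + ‖φ‖) ^ (γ (s, θ))) ∧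
      ContinuousOn (iterLineDeriv (modelMgf μ) (directions is js))
        {z | (z.1, z.2.2) ∈ interior (modelDomain Θ μ)}

/-- The `m × p` matrix `∇_s ∇_θ K₀(s; θ)`, with entries `∂²K₀ / ∂sᵢ ∂θⱼ`. -/
def mixedHessian {m p : ℕ} (μ : Vec p → Measure (Vec m)) (s : Vec m) (θ : Vec p) :
    Matrix (Fin m) (Fin p) ℝ :=
  Matrix.of fun i j =>
    partialDeriv i (fun s' => partialDeriv j (fun θ' => cgf (μ θ') s') θ) s

/-- The matrix
`H = ∇_θᵀ∇_θ K₀ - (∇_s∇_θ K₀)ᵀ (K₀'')⁻¹ (∇_s∇_θ K₀)` at `(s, θ)`. -/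
def rateHessian {m p : ℕ} (μ : Vec p → Measure (Vec m)) (s : Vec m) (θ : Vec p) :
    Matrix (Fin p) (Fin p) ℝ :=
  hessian (fun θ' => cgf (μ θ') s) θ -
    (mixedHessian μ s θ).transpose * (hessian (cgf (μ θ)) s)⁻¹ * mixedHessian μ s θ

end Saddlepoint

end

set_option linter.unusedSectionVars false

/-! ### Calculus along lines -/

section LineCalculus

variable {E F : Type*} [NormedAddCommGroup E] [NormedSpace ℝ E] [NormedAddCommGroup F]
  [NormedSpace ℝ F]

/-! Tilt the law of `X` by the saddlepoint and invert the Fourier transform. At `x = ny` both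
likelihoods then carry the same exponential factor: `L = exp(n r) k Iₙ` and `L̂ = exp(n r) k G`.
Here `r(θ, y) = K₀(ŝ; θ) - ŝ y`, the number `k` depends on `n` and `m` only, `ρ` is the
characteristic function of `Y_θ` tilted by `ŝ` and centred at `y`, `Iₙ = n^(m/2) ∫ Re ρⁿ`, and `G =
∫ exp(-a/2)` with `a` the quadratic form of `K₀''` (`likelihood_eq`, `saddlepointLikelihood_eq`).
The task is therefore to compare the local maximisers of `r + (log Iₙ)/n` and `r + (log G)/n`.

The leading term `r` is common to both. By the envelope theorem its `θ`-gradient is `∇_θ K₀` at the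
saddlepoint, which vanishes at `(θ₀, y₀)`, and its Hessian there is the Schur complement `H`
(`fderiv_chartRate`, `fderiv_fderiv_chartRate`). Hence `r` is uniformly strongly concave in `θ` on a
ball, for all `y` near `y₀`. The perturbations do not spoil this, since the second derivatives of
`Iₙ` are `O(√n)` and are divided by `n`. Strong concavity yields existence and uniqueness of the
maximisers and turns a gradient difference `ε` into a distance at most `ε/κ`
(`StronglyConcaveOnBall.norm_sub_le`). The gradients differ by `1/n` times the difference of the
logarithmic derivatives of `Iₙ` and `G`. So the rate `1/n²` follows once `Iₙ - G` and its
`θ`-derivatives are `O(1/n)`, uniformly in `(θ, y)` (`LaplaceFamily.exists_bounds`).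

For that estimate, near `φ = 0` the real part of `ρ` is `1 - a/2 + O(|φ|⁴)` and its imaginary part
is `O(|φ|³)`. The density being real, only real parts of powers of `ρ` matter, so the cubic term
enters squared. The errors are of the form `n |φ|⁴` and `n² |φ|⁶`, and each has size `1/n` on the
scale `|φ| ~ n^(-1/2)`. The derivative of `ρ` in `θ`, at fixed `y`, has an expansion of the same
kind because the normalisation and the centring persist. The decay bound dominates the integrals. It
also forces `a ≥ 2 δ² |φ|²`, so `K₀''` is positive definite, the saddlepoint is a `C²` function of
`(θ, y)` by the inverse function theorem, and it is unique by convexity.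

The growth bound supplies directional derivatives in one prescribed order only.
`HasLineDerivAt.of_swap` reorders them, and the Cauchy-Riemann equations supply the derivatives in
`φ`. -/

theorem HasLineDerivAt.hasDerivAt_line {f : E → F} {f' : F} {z v : E} {t : ℝ}
    (h : HasLineDerivAt ℝ f f' (z + t • v) v) : HasDerivAt (fun τ : ℝ => f (z + τ • v)) f' t := by
  have h1 : HasDerivAt (fun τ : ℝ => f (z + t • v + τ • v)) f' (t - t) := by
    rw [sub_self]; exact h
  have h2 := h1.scomp (h := fun τ : ℝ => τ - t) t ((hasDerivAt_id t).sub_const t)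
  rw [one_smul] at h2
  refine h2.congr_of_eventuallyEq (Eventually.of_forall fun τ => ?_)
  simp only [Function.comp]
  congr 1
  rw [add_assoc, ← add_smul]
  simp

/-- Symmetry of mixed second directional derivatives, when only one of them is known to exist. -/
theorem HasLineDerivAt.of_swap {f fu fv fuv : E → F} {Ω : Set E} (hΩ : IsOpen Ω) {u v : E}
    (hu : ∀ z ∈ Ω, HasLineDerivAt ℝ f (fu z) z u) (hv : ∀ z ∈ Ω, HasLineDerivAt ℝ f (fv z) z v)
    (huv : ∀ z ∈ Ω, HasLineDerivAt ℝ fu (fuv z) z v) (hc : ContinuousOn fuv Ω) {z : E}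
    (hz : z ∈ Ω) : HasLineDerivAt ℝ fv (fuv z) z u := by
  rw [HasLineDerivAt, hasDerivAt_iff_isLittleO_nhds_zero, Asymptotics.isLittleO_iff]
  intro ε hε
  have hcz : ContinuousAt fuv z := hc.continuousAt (hΩ.mem_nhds hz)
  obtain ⟨r, hr, hball⟩ : ∃ r > 0, ∀ w, dist w z < r → w ∈ Ω ∧ ‖fuv w - fuv z‖ ≤ ε := by
    have h1 : ∀ᶠ w in 𝓝 z, w ∈ Ω ∧ ‖fuv w - fuv z‖ ≤ ε := by
      filter_upwards [hΩ.mem_nhds hz, Metric.tendsto_nhds.1 hcz ε hε] with w hw1 hw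
      rw [← dist_eq_norm]; exact ⟨hw1, hw.le⟩
    obtain ⟨r, hr, h⟩ := Metric.eventually_nhds_iff.1 h1
    exact ⟨r, hr, fun w hw => h hw⟩
  obtain ⟨η, hη, hsmall⟩ : ∃ η > 0, ∀ a b : ℝ, |a| ≤ η → |b| ≤ η → dist (z + a • u + b • v) z < r := by
    refine ⟨r / (2 * (‖u‖ + ‖v‖ + 1)), by positivity, fun a b ha hb => ?_⟩
    rw [dist_eq_norm, add_assoc, add_sub_cancel_left]
    have hpos : 0 < ‖u‖ + ‖v‖ + 1 := by positivity
    calc ‖a • u + b • v‖ ≤ |a| * ‖u‖ + |b| * ‖v‖ := by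
          refine (norm_add_le _ _).trans ?_
          rw [norm_smul, norm_smul, Real.norm_eq_abs, Real.norm_eq_abs]
      _ ≤ r / (2 * (‖u‖ + ‖v‖ + 1)) * ‖u‖ + r / (2 * (‖u‖ + ‖v‖ + 1)) * ‖v‖ := by gcongr
      _ = r / 2 * ((‖u‖ + ‖v‖) / (‖u‖ + ‖v‖ + 1)) := by field_simp
      _ ≤ r / 2 * 1 := by
          gcongr
          rw [div_le_one hpos]; linarith
      _ < r := by linarith
  have hmem : ∀ a b : ℝ, |a| ≤ η → |b| ≤ η → z + a • u + b • v ∈ Ω ∧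
      ‖fuv (z + a • u + b • v) - fuv z‖ ≤ ε := fun a b ha hb => hball _ (hsmall a b ha hb)
  have habs : ∀ {a t : ℝ}, |a| ≤ η → t ∈ Set.uIcc 0 a → |t| ≤ η := by
    intro a t ha ht
    have := Set.abs_sub_left_of_mem_uIcc ht
    simp only [sub_zero] at this
    exact this.trans ha
  filter_upwards [Metric.ball_mem_nhds (0 : ℝ) hη] with a ha
  have ha' : |a| ≤ η := by
    rw [Metric.mem_ball, dist_zero_right] at ha; exact ha.le
  -- variation of `fu` in the direction `v`
  have key1 : ∀ α b : ℝ, |α| ≤ η → |b| ≤ η →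
      ‖fu (z + α • u + b • v) - fu (z + α • u) - b • fuv z‖ ≤ ε * |b| := by
    intro α b hα hb
    have hder : ∀ t ∈ Set.uIcc 0 b, HasDerivWithinAt
        (fun t : ℝ => fu (z + α • u + t • v) - t • fuv z)
        (fuv (z + α • u + t • v) - fuv z) (Set.uIcc 0 b) t := by
      intro t ht
      have h1 := (huv _ (hmem α t hα (habs hb ht)).1).hasDerivAt_line
      have h2 : HasDerivAt (fun t : ℝ => t • fuv z) (fuv z) t := by
        simpa using (hasDerivAt_id t).smul_const (fuv z)
      exact (h1.sub h2).hasDerivWithinAt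
    have := (convex_uIcc (0 : ℝ) b).norm_image_sub_le_of_norm_hasDerivWithin_le hder
      (fun t ht => (hmem α t hα (habs hb ht)).2) Set.left_mem_uIcc Set.right_mem_uIcc
    simp only [zero_smul, add_zero, sub_zero, Real.norm_eq_abs] at this
    convert this using 2
    abel
  -- The mean value inequality in the direction `u`, applied to the difference of `f` on two
  -- parallel segments, bounds the second difference of `f` over the parallelogram with sides `a •
  -- u` and `b • v`.
  have key2 : ∀ b : ℝ, |b| ≤ η →
      ‖(f (z + a • u + b • v) - f (z + a • u) - (b * a) • fuv z) - (f (z + b • v) - f z)‖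
        ≤ ε * |b| * |a| := by
    intro b hb
    have hder : ∀ t ∈ Set.uIcc 0 a, HasDerivWithinAt
        (fun t : ℝ => f (z + b • v + t • u) - f (z + t • u) - t • (b • fuv z))
        (fu (z + b • v + t • u) - fu (z + t • u) - b • fuv z) (Set.uIcc 0 a) t := by
      intro t ht
      have e : z + b • v + t • u = z + t • u + b • v := by abel
      have h1 := (hu (z + b • v + t • u) (by
        rw [e]; exact (hmem t b (habs ha' ht) hb).1)).hasDerivAt_line
      have h3 := (hu (z + t • u) (by
        have := (hmem t 0 (habs ha' ht) (by simpa using hη.le)).1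
        simpa using this)).hasDerivAt_line
      have h2 : HasDerivAt (fun t : ℝ => t • (b • fuv z)) (b • fuv z) t := by
        simpa using (hasDerivAt_id t).smul_const (b • fuv z)
      exact ((h1.sub h3).sub h2).hasDerivWithinAt
    have := (convex_uIcc (0 : ℝ) a).norm_image_sub_le_of_norm_hasDerivWithin_le hder
      (C := ε * |b|) (fun t ht => by
        have := key1 t b (habs ha' ht) hb
        rwa [show z + t • u + b • v = z + b • v + t • u by abel] at this)
      Set.left_mem_uIcc Set.right_mem_uIcc
    simp only [zero_smul, add_zero, sub_zero, Real.norm_eq_abs] at this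
    rw [show z + b • v + a • u = z + a • u + b • v by abel, smul_smul, mul_comm a b] at this
    exact this
  have hlim : HasDerivAt (fun b : ℝ =>
      (f (z + a • u + b • v) - f (z + a • u) - (b * a) • fuv z) - (f (z + b • v) - f z))
      ((fv (z + a • u) - a • fuv z) - fv z) 0 := by
    have h1 : HasDerivAt (fun b : ℝ => f (z + a • u + b • v)) (fv (z + a • u)) 0 :=
      hv _ (by simpa using (hmem a 0 ha' (by simpa using hη.le)).1)
    have h2 : HasDerivAt (fun b : ℝ => f (z + b • v)) (fv z) 0 := hv _ hz
    have h3 : HasDerivAt (fun b : ℝ => (b * a) • fuv z) (a • fuv z) 0 := by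
      simpa using ((hasDerivAt_id (0 : ℝ)).mul_const a).smul_const (fuv z)
    exact ((h1.sub_const _).sub h3).sub (h2.sub_const _)
  -- The increment in `b` is at most `ε |a| |b|`, so the derivative at `b = 0`, which is the
  -- increment of `fv` minus `a • fuv z`, has norm at most `ε |a|`.
  have hb := hlim.le_of_lip' (C := ε * |a|) (by positivity) (by
    filter_upwards [Metric.ball_mem_nhds (0 : ℝ) hη] with b hb
    have hb' : |b| ≤ η := by
      rw [Metric.mem_ball, dist_zero_right] at hb; exact hb.le
    have := key2 b hb'
    simp only [zero_smul, add_zero, sub_self, zero_mul, sub_zero, Real.norm_eq_abs]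
    calc _ ≤ _ := this
      _ = _ := by ring)
  simp only [zero_add, zero_smul, add_zero, Real.norm_eq_abs]
  rw [show fv (z + a • u) - fv z - a • fuv z = (fv (z + a • u) - a • fuv z) - fv z by abel]
  exact hb

/-- A function whose partial derivatives along a basis are continuous is differentiable. -/
theorem hasFDerivAt_of_continuousOn_lineDeriv_basis {ι : Type*} [Fintype ι]
    [FiniteDimensional ℝ E] (b : Module.Basis ι ℝ E) {f : E → F} {f' : ι → E → F} {Ω : Set E}
    (hΩ : IsOpen Ω) (h : ∀ i, ∀ z ∈ Ω, HasLineDerivAt ℝ f (f' i z) z (b i))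
    (hc : ∀ i, ContinuousOn (f' i) Ω) {z : E} (hz : z ∈ Ω) :
    HasFDerivAt f (∑ i, (LinearMap.toContinuousLinearMap (b.coord i)).smulRight (f' i z)) z := by
  classical
  rw [hasFDerivAt_iff_isLittleO_nhds_zero, Asymptotics.isLittleO_iff]
  intro ε hε
  -- coordinates are bounded by the norm
  obtain ⟨K, hK0, hK⟩ : ∃ K > 0, ∀ w : E, ∑ i, |b.coord i w| ≤ K * ‖w‖ := by
    refine ⟨∑ i, ‖LinearMap.toContinuousLinearMap (b.coord i)‖ + 1, by positivity, fun w => ?_⟩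
    calc ∑ i, |b.coord i w| ≤ ∑ i, ‖LinearMap.toContinuousLinearMap (b.coord i)‖ * ‖w‖ := by
          refine Finset.sum_le_sum fun i _ => ?_
          exact (LinearMap.toContinuousLinearMap (b.coord i)).le_opNorm w
      _ ≤ _ := by rw [← Finset.sum_mul]; gcongr; linarith
  set B : ℝ := ∑ i, ‖b i‖ + 1 with hB
  have hB0 : 0 < B := by positivity
  have hBi : ∀ i, ‖b i‖ ≤ B := fun i => by
    have := Finset.single_le_sum (f := fun i => ‖b i‖) (fun i _ => norm_nonneg _)
      (Finset.mem_univ i)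
    linarith
  have hev : ∀ᶠ w in 𝓝 z, w ∈ Ω ∧ ∀ i, ‖f' i w - f' i z‖ ≤ ε / K := by
    refine Filter.Eventually.and (hΩ.mem_nhds hz) (eventually_all.2 fun i => ?_)
    have hcz : ContinuousAt (f' i) z := (hc i).continuousAt (hΩ.mem_nhds hz)
    filter_upwards [Metric.tendsto_nhds.1 hcz (ε / K) (by positivity)] with w hw
    rw [← dist_eq_norm]; exact hw.le
  obtain ⟨r, hr, hball⟩ := Metric.eventually_nhds_iff.1 hev
  -- The coordinates are switched on one at a time; each switch is a mean value inequality along one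
  -- basis vector. The condition on `c` keeps all intermediate points in the ball of radius `r`.
  have key : ∀ c : ι → ℝ, (∑ i, |c i|) * B < r → ∀ s : Finset ι,
      ‖f (z + ∑ i ∈ s, c i • b i) - f z - ∑ i ∈ s, c i • f' i z‖ ≤ ε / K * ∑ i ∈ s, |c i| := by
    intro c hcr s
    induction s using Finset.induction_on with
    | empty => simp
    | insert j s hj ih =>
      rw [Finset.sum_insert hj, Finset.sum_insert hj, Finset.sum_insert hj]
      set w := z + ∑ i ∈ s, c i • b i with hw
      have hmem : ∀ t ∈ Set.uIcc 0 (c j), dist (w + t • b j) z < r := by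
        intro t ht
        have ht' : |t| ≤ |c j| := by
          simpa using Set.abs_sub_left_of_mem_uIcc ht
        rw [dist_eq_norm, hw, add_assoc, add_sub_cancel_left]
        refine lt_of_le_of_lt ?_ hcr
        calc ‖∑ i ∈ s, c i • b i + t • b j‖ ≤ ∑ i ∈ s, |c i| * B + |c j| * B := by
              refine (norm_add_le _ _).trans (add_le_add ((norm_sum_le _ _).trans
                (Finset.sum_le_sum fun i _ => ?_)) ?_)
              · rw [norm_smul, Real.norm_eq_abs]
                exact mul_le_mul_of_nonneg_left (hBi i) (abs_nonneg _)
              · rw [norm_smul, Real.norm_eq_abs]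
                exact mul_le_mul ht' (hBi j) (norm_nonneg _) (abs_nonneg _)
          _ = (∑ i ∈ insert j s, |c i|) * B := by
              rw [Finset.sum_insert hj, add_mul, Finset.sum_mul]; ring
          _ ≤ (∑ i, |c i|) * B := by
              refine mul_le_mul_of_nonneg_right ?_ hB0.le
              exact Finset.sum_le_univ_sum_of_nonneg (f := fun i => |c i|) fun i => abs_nonneg _
      have hder : ∀ t ∈ Set.uIcc 0 (c j), HasDerivWithinAt
          (fun t : ℝ => f (w + t • b j) - t • f' j z) (f' j (w + t • b j) - f' j z)
          (Set.uIcc 0 (c j)) t := by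
        intro t ht
        have h1 := (h j _ (hball (hmem t ht)).1).hasDerivAt_line
        have h2 : HasDerivAt (fun t : ℝ => t • f' j z) (f' j z) t := by
          simpa using (hasDerivAt_id t).smul_const (f' j z)
        exact (h1.sub h2).hasDerivWithinAt
      have := (convex_uIcc (0 : ℝ) (c j)).norm_image_sub_le_of_norm_hasDerivWithin_le hder
        (fun t ht => (hball (hmem t ht)).2 j) Set.left_mem_uIcc Set.right_mem_uIcc
      simp only [zero_smul, add_zero, sub_zero, Real.norm_eq_abs] at this
      have e : f (z + (c j • b j + ∑ i ∈ s, c i • b i)) - f z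
          - (c j • f' j z + ∑ i ∈ s, c i • f' i z)
          = (f (w + c j • b j) - c j • f' j z - f w) +
            (f w - f z - ∑ i ∈ s, c i • f' i z) := by
        rw [hw, show z + (c j • b j + ∑ i ∈ s, c i • b i)
          = z + ∑ i ∈ s, c i • b i + c j • b j by abel]
        abel
      rw [e, mul_add]
      exact (norm_add_le _ _).trans (add_le_add this ih)
  have hrad : 0 < r / (K * B) := by positivity
  filter_upwards [Metric.ball_mem_nhds (0 : E) hrad] with w hw
  rw [Metric.mem_ball, dist_zero_right, lt_div_iff₀ (by positivity)] at hw
  have hsum : ∑ i, b.coord i w • b i = w := by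
    simp [b.sum_repr w]
  have := key (fun i => b.coord i w) (lt_of_le_of_lt
    (mul_le_mul_of_nonneg_right (hK w) hB0.le) (by linarith)) Finset.univ
  rw [hsum] at this
  have e2 : (∑ i, (LinearMap.toContinuousLinearMap (b.coord i)).smulRight (f' i z)) w
      = ∑ i, b.coord i w • f' i z := by
    simp
  rw [e2]
  refine this.trans ?_
  calc ε / K * ∑ i, |b.coord i w| ≤ ε / K * (K * ‖w‖) := by gcongr; exact hK w
    _ = ε * ‖w‖ := by field_simp

theorem contDiffOn_succ_of_lineDeriv_basis {ι : Type*} [Fintype ι]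
    [FiniteDimensional ℝ E] (b : Module.Basis ι ℝ E) {f : E → F} {f' : ι → E → F} {Ω : Set E}
    (hΩ : IsOpen Ω) (n : ℕ) (h : ∀ i, ∀ z ∈ Ω, HasLineDerivAt ℝ f (f' i z) z (b i))
    (hc : ∀ i, ContDiffOn ℝ n (f' i) Ω) : ContDiffOn ℝ (n + 1) f Ω := by
  have hd := fun z hz => hasFDerivAt_of_continuousOn_lineDeriv_basis b hΩ h
    (fun i => (hc i).continuousOn) (z := z) hz
  rw [contDiffOn_succ_iff_fderiv_of_isOpen hΩ]
  refine ⟨fun z hz => (hd z hz).differentiableAt.differentiableWithinAt, by simp, ?_⟩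
  have : ContDiffOn ℝ n (fun z => ∑ i,
      (LinearMap.toContinuousLinearMap (b.coord i)).smulRight (f' i z)) Ω := by
    refine ContDiffOn.sum fun i _ => ?_
    exact contDiffOn_const.smulRight (hc i)
  exact this.congr fun z hz => (hd z hz).fderiv

/-- Taylor's formula of order four, given by a chain of derivatives. -/
theorem norm_sub_taylor_le {f₀ f₁ f₂ f₃ f₄ : ℝ → F} {B : ℝ}
    (h₀ : ∀ t, HasDerivAt f₀ (f₁ t) t) (h₁ : ∀ t, HasDerivAt f₁ (f₂ t) t)
    (h₂ : ∀ t, HasDerivAt f₂ (f₃ t) t) (h₃ : ∀ t, HasDerivAt f₃ (f₄ t) t)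
    (hB : ∀ t ∈ Set.Icc (0 : ℝ) 1, ‖f₄ t‖ ≤ B) :
    ‖f₀ 1 - (f₀ 0 + f₁ 0 + (1 / 2 : ℝ) • f₂ 0 + (1 / 6 : ℝ) • f₃ 0)‖ ≤ B := by
  -- One integration over a subinterval of `[0, 1]` preserves the bound `B`; it is repeated four
  -- times, without gaining the factor `1/4!`.
  have step : ∀ {g g' : ℝ → F}, (∀ t, HasDerivAt g (g' t) t) → g 0 = 0 →
      (∀ t ∈ Set.Icc (0 : ℝ) 1, ‖g' t‖ ≤ B) → ∀ t ∈ Set.Icc (0 : ℝ) 1, ‖g t‖ ≤ B := by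
    intro g g' hg hg0 hb t ht
    have := (convex_Icc (0 : ℝ) 1).norm_image_sub_le_of_norm_hasDerivWithin_le
      (fun x _ => (hg x).hasDerivWithinAt) hb (Set.left_mem_Icc.2 zero_le_one) ht
    rw [hg0, sub_zero, sub_zero, Real.norm_eq_abs, abs_of_nonneg ht.1] at this
    have hB0 : 0 ≤ B := (norm_nonneg _).trans (hb t ht)
    exact this.trans (mul_le_of_le_one_right hB0 ht.2)
  have d1 : ∀ (c : F) (t : ℝ), HasDerivAt (fun t : ℝ => t • c) c t := fun c t => by
    simpa using (hasDerivAt_id t).smul_const c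
  have d2 : ∀ (c : F) (t : ℝ), HasDerivAt (fun t : ℝ => (t ^ 2 / 2) • c) (t • c) t := fun c t => by
    have : HasDerivAt (fun t : ℝ => t ^ 2 / 2) t t := by
      have := (hasDerivAt_pow 2 t).div_const 2
      simpa using this
    exact this.smul_const c
  have d3 : ∀ (c : F) (t : ℝ), HasDerivAt (fun t : ℝ => (t ^ 3 / 6) • c) ((t ^ 2 / 2) • c) t :=
    fun c t => by
    have : HasDerivAt (fun t : ℝ => t ^ 3 / 6) (t ^ 2 / 2) t := by
      have := (hasDerivAt_pow 3 t).div_const 6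
      rwa [show ((3 : ℕ) : ℝ) * t ^ (3 - 1) / 6 = t ^ 2 / 2 by push_cast; ring] at this
    exact this.smul_const c
  have s3 := step (g := fun t => f₃ t - f₃ 0) (fun t => (h₃ t).sub_const _) (by simp) hB
  have s2 := step (g := fun t => f₂ t - f₂ 0 - t • f₃ 0)
    (fun t => ((h₂ t).sub_const _).sub (d1 _ t)) (by simp) s3
  have s1 := step (g := fun t => f₁ t - f₁ 0 - t • f₂ 0 - (t ^ 2 / 2) • f₃ 0)
    (fun t => (((h₁ t).sub_const _).sub (d1 _ t)).sub (d2 _ t)) (by simp) s2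
  have s0 := step (g := fun t => f₀ t - f₀ 0 - t • f₁ 0 - (t ^ 2 / 2) • f₂ 0 - (t ^ 3 / 6) • f₃ 0)
    (fun t => ((((h₀ t).sub_const _).sub (d1 _ t)).sub (d2 _ t)).sub (d3 _ t)) (by simp) s1
  have := s0 1 (Set.right_mem_Icc.2 zero_le_one)
  simp only [one_smul, one_pow] at this
  convert this using 2
  abel

end LineCalculus

/-! ### Local maximisers of strongly concave functions -/

section StrongConcavity

variable {E : Type*} [NormedAddCommGroup E] [NormedSpace ℝ E]

/-- On the ball of radius `r` about `x₀`, `g₁ x u` is the derivative of `f` at `x` in the unit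
direction `u`, and the second derivatives in unit directions are at most `-κ`. -/
structure StronglyConcaveOnBall (f : E → ℝ) (g₁ : E → E → ℝ) (x₀ : E) (r κ : ℝ) : Prop where
  hasLineDerivAt : ∀ x ∈ Metric.ball x₀ r, ∀ u, ‖u‖ = 1 → HasLineDerivAt ℝ f (g₁ x u) x u
  second : ∀ x ∈ Metric.ball x₀ r, ∀ u, ‖u‖ = 1 →
    ∃ c ≤ -κ, HasLineDerivAt ℝ (fun z => g₁ z u) c x u

namespace StronglyConcaveOnBall

variable {f : E → ℝ} {g₁ : E → E → ℝ} {x₀ : E} {r κ : ℝ}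

theorem slope_le (h : StronglyConcaveOnBall f g₁ x₀ r κ) {x u : E} {t : ℝ} (hu : ‖u‖ = 1)
    (ht : 0 ≤ t) (hx : x ∈ Metric.ball x₀ r) (hy : x + t • u ∈ Metric.ball x₀ r) :
    g₁ (x + t • u) u - g₁ x u ≤ -κ * t := by
  have hmem : ∀ τ ∈ Set.Icc 0 t, x + τ • u ∈ Metric.ball x₀ r := by
    intro τ hτ
    rcases ht.eq_or_lt with rfl | htpos
    · have : τ = 0 := le_antisymm hτ.2 hτ.1
      simpa [this] using hx
    have := (convex_ball x₀ r).add_smul_sub_mem hx hy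
      (t := τ / t) ⟨div_nonneg hτ.1 ht, div_le_one_of_le₀ hτ.2 ht⟩
    rwa [add_sub_cancel_left, smul_smul, div_mul_cancel₀ _ htpos.ne'] at this
  choose! c hc hd using fun x hx => h.second x hx u hu
  have hder : ∀ τ ∈ Set.Icc 0 t, HasDerivAt (fun τ : ℝ => g₁ (x + τ • u) u) (c (x + τ • u)) τ :=
    fun τ hτ => (hd _ (hmem τ hτ)).hasDerivAt_line
  have := (convex_Icc (0 : ℝ) t).image_sub_le_mul_sub_of_deriv_le (C := -κ)
    (f := fun τ : ℝ => g₁ (x + τ • u) u)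
    (fun τ hτ => (hder τ hτ).continuousAt.continuousWithinAt)
    (fun τ hτ => (hder τ (interior_subset hτ)).differentiableAt.differentiableWithinAt)
    (fun τ hτ => by rw [(hder τ (interior_subset hτ)).deriv]; exact hc _ (hmem τ (interior_subset hτ)))
    0 (Set.left_mem_Icc.2 ht) t (Set.right_mem_Icc.2 ht) ht
  simpa using this

theorem deriv_eq_zero (h : StronglyConcaveOnBall f g₁ x₀ r κ) {x u : E} (hu : ‖u‖ = 1)
    (hx : x ∈ Metric.ball x₀ r) (hmax : IsLocalMax f x) : g₁ x u = 0 := by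
  have h1 : HasDerivAt (fun τ : ℝ => f (x + τ • u)) (g₁ x u) 0 := h.hasLineDerivAt x hx u hu
  refine IsLocalMax.hasDerivAt_eq_zero ?_ h1
  have hc : Tendsto (fun τ : ℝ => x + τ • u) (𝓝 0) (𝓝 x) := by
    have : Continuous (fun τ : ℝ => x + τ • u) := by fun_prop
    simpa using this.tendsto 0
  have := hc.eventually hmax
  simpa [IsLocalMax, IsMaxFilter] using this

theorem exists_direction (x y : E) : x = y ∨ ∃ u : E, ‖u‖ = 1 ∧ y = x + ‖x - y‖ • u := by
  by_cases hxy : x = y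
  · exact Or.inl hxy
  have hn : ‖x - y‖ ≠ 0 := by rwa [norm_ne_zero_iff, sub_ne_zero]
  refine Or.inr ⟨‖x - y‖⁻¹ • (y - x), ?_, ?_⟩
  · rw [norm_smul, norm_inv, norm_norm, norm_sub_rev y x, inv_mul_cancel₀ hn]
  · rw [smul_smul, mul_inv_cancel₀ hn, one_smul, add_sub_cancel]

/-- At the maximiser `y` of `f'` the derivative of `f'` vanishes, so that of `f` is at most `ε` in
absolute value. But along the segment from `x`, where it is zero, the derivative of `f` has fallen
by at least `κ ‖x - y‖`. -/
theorem norm_sub_le {f' : E → ℝ} {g₁' : E → E → ℝ} {ε : ℝ} (hκ : 0 < κ) (hε : 0 ≤ ε)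
    (h : StronglyConcaveOnBall f g₁ x₀ r κ) (h' : StronglyConcaveOnBall f' g₁' x₀ r κ)
    (hclose : ∀ x ∈ Metric.ball x₀ r, ∀ u, ‖u‖ = 1 → |g₁ x u - g₁' x u| ≤ ε) {x y : E}
    (hx : x ∈ Metric.ball x₀ r) (hy : y ∈ Metric.ball x₀ r) (hfx : IsLocalMax f x)
    (hfy : IsLocalMax f' y) : ‖x - y‖ ≤ ε / κ := by
  rcases exists_direction x y with rfl | ⟨u, hu, hyx⟩
  · simp; positivity
  have h1 := h.slope_le hu (norm_nonneg (x - y)) hx (by rwa [← hyx])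
  rw [← hyx, h.deriv_eq_zero hu hx hfx] at h1
  have h2 := hclose y hy u hu
  rw [h'.deriv_eq_zero hu hy hfy] at h2
  have h3 := neg_abs_le (g₁ y u - 0)
  rw [le_div_iff₀ hκ]
  linarith

/-- A maximiser over the closed ball of radius `r / 2` cannot lie on the boundary: the derivative
there towards the centre exceeds the one at the centre by at least `κ r / 2`, hence is positive, and
`f` would increase inwards. Uniqueness is `norm_sub_le` with equal functions and `ε = 0`. -/
theorem exists_unique_isLocalMax [ProperSpace E] (hr : 0 < r) (hκ : 0 < κ)
    (h : StronglyConcaveOnBall f g₁ x₀ r κ) (hcont : ContinuousOn f (Metric.ball x₀ r))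
    (h0 : ∀ u, ‖u‖ = 1 → |g₁ x₀ u| ≤ κ * r / 4) :
    ∃ x ∈ Metric.ball x₀ r, IsLocalMax f x ∧
      ∀ y ∈ Metric.ball x₀ r, IsLocalMax f y → y = x := by
  have hsub : Metric.closedBall x₀ (r / 2) ⊆ Metric.ball x₀ r :=
    Metric.closedBall_subset_ball (by linarith)
  obtain ⟨x, hx, hmax⟩ := (isCompact_closedBall x₀ (r / 2)).exists_isMaxOn
    ⟨x₀, Metric.mem_closedBall_self (by positivity)⟩ (hcont.mono hsub)
  have hlt : x ∈ Metric.ball x₀ (r / 2) := by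
    by_contra hnot
    have hd : ‖x - x₀‖ = r / 2 := by
      rw [← dist_eq_norm]
      exact le_antisymm hx (not_lt.1 hnot)
    rcases exists_direction x x₀ with rfl | ⟨u, hu, hx0⟩
    · simp at hd; linarith
    rw [hd] at hx0
    have h1 := h.slope_le hu (by positivity : (0 : ℝ) ≤ r / 2) (hsub hx)
      (by rw [← hx0]; exact Metric.mem_ball_self hr)
    rw [← hx0] at h1
    have h2 := neg_abs_le (g₁ x₀ u)
    have h3 := h0 u hu
    have hpos : 0 < g₁ x u := by nlinarith [mul_pos hκ hr]
    have h4 : HasDerivAt (fun τ : ℝ => f (x + τ • u)) (g₁ x u) 0 :=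
      h.hasLineDerivAt x (hsub hx) u hu
    have h5 := h4.tendsto_slope_zero_right
    have h6 : ∀ᶠ τ in 𝓝[>] (0 : ℝ), τ⁻¹ • (f (x + (0 + τ) • u) - f (x + (0 : ℝ) • u)) ≤ 0 := by
      filter_upwards [Ioo_mem_nhdsGT (show (0 : ℝ) < r / 2 by positivity)] with τ hτ
      have hm : x + τ • u ∈ Metric.closedBall x₀ (r / 2) := by
        have hx0' : x₀ ∈ Metric.closedBall x₀ (r / 2) :=
          Metric.mem_closedBall_self (by positivity)
        have := (convex_closedBall x₀ (r / 2)).add_smul_sub_mem hx hx0' (t := τ / (r / 2))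
          ⟨by have := hτ.1; positivity, div_le_one_of_le₀ hτ.2.le (by positivity)⟩
        have e : (x₀ - x) = (r / 2) • u := by
          rw [sub_eq_iff_eq_add']; exact hx0
        rwa [e, smul_smul, div_mul_cancel₀ _ (by positivity)] at this
      have h7 : f (x + τ • u) ≤ f x := hmax hm
      simp only [zero_add, zero_smul, add_zero, smul_eq_mul]
      exact mul_nonpos_of_nonneg_of_nonpos (inv_nonneg.2 hτ.1.le) (by linarith)
    exact absurd (le_of_tendsto h5 h6) (not_le.2 hpos)
  have hloc : IsLocalMax f x :=
    hmax.isLocalMax (Metric.closedBall_mem_nhds_of_mem hlt)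
  refine ⟨x, hsub hx, hloc, fun y hy hfy => ?_⟩
  have := norm_sub_le hκ le_rfl h h (fun x _ u _ => by simp) hy (hsub hx) hfy hloc
  simpa [sub_eq_zero] using this

end StronglyConcaveOnBall

end StrongConcavity

/-! ### Fourier inversion for finite measures -/

section FourierInversion

open scoped FourierTransform ContDiff

variable {V : Type*} [NormedAddCommGroup V] [InnerProductSpace ℝ V] [FiniteDimensional ℝ V]
  [MeasurableSpace V] [BorelSpace V]

/-- Self-adjointness of the Fourier transform is used twice: writing `g = 𝓕 h`, once to move the
transform from `h` to `ν`, and once to move the transform in `h = 𝓕⁻ g` from `g` to the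
characteristic function. -/
theorem integral_schwartz_eq_integral_fourier_charFun (ν : Measure V) [IsFiniteMeasure ν]
    (hχ : Integrable (fun v => charFun ν ((2 * Real.pi) • v))) (g : SchwartzMap V ℂ) :
    ∫ x, g x ∂ν = ∫ x, g x * 𝓕 (fun v => charFun ν ((2 * Real.pi) • v)) x := by
  set G : V → ℂ := fun v => charFun ν ((2 * Real.pi) • v) with hG
  set h : SchwartzMap V ℂ := 𝓕⁻ g with hh
  have hgh : 𝓕 h = g := FourierTransform.fourier_fourierInv_eq g
  have hh' : ∀ v, h v = 𝓕 (g : V → ℂ) (-v) := by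
    intro v
    rw [hh, SchwartzMap.fourierInv_coe, Real.fourierInv_eq_fourier_neg]
  have h1 := VectorFourier.integral_fourierIntegral_smul_eq_flip (L := innerₗ V) (μ := volume)
    (ν := ν) (f := (h : V → ℂ)) (g := fun _ => (1 : ℂ)) Real.continuous_fourierChar
    (by simpa using! continuous_inner) h.integrable (integrable_const _)
  have h2 : ∀ v, VectorFourier.fourierIntegral Real.fourierChar ν (innerₗ V).flip
      (fun _ => (1 : ℂ)) v = G (-v) := by
    intro v
    rw [VectorFourier.fourierIntegral]
    simp only [hG, charFun_apply]
    refine integral_congr_ae (Eventually.of_forall fun x => ?_)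
    simp only [LinearMap.flip_apply, innerₗ_apply_apply, Circle.smul_def,
      Real.fourierChar_apply, smul_eq_mul, mul_one, inner_smul_right, inner_neg_right,
      real_inner_comm x v]
  simp only [h2, smul_eq_mul, mul_one] at h1
  have h3 : ∫ x, g x ∂ν = ∫ v, h v * G (-v) := by
    rw [← h1, ← hgh]
    rfl
  have h4 := VectorFourier.integral_fourierIntegral_smul_eq_flip (L := innerₗ V)
    (μ := (volume : Measure V)) (ν := (volume : Measure V)) (f := (g : V → ℂ)) (g := G)
    Real.continuous_fourierChar (by simpa using! continuous_inner) g.integrable hχ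
  rw [h3, ← integral_neg_eq_self]
  simp only [neg_neg, hh']
  refine h4.trans ?_
  have : (innerₗ V).flip = innerₗ V := by
    ext x y
    simp
  rw [this]
  rfl

/-- Two locally finite measures that agree on smooth compactly supported functions are equal. -/
theorem MeasureTheory.Measure.ext_of_integral_contDiff {ν₁ ν₂ : Measure V}
    [IsLocallyFiniteMeasure ν₁] [IsLocallyFiniteMeasure ν₂]
    (h : ∀ g : V → ℝ, ContDiff ℝ ∞ g → HasCompactSupport g → (∀ x, 0 ≤ g x) →
      ∫ x, g x ∂ν₁ = ∫ x, g x ∂ν₂) : ν₁ = ν₂ := by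
  refine Measure.OuterRegular.ext_isOpen_isBounded fun U hU hb => ?_
  obtain ⟨f, hf, hfc, hfr⟩ := hU.exists_contDiff_support_eq (n := ⊤)
  have hf0 : ∀ x, 0 ≤ f x := fun x => (hfr ⟨x, rfl⟩).1
  -- Smooth functions supported in the closure of the bounded set `U` that tend pointwise to its
  -- indicator: at a point of `U` the value is `1` as soon as `k * f x ≥ 1`.
  set g : ℕ → V → ℝ := fun k x => Real.smoothTransition (k * f x) with hg
  have hgs : ∀ k, Function.support (g k) ⊆ U := by
    intro k x hx
    rw [← hf]
    intro hfx
    exact hx (by simp [hg, hfx])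
  have hgc : ∀ k, ContDiff ℝ ∞ (g k) := fun k =>
    Real.smoothTransition.contDiff.comp (contDiff_const.mul hfc)
  have hcs : ∀ k, HasCompactSupport (g k) := fun k =>
    HasCompactSupport.intro' hb.isCompact_closure isClosed_closure fun x hx => by
      by_contra hne
      exact hx (subset_closure (hgs k hne))
  have hlim : ∀ ν : Measure V, IsLocallyFiniteMeasure ν →
      Tendsto (fun k => ∫ x, g k x ∂ν) atTop (𝓝 (ν.real U)) := by
    intro ν hν
    rw [← integral_indicator_one hU.measurableSet]
    refine tendsto_integral_of_dominated_convergence (U.indicator 1)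
      (fun k => (hgc k).continuous.aestronglyMeasurable) ?_ ?_ ?_
    · exact (integrable_indicator_iff hU.measurableSet).2
        (integrableOn_const (hs := hb.measure_lt_top.ne))
    · refine fun k => Eventually.of_forall fun x => ?_
      by_cases hx : x ∈ U
      · simp only [hg, Real.norm_eq_abs, abs_of_nonneg (Real.smoothTransition.nonneg _),
          Set.indicator_of_mem hx, Pi.one_apply]
        exact Real.smoothTransition.le_one _
      · have : g k x = 0 := by
          by_contra hne
          exact hx (hgs k hne)
        simp [this, Set.indicator_of_notMem hx]
    · refine Eventually.of_forall fun x => ?_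
      by_cases hx : x ∈ U
      · have hpos : 0 < f x := lt_of_le_of_ne (hf0 x) (by
          rw [← hf] at hx; exact Ne.symm hx)
        rw [Set.indicator_of_mem hx, Pi.one_apply]
        refine tendsto_const_nhds.congr' ?_
        filter_upwards [eventually_ge_atTop (Nat.ceil (1 / f x))] with k hk
        refine (Real.smoothTransition.one_of_one_le ?_).symm
        have : 1 / f x ≤ k := (Nat.le_ceil _).trans (by exact_mod_cast hk)
        rwa [div_le_iff₀ hpos] at this
      · have : ∀ k, g k x = 0 := fun k => by
          by_contra hne
          exact hx (hgs k hne)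
        simp [this, Set.indicator_of_notMem hx]
  have heq := tendsto_nhds_unique (hlim ν₁ inferInstance)
    ((hlim ν₂ inferInstance).congr fun k =>
      (h (g k) (hgc k) (hcs k) fun x => Real.smoothTransition.nonneg _).symm)
  exact (measureReal_eq_measureReal_iff hb.measure_lt_top.ne hb.measure_lt_top.ne).1 heq

/-- Testing against smooth bumps identifies the measure with the transform `F` of its characteristic
function. If `Re F` were negative at `x₀`, a bump `g` supported where `Re F < 0` would satisfy `∫ g
Re F = ∫ g dν ≥ 0`, so `g Re F` would vanish identically, contrary to `g x₀ = 1`. -/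
theorem fourier_charFun_density (ν : Measure V) [IsFiniteMeasure ν]
    (hχ : Integrable (fun v => charFun ν ((2 * Real.pi) • v))) :
    Continuous (fun x => (𝓕 (fun v => charFun ν ((2 * Real.pi) • v)) x).re) ∧
    (∀ x, 0 ≤ (𝓕 (fun v => charFun ν ((2 * Real.pi) • v)) x).re) ∧
    ν = volume.withDensity
      fun x => ENNReal.ofReal (𝓕 (fun v => charFun ν ((2 * Real.pi) • v)) x).re := by
  set F := 𝓕 (fun v => charFun ν ((2 * Real.pi) • v)) with hF
  have hFc : Continuous F :=
    VectorFourier.fourierIntegral_continuous Real.continuous_fourierChar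
      (by simpa using! continuous_inner) hχ
  have hFr : Continuous fun x => (F x).re := Complex.continuous_re.comp hFc
  have key : ∀ g : V → ℝ, ContDiff ℝ ∞ g → HasCompactSupport g →
      ∫ x, g x ∂ν = ∫ x, g x * (F x).re := by
    intro g hg hgs
    have hg' : ContDiff ℝ ∞ (fun x => (g x : ℂ)) := Complex.ofRealCLM.contDiff.comp hg
    have hgs' : HasCompactSupport (fun x => (g x : ℂ)) :=
      hgs.comp_left (g := ((↑) : ℝ → ℂ)) (by simp)
    have h1 := integral_schwartz_eq_integral_fourier_charFun ν hχ (hgs'.toSchwartzMap hg')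
    simp only [HasCompactSupport.toSchwartzMap_toFun] at h1
    have h2 : Integrable (fun x => (g x : ℂ) * F x) :=
      ((Complex.continuous_ofReal.comp hg.continuous).mul hFc).integrable_of_hasCompactSupport
        hgs'.mul_right
    have h3 := congrArg Complex.re h1
    rw [show (∫ x, (g x : ℂ) ∂ν) = ((∫ x, g x ∂ν : ℝ) : ℂ) from integral_ofReal,
      Complex.ofReal_re] at h3
    rw [h3]
    have := integral_re h2
    simp only [RCLike.re_to_complex, Complex.re_ofReal_mul] at this
    exact this.symm
  have hnn : ∀ x, 0 ≤ (F x).re := by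
    intro x₀
    by_contra hneg
    rw [not_le] at hneg
    obtain ⟨g, hgt, hgs, hgc, hgr, hg1⟩ := exists_contDiff_tsupport_subset (n := ⊤)
      ((isOpen_Iio.preimage hFr).mem_nhds (show x₀ ∈ (fun x => (F x).re) ⁻¹' Set.Iio 0 from hneg))
    have hg0 : ∀ x, 0 ≤ g x := fun x => (hgr ⟨x, rfl⟩).1
    have hcont : Continuous fun x => -(g x * (F x).re) := (hgc.continuous.mul hFr).neg
    have hnonneg : ∀ x, 0 ≤ -(g x * (F x).re) := by
      intro x
      by_cases hx : x ∈ tsupport g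
      · have : (F x).re < 0 := hgt hx
        nlinarith [hg0 x]
      · simp [image_eq_zero_of_notMem_tsupport hx]
    have hint : Integrable fun x => -(g x * (F x).re) :=
      hcont.integrable_of_hasCompactSupport (hgs.mul_right.neg)
    have h0 : ∫ x, -(g x * (F x).re) = 0 := by
      refine le_antisymm ?_ (integral_nonneg hnonneg)
      rw [integral_neg, ← key g hgc hgs, neg_nonpos]
      exact integral_nonneg hg0
    have h1 := (integral_eq_zero_iff_of_nonneg hnonneg hint).1 h0
    have h2 := congrFun ((Continuous.ae_eq_iff_eq volume hcont continuous_zero).1 h1) x₀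
    simp only [hg1, one_mul, Pi.zero_apply] at h2
    linarith
  refine ⟨hFr, hnn, ?_⟩
  have : IsLocallyFiniteMeasure (volume.withDensity fun x : V => ENNReal.ofReal (F x).re) :=
    IsLocallyFiniteMeasure.withDensity_ofReal hFr
  refine Measure.ext_of_integral_contDiff fun g hg hgs hg0 => ?_
  rw [key g hg hgs, integral_withDensity_eq_integral_toReal_smul
    hFr.measurable.ennreal_ofReal (Eventually.of_forall fun _ => ENNReal.ofReal_lt_top)]
  refine integral_congr_ae (Eventually.of_forall fun x => ?_)
  simp only [ENNReal.toReal_ofReal (hnn x), smul_eq_mul, mul_comm]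

/-- The density of a finite measure with integrable characteristic function. -/
theorem exists_density_of_integrable_charFun (ν : Measure V) [IsFiniteMeasure ν]
    (hχ : Integrable (charFun ν)) :
    ∃ f : V → ℝ, Continuous f ∧ (∀ x, 0 ≤ f x) ∧
      (ν = volume.withDensity fun x => ENNReal.ofReal (f x)) ∧
      ∀ x, f x = ((2 * Real.pi) ^ Module.finrank ℝ V)⁻¹ *
        (∫ φ, Complex.exp (-(inner ℝ φ x : ℝ) * Complex.I) * charFun ν φ).re := by
  have hχ' : Integrable (fun v => charFun ν ((2 * Real.pi) • v)) :=
    hχ.comp_smul (by positivity)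
  obtain ⟨h1, h2, h3⟩ := fourier_charFun_density ν hχ'
  refine ⟨_, h1, h2, h3, fun x => ?_⟩
  have h4 := Measure.integral_comp_smul (volume : Measure V)
    (fun φ => Complex.exp (-(inner ℝ φ x : ℝ) * Complex.I) * charFun ν φ) (2 * Real.pi)
  rw [abs_of_pos (by positivity)] at h4
  have h5 : 𝓕 (fun v => charFun ν ((2 * Real.pi) • v)) x = ((2 * Real.pi) ^ Module.finrank ℝ V)⁻¹ •
        (∫ φ, Complex.exp (-(inner ℝ φ x : ℝ) * Complex.I) * charFun ν φ) := by
    rw [← h4, Real.fourier_eq']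
    refine integral_congr_ae (Eventually.of_forall fun v => ?_)
    simp only [inner_smul_left, smul_eq_mul]
    congr 3
    simp
  rw [h5, Complex.smul_re, smul_eq_mul]

end FourierInversion

/-! ### Laplace approximation of integrals of powers -/

section PowerExpansion

theorem norm_pow_sub_pow_le {x y : ℂ} {d : ℝ} (hx : ‖x‖ ≤ d) (hy : ‖y‖ ≤ d) (n : ℕ) :
    ‖x ^ (n + 1) - y ^ (n + 1)‖ ≤ (n + 1) * ‖x - y‖ * d ^ n := by
  have hd : 0 ≤ d := (norm_nonneg _).trans hx
  induction n with
  | zero => simp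
  | succ n ih =>
    have e : x ^ (n + 1 + 1) - y ^ (n + 1 + 1) =
      x * (x ^ (n + 1) - y ^ (n + 1)) + (x - y) * y ^ (n + 1) := by ring
    rw [e]
    refine (norm_add_le _ _).trans ?_
    rw [norm_mul, norm_mul, norm_pow]
    calc ‖x‖ * ‖x ^ (n + 1) - y ^ (n + 1)‖ + ‖x - y‖ * ‖y‖ ^ (n + 1)
        ≤ d * ((n + 1) * ‖x - y‖ * d ^ n) + ‖x - y‖ * d ^ (n + 1) := by gcongr
      _ = _ := by push_cast; ring

/-- The linear term is kept apart because for real `y` its real part is governed by `Re (x - y)`,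
which in the application is one order smaller than `‖x - y‖`; only the remainder is estimated by
norms. -/
theorem norm_pow_sub_pow_sub_le {x y : ℂ} {d : ℝ} (hx : ‖x‖ ≤ d) (hy : ‖y‖ ≤ d) (n : ℕ) :
    ‖x ^ (n + 2) - y ^ (n + 2) - (n + 2) * y ^ (n + 1) * (x - y)‖ ≤
      (n + 2) ^ 2 * ‖x - y‖ ^ 2 * d ^ n := by
  have hd : 0 ≤ d := (norm_nonneg _).trans hx
  induction n with
  | zero =>
    have e : x ^ (0 + 2) - y ^ (0 + 2) - ((0 : ℕ) + 2) * y ^ (0 + 1) * (x - y) = (x - y) ^ 2 := by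
      push_cast; ring
    rw [e, norm_pow]
    have : 0 ≤ ‖x - y‖ ^ 2 := by positivity
    simp only [CharP.cast_eq_zero, zero_add, pow_zero, mul_one]
    nlinarith
  | succ n ih =>
    have e : x ^ (n + 1 + 2) - y ^ (n + 1 + 2) - ((n + 1 : ℕ) + 2) * y ^ (n + 1 + 1) * (x - y) =
      x * (x ^ (n + 2) - y ^ (n + 2) - (n + 2) * y ^ (n + 1) * (x - y)) +
        (n + 2) * y ^ (n + 1) * (x - y) ^ 2 := by
      push_cast; ring
    rw [e]
    refine (norm_add_le _ _).trans ?_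
    have hn : ‖((n : ℂ) + 2)‖ = (n : ℝ) + 2 := by
      have : ((n : ℂ) + 2) = ((n + 2 : ℕ) : ℂ) := by push_cast; rfl
      rw [this, Complex.norm_natCast]; push_cast; rfl
    rw [norm_mul, norm_mul, norm_mul, norm_pow, norm_pow, hn]
    calc ‖x‖ * ‖x ^ (n + 2) - y ^ (n + 2) - (n + 2) * y ^ (n + 1) * (x - y)‖ +
          (n + 2) * ‖y‖ ^ (n + 1) * ‖x - y‖ ^ 2
        ≤ d * ((n + 2) ^ 2 * ‖x - y‖ ^ 2 * d ^ n) + (n + 2) * d ^ (n + 1) * ‖x - y‖ ^ 2 := by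
          gcongr
      _ = ((n + 2) ^ 2 + (n + 2)) * (‖x - y‖ ^ 2 * d ^ (n + 1)) := by ring
      _ ≤ ((n + 1 : ℕ) + 2) ^ 2 * (‖x - y‖ ^ 2 * d ^ (n + 1)) := by
          gcongr
          push_cast
          nlinarith [(Nat.cast_nonneg n : (0 : ℝ) ≤ n)]
      _ = _ := by push_cast; ring

end PowerExpansion

/-! ### Dominating functions for `n`-th powers -/

section Laplace

variable {V : Type*} [NormedAddCommGroup V] [InnerProductSpace ℝ V] [FiniteDimensional ℝ V]
  [MeasurableSpace V] [BorelSpace V]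

/-- The polynomially decaying function `(1 + δ |φ|²)^(-δ)`. -/
noncomputable def bracketDecay (δ : ℝ) (φ : V) : ℝ := (1 + δ * ‖φ‖ ^ 2) ^ (-δ)

variable {δ : ℝ}

theorem bracketDecay_pos (hδ : 0 < δ) (φ : V) : 0 < bracketDecay δ φ :=
  Real.rpow_pos_of_pos (by positivity) _

theorem bracketDecay_le_one (hδ : 0 < δ) (φ : V) : bracketDecay δ φ ≤ 1 :=
  Real.rpow_le_one_of_one_le_of_nonpos (by nlinarith [sq_nonneg ‖φ‖]) (by linarith)

theorem bracketDecay_anti {δ' : ℝ} (hδ : 0 < δ) (h : δ ≤ δ') (φ : V) :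
    bracketDecay δ' φ ≤ bracketDecay δ φ := by
  have h1 : 1 ≤ 1 + δ * ‖φ‖ ^ 2 := by nlinarith [sq_nonneg ‖φ‖]
  calc (1 + δ' * ‖φ‖ ^ 2) ^ (-δ') ≤ (1 + δ * ‖φ‖ ^ 2) ^ (-δ') :=
        Real.rpow_le_rpow_of_nonpos (by positivity) (by gcongr) (by linarith)
    _ ≤ _ := Real.rpow_le_rpow_of_exponent_le h1 (by linarith)

theorem continuous_bracketDecay (hδ : 0 < δ) : Continuous (bracketDecay δ : V → ℝ) := by
  unfold bracketDecay
  refine Continuous.rpow_const (by fun_prop) fun φ => Or.inl ?_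
  positivity

/-- By `log (1 + t) ≤ t`, the bracket is at least `exp (-δ² |φ|²)`. This puts the Gaussian under the
same majorant as `ρ`. -/
theorem exp_neg_le_bracketDecay (hδ : 0 < δ) {x : ℝ} (φ : V) (h : δ ^ 2 * ‖φ‖ ^ 2 ≤ x) :
    Real.exp (-x) ≤ bracketDecay δ φ := by
  have hpos : 0 < 1 + δ * ‖φ‖ ^ 2 := by positivity
  rw [bracketDecay, Real.rpow_def_of_pos hpos]
  apply Real.exp_le_exp.2
  have := Real.log_le_sub_one_of_pos hpos
  nlinarith

/-- The dominating functions for Laplace approximation. -/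
noncomputable def laplaceWeight (δ : ℝ) (κ a n : ℕ) (φ : V) : ℝ :=
  ‖φ‖ ^ a * (1 + ‖φ‖) ^ κ * bracketDecay δ φ ^ (n - 3)

theorem laplaceWeight_nonneg (hδ : 0 < δ) (κ a n : ℕ) (φ : V) : 0 ≤ laplaceWeight δ κ a n φ := by
  have := bracketDecay_pos hδ φ
  unfold laplaceWeight
  positivity

theorem continuous_laplaceWeight (hδ : 0 < δ) (κ a n : ℕ) :
    Continuous (laplaceWeight δ κ a n : V → ℝ) := by
  have := continuous_bracketDecay (V := V) hδ
  unfold laplaceWeight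
  fun_prop

/-- Bernoulli's inequality `(1 + s)^(n/N) ≥ 1 + n s / N` with `s = δ |ψ|² / n` gives a bound in
which `n` no longer appears. The condition `n ≥ 6` ensures `n - 3 ≥ n / 2`, and a large `N` makes
the bound integrable. -/
theorem bracketDecay_pow_scaled_le (hδ : 0 < δ) {N n : ℕ} (hN : 6 ≤ N) (hn : N ≤ n) (ψ : V) :
    bracketDecay δ ((√(n : ℝ))⁻¹ • ψ) ^ (n - 3) ≤
      (1 + δ * ‖ψ‖ ^ 2 / N) ^ (-(δ * N / 2)) := by
  have hn0 : (0 : ℝ) < n := by exact_mod_cast (by omega : 0 < n)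
  have hN0 : (0 : ℝ) < N := by exact_mod_cast (by omega : 0 < N)
  set s := δ * ‖ψ‖ ^ 2 / n with hs
  have hs0 : 0 ≤ s := by positivity
  have e1 : bracketDecay δ ((√(n : ℝ))⁻¹ • ψ) = (1 + s) ^ (-δ) := by
    rw [bracketDecay, norm_smul, mul_pow, norm_inv, Real.norm_eq_abs, inv_pow, sq_abs,
      Real.sq_sqrt hn0.le, hs]
    congr 2
    field_simp
  have hb := one_add_mul_self_le_rpow_one_add (s := s) (by linarith) (p := n / N)
    (by rw [le_div_iff₀ hN0]; simpa using (by exact_mod_cast hn : (N : ℝ) ≤ n))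
  have e2 : (n : ℝ) / N * s = δ * ‖ψ‖ ^ 2 / N := by rw [hs]; field_simp
  rw [e2] at hb
  rw [e1, ← Real.rpow_natCast, ← Real.rpow_mul (by positivity)]
  have h3 : ((n - 3 : ℕ) : ℝ) = n - 3 := by
    rw [Nat.cast_sub (by omega)]; norm_num
  have hn6 : (6 : ℝ) ≤ n := by exact_mod_cast hN.trans hn
  calc (1 + s) ^ (-δ * ((n - 3 : ℕ) : ℝ)) ≤ (1 + s) ^ ((n / N : ℝ) * (-(δ * N / 2))) := by
        refine Real.rpow_le_rpow_of_exponent_le (by linarith) ?_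
        rw [h3]
        have : (n / N : ℝ) * (-(δ * N / 2)) = -(δ * n / 2) := by field_simp
        rw [this]
        nlinarith
    _ = ((1 + s) ^ (n / N : ℝ)) ^ (-(δ * N / 2)) := Real.rpow_mul (by positivity) _ _
    _ ≤ _ := Real.rpow_le_rpow_of_nonpos (by positivity) hb (by
        rw [neg_nonpos]; positivity)

/-- The base is at least a multiple of `(1 + ‖ψ‖)²`, so the integrand is at most a multiple of `(1 +
‖ψ‖)^(-(δ N - a - κ))`, an exponent beyond the dimension. -/
theorem integrable_bracket (hδ : 0 < δ) (κ a : ℕ) {N : ℕ} (hN : 0 < N)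
    (hNδ : (a + κ + Module.finrank ℝ V : ℝ) < δ * N) :
    Integrable fun ψ : V => ‖ψ‖ ^ a * (1 + ‖ψ‖) ^ κ *
      (1 + δ * ‖ψ‖ ^ 2 / N) ^ (-(δ * N / 2)) := by
  have hN0 : (0 : ℝ) < N := by exact_mod_cast hN
  set c : ℝ := min 1 (δ / N) / 2 with hc
  have hc0 : 0 < c := by positivity
  have hle : ∀ ψ : V, c * (1 + ‖ψ‖) ^ 2 ≤ 1 + δ * ‖ψ‖ ^ 2 / N := by
    intro ψ
    have h1 : c ≤ 1 / 2 := by rw [hc]; gcongr; exact min_le_left _ _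
    have h2 : c ≤ δ / N / 2 := by rw [hc]; gcongr; exact min_le_right _ _
    have h3 : (1 + ‖ψ‖) ^ 2 ≤ 2 * (1 + ‖ψ‖ ^ 2) := by nlinarith [sq_nonneg (1 - ‖ψ‖)]
    calc c * (1 + ‖ψ‖) ^ 2 ≤ c * (2 * (1 + ‖ψ‖ ^ 2)) := by gcongr
      _ = 2 * c + 2 * c * ‖ψ‖ ^ 2 := by ring
      _ ≤ 2 * (1 / 2) + 2 * (δ / N / 2) * ‖ψ‖ ^ 2 := by gcongr
      _ = _ := by ring
  have hint := (integrable_one_add_norm (E := V) (μ := volume) (r := δ * N - (a + κ))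
    (by linarith)).const_mul (c ^ (-(δ * N / 2)))
  refine hint.mono' ?_ (Eventually.of_forall fun ψ => ?_)
  · refine Continuous.aestronglyMeasurable ?_
    refine Continuous.mul (by fun_prop) (Continuous.rpow_const (by fun_prop) fun ψ => Or.inl ?_)
    positivity
  · rw [Real.norm_of_nonneg (by positivity)]
    have hp : (0 : ℝ) < 1 + ‖ψ‖ := by positivity
    calc ‖ψ‖ ^ a * (1 + ‖ψ‖) ^ κ * (1 + δ * ‖ψ‖ ^ 2 / N) ^ (-(δ * N / 2))
        ≤ (1 + ‖ψ‖) ^ a * (1 + ‖ψ‖) ^ κ * (c * (1 + ‖ψ‖) ^ 2) ^ (-(δ * N / 2)) := by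
          have h1 : ‖ψ‖ ≤ 1 + ‖ψ‖ := by linarith
          have h2 := Real.rpow_le_rpow_of_nonpos (z := -(δ * N / 2)) (by positivity) (hle ψ)
            (by rw [neg_nonpos]; positivity)
          gcongr
      _ = c ^ (-(δ * N / 2)) * (1 + ‖ψ‖) ^ (-(δ * N - (a + κ))) := by
          rw [Real.mul_rpow hc0.le (by positivity), ← Real.rpow_natCast (1 + ‖ψ‖) a,
            ← Real.rpow_natCast (1 + ‖ψ‖) κ, ← Real.rpow_natCast (1 + ‖ψ‖) 2,
            ← Real.rpow_mul hp.le]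
          rw [mul_left_comm, ← Real.rpow_add hp, ← Real.rpow_add hp]
          congr 2
          push_cast
          ring

/-- Integrals against the dominating functions, after rescaling. -/
theorem exists_laplaceWeight_bound (hδ : 0 < δ) (κ a : ℕ) :
    ∃ (N : ℕ) (C : ℝ), 0 ≤ C ∧ ∀ n : ℕ, N ≤ n → Integrable (laplaceWeight δ κ a n : V → ℝ) ∧
      √(n : ℝ) ^ Module.finrank ℝ V * ∫ φ : V, laplaceWeight δ κ a n φ ≤ C / √(n : ℝ) ^ a := by
  obtain ⟨N₁, hN₁⟩ := exists_nat_gt ((a + κ + Module.finrank ℝ V : ℝ) / δ)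
  set N := max N₁ 6 with hN
  have hNδ : (a + κ + Module.finrank ℝ V : ℝ) < δ * N := by
    rw [div_lt_iff₀ hδ] at hN₁
    have : (N₁ : ℝ) ≤ N := by exact_mod_cast le_max_left _ _
    nlinarith
  have h6 : 6 ≤ N := le_max_right _ _
  have hint := integrable_bracket (V := V) hδ κ a (by omega : 0 < N) hNδ
  refine ⟨N, ∫ ψ : V, ‖ψ‖ ^ a * (1 + ‖ψ‖) ^ κ * (1 + δ * ‖ψ‖ ^ 2 / N) ^ (-(δ * N / 2)),
    integral_nonneg fun ψ => by positivity, fun n hn => ?_⟩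
  have hn0 : (0 : ℝ) < n := by exact_mod_cast (by omega : 0 < n)
  have hn1 : (1 : ℝ) ≤ n := by exact_mod_cast (by omega : 1 ≤ n)
  have hs : 0 < √(n : ℝ) := Real.sqrt_pos.2 hn0
  have hs1 : 1 ≤ √(n : ℝ) := Real.one_le_sqrt.2 hn1
  have hle : ∀ ψ : V, laplaceWeight δ κ a n ((√(n : ℝ))⁻¹ • ψ) ≤
      (√(n : ℝ) ^ a)⁻¹ * (‖ψ‖ ^ a * (1 + ‖ψ‖) ^ κ *
        (1 + δ * ‖ψ‖ ^ 2 / N) ^ (-(δ * N / 2))) := by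
    intro ψ
    have e : ‖(√(n : ℝ))⁻¹ • ψ‖ = (√(n : ℝ))⁻¹ * ‖ψ‖ := by
      rw [norm_smul, norm_inv, Real.norm_of_nonneg hs.le]
    have e2 : (√(n : ℝ))⁻¹ * ‖ψ‖ ≤ ‖ψ‖ :=
      mul_le_of_le_one_left (norm_nonneg _) (inv_le_one_of_one_le₀ hs1)
    have h1 := bracketDecay_pow_scaled_le hδ h6 hn ψ
    have h2 := bracketDecay_pos hδ ((√(n : ℝ))⁻¹ • ψ)
    rw [laplaceWeight, e, mul_pow, inv_pow]
    calc (√(n : ℝ) ^ a)⁻¹ * ‖ψ‖ ^ a * (1 + (√(n : ℝ))⁻¹ * ‖ψ‖) ^ κ *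
          bracketDecay δ ((√(n : ℝ))⁻¹ • ψ) ^ (n - 3)
        ≤ (√(n : ℝ) ^ a)⁻¹ * ‖ψ‖ ^ a * (1 + ‖ψ‖) ^ κ *
          (1 + δ * ‖ψ‖ ^ 2 / N) ^ (-(δ * N / 2)) := by gcongr
      _ = _ := by ring
  have hint2 : Integrable fun ψ : V => laplaceWeight δ κ a n ((√(n : ℝ))⁻¹ • ψ) := by
    refine (hint.const_mul ((√(n : ℝ) ^ a)⁻¹)).mono' ?_ (Eventually.of_forall fun ψ => ?_)
    · exact ((continuous_laplaceWeight hδ κ a n).comp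
        (continuous_const_smul _)).aestronglyMeasurable
    · rw [Real.norm_of_nonneg (laplaceWeight_nonneg hδ κ a n _)]
      exact hle ψ
  refine ⟨(integrable_comp_smul_iff volume _ (inv_ne_zero hs.ne')).1 hint2, ?_⟩
  have h4 := Measure.integral_comp_smul (volume : Measure V) (laplaceWeight δ κ a n)
    (√(n : ℝ))⁻¹
  rw [inv_pow, inv_inv, abs_of_pos (by positivity), smul_eq_mul] at h4
  rw [← h4, div_eq_inv_mul, ← integral_const_mul]
  exact integral_mono hint2 (hint.const_mul _) hle

end Laplace

/-! ### Pointwise comparison of `ρⁿ` with the Gaussian -/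

section LaplaceExpansion

variable {V : Type*} [NormedAddCommGroup V] [InnerProductSpace ℝ V] [FiniteDimensional ℝ V]
  [MeasurableSpace V] [BorelSpace V]

/-- `ρ` decays polynomially and agrees near `0` with the Gaussian `exp (-a / 2)` up to an odd
imaginary term of order three and a real term of order four. -/
structure LaplacePair (δ C : ℝ) (κ : ℕ) (ρ : V → ℂ) (a : V → ℝ) : Prop where
  cont : Continuous ρ
  cont_form : Continuous a
  norm_le : ∀ φ, ‖ρ φ‖ ≤ bracketDecay δ φ
  exp_le : ∀ φ, Real.exp (-(a φ / 2)) ≤ bracketDecay δ φ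
  re_le : ∀ φ, |(ρ φ).re - (1 - a φ / 2)| ≤ C * ‖φ‖ ^ 4 * (1 + ‖φ‖) ^ κ
  im_le : ∀ φ, |(ρ φ).im| ≤ C * ‖φ‖ ^ 3 * (1 + ‖φ‖) ^ κ
  form_nonneg : ∀ φ, 0 ≤ a φ
  form_le : ∀ φ, a φ ≤ C * ‖φ‖ ^ 2
  form_smul : ∀ (t : ℝ) φ, a (t • φ) = t ^ 2 * a φ

/-- Derivatives of the functions in `LaplacePair` with respect to a parameter. -/
structure LaplaceDeriv (C : ℝ) (κ : ℕ) (ρ₁ : V → ℂ) (a₁ : V → ℝ) : Prop where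
  cont : Continuous ρ₁
  cont_form : Continuous a₁
  re_le : ∀ φ, |(ρ₁ φ).re + a₁ φ / 2| ≤ C * ‖φ‖ ^ 4 * (1 + ‖φ‖) ^ κ
  im_le : ∀ φ, |(ρ₁ φ).im| ≤ C * ‖φ‖ ^ 3 * (1 + ‖φ‖) ^ κ
  form_le : ∀ φ, |a₁ φ| ≤ C * ‖φ‖ ^ 2
  form_smul : ∀ (t : ℝ) φ, a₁ (t • φ) = t ^ 2 * a₁ φ

variable {δ C : ℝ} {κ : ℕ} {ρ ρ₁ ρ₂ : V → ℂ} {a a₁ : V → ℝ}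

/-- The exponent `n - 3` in the weights allows for three lost factors: one from differentiating the
`n`-th power, two from expanding `ρ^(n-1)` to second order. -/
theorem bracketDecay_pow_le (hδ : 0 < δ) (φ : V) {n k : ℕ} (h : n - 3 ≤ k) :
    bracketDecay δ φ ^ k ≤ bracketDecay δ φ ^ (n - 3) :=
  pow_le_pow_of_le_one (bracketDecay_pos hδ φ).le (bracketDecay_le_one hδ φ) h

namespace LaplacePair

/-- The real part and the Gaussian share the quadratic term, and `|1 - x - exp (-x)| ≤ x²` for `x =
a / 2 = O(|φ|²)`. -/
theorem abs_re_sub_le (hC : 0 ≤ C) (h : LaplacePair δ C κ ρ a) (φ : V) :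
    |(ρ φ).re - Real.exp (-(a φ / 2))| ≤ (C + C ^ 2) * ‖φ‖ ^ 4 * (1 + ‖φ‖) ^ κ := by
  have h1 := h.re_le φ
  have h0 : 0 ≤ a φ / 2 := by have := h.form_nonneg φ; linarith
  have h2 : |1 - a φ / 2 - Real.exp (-(a φ / 2))| ≤ (a φ / 2) ^ 2 := by
    rw [abs_le]
    constructor
    · by_cases hx : a φ / 2 ≤ 1
      · have := Real.abs_exp_sub_one_sub_id_le (x := -(a φ / 2)) (by rwa [abs_neg, abs_of_nonneg h0])
        rw [abs_le] at this
        nlinarith [this.2]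
      · rw [not_le] at hx
        have : Real.exp (-(a φ / 2)) ≤ 1 := Real.exp_le_one_iff.2 (by linarith)
        nlinarith
    · have := Real.add_one_le_exp (-(a φ / 2))
      nlinarith [sq_nonneg (a φ / 2)]
  have h3 : (a φ / 2) ^ 2 ≤ C ^ 2 * ‖φ‖ ^ 4 * (1 + ‖φ‖) ^ κ := by
    have hp : 1 ≤ (1 + ‖φ‖) ^ κ := one_le_pow₀ (by linarith [norm_nonneg φ])
    calc (a φ / 2) ^ 2 ≤ (C * ‖φ‖ ^ 2) ^ 2 := by
          refine pow_le_pow_left₀ h0 ?_ 2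
          have := h.form_le φ
          have := h.form_nonneg φ
          linarith
      _ = C ^ 2 * ‖φ‖ ^ 4 * 1 := by ring
      _ ≤ _ := by gcongr
  calc |(ρ φ).re - Real.exp (-(a φ / 2))|
      = |((ρ φ).re - (1 - a φ / 2)) + (1 - a φ / 2 - Real.exp (-(a φ / 2)))| := by ring_nf
    _ ≤ _ := abs_add_le _ _
    _ ≤ C * ‖φ‖ ^ 4 * (1 + ‖φ‖) ^ κ + C ^ 2 * ‖φ‖ ^ 4 * (1 + ‖φ‖) ^ κ :=
        add_le_add h1 (h2.trans h3)
    _ = _ := by ring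

/-- The imaginary part limits the order to three; the extra factor `1 + ‖φ‖` absorbs the
fourth-order real part. -/
theorem norm_sub_le (hC : 0 ≤ C) (h : LaplacePair δ C κ ρ a) (φ : V) :
    ‖ρ φ - (Real.exp (-(a φ / 2)) : ℝ)‖ ≤ (2 * C + C ^ 2) * ‖φ‖ ^ 3 * (1 + ‖φ‖) ^ (κ + 1) := by
  have h1 := h.abs_re_sub_le hC φ
  have h2 := h.im_le φ
  refine (Complex.norm_le_abs_re_add_abs_im _).trans ?_
  rw [Complex.sub_re, Complex.sub_im, Complex.ofReal_re, Complex.ofReal_im, sub_zero]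
  have hp : (1 + ‖φ‖) ^ κ ≤ (1 + ‖φ‖) ^ (κ + 1) :=
    pow_le_pow_right₀ (by linarith [norm_nonneg φ]) (Nat.le_succ _)
  calc _ ≤ (C + C ^ 2) * ‖φ‖ ^ 4 * (1 + ‖φ‖) ^ κ + C * ‖φ‖ ^ 3 * (1 + ‖φ‖) ^ κ :=
        add_le_add h1 h2
    _ = (C + C ^ 2) * ‖φ‖ ^ 3 * (‖φ‖ * (1 + ‖φ‖) ^ κ) + C * ‖φ‖ ^ 3 * (1 + ‖φ‖) ^ κ := by ring
    _ ≤ (C + C ^ 2) * ‖φ‖ ^ 3 * ((1 + ‖φ‖) * (1 + ‖φ‖) ^ κ)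
          + C * ‖φ‖ ^ 3 * (1 + ‖φ‖) ^ (κ + 1) := by
        gcongr; linarith
    _ = _ := by ring

/-- In the second-order expansion about the real number `b = exp (-a / 2)`, the linear term has real
part of size `n |φ|⁴` because its coefficient is real, and the remainder is `n² (|φ|³)²`. Both have
size `1/n` when `|φ| ~ n^(-1/2)`. -/
theorem abs_re_pow_sub_le (hδ : 0 < δ) (hC : 0 ≤ C) (h : LaplacePair δ C κ ρ a) (φ : V) (n : ℕ) :
    |(ρ φ ^ (n + 2)).re - Real.exp (-(a φ / 2)) ^ (n + 2)| ≤
      ((n + 2) ^ 2 * (2 * C + C ^ 2) ^ 2 * ‖φ‖ ^ 6 + (n + 2) * (C + C ^ 2) * ‖φ‖ ^ 4) *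
        (1 + ‖φ‖) ^ (2 * κ + 2) * bracketDecay δ φ ^ n := by
  set b : ℝ := Real.exp (-(a φ / 2)) with hb
  have hb0 : 0 < b := Real.exp_pos _
  set D := bracketDecay δ φ with hD
  have hD0 : 0 < D := bracketDecay_pos hδ φ
  have hD1 : D ≤ 1 := bracketDecay_le_one hδ φ
  have hbD : ‖(b : ℂ)‖ ≤ D := by
    rw [Complex.norm_real, Real.norm_of_nonneg hb0.le]; exact h.exp_le φ
  have h1 := norm_pow_sub_pow_sub_le (h.norm_le φ) hbD n
  have h2 := (Complex.abs_re_le_norm _).trans h1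
  have e : (ρ φ ^ (n + 2) - (b : ℂ) ^ (n + 2) - (n + 2) * (b : ℂ) ^ (n + 1) * (ρ φ - b)).re =
      (ρ φ ^ (n + 2)).re - b ^ (n + 2) - (n + 2) * b ^ (n + 1) * ((ρ φ).re - b) := by
    have e1 : ((n : ℂ) + 2) * (b : ℂ) ^ (n + 1) * (ρ φ - b) =
        (((n + 2) * b ^ (n + 1) : ℝ) : ℂ) * (ρ φ - b) := by push_cast; ring
    have e2 : (b : ℂ) ^ (n + 2) = ((b ^ (n + 2) : ℝ) : ℂ) := by push_cast; ring
    rw [Complex.sub_re, Complex.sub_re, e1, Complex.re_ofReal_mul, Complex.sub_re, e2,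
      Complex.ofReal_re, Complex.ofReal_re]
  rw [e] at h2
  have hp1 : (1 + ‖φ‖) ^ κ ≤ (1 + ‖φ‖) ^ (2 * κ + 2) :=
    pow_le_pow_right₀ (by linarith [norm_nonneg φ]) (by omega)
  have h3 : ‖ρ φ - b‖ ^ 2 ≤ (2 * C + C ^ 2) ^ 2 * ‖φ‖ ^ 6 * (1 + ‖φ‖) ^ (2 * κ + 2) := by
    calc ‖ρ φ - b‖ ^ 2 ≤ ((2 * C + C ^ 2) * ‖φ‖ ^ 3 * (1 + ‖φ‖) ^ (κ + 1)) ^ 2 :=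
          pow_le_pow_left₀ (norm_nonneg _) (h.norm_sub_le hC φ) 2
      _ = _ := by ring
  have h4 : |((n : ℝ) + 2) * b ^ (n + 1) * ((ρ φ).re - b)| ≤
      (n + 2) * D ^ n * ((C + C ^ 2) * ‖φ‖ ^ 4 * (1 + ‖φ‖) ^ (2 * κ + 2)) := by
    rw [abs_mul, abs_of_nonneg (by positivity)]
    have : b ^ (n + 1) ≤ D ^ n := by
      calc b ^ (n + 1) ≤ D ^ (n + 1) := pow_le_pow_left₀ hb0.le (h.exp_le φ) _
        _ ≤ D ^ n := pow_le_pow_of_le_one hD0.le hD1 (Nat.le_succ _)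
    have h5 := h.abs_re_sub_le hC φ
    have : |(ρ φ).re - b| ≤ (C + C ^ 2) * ‖φ‖ ^ 4 * (1 + ‖φ‖) ^ (2 * κ + 2) :=
      h5.trans (by gcongr)
    gcongr
  calc |(ρ φ ^ (n + 2)).re - b ^ (n + 2)|
      = |((ρ φ ^ (n + 2)).re - b ^ (n + 2) - (n + 2) * b ^ (n + 1) * ((ρ φ).re - b)) +
          (n + 2) * b ^ (n + 1) * ((ρ φ).re - b)| := by ring_nf
    _ ≤ _ := abs_add_le _ _
    _ ≤ (n + 2) ^ 2 * ((2 * C + C ^ 2) ^ 2 * ‖φ‖ ^ 6 * (1 + ‖φ‖) ^ (2 * κ + 2)) * D ^ n +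
        (n + 2) * D ^ n * ((C + C ^ 2) * ‖φ‖ ^ 4 * (1 + ‖φ‖) ^ (2 * κ + 2)) := by
        refine add_le_add (h2.trans ?_) h4
        gcongr
    _ = _ := by ring

/-- A power of the real number `b` has no imaginary part, so the first-order difference of powers
suffices. -/
theorem abs_im_pow_le (hC : 0 ≤ C) (h : LaplacePair δ C κ ρ a) (φ : V) (n : ℕ) :
    |(ρ φ ^ (n + 1)).im| ≤ (n + 1) * ((2 * C + C ^ 2) * ‖φ‖ ^ 3 * (1 + ‖φ‖) ^ (κ + 1)) *
      bracketDecay δ φ ^ n := by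
  set b : ℝ := Real.exp (-(a φ / 2)) with hb
  have hb0 : 0 < b := Real.exp_pos _
  have hbD : ‖(b : ℂ)‖ ≤ bracketDecay δ φ := by
    rw [Complex.norm_real, Real.norm_of_nonneg hb0.le]; exact h.exp_le φ
  have h1 := norm_pow_sub_pow_le (h.norm_le φ) hbD n
  have h2 := (Complex.abs_im_le_norm _).trans h1
  have e2 : (b : ℂ) ^ (n + 1) = ((b ^ (n + 1) : ℝ) : ℂ) := by push_cast; ring
  rw [Complex.sub_im, e2, Complex.ofReal_im, sub_zero] at h2
  refine h2.trans ?_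
  have : 0 ≤ bracketDecay δ φ := (norm_nonneg _).trans hbD
  have := h.norm_sub_le hC φ
  gcongr

end LaplacePair

/-- The derivative of the `n`-th power is close to that of the Gaussian. -/
theorem LaplaceDeriv.abs_re_sub_le (hδ : 0 < δ) (hC : 0 ≤ C) (h : LaplacePair δ C κ ρ a)
    (h₁ : LaplaceDeriv C κ ρ₁ a₁) (φ : V) (n : ℕ) :
    |((n + 3) * ρ φ ^ (n + 2) * ρ₁ φ).re -
        -((n + 3) * (a₁ φ / 2) * Real.exp (-(a φ / 2)) ^ (n + 3))| ≤
      ((n + 3) ^ 3 * ((2 * C + C ^ 2) ^ 2 * C) * ‖φ‖ ^ 8 +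
        (n + 3) ^ 2 * ((C + C ^ 2) * C + (2 * C + C ^ 2) * C) * ‖φ‖ ^ 6 +
        (n + 3) * (C ^ 2 + C) * ‖φ‖ ^ 4) *
        (1 + ‖φ‖) ^ (3 * κ + 2) * bracketDecay δ φ ^ n := by
  set b : ℝ := Real.exp (-(a φ / 2)) with hb
  have hb0 : 0 < b := Real.exp_pos _
  set D := bracketDecay δ φ with hD
  have hD0 : 0 < D := bracketDecay_pos hδ φ
  have hD1 : D ≤ 1 := bracketDecay_le_one hδ φ
  set x := ‖φ‖ with hx
  have hx0 : 0 ≤ x := norm_nonneg _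
  have h1x : 1 ≤ 1 + x := by linarith
  have hDn : ∀ k, n ≤ k → D ^ k ≤ D ^ n := fun k hk => pow_le_pow_of_le_one hD0.le hD1 hk
  have hP : ∀ k, k ≤ 3 * κ + 2 → (1 + x) ^ k ≤ (1 + x) ^ (3 * κ + 2) := fun k hk =>
    pow_le_pow_right₀ h1x hk
  have hP1 : 1 ≤ (1 + x) ^ (3 * κ + 2) := one_le_pow₀ h1x
  set P := (1 + x) ^ (3 * κ + 2) with hPdef
  -- The error splits into four parts: replacing `Re ρ^(n+2)` by `b^(n+2)`, replacing `b^(n+2)` by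
  -- `b^(n+3)`, replacing `Re ρ₁` by `-a₁ / 2`, and the product of the two imaginary parts, each of
  -- third order.
  have t1 : |((ρ φ ^ (n + 2)).re - b ^ (n + 2)) * (a₁ φ / 2)| ≤
      ((n + 3) ^ 2 * (2 * C + C ^ 2) ^ 2 * x ^ 6 + (n + 3) * (C + C ^ 2) * x ^ 4) * P * D ^ n *
        (C * x ^ 2) := by
    rw [abs_mul]
    have e1 := h.abs_re_pow_sub_le hδ hC φ n
    have e2 : |a₁ φ / 2| ≤ C * x ^ 2 := by
      rw [abs_div, abs_two]
      have := h₁.form_le φ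
      have := abs_nonneg (a₁ φ)
      linarith
    have e3 := hP (2 * κ + 2) (by omega)
    refine mul_le_mul (e1.trans ?_) e2 (abs_nonneg _) (by positivity)
    gcongr <;> linarith
  have t2 : |b ^ (n + 2) * (1 - b) * (a₁ φ / 2)| ≤ D ^ n * (C * x ^ 2) * (C * x ^ 2) := by
    rw [abs_mul, abs_mul]
    have e1 : |b ^ (n + 2)| ≤ D ^ n := by
      rw [abs_of_pos (by positivity)]
      exact (pow_le_pow_left₀ hb0.le (h.exp_le φ) _).trans (hDn _ (by omega))
    have e2 : |1 - b| ≤ C * x ^ 2 := by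
      have h5 := Real.add_one_le_exp (-(a φ / 2))
      have h6 := h.form_nonneg φ
      have h7 := h.form_le φ
      have h8 : b ≤ 1 := Real.exp_le_one_iff.2 (by linarith)
      rw [abs_of_nonneg (by linarith)]
      linarith
    have e3 : |a₁ φ / 2| ≤ C * x ^ 2 := by
      rw [abs_div, abs_two]
      have := h₁.form_le φ
      have := abs_nonneg (a₁ φ)
      linarith
    gcongr
  have t3 : |(ρ φ ^ (n + 2)).re * ((ρ₁ φ).re + a₁ φ / 2)| ≤ D ^ n * (C * x ^ 4 * P) := by
    rw [abs_mul]
    have e1 : |(ρ φ ^ (n + 2)).re| ≤ D ^ n := by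
      refine (Complex.abs_re_le_norm _).trans ?_
      rw [norm_pow]
      exact (pow_le_pow_left₀ (norm_nonneg _) (h.norm_le φ) _).trans (hDn _ (by omega))
    have e2 := h₁.re_le φ
    have e3 := hP κ (by omega)
    refine mul_le_mul e1 (e2.trans ?_) (abs_nonneg _) (by positivity)
    gcongr
  have t4 : |(ρ φ ^ (n + 2)).im * (ρ₁ φ).im| ≤
      (n + 3) * ((2 * C + C ^ 2) * C) * x ^ 6 * P * D ^ n := by
    rw [abs_mul]
    have e1 := h.abs_im_pow_le hC φ (n + 1)
    have e2 := h₁.im_le φ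
    have e3 := hP (κ + 1 + κ) (by omega)
    calc _ ≤ (((n + 1 : ℕ) + 1) * ((2 * C + C ^ 2) * x ^ 3 * (1 + x) ^ (κ + 1)) * D ^ (n + 1)) *
          (C * x ^ 3 * (1 + x) ^ κ) :=
          mul_le_mul e1 e2 (abs_nonneg _) (by positivity)
      _ = ((n : ℝ) + 2) * ((2 * C + C ^ 2) * C) * x ^ 6 * (1 + x) ^ (κ + 1 + κ) * D ^ (n + 1) := by
          push_cast; ring
      _ ≤ (n + 3) * ((2 * C + C ^ 2) * C) * x ^ 6 * P * D ^ n := by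
          have := hDn (n + 1) (by omega)
          gcongr; linarith
  have e0 : ((n + 3) * ρ φ ^ (n + 2) * ρ₁ φ).re = (n + 3) *
      ((ρ φ ^ (n + 2)).re * (ρ₁ φ).re - (ρ φ ^ (n + 2)).im * (ρ₁ φ).im) := by
    have : ((n : ℂ) + 3) * ρ φ ^ (n + 2) * ρ₁ φ = (((n : ℝ) + 3 : ℝ) : ℂ) * (ρ φ ^ (n + 2) * ρ₁ φ) := by
      push_cast; ring
    rw [this, Complex.re_ofReal_mul, Complex.mul_re]
  have e1 : ((n + 3) * ρ φ ^ (n + 2) * ρ₁ φ).re - -((n + 3) * (a₁ φ / 2) * b ^ (n + 3)) =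
      (n + 3) * (-(((ρ φ ^ (n + 2)).re - b ^ (n + 2)) * (a₁ φ / 2)) +
        -(b ^ (n + 2) * (1 - b) * (a₁ φ / 2)) + (ρ φ ^ (n + 2)).re * ((ρ₁ φ).re + a₁ φ / 2) +
        -((ρ φ ^ (n + 2)).im * (ρ₁ φ).im)) := by
    rw [e0]; ring
  rw [e1, abs_mul, abs_of_nonneg (by positivity : (0 : ℝ) ≤ n + 3)]
  have t : |-(((ρ φ ^ (n + 2)).re - b ^ (n + 2)) * (a₁ φ / 2)) +
        -(b ^ (n + 2) * (1 - b) * (a₁ φ / 2)) + (ρ φ ^ (n + 2)).re * ((ρ₁ φ).re + a₁ φ / 2) +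
        -((ρ φ ^ (n + 2)).im * (ρ₁ φ).im)| ≤
      ((n + 3) ^ 2 * (2 * C + C ^ 2) ^ 2 * x ^ 6 + (n + 3) * (C + C ^ 2) * x ^ 4) * P * D ^ n *
        (C * x ^ 2) + D ^ n * (C * x ^ 2) * (C * x ^ 2) * P + D ^ n * (C * x ^ 4 * P) +
        (n + 3) * ((2 * C + C ^ 2) * C) * x ^ 6 * P * D ^ n := by
    have t2' : |b ^ (n + 2) * (1 - b) * (a₁ φ / 2)| ≤ D ^ n * (C * x ^ 2) * (C * x ^ 2) * P :=
      t2.trans (le_mul_of_one_le_right (by positivity) hP1)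
    refine (abs_add_le _ _).trans (add_le_add ((abs_add_le _ _).trans (add_le_add
      ((abs_add_le _ _).trans (add_le_add ?_ ?_)) t3)) ?_)
    · rw [abs_neg]; exact t1
    · rw [abs_neg]; exact t2'
    · rw [abs_neg]; exact t4
  calc _ ≤ ((n : ℝ) + 3) * _ := mul_le_mul_of_nonneg_left t (by positivity)
    _ = _ := by ring

theorem LaplaceDeriv.norm_le (hC : 0 ≤ C) (h₁ : LaplaceDeriv C κ ρ₁ a₁) (φ : V) :
    ‖ρ₁ φ‖ ≤ 3 * C * ‖φ‖ ^ 2 * (1 + ‖φ‖) ^ (κ + 2) := by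
  have hx0 : 0 ≤ ‖φ‖ := norm_nonneg _
  set x := ‖φ‖ with hx
  have h1x : 1 ≤ 1 + x := by linarith
  have e1 := h₁.re_le φ
  have e2 := h₁.im_le φ
  have e3 := h₁.form_le φ
  refine (Complex.norm_le_abs_re_add_abs_im _).trans ?_
  have e4 : |(ρ₁ φ).re| ≤ |(ρ₁ φ).re + a₁ φ / 2| + |a₁ φ| / 2 := by
    calc |(ρ₁ φ).re| = |((ρ₁ φ).re + a₁ φ / 2) + -(a₁ φ / 2)| := by ring_nf
      _ ≤ _ := abs_add_le _ _
      _ = _ := by rw [abs_neg, abs_div, abs_two]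
  have p1 : x ^ 4 * (1 + x) ^ κ ≤ x ^ 2 * (1 + x) ^ (κ + 2) := by
    calc x ^ 4 * (1 + x) ^ κ = x ^ 2 * (x ^ 2 * (1 + x) ^ κ) := by ring
      _ ≤ x ^ 2 * ((1 + x) ^ 2 * (1 + x) ^ κ) := by gcongr; linarith
      _ = _ := by ring
  have p2 : x ^ 3 * (1 + x) ^ κ ≤ x ^ 2 * (1 + x) ^ (κ + 2) := by
    calc x ^ 3 * (1 + x) ^ κ = x ^ 2 * (x * (1 + x) ^ κ) := by ring
      _ ≤ x ^ 2 * ((1 + x) ^ 2 * (1 + x) ^ κ) := by gcongr; nlinarith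
      _ = _ := by ring
  have p3 : x ^ 2 ≤ x ^ 2 * (1 + x) ^ (κ + 2) :=
    le_mul_of_one_le_right (by positivity) (one_le_pow₀ h1x)
  have hz : 0 ≤ |a₁ φ| := abs_nonneg _
  nlinarith [mul_le_mul_of_nonneg_left p1 hC, mul_le_mul_of_nonneg_left p2 hC,
    mul_le_mul_of_nonneg_left p3 hC]

end LaplaceExpansion

/-! ### Rescaled integrals and their error `1/n` -/

section LaplaceIntegrals

variable {V : Type*} [NormedAddCommGroup V] [InnerProductSpace ℝ V] [FiniteDimensional ℝ V]
  [MeasurableSpace V] [BorelSpace V] {δ C : ℝ} {κ : ℕ}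

/-- The rescaled integral of the `n`-th power. -/
noncomputable def laplaceInt (n : ℕ) (ρ : V → ℂ) : ℝ :=
  √(n : ℝ) ^ Module.finrank ℝ V * ∫ φ, (ρ φ ^ n).re

/-- The derivative of `laplaceInt` with respect to a parameter. -/
noncomputable def laplaceIntDeriv (n : ℕ) (ρ ρ₁ : V → ℂ) : ℝ :=
  √(n : ℝ) ^ Module.finrank ℝ V * ∫ φ, (n * ρ φ ^ (n - 1) * ρ₁ φ).re

/-- The Gaussian integral of a quadratic form. -/
noncomputable def gaussInt (a : V → ℝ) : ℝ := ∫ φ, Real.exp (-(a φ / 2))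

/-- The derivative of `gaussInt` with respect to a parameter. -/
noncomputable def gaussIntDeriv (a a₁ : V → ℝ) : ℝ :=
  ∫ φ, -((a₁ φ / 2) * Real.exp (-(a φ / 2)))

theorem exists_laplaceWeight_bounds (hδ : 0 < δ) (κ A : ℕ) :
    ∃ (N : ℕ) (C : ℝ), 3 ≤ N ∧ 0 ≤ C ∧ ∀ n : ℕ, N ≤ n → ∀ a ≤ A,
      Integrable (laplaceWeight δ κ a n : V → ℝ) ∧
      √(n : ℝ) ^ Module.finrank ℝ V * ∫ φ : V, laplaceWeight δ κ a n φ ≤ C / √(n : ℝ) ^ a := by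
  induction A with
  | zero =>
    obtain ⟨N, C, hC, h⟩ := exists_laplaceWeight_bound (V := V) hδ κ 0
    refine ⟨max N 3, C, le_max_right _ _, hC, fun n hn a ha => ?_⟩
    obtain rfl : a = 0 := by omega
    exact h n ((le_max_left _ _).trans hn)
  | succ A ih =>
    obtain ⟨N, C, hN, hC, h⟩ := ih
    obtain ⟨N', C', hC', h'⟩ := exists_laplaceWeight_bound (V := V) hδ κ (A + 1)
    refine ⟨max N N', max C C', hN.trans (le_max_left _ _), hC.trans (le_max_left _ _),
      fun n hn a ha => ?_⟩
    rcases Nat.lt_or_ge A a with hlt | hle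
    · obtain rfl : a = A + 1 := by omega
      obtain ⟨i1, i2⟩ := h' n ((le_max_right _ _).trans hn)
      exact ⟨i1, i2.trans (by gcongr; exact le_max_right _ _)⟩
    · obtain ⟨i1, i2⟩ := h n ((le_max_left _ _).trans hn) a hle
      exact ⟨i1, i2.trans (by gcongr; exact le_max_left _ _)⟩

theorem sqrt_pow_mul_integral_eq {n : ℕ} (hn : 0 < n) (f : V → ℝ) :
    √(n : ℝ) ^ Module.finrank ℝ V * ∫ φ, f φ = ∫ ψ, f ((√(n : ℝ))⁻¹ • ψ) := by
  have hs : 0 < √(n : ℝ) := Real.sqrt_pos.2 (by exact_mod_cast hn)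
  rw [Measure.integral_comp_smul, inv_pow, inv_inv, abs_of_pos (by positivity), smul_eq_mul]

theorem inv_sqrt_sq_mul {n : ℕ} (hn : 0 < n) : (√(n : ℝ))⁻¹ ^ 2 * n = 1 := by
  have : (0 : ℝ) < n := by exact_mod_cast hn
  rw [inv_pow, Real.sq_sqrt this.le, inv_mul_cancel₀ this.ne']

theorem exp_form_scaled {a : V → ℝ} (ha : ∀ (t : ℝ) φ, a (t • φ) = t ^ 2 * a φ) {n : ℕ}
    (hn : 0 < n) (ψ : V) :
    Real.exp (-(a ((√(n : ℝ))⁻¹ • ψ) / 2)) ^ n = Real.exp (-(a ψ / 2)) := by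
  rw [← Real.exp_nat_mul, ha]
  congr 1
  linear_combination -(a ψ / 2) * inv_sqrt_sq_mul hn

/-- Homogeneity of degree two writes the Gaussian integral as one of `n`-th powers in the unscaled
variable, ready for comparison with `laplaceInt`. -/
theorem gaussInt_eq_scaled {a : V → ℝ} (ha : ∀ (t : ℝ) φ, a (t • φ) = t ^ 2 * a φ) {n : ℕ}
    (hn : 0 < n) : gaussInt a = √(n : ℝ) ^ Module.finrank ℝ V *
      ∫ φ, Real.exp (-(a φ / 2)) ^ n := by
  rw [sqrt_pow_mul_integral_eq hn, gaussInt]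
  simp only [exp_form_scaled ha hn]

theorem gaussIntDeriv_eq_scaled {a a₁ : V → ℝ} (ha : ∀ (t : ℝ) φ, a (t • φ) = t ^ 2 * a φ)
    (ha₁ : ∀ (t : ℝ) φ, a₁ (t • φ) = t ^ 2 * a₁ φ) {n : ℕ} (hn : 0 < n) :
    gaussIntDeriv a a₁ = √(n : ℝ) ^ Module.finrank ℝ V *
      ∫ φ, -(n * (a₁ φ / 2) * Real.exp (-(a φ / 2)) ^ n) := by
  rw [sqrt_pow_mul_integral_eq hn, gaussIntDeriv]
  refine integral_congr_ae (Eventually.of_forall fun ψ => ?_)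
  simp only [exp_form_scaled ha hn, ha₁]
  linear_combination (a₁ ψ / 2 * Real.exp (-(a ψ / 2))) * inv_sqrt_sq_mul hn

theorem LaplacePair.norm_pow_le_weight (hδ : 0 < δ) {ρ : V → ℂ} {a : V → ℝ}
    (h : LaplacePair δ C κ ρ a) (κ' n : ℕ) (φ : V) :
    ‖ρ φ ^ n‖ ≤ laplaceWeight δ κ' 0 n φ := by
  rw [norm_pow, laplaceWeight, pow_zero, one_mul]
  have h1 := bracketDecay_pow_le hδ φ (n := n) (k := n) (by omega)
  have h2 := bracketDecay_pos hδ φ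
  have h3 : 1 ≤ (1 + ‖φ‖) ^ κ' := one_le_pow₀ (by linarith [norm_nonneg φ])
  calc ‖ρ φ‖ ^ n ≤ bracketDecay δ φ ^ n := pow_le_pow_left₀ (norm_nonneg _) (h.norm_le φ) n
    _ ≤ bracketDecay δ φ ^ (n - 3) := h1
    _ ≤ _ := le_mul_of_one_le_left (by positivity) h3

theorem LaplacePair.exp_pow_le_weight (hδ : 0 < δ) {ρ : V → ℂ} {a : V → ℝ}
    (h : LaplacePair δ C κ ρ a) (κ' n : ℕ) (φ : V) :
    Real.exp (-(a φ / 2)) ^ n ≤ laplaceWeight δ κ' 0 n φ := by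
  rw [laplaceWeight, pow_zero, one_mul]
  have h1 := bracketDecay_pow_le hδ φ (n := n) (k := n) (by omega)
  have h2 := bracketDecay_pos hδ φ
  have h3 : 1 ≤ (1 + ‖φ‖) ^ κ' := one_le_pow₀ (by linarith [norm_nonneg φ])
  calc Real.exp (-(a φ / 2)) ^ n ≤ bracketDecay δ φ ^ n :=
        pow_le_pow_left₀ (Real.exp_pos _).le (h.exp_le φ) n
    _ ≤ bracketDecay δ φ ^ (n - 3) := h1
    _ ≤ _ := le_mul_of_one_le_left (by positivity) h3

theorem scaled_integral_sub_le {n : ℕ} {f g w : V → ℝ} (hf : Integrable f) (hg : Integrable g)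
    (hw : Integrable w) (h : ∀ φ, |f φ - g φ| ≤ w φ) :
    |√(n : ℝ) ^ Module.finrank ℝ V * (∫ φ, f φ) - √(n : ℝ) ^ Module.finrank ℝ V * ∫ φ, g φ| ≤
      √(n : ℝ) ^ Module.finrank ℝ V * ∫ φ, w φ := by
  rw [← mul_sub, ← integral_sub hf hg, abs_mul, abs_of_nonneg (by positivity)]
  refine mul_le_mul_of_nonneg_left ?_ (by positivity)
  exact (norm_integral_le_integral_norm _).trans
    (integral_mono (hf.sub hg).norm hw h)

theorem div_sqrt_pow_four {n : ℕ} (hn : 0 < n) : (n : ℝ) / √(n : ℝ) ^ 4 = 1 / n := by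
  have h : (0 : ℝ) < n := by exact_mod_cast hn
  rw [show √(n : ℝ) ^ 4 = (√(n : ℝ) ^ 2) ^ 2 by ring, Real.sq_sqrt h.le]
  field_simp

theorem div_sqrt_pow_six {n : ℕ} (hn : 0 < n) : (n : ℝ) ^ 2 / √(n : ℝ) ^ 6 = 1 / n := by
  have h : (0 : ℝ) < n := by exact_mod_cast hn
  rw [show √(n : ℝ) ^ 6 = (√(n : ℝ) ^ 2) ^ 3 by ring, Real.sq_sqrt h.le]
  field_simp

theorem div_sqrt_pow_eight {n : ℕ} (hn : 0 < n) : (n : ℝ) ^ 3 / √(n : ℝ) ^ 8 = 1 / n := by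
  have h : (0 : ℝ) < n := by exact_mod_cast hn
  rw [show √(n : ℝ) ^ 8 = (√(n : ℝ) ^ 2) ^ 4 by ring, Real.sq_sqrt h.le]
  field_simp

/-- The pointwise error consists of `n² |φ|⁶` and `n |φ|⁴`. Against the weights `|φ|^a` integrates
to order `n^(-a/2)`, so both contribute `1/n`. -/
theorem exists_laplaceInt_sub_gaussInt_le (hδ : 0 < δ) (hC : 0 ≤ C) (κ : ℕ) :
    ∃ (N : ℕ) (C' : ℝ), 3 ≤ N ∧ 0 ≤ C' ∧ ∀ n : ℕ, N ≤ n → ∀ (ρ : V → ℂ) (a : V → ℝ),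
      LaplacePair δ C κ ρ a → |laplaceInt n ρ - gaussInt a| ≤ C' / n := by
  obtain ⟨N, C₀, hN, hC₀, hw⟩ := exists_laplaceWeight_bounds (V := V) hδ (2 * κ + 2) 8
  refine ⟨N, ((2 * C + C ^ 2) ^ 2 + (C + C ^ 2)) * C₀, hN, by positivity,
    fun n hn ρ a h => ?_⟩
  have hn0 : 0 < n := by omega
  obtain ⟨i0, -⟩ := hw n hn 0 (by omega)
  obtain ⟨i6, b6⟩ := hw n hn 6 (by omega)
  obtain ⟨i4, b4⟩ := hw n hn 4 (by omega)
  set w : V → ℝ := fun φ => ((n : ℝ) ^ 2 * (2 * C + C ^ 2) ^ 2) * laplaceWeight δ (2 * κ + 2) 6 n φ +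
    (n * (C + C ^ 2)) * laplaceWeight δ (2 * κ + 2) 4 n φ with hwdef
  have hwi : Integrable w := (i6.const_mul _).add (i4.const_mul _)
  have hf : Integrable fun φ => (ρ φ ^ n).re := by
    refine i0.mono' (Complex.continuous_re.comp (h.cont.pow n)).aestronglyMeasurable
      (Eventually.of_forall fun φ => ?_)
    exact (Complex.abs_re_le_norm _).trans (h.norm_pow_le_weight hδ _ n φ)
  have hg : Integrable fun φ => Real.exp (-(a φ / 2)) ^ n := by
    refine i0.mono' (((h.cont_form.div_const 2).neg.rexp).pow n).aestronglyMeasurable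
      (Eventually.of_forall fun φ => ?_)
    rw [Real.norm_of_nonneg (by positivity)]
    exact h.exp_pow_le_weight hδ _ n φ
  have hle : ∀ φ, |(ρ φ ^ n).re - Real.exp (-(a φ / 2)) ^ n| ≤ w φ := by
    intro φ
    obtain ⟨k, rfl⟩ : ∃ k, n = k + 2 := ⟨n - 2, by omega⟩
    have h1 := h.abs_re_pow_sub_le hδ hC φ k
    have h2 : bracketDecay δ φ ^ k ≤ bracketDecay δ φ ^ (k - 1) :=
      bracketDecay_pow_le hδ φ (n := k + 2) (k := k) (by omega)
    have h3 := bracketDecay_pos hδ φ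
    rw [hwdef]
    simp only [laplaceWeight]
    push_cast
    generalize k - 1 = j at h2 ⊢
    have hP : 0 ≤ (1 + ‖φ‖) ^ (2 * κ + 2) := by positivity
    generalize (1 + ‖φ‖) ^ (2 * κ + 2) = P at h1 hP ⊢
    calc _ ≤ _ := h1
      _ ≤ (((k : ℝ) + 2) ^ 2 * (2 * C + C ^ 2) ^ 2 * ‖φ‖ ^ 6 + (k + 2) * (C + C ^ 2) * ‖φ‖ ^ 4) *
        P * bracketDecay δ φ ^ j := by gcongr
      _ = _ := by ring
  rw [gaussInt_eq_scaled h.form_smul hn0, laplaceInt]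
  refine (scaled_integral_sub_le hf hg hwi hle).trans ?_
  rw [hwdef, integral_add (i6.const_mul _) (i4.const_mul _), integral_const_mul,
    integral_const_mul]
  have e6 := div_sqrt_pow_six hn0
  have e4 := div_sqrt_pow_four hn0
  calc _ = ((n : ℝ) ^ 2 * (2 * C + C ^ 2) ^ 2) * (√(n : ℝ) ^ Module.finrank ℝ V *
        (∫ φ : V, laplaceWeight δ (2 * κ + 2) 6 n φ)) + (n * (C + C ^ 2)) *
        (√(n : ℝ) ^ Module.finrank ℝ V * (∫ φ : V, laplaceWeight δ (2 * κ + 2) 4 n φ)) := by ring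
    _ ≤ ((n : ℝ) ^ 2 * (2 * C + C ^ 2) ^ 2) * (C₀ / √(n : ℝ) ^ 6) + (n * (C + C ^ 2)) *
        (C₀ / √(n : ℝ) ^ 4) := by gcongr
    _ = (2 * C + C ^ 2) ^ 2 * C₀ * ((n : ℝ) ^ 2 / √(n : ℝ) ^ 6) +
        (C + C ^ 2) * C₀ * (n / √(n : ℝ) ^ 4) := by ring
    _ = _ := by rw [e6, e4]; ring

/-- The integrand of `laplaceIntDeriv` is dominated. -/
theorem norm_mul_pow_mul_le (hδ : 0 < δ) (hC : 0 ≤ C) {ρ ρ₁ : V → ℂ} {a a₁ : V → ℝ}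
    (h : LaplacePair δ C κ ρ a) (h₁ : LaplaceDeriv C κ ρ₁ a₁) {κ' : ℕ} (hκ : κ + 2 ≤ κ')
    (n : ℕ) (φ : V) :
    ‖n * ρ φ ^ (n - 1) * ρ₁ φ‖ ≤ n * (3 * C) * laplaceWeight δ κ' 2 n φ := by
  rw [norm_mul, norm_mul, Complex.norm_natCast, norm_pow, laplaceWeight]
  have h2 := bracketDecay_pos hδ φ
  have e1 : ‖ρ φ‖ ^ (n - 1) ≤ bracketDecay δ φ ^ (n - 3) :=
    (pow_le_pow_left₀ (norm_nonneg _) (h.norm_le φ) _).trans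
      (bracketDecay_pow_le hδ φ (by omega))
  have e2 := h₁.norm_le hC φ
  have e3 : (1 + ‖φ‖) ^ (κ + 2) ≤ (1 + ‖φ‖) ^ κ' :=
    pow_le_pow_right₀ (by linarith [norm_nonneg φ]) hκ
  calc (n : ℝ) * ‖ρ φ‖ ^ (n - 1) * ‖ρ₁ φ‖ ≤ n * bracketDecay δ φ ^ (n - 3) *
        (3 * C * ‖φ‖ ^ 2 * (1 + ‖φ‖) ^ κ') := by
        gcongr
        exact e2.trans (by gcongr)
    _ = _ := by ring

/-- The pointwise error consists of `n³ |φ|⁸`, `n² |φ|⁶` and `n |φ|⁴`, each of which integrates to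
order `1/n`. -/
theorem exists_laplaceIntDeriv_sub_le (hδ : 0 < δ) (hC : 0 ≤ C) (κ : ℕ) :
    ∃ (N : ℕ) (C' : ℝ), 3 ≤ N ∧ 0 ≤ C' ∧ ∀ n : ℕ, N ≤ n → ∀ (ρ ρ₁ : V → ℂ) (a a₁ : V → ℝ),
      LaplacePair δ C κ ρ a → LaplaceDeriv C κ ρ₁ a₁ →
      |laplaceIntDeriv n ρ ρ₁ - gaussIntDeriv a a₁| ≤ C' / n := by
  obtain ⟨N, C₀, hN, hC₀, hw⟩ := exists_laplaceWeight_bounds (V := V) hδ (3 * κ + 2) 8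
  set c8 := (2 * C + C ^ 2) ^ 2 * C with hc8
  set c6 := (C + C ^ 2) * C + (2 * C + C ^ 2) * C with hc6
  set c4 := C ^ 2 + C with hc4
  refine ⟨N, (c8 + c6 + c4) * C₀, hN, by positivity, fun n hn ρ ρ₁ a a₁ h h₁ => ?_⟩
  have hn0 : 0 < n := by omega
  obtain ⟨i2, -⟩ := hw n hn 2 (by omega)
  obtain ⟨i8, b8⟩ := hw n hn 8 (by omega)
  obtain ⟨i6, b6⟩ := hw n hn 6 (by omega)
  obtain ⟨i4, b4⟩ := hw n hn 4 (by omega)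
  set w : V → ℝ := fun φ => ((n : ℝ) ^ 3 * c8) * laplaceWeight δ (3 * κ + 2) 8 n φ +
    ((n : ℝ) ^ 2 * c6) * laplaceWeight δ (3 * κ + 2) 6 n φ +
    (n * c4) * laplaceWeight δ (3 * κ + 2) 4 n φ with hwdef
  have hwi : Integrable w := ((i8.const_mul _).add (i6.const_mul _)).add (i4.const_mul _)
  have hf : Integrable fun φ => (n * ρ φ ^ (n - 1) * ρ₁ φ).re := by
    refine (i2.const_mul (n * (3 * C))).mono' (Complex.continuous_re.comp
      ((continuous_const.mul (h.cont.pow _)).mul h₁.cont)).aestronglyMeasurable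
      (Eventually.of_forall fun φ => ?_)
    exact (Complex.abs_re_le_norm _).trans (norm_mul_pow_mul_le hδ hC h h₁ (by omega) n φ)
  have hg : Integrable fun φ => -((n : ℝ) * (a₁ φ / 2) * Real.exp (-(a φ / 2)) ^ n) := by
    refine (i2.const_mul (n * C)).mono' ?_ (Eventually.of_forall fun φ => ?_)
    · have := h₁.cont_form
      have := h.cont_form
      exact Continuous.aestronglyMeasurable (by fun_prop)
    · have e1 := h₁.form_le φ
      have e2 : |a₁ φ / 2| ≤ C * ‖φ‖ ^ 2 := by
        rw [abs_div, abs_two]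
        have := abs_nonneg (a₁ φ)
        linarith
      have e3 := h.exp_pow_le_weight hδ (3 * κ + 2) n φ
      rw [norm_neg, norm_mul, norm_mul, Real.norm_natCast, Real.norm_eq_abs,
        Real.norm_of_nonneg (by positivity)]
      calc (n : ℝ) * |a₁ φ / 2| * Real.exp (-(a φ / 2)) ^ n
          ≤ n * (C * ‖φ‖ ^ 2) * laplaceWeight δ (3 * κ + 2) 0 n φ := by gcongr
        _ = _ := by simp only [laplaceWeight]; ring
  have hle : ∀ φ, |(n * ρ φ ^ (n - 1) * ρ₁ φ).re -
      -((n : ℝ) * (a₁ φ / 2) * Real.exp (-(a φ / 2)) ^ n)| ≤ w φ := by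
    intro φ
    obtain ⟨k, rfl⟩ : ∃ k, n = k + 3 := ⟨n - 3, by omega⟩
    have h1 := h₁.abs_re_sub_le hδ hC h φ k
    rw [hwdef]
    simp only [laplaceWeight]
    push_cast
    refine h1.trans (le_of_eq ?_)
    ring
  rw [gaussIntDeriv_eq_scaled h.form_smul h₁.form_smul hn0, laplaceIntDeriv]
  refine (scaled_integral_sub_le hf hg hwi hle).trans ?_
  have hwe : ∫ φ, w φ = ((n : ℝ) ^ 3 * c8) * (∫ φ : V, laplaceWeight δ (3 * κ + 2) 8 n φ) +
      ((n : ℝ) ^ 2 * c6) * (∫ φ : V, laplaceWeight δ (3 * κ + 2) 6 n φ) +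
      (n * c4) * (∫ φ : V, laplaceWeight δ (3 * κ + 2) 4 n φ) := by
    simp only [hwdef]
    rw [integral_add (by exact (i8.const_mul _).add (i6.const_mul _)) (i4.const_mul _),
      integral_add (i8.const_mul _) (i6.const_mul _), integral_const_mul,
      integral_const_mul, integral_const_mul]
  rw [hwe]
  have e8 := div_sqrt_pow_eight hn0
  have e6 := div_sqrt_pow_six hn0
  have e4 := div_sqrt_pow_four hn0
  calc _ = ((n : ℝ) ^ 3 * c8) * (√(n : ℝ) ^ Module.finrank ℝ V *
        (∫ φ : V, laplaceWeight δ (3 * κ + 2) 8 n φ)) + ((n : ℝ) ^ 2 * c6) *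
        (√(n : ℝ) ^ Module.finrank ℝ V * (∫ φ : V, laplaceWeight δ (3 * κ + 2) 6 n φ)) + (n * c4) *
        (√(n : ℝ) ^ Module.finrank ℝ V * (∫ φ : V, laplaceWeight δ (3 * κ + 2) 4 n φ)) := by ring
    _ ≤ ((n : ℝ) ^ 3 * c8) * (C₀ / √(n : ℝ) ^ 8) + ((n : ℝ) ^ 2 * c6) * (C₀ / √(n : ℝ) ^ 6) +
        (n * c4) * (C₀ / √(n : ℝ) ^ 4) := by gcongr
    _ = c8 * C₀ * ((n : ℝ) ^ 3 / √(n : ℝ) ^ 8) + c6 * C₀ * ((n : ℝ) ^ 2 / √(n : ℝ) ^ 6) +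
        c4 * C₀ * (n / √(n : ℝ) ^ 4) := by ring
    _ = _ := by rw [e8, e6, e4]; ring

end LaplaceIntegrals

section ParametricLine

variable {V : Type*} [TopologicalSpace V] [MeasurableSpace V] [OpensMeasurableSpace V]
  [SecondCountableTopology V]
  {Z : Type*} [NormedAddCommGroup Z] [NormedSpace ℝ Z] {μ : Measure V}

/-- Differentiation of an integral with respect to a parameter along a line. -/
theorem hasLineDerivAt_integral_of_dominated {W : Set Z} (hW : IsOpen W) {f f₁ : Z → V → ℝ} {v : Z}
    {bound : V → ℝ} (hf : ∀ z ∈ W, Continuous (f z)) (hf₁ : ∀ z ∈ W, Continuous (f₁ z))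
    (hd : ∀ z ∈ W, ∀ φ, HasLineDerivAt ℝ (fun z => f z φ) (f₁ z φ) z v)
    (hb : ∀ z ∈ W, ∀ φ, |f₁ z φ| ≤ bound φ) (hbi : Integrable bound μ) {z : Z} (hz : z ∈ W)
    (hi : Integrable (f z) μ) :
    HasLineDerivAt ℝ (fun z => ∫ φ, f z φ ∂μ) (∫ φ, f₁ z φ ∂μ) z v := by
  have hc : Continuous fun t : ℝ => z + t • v := by fun_prop
  have hs : (fun t : ℝ => z + t • v) ⁻¹' W ∈ 𝓝 (0 : ℝ) :=
    (hW.preimage hc).mem_nhds (by simpa using hz)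
  have := hasDerivAt_integral_of_dominated_loc_of_deriv_le (μ := μ)
    (F := fun (t : ℝ) φ => f (z + t • v) φ) (F' := fun (t : ℝ) φ => f₁ (z + t • v) φ)
    (x₀ := 0) (bound := bound) hs
    (Filter.mem_of_superset hs fun t ht => (hf _ ht).aestronglyMeasurable)
    (by simpa using hi) (by simpa using (hf₁ z hz).aestronglyMeasurable)
    (Eventually.of_forall fun φ t ht => hb _ ht φ) hbi
    (Eventually.of_forall fun φ t ht => (hd _ ht φ).hasDerivAt_line)
  simpa [HasLineDerivAt] using this.2

end ParametricLine

/-! ### Families depending on a parameter -/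

section LaplaceFamily

variable {V : Type*} [NormedAddCommGroup V] [InnerProductSpace ℝ V] [FiniteDimensional ℝ V]
  [MeasurableSpace V] [BorelSpace V] {δ C : ℝ} {κ : ℕ}
  {Z : Type*} [NormedAddCommGroup Z] [NormedSpace ℝ Z]

/-- A family of functions as in `LaplacePair`, twice differentiable along the directions in `S`. -/
structure LaplaceFamily (W S : Set Z) (δ C : ℝ) (κ : ℕ) (ρ : Z → V → ℂ) (ρ₁ ρ₂ : Z → Z → V → ℂ)
    (a : Z → V → ℝ) (a₁ : Z → Z → V → ℝ) : Prop where
  pair : ∀ z ∈ W, LaplacePair δ C κ (ρ z) (a z)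
  deriv : ∀ z ∈ W, ∀ v ∈ S, LaplaceDeriv C κ (ρ₁ z v) (a₁ z v)
  cont_second : ∀ z ∈ W, ∀ v ∈ S, Continuous (ρ₂ z v)
  second_le : ∀ z ∈ W, ∀ v ∈ S, ∀ φ, ‖ρ₂ z v φ‖ ≤ C * ‖φ‖ * (1 + ‖φ‖) ^ κ
  contAt : ∀ z ∈ W, ∀ φ, ContinuousAt (fun z => ρ z φ) z
  line : ∀ z ∈ W, ∀ v ∈ S, ∀ φ, HasLineDerivAt ℝ (fun z => ρ z φ) (ρ₁ z v φ) z v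
  line_deriv : ∀ z ∈ W, ∀ v ∈ S, ∀ φ, HasLineDerivAt ℝ (fun z => ρ₁ z v φ) (ρ₂ z v φ) z v
  line_form : ∀ z ∈ W, ∀ v ∈ S, ∀ φ, HasLineDerivAt ℝ (fun z => a z φ) (a₁ z v φ) z v

theorem HasLineDerivAt.re {f : Z → ℂ} {f' : ℂ} {z v : Z} (h : HasLineDerivAt ℝ f f' z v) :
    HasLineDerivAt ℝ (fun z => (f z).re) f'.re z v :=
  (Complex.reCLM.hasFDerivAt.comp_hasDerivAt (0 : ℝ) h :)

theorem integrable_laplaceWeight_scaled {n : ℕ} (hn : 0 < n) {κ a : ℕ}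
    (h : Integrable (laplaceWeight δ κ a n : V → ℝ)) :
    Integrable fun ψ : V => laplaceWeight δ κ a n ((√(n : ℝ))⁻¹ • ψ) :=
  h.comp_smul (inv_ne_zero (Real.sqrt_pos.2 (by exact_mod_cast hn)).ne')

theorem LaplacePair.exp_le_scaled_weight (hδ : 0 < δ) {ρ : V → ℂ} {a : V → ℝ}
    (h : LaplacePair δ C κ ρ a) (κ' : ℕ) {n : ℕ} (hn : 0 < n) (ψ : V) :
    Real.exp (-(a ψ / 2)) ≤ laplaceWeight δ κ' 0 n ((√(n : ℝ))⁻¹ • ψ) := by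
  rw [← exp_form_scaled h.form_smul hn]
  exact h.exp_pow_le_weight hδ κ' n _

/-- For a fixed `n` the majorant depends on `δ` and `C` only, as is needed to differentiate the
Gaussian integral under the integral sign. -/
theorem abs_form_deriv_mul_exp_le (hδ : 0 < δ) {ρ ρ₁ : V → ℂ} {a a₁ : V → ℝ}
    (h : LaplacePair δ C κ ρ a) (h₁ : LaplaceDeriv C κ ρ₁ a₁) (κ' : ℕ) {n : ℕ} (hn : 0 < n)
    (ψ : V) : |-((a₁ ψ / 2) * Real.exp (-(a ψ / 2)))| ≤
      C * n * laplaceWeight δ κ' 2 n ((√(n : ℝ))⁻¹ • ψ) := by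
  rw [abs_neg, abs_mul, abs_of_pos (Real.exp_pos _), abs_div, abs_two]
  have e1 := h₁.form_le ψ
  have e2 := h.exp_le_scaled_weight hδ κ' hn ψ
  have hn0 : (0 : ℝ) < n := by exact_mod_cast hn
  have hs : 0 < √(n : ℝ) := Real.sqrt_pos.2 hn0
  have e3 : |a₁ ψ| / 2 ≤ C * ‖ψ‖ ^ 2 := by
    have := abs_nonneg (a₁ ψ)
    linarith
  calc |a₁ ψ| / 2 * Real.exp (-(a ψ / 2))
      ≤ (C * ‖ψ‖ ^ 2) * laplaceWeight δ κ' 0 n ((√(n : ℝ))⁻¹ • ψ) :=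
        mul_le_mul e3 e2 (Real.exp_pos _).le ((by positivity : (0 : ℝ) ≤ |a₁ ψ| / 2).trans e3)
    _ = _ := by
        have e4 : ‖(√(n : ℝ))⁻¹ • ψ‖ ^ 2 * n = ‖ψ‖ ^ 2 := by
          rw [norm_smul, norm_inv, Real.norm_of_nonneg hs.le, mul_pow]
          linear_combination ‖ψ‖ ^ 2 * inv_sqrt_sq_mul hn
        rw [← e4]
        simp only [laplaceWeight]
        ring

theorem LaplacePair.integrable_exp (hδ : 0 < δ) {ρ : V → ℂ} {a : V → ℝ}
    (h : LaplacePair δ C κ ρ a) : Integrable fun ψ => Real.exp (-(a ψ / 2)) := by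
  obtain ⟨N, C₀, hN, _, hw⟩ := exists_laplaceWeight_bounds (V := V) hδ 0 0
  have hi := integrable_laplaceWeight_scaled (by omega) (hw N le_rfl 0 le_rfl).1
  refine hi.mono' (h.cont_form.div_const 2).neg.rexp.aestronglyMeasurable
    (Eventually.of_forall fun ψ => ?_)
  rw [Real.norm_of_nonneg (Real.exp_pos _).le]
  exact h.exp_le_scaled_weight hδ 0 (by omega) ψ

/-- On the unit ball the form is at most `C`, so the integrand is at least `exp (-C / 2)` there. -/
theorem exists_gaussInt_lower_bound (hδ : 0 < δ) (hC : 0 ≤ C) :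
    ∃ c > 0, ∀ (ρ : V → ℂ) (a : V → ℝ), LaplacePair δ C κ ρ a → c ≤ gaussInt a := by
  have hvol : 0 < volume.real (Metric.ball (0 : V) 1) :=
    ENNReal.toReal_pos (Metric.measure_ball_pos volume _ one_pos).ne' measure_ball_lt_top.ne
  refine ⟨volume.real (Metric.ball (0 : V) 1) * Real.exp (-(C / 2)), by positivity,
    fun ρ a h => ?_⟩
  have hi := h.integrable_exp hδ
  calc volume.real (Metric.ball (0 : V) 1) * Real.exp (-(C / 2))
      = ∫ _ψ in Metric.ball (0 : V) 1, Real.exp (-(C / 2)) := by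
        rw [setIntegral_const, smul_eq_mul]
    _ ≤ ∫ ψ in Metric.ball (0 : V) 1, Real.exp (-(a ψ / 2)) := by
        refine setIntegral_mono_on (integrableOn_const (hs := measure_ball_lt_top.ne))
          hi.integrableOn Metric.isOpen_ball.measurableSet fun ψ hψ => ?_
        rw [Metric.mem_ball, dist_zero_right] at hψ
        have h1 := h.form_le ψ
        have h2 : ‖ψ‖ ^ 2 ≤ 1 := pow_le_one₀ (norm_nonneg _) hψ.le
        apply Real.exp_le_exp.2
        nlinarith
    _ ≤ gaussInt a := setIntegral_le_integral hi (Eventually.of_forall fun _ => (Real.exp_pos _).le)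

/-- The asymptotic behaviour of `laplaceInt` and of its derivatives, uniformly in a family. -/
theorem LaplaceFamily.exists_bounds {W S : Set Z} (hW : IsOpen W) (hδ : 0 < δ) (hC : 0 ≤ C)
    {ρ : Z → V → ℂ} {ρ₁ ρ₂ : Z → Z → V → ℂ} {a : Z → V → ℝ} {a₁ : Z → Z → V → ℝ}
    (h : LaplaceFamily W S δ C κ ρ ρ₁ ρ₂ a a₁) :
    ∃ (N : ℕ) (C' c : ℝ), 3 ≤ N ∧ 0 ≤ C' ∧ 0 < c ∧ ∀ z ∈ W, c ≤ gaussInt (a z) ∧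
      (∀ v ∈ S, HasLineDerivAt ℝ (fun z => gaussInt (a z)) (gaussIntDeriv (a z) (a₁ z v)) z v ∧
        |gaussIntDeriv (a z) (a₁ z v)| ≤ C') ∧
      ∀ n : ℕ, N ≤ n → |laplaceInt n (ρ z) - gaussInt (a z)| ≤ C' / n ∧
        ContinuousAt (fun z => laplaceInt n (ρ z)) z ∧
        ∀ v ∈ S,
          HasLineDerivAt ℝ (fun z => laplaceInt n (ρ z)) (laplaceIntDeriv n (ρ z) (ρ₁ z v)) z v ∧
          |laplaceIntDeriv n (ρ z) (ρ₁ z v) - gaussIntDeriv (a z) (a₁ z v)| ≤ C' / n ∧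
          ∃ c₂, |c₂| ≤ C' * √(n : ℝ) ∧
            HasLineDerivAt ℝ (fun z => laplaceIntDeriv n (ρ z) (ρ₁ z v)) c₂ z v := by
  obtain ⟨N₀, C₀, hN₀, hC₀, h0⟩ := exists_laplaceInt_sub_gaussInt_le (V := V) hδ hC κ
  obtain ⟨N₁, C₁, hN₁, hC₁, h1⟩ := exists_laplaceIntDeriv_sub_le (V := V) hδ hC κ
  obtain ⟨N₂, C₂, hN₂, hC₂, hw⟩ := exists_laplaceWeight_bounds (V := V) hδ (2 * κ + 4) 4
  obtain ⟨c, hc, hcl⟩ := exists_gaussInt_lower_bound (V := V) (κ := κ) hδ hC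
  -- The Gaussian integral does not involve `n`; the rescaled weight at the single value `N₂`
  -- dominates its derivative for all parameters in `W`.
  set bound : V → ℝ := fun ψ =>
    C * N₂ * laplaceWeight δ (2 * κ + 4) 2 N₂ ((√(N₂ : ℝ))⁻¹ • ψ) with hbound
  have hbi : Integrable bound :=
    (integrable_laplaceWeight_scaled (by omega) (hw N₂ le_rfl 2 (by omega)).1).const_mul _
  set C₃ := ∫ ψ, bound ψ with hC₃
  have hC₃0 : 0 ≤ C₃ := integral_nonneg fun ψ => by
    have := laplaceWeight_nonneg hδ (2 * κ + 4) 2 N₂ ((√(N₂ : ℝ))⁻¹ • ψ)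
    simp only [hbound, Pi.zero_apply]; positivity
  set C₄ := 9 * C ^ 2 * C₂ + C * C₂ with hC₄
  refine ⟨max N₀ (max N₁ N₂), C₀ + C₁ + C₃ + C₄, c, hN₀.trans (le_max_left _ _), by positivity, hc,
    fun z hz => ⟨hcl _ _ (h.pair z hz), fun v hv => ⟨?_, ?_⟩, fun n hn => ⟨?_, ?_, fun v hv =>
      ⟨?_, ?_, ?_⟩⟩⟩⟩
  · refine hasLineDerivAt_integral_of_dominated hW (bound := bound)
      (f := fun z ψ => Real.exp (-(a z ψ / 2)))
      (f₁ := fun z ψ => -((a₁ z v ψ / 2) * Real.exp (-(a z ψ / 2))))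
      (fun z hz => ((h.pair z hz).cont_form.div_const 2).neg.rexp)
      (fun z hz => ?_) (fun z hz ψ => ?_) (fun z hz ψ => ?_) hbi hz ((h.pair z hz).integrable_exp hδ)
    · have := (h.pair z hz).cont_form
      have := (h.deriv z hz v hv).cont_form
      fun_prop
    · have h2 : HasDerivAt (fun t : ℝ => a (z + t • v) ψ) (a₁ z v ψ) 0 := h.line_form z hz v hv ψ
      have h3 := (h2.div_const 2).neg.exp
      refine HasDerivAt.congr_deriv h3 ?_
      simp only [Pi.neg_apply, zero_smul, add_zero]
      ring
    · exact abs_form_deriv_mul_exp_le hδ (h.pair z hz) (h.deriv z hz v hv) _ (by omega) ψ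
  · have : |gaussIntDeriv (a z) (a₁ z v)| ≤ C₃ := by
      rw [gaussIntDeriv, ← Real.norm_eq_abs]
      refine norm_integral_le_of_norm_le hbi (Eventually.of_forall fun ψ => ?_)
      exact abs_form_deriv_mul_exp_le hδ (h.pair z hz) (h.deriv z hz v hv) _ (by omega) ψ
    have : 0 ≤ C₄ := by positivity
    linarith
  · refine (h0 n ((le_max_left _ _).trans hn) _ _ (h.pair z hz)).trans ?_
    have : 0 ≤ C₄ := by positivity
    gcongr
    linarith
  · refine ContinuousAt.mul continuousAt_const ?_
    have hn2 : N₂ ≤ n := (le_max_right _ _).trans ((le_max_right _ _).trans hn)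
    refine continuousAt_of_dominated (bound := laplaceWeight δ (2 * κ + 4) 0 n) ?_ ?_
      (hw n hn2 0 (by omega)).1 (Eventually.of_forall fun φ => ?_)
    · filter_upwards [hW.mem_nhds hz] with z' hz'
      exact (Complex.continuous_re.comp ((h.pair z' hz').cont.pow n)).aestronglyMeasurable
    · filter_upwards [hW.mem_nhds hz] with z' hz'
      exact Eventually.of_forall fun φ => (Complex.abs_re_le_norm _).trans
        ((h.pair z' hz').norm_pow_le_weight hδ _ n φ)
    · exact Complex.continuous_re.continuousAt.comp ((h.contAt z hz φ).pow n)
  · have hn2 : N₂ ≤ n := (le_max_right _ _).trans ((le_max_right _ _).trans hn)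
    have hi : Integrable fun φ => (ρ z φ ^ n).re := by
      refine (hw n hn2 0 (by omega)).1.mono'
        (Complex.continuous_re.comp ((h.pair z hz).cont.pow n)).aestronglyMeasurable
        (Eventually.of_forall fun φ => ?_)
      exact (Complex.abs_re_le_norm _).trans ((h.pair z hz).norm_pow_le_weight hδ _ n φ)
    have hd := hasLineDerivAt_integral_of_dominated hW (μ := volume)
      (bound := fun φ => n * (3 * C) * laplaceWeight δ (2 * κ + 4) 2 n φ) (v := v)
      (f := fun z φ => (ρ z φ ^ n).re)
      (f₁ := fun z φ => (n * ρ z φ ^ (n - 1) * ρ₁ z v φ).re)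
      (fun z hz => Complex.continuous_re.comp ((h.pair z hz).cont.pow n))
      (fun z hz => Complex.continuous_re.comp
        ((continuous_const.mul ((h.pair z hz).cont.pow _)).mul (h.deriv z hz v hv).cont))
      (fun z hz φ => ?_) (fun z hz φ => (Complex.abs_re_le_norm _).trans
        (norm_mul_pow_mul_le hδ hC (h.pair z hz) (h.deriv z hz v hv) (by omega) n φ))
      ((hw n hn2 2 (by omega)).1.const_mul _) hz hi
    · exact HasDerivAt.const_mul _ hd
    · have h2 : HasDerivAt (fun t : ℝ => ρ (z + t • v) φ) (ρ₁ z v φ) 0 := h.line z hz v hv φ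
      have h3 := h2.pow n
      simp only [zero_smul, add_zero] at h3
      exact HasLineDerivAt.re h3
  · refine (h1 n ((le_max_left _ _).trans ((le_max_right _ _).trans hn)) _ _ _ _ (h.pair z hz)
      (h.deriv z hz v hv)).trans ?_
    have : 0 ≤ C₄ := by positivity
    gcongr
    linarith
  · have hn2 : N₂ ≤ n := (le_max_right _ _).trans ((le_max_right _ _).trans hn)
    have hn0 : (0 : ℝ) < n := by exact_mod_cast (by omega : 0 < n)
    obtain ⟨i4, b4⟩ := hw n hn2 4 (by omega)
    obtain ⟨i1, b1⟩ := hw n hn2 1 (by omega)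
    obtain ⟨i2, -⟩ := hw n hn2 2 (by omega)
    -- The second derivative of `ρⁿ`. As `ρ₁ = O(|φ|²)` and `ρ₂ = O(|φ|)`, its two terms are of size
    -- `n² |φ|⁴` and `n |φ|`, which integrate to orders `1` and `√n`. The weaker order `√n` is
    -- enough, since the logarithm is later divided by `n`.
    set f₂ : Z → V → ℂ := fun z φ =>
      n * (((n - 1 : ℕ) : ℂ) * ρ z φ ^ (n - 1 - 1) * ρ₁ z v φ) * ρ₁ z v φ +
        n * ρ z φ ^ (n - 1) * ρ₂ z v φ with hf₂
    set w : V → ℝ := fun φ => ((n : ℝ) ^ 2 * (9 * C ^ 2)) * laplaceWeight δ (2 * κ + 4) 4 n φ +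
      (n * C) * laplaceWeight δ (2 * κ + 4) 1 n φ with hwdef
    have hwi : Integrable w := (i4.const_mul _).add (i1.const_mul _)
    have hle : ∀ z ∈ W, ∀ φ, ‖f₂ z φ‖ ≤ w φ := by
      intro z hz φ
      have p1 := (h.deriv z hz v hv).norm_le hC φ
      have p2 := h.second_le z hz v hv φ
      have hD := bracketDecay_pos hδ φ
      have q1 : ‖ρ z φ‖ ^ (n - 1) ≤ bracketDecay δ φ ^ (n - 3) :=
        (pow_le_pow_left₀ (norm_nonneg _) ((h.pair z hz).norm_le φ) _).trans
          (bracketDecay_pow_le hδ φ (by omega))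
      have q2 : ‖ρ z φ‖ ^ (n - 1 - 1) ≤ bracketDecay δ φ ^ (n - 3) :=
        (pow_le_pow_left₀ (norm_nonneg _) ((h.pair z hz).norm_le φ) _).trans
          (bracketDecay_pow_le hδ φ (by omega))
      have hx : 1 ≤ 1 + ‖φ‖ := by linarith [norm_nonneg φ]
      have q3 : (1 + ‖φ‖) ^ κ ≤ (1 + ‖φ‖) ^ (2 * κ + 4) := pow_le_pow_right₀ hx (by omega)
      have q4 : ((n - 1 : ℕ) : ℝ) ≤ n := by exact_mod_cast Nat.sub_le _ _
      refine (norm_add_le _ _).trans ?_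
      simp only [norm_mul, norm_pow, Complex.norm_natCast]
      calc (n : ℝ) * (((n - 1 : ℕ) : ℝ) * ‖ρ z φ‖ ^ (n - 1 - 1) * ‖ρ₁ z v φ‖) * ‖ρ₁ z v φ‖ +
            n * ‖ρ z φ‖ ^ (n - 1) * ‖ρ₂ z v φ‖
          ≤ n * (n * bracketDecay δ φ ^ (n - 3) * (3 * C * ‖φ‖ ^ 2 * (1 + ‖φ‖) ^ (κ + 2))) *
              (3 * C * ‖φ‖ ^ 2 * (1 + ‖φ‖) ^ (κ + 2)) +
            n * bracketDecay δ φ ^ (n - 3) * (C * ‖φ‖ * (1 + ‖φ‖) ^ (2 * κ + 4)) := by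
            gcongr
            exact p2.trans (by gcongr)
        _ = w φ := by
            simp only [hwdef, laplaceWeight]
            ring
    have hi : Integrable fun φ => (n * ρ z φ ^ (n - 1) * ρ₁ z v φ).re := by
      refine (i2.const_mul (n * (3 * C))).mono' (Complex.continuous_re.comp
        ((continuous_const.mul ((h.pair z hz).cont.pow _)).mul
          (h.deriv z hz v hv).cont)).aestronglyMeasurable (Eventually.of_forall fun φ => ?_)
      exact (Complex.abs_re_le_norm _).trans
        (norm_mul_pow_mul_le hδ hC (h.pair z hz) (h.deriv z hz v hv) (by omega) n φ)
    have hd := hasLineDerivAt_integral_of_dominated hW (μ := volume) (bound := w) (v := v)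
      (f := fun z φ => (n * ρ z φ ^ (n - 1) * ρ₁ z v φ).re) (f₁ := fun z φ => (f₂ z φ).re)
      (fun z hz => Complex.continuous_re.comp
        ((continuous_const.mul ((h.pair z hz).cont.pow _)).mul (h.deriv z hz v hv).cont))
      (fun z hz => ?_) (fun z hz φ => ?_)
      (fun z hz φ => (Complex.abs_re_le_norm _).trans (hle z hz φ)) hwi hz hi
    · refine ⟨_, ?_, HasDerivAt.const_mul _ hd⟩
      rw [abs_mul, abs_of_nonneg (by positivity)]
      have hwe : ∫ φ, w φ = ((n : ℝ) ^ 2 * (9 * C ^ 2)) *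
          (∫ φ : V, laplaceWeight δ (2 * κ + 4) 4 n φ) +
          (n * C) * (∫ φ : V, laplaceWeight δ (2 * κ + 4) 1 n φ) := by
        simp only [hwdef]
        rw [integral_add (i4.const_mul _) (i1.const_mul _), integral_const_mul, integral_const_mul]
      have hs : 0 < √(n : ℝ) := Real.sqrt_pos.2 hn0
      have hs1 : 1 ≤ √(n : ℝ) := Real.one_le_sqrt.2 (by exact_mod_cast (by omega : 1 ≤ n))
      have e4 : (n : ℝ) ^ 2 / √(n : ℝ) ^ 4 = 1 := by
        rw [show √(n : ℝ) ^ 4 = (√(n : ℝ) ^ 2) ^ 2 by ring, Real.sq_sqrt hn0.le]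
        field_simp
      have e1 : (n : ℝ) / √(n : ℝ) ^ 1 = √(n : ℝ) := by
        rw [pow_one, Real.div_sqrt]
      calc √(n : ℝ) ^ Module.finrank ℝ V * |∫ φ, (f₂ z φ).re|
          ≤ √(n : ℝ) ^ Module.finrank ℝ V * ∫ φ, w φ := by
            refine mul_le_mul_of_nonneg_left ?_ (by positivity)
            rw [← Real.norm_eq_abs]
            refine norm_integral_le_of_norm_le hwi (Eventually.of_forall fun φ => ?_)
            exact (Complex.abs_re_le_norm _).trans (hle z hz φ)
        _ = ((n : ℝ) ^ 2 * (9 * C ^ 2)) * (√(n : ℝ) ^ Module.finrank ℝ V *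
              (∫ φ : V, laplaceWeight δ (2 * κ + 4) 4 n φ)) + (n * C) *
              (√(n : ℝ) ^ Module.finrank ℝ V *
                (∫ φ : V, laplaceWeight δ (2 * κ + 4) 1 n φ)) := by
            rw [hwe]; ring
        _ ≤ ((n : ℝ) ^ 2 * (9 * C ^ 2)) * (C₂ / √(n : ℝ) ^ 4) + (n * C) * (C₂ / √(n : ℝ) ^ 1) := by
            gcongr
        _ = 9 * C ^ 2 * C₂ * ((n : ℝ) ^ 2 / √(n : ℝ) ^ 4) + C * C₂ * (n / √(n : ℝ) ^ 1) := by ring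
        _ = 9 * C ^ 2 * C₂ * 1 + C * C₂ * √(n : ℝ) := by rw [e4, e1]
        _ ≤ 9 * C ^ 2 * C₂ * √(n : ℝ) + C * C₂ * √(n : ℝ) := by gcongr
        _ = C₄ * √(n : ℝ) := by rw [hC₄]; ring
        _ ≤ _ := by gcongr; linarith
    · have c1 := (h.pair z hz).cont
      have c2 := (h.deriv z hz v hv).cont
      have c3 := h.cont_second z hz v hv
      refine Complex.continuous_re.comp ?_
      simp only [hf₂]
      fun_prop
    · have h2 : HasDerivAt (fun t : ℝ => ρ (z + t • v) φ) (ρ₁ z v φ) 0 := h.line z hz v hv φ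
      have h3 : HasDerivAt (fun t : ℝ => ρ₁ (z + t • v) v φ) (ρ₂ z v φ) 0 :=
        h.line_deriv z hz v hv φ
      have h4 := ((h2.pow (n - 1)).const_mul (n : ℂ)).mul h3
      refine HasLineDerivAt.re ?_
      refine HasDerivAt.congr_deriv h4 ?_
      simp [hf₂]

end LaplaceFamily

namespace Saddlepoint

/-! ### Derivatives of `M₀` in `s`, `φ` and `θ` -/

section ModelCalculus

variable {m p : ℕ} {Θ : Set (Vec p)} {μ : Vec p → Measure (Vec m)}

/-- The partial derivatives of `M₀(s + i φ; θ)` in `θ` (indices `is`) and `s` (indices `js`). -/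
noncomputable def mgfDeriv (μ : Vec p → Measure (Vec m)) (is : List (Fin p)) (js : List (Fin m)) :
    Vec m × Vec m × Vec p → ℂ :=
  iterLineDeriv (modelMgf μ) (directions is js)

/-- The orders of differentiation to which the growth bound applies, and order zero. -/
def Admissible (is : List (Fin p)) (js : List (Fin m)) : Prop :=
  (is.length ≤ 1 ∧ is.length + js.length ≤ 6) ∨ (is.length = 2 ∧ js.length ≤ 2)

/-- The set of `(s, φ, θ)` with `(s, θ) ∈ int 𝒮`. -/
def tubeDomain (Θ : Set (Vec p)) (μ : Vec p → Measure (Vec m)) : Set (Vec m × Vec m × Vec p) :=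
  {z | (z.1, z.2.2) ∈ interior (modelDomain Θ μ)}

theorem isOpen_tubeDomain : IsOpen (tubeDomain Θ μ) :=
  isOpen_interior.preimage (by fun_prop : Continuous fun z : Vec m × Vec m × Vec p => (z.1, z.2.2))

theorem Admissible.of_cons_left {i : Fin p} {is : List (Fin p)} {js : List (Fin m)}
    (h : Admissible (i :: is) js) : Admissible is js := by
  simp only [Admissible, List.length_cons] at *
  omega

theorem Admissible.of_cons_right {j : Fin m} {is : List (Fin p)} {js : List (Fin m)}
    (h : Admissible is (j :: js)) : Admissible is js := by
  simp only [Admissible, List.length_cons] at *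
  omega

/-- Finite exponential moments on both sides of `s` supply the majorant for differentiating `M₀` in
the direction `v`. -/
theorem exists_integrable_shift {s : Vec m} {θ : Vec p}
    (h : (s, θ) ∈ interior (modelDomain Θ μ)) (v : Vec m) :
    ∃ r : ℝ, 0 < r ∧ s + r • v ∈ mgfDomain (μ θ) ∧ s + (-r) • v ∈ mgfDomain (μ θ) := by
  have hc : Continuous fun t : ℝ => (s + t • v, θ) := by fun_prop
  have h0 : (fun t : ℝ => (s + t • v, θ)) ⁻¹' interior (modelDomain Θ μ) ∈ 𝓝 (0 : ℝ) :=
    (isOpen_interior.preimage hc).mem_nhds (by simpa using h)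
  obtain ⟨ε, hε, hb⟩ := Metric.mem_nhds_iff.1 h0
  have hm : ∀ t : ℝ, |t| < ε → s + t • v ∈ mgfDomain (μ θ) := fun t ht =>
    (interior_subset (hb (by simpa using ht))).2
  refine ⟨ε / 2, by positivity, hm _ ?_, hm _ ?_⟩
  · rw [abs_of_pos (by positivity)]; linarith
  · rw [abs_neg, abs_of_pos (by positivity)]; linarith

/-- `M₀` is holomorphic in each coordinate of `s + i φ`. -/
theorem exists_hasDerivAt_complexMgf {ν : Measure (Vec m)} {s φ v : Vec m} {r : ℝ} (hr : 0 < r)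
    (hp : s + r • v ∈ mgfDomain ν) (hn : s + (-r) • v ∈ mgfDomain ν)
    (hs : s ∈ mgfDomain ν) :
    ∃ c, HasDerivAt (fun w : ℂ => ∫ x, Complex.exp ((inner ℝ s x : ℝ) +
      (inner ℝ φ x : ℝ) * Complex.I + w * (inner ℝ v x : ℝ)) ∂ν) c 0 := by
  refine ⟨_, (hasDerivAt_integral_of_dominated_loc_of_deriv_le (μ := ν) (x₀ := (0 : ℂ))
    (F' := fun w x => Complex.exp ((inner ℝ s x : ℝ) +
      (inner ℝ φ x : ℝ) * Complex.I + w * (inner ℝ v x : ℝ)) * (inner ℝ v x : ℝ))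
    (bound := fun x => 2 / r * (Real.exp (inner ℝ (s + r • v) x) +
      Real.exp (inner ℝ (s + (-r) • v) x)))
    (Metric.ball_mem_nhds 0 (half_pos hr)) ?_ ?_ ?_ ?_ ?_ ?_).2⟩
  · refine Eventually.of_forall fun w => Continuous.aestronglyMeasurable ?_
    fun_prop
  · refine (hs.mono' (Continuous.aestronglyMeasurable ?_) (Eventually.of_forall fun x => ?_))
    · fun_prop
    · rw [Complex.norm_exp]
      simp
  · refine Continuous.aestronglyMeasurable ?_
    fun_prop
  · refine Eventually.of_forall fun x w hw => ?_
    have hw' : ‖w‖ < r / 2 := by simpa using hw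
    rw [norm_mul, Complex.norm_exp, Complex.norm_real, Real.norm_eq_abs]
    set a := inner ℝ v x with ha
    have e1 : ((inner ℝ s x : ℝ) + (inner ℝ φ x : ℝ) * Complex.I + w * (a : ℝ) : ℂ).re =
        inner ℝ s x + w.re * a := by simp
    rw [e1, inner_add_left, inner_add_left, real_inner_smul_left, real_inner_smul_left, ← ha]
    have e2 : w.re * a ≤ r / 2 * |a| := by
      calc w.re * a ≤ |w.re * a| := le_abs_self _
        _ = |w.re| * |a| := abs_mul _ _
        _ ≤ r / 2 * |a| := by
          gcongr
          exact (Complex.abs_re_le_norm w).trans hw'.le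
    -- The factor `|a|` produced by differentiation is absorbed by half of the exponential room `r
    -- |a|`; the other half serves the perturbation `w`.
    have e3 : |a| ≤ 2 / r * Real.exp (r / 2 * |a|) := by
      have := Real.add_one_le_exp (r / 2 * |a|)
      rw [div_mul_eq_mul_div, le_div_iff₀ hr]
      linarith
    calc Real.exp (inner ℝ s x + w.re * a) * |a|
        ≤ Real.exp (inner ℝ s x + r / 2 * |a|) * (2 / r * Real.exp (r / 2 * |a|)) := by
          gcongr
      _ = 2 / r * Real.exp (inner ℝ s x + r * |a|) := by
          rw [mul_left_comm, ← Real.exp_add]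
          ring_nf
      _ ≤ _ := by
          refine mul_le_mul_of_nonneg_left ?_ (by positivity)
          rcases abs_cases a with ⟨h, -⟩ | ⟨h, -⟩ <;> rw [h]
          · have := Real.exp_pos (inner ℝ s x + -r * a)
            linarith
          · have := Real.exp_pos (inner ℝ s x + r * a)
            rw [show r * -a = -r * a by ring]
            linarith
  · exact (Integrable.add hp hn).const_mul _
  · refine Eventually.of_forall fun x w _ => ?_
    have := (((hasDerivAt_id w).mul_const ((inner ℝ v x : ℝ) : ℂ)).const_add
      ((inner ℝ s x : ℝ) + (inner ℝ φ x : ℝ) * Complex.I : ℂ)).cexp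
    simpa using this

/-- This is the Cauchy-Riemann equation: `w ↦ M₀(s + iφ + w eⱼ)` is complex differentiable at `0`,
so its derivative along imaginary `w` is `i` times the one along real `w`. -/
theorem hasLineDerivAt_modelMgf_imaginary {z : Vec m × Vec m × Vec p} (hz : z ∈ tubeDomain Θ μ)
    (j : Fin m) :
    HasLineDerivAt ℝ (modelMgf μ) (Complex.I * mgfDeriv μ [] [j] z) z
      (0, EuclideanSpace.single j 1, 0) := by
  obtain ⟨s, φ, θ⟩ := z
  obtain ⟨r, hr, hp, hn⟩ := exists_integrable_shift hz (EuclideanSpace.single j 1)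
  obtain ⟨c, hc⟩ := exists_hasDerivAt_complexMgf (φ := φ) hr hp hn (interior_subset hz).2
  have h1 : HasDerivAt (fun t : ℝ => modelMgf μ ((s, φ, θ) + t • (EuclideanSpace.single j 1, 0, 0)))
      c 0 := by
    have h3 := HasDerivAt.comp_ofReal (z := 0) (by simpa using hc)
    refine h3.congr_of_eventuallyEq (Eventually.of_forall fun t => ?_)
    simp only [modelMgf, complexMgf, Prod.fst_add, Prod.snd_add, Prod.smul_fst,
      Prod.smul_snd, smul_zero, add_zero, inner_add_left, real_inner_smul_left]
    refine integral_congr_ae (Eventually.of_forall fun x => ?_)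
    simp only
    congr 1
    push_cast
    ring
  have h1' : HasDerivAt (fun t : ℝ => modelMgf μ ((s, φ, θ) + t • (0, EuclideanSpace.single j 1, 0)))
      (Complex.I * c) 0 := by
    have h2 : HasDerivAt (fun w : ℂ => w * Complex.I) Complex.I 0 := by
      simpa using (hasDerivAt_id (0 : ℂ)).mul_const Complex.I
    have h3 := HasDerivAt.comp (0 : ℂ) (h := fun w : ℂ => w * Complex.I) (by simpa using hc) h2
    rw [mul_comm] at h3
    have h3 := HasDerivAt.comp_ofReal (z := 0) (by simpa using h3)
    refine h3.congr_of_eventuallyEq (Eventually.of_forall fun t => ?_)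
    simp only [modelMgf, complexMgf, Prod.fst_add, Prod.snd_add, Prod.smul_fst,
      Prod.smul_snd, smul_zero, add_zero, inner_add_left, real_inner_smul_left]
    refine integral_congr_ae (Eventually.of_forall fun x => ?_)
    simp only
    congr 1
    push_cast
    ring
  have h4 : mgfDeriv μ [] [j] (s, φ, θ) = c := h1.deriv
  rw [h4]
  exact h1'

section Growth

/-- The regularity in the growth bound, without the bound. -/
def MgfSmooth (Θ : Set (Vec p)) (μ : Vec p → Measure (Vec m)) : Prop :=
  ∀ (is : List (Fin p)) (js : List (Fin m)), Admissible is js → 1 ≤ is.length + js.length →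
    (∀ z ∈ tubeDomain Θ μ, IterLineDifferentiableAt (modelMgf μ) (directions is js) z) ∧
      ContinuousOn (mgfDeriv μ is js) (tubeDomain Θ μ)

theorem GrowthBound.mgfSmooth (h : GrowthBound Θ μ) : MgfSmooth Θ μ := by
  obtain ⟨γ, -, -, h⟩ := h
  intro is js ha hl
  have hb : (is.length ≤ 1 ∧ 1 ≤ is.length + js.length ∧ is.length + js.length ≤ 6) ∨
      (is.length = 2 ∧ js.length ≤ 2) := by
    simp only [Admissible] at ha
    omega
  obtain ⟨h1, h2⟩ := h is js hb
  exact ⟨fun z hz => (h1 z.1 z.2.1 z.2.2 hz).1, h2⟩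

theorem MgfSmooth.hasLineDerivAt_param (h : MgfSmooth Θ μ) {i : Fin p} {is : List (Fin p)} {js : List (Fin m)}
    (ha : Admissible (i :: is) js) {z : Vec m × Vec m × Vec p} (hz : z ∈ tubeDomain Θ μ) :
    HasLineDerivAt ℝ (mgfDeriv μ is js) (mgfDeriv μ (i :: is) js z) z
      (0, 0, EuclideanSpace.single i 1) :=
  LineDifferentiableAt.hasLineDerivAt
    ((h (i :: is) js ha (by simp only [List.length_cons]; omega)).1 z hz).2

theorem MgfSmooth.hasLineDerivAt_real (h : MgfSmooth Θ μ) {j : Fin m} {js : List (Fin m)}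
    (ha : Admissible ([] : List (Fin p)) (j :: js)) {z : Vec m × Vec m × Vec p}
    (hz : z ∈ tubeDomain Θ μ) :
    HasLineDerivAt ℝ (mgfDeriv μ [] js) (mgfDeriv μ [] (j :: js) z) z
      (EuclideanSpace.single j 1, 0, 0) :=
  LineDifferentiableAt.hasLineDerivAt
    ((h [] (j :: js) ha (by simp only [List.length_cons]; omega)).1 z hz).2

/-- The growth bound differentiates in `s` first and in `θ` last, while here the outermost
derivative is in `s`. `HasLineDerivAt.of_swap` exchanges them, as it requires the existence of just
one mixed derivative. -/
theorem MgfSmooth.hasLineDerivAt_real_param (h : MgfSmooth Θ μ) {i : Fin p} {j : Fin m} {js : List (Fin m)}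
    (ha : Admissible [i] (j :: js)) {z : Vec m × Vec m × Vec p} (hz : z ∈ tubeDomain Θ μ) :
    HasLineDerivAt ℝ (mgfDeriv μ [i] js) (mgfDeriv μ [i] (j :: js) z) z
      (EuclideanSpace.single j 1, 0, 0) :=
  HasLineDerivAt.of_swap isOpen_tubeDomain
    (fun _ hz => h.hasLineDerivAt_real ha.of_cons_left hz)
    (fun _ hz => h.hasLineDerivAt_param ha.of_cons_right hz)
    (fun _ hz => h.hasLineDerivAt_param ha hz) (h _ _ ha (by simp)).2 hz

/-- Induction on the derivatives already taken, each being exchanged with the one in `φⱼ`. The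
Cauchy-Riemann equation is available for `M₀` itself, hence the new index becomes the innermost one
and is appended at the end of the list. -/
theorem MgfSmooth.hasLineDerivAt_imaginary (h : MgfSmooth Θ μ) (j : Fin m) : ∀ (is : List (Fin p)) (js : List (Fin m)),
    Admissible is (js ++ [j]) → ∀ z ∈ tubeDomain Θ μ,
    HasLineDerivAt ℝ (mgfDeriv μ is js) (Complex.I * mgfDeriv μ is (js ++ [j]) z) z
      (0, EuclideanSpace.single j 1, 0) := by
  intro is
  induction is with
  | nil =>
    intro js
    induction js with
    | nil => exact fun _ z hz => hasLineDerivAt_modelMgf_imaginary hz j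
    | cons a js ih =>
      intro ha z hz
      refine HasLineDerivAt.of_swap isOpen_tubeDomain
        (fun z hz => ih ha.of_cons_right z hz)
        (fun z hz => h.hasLineDerivAt_real (j := a) (by
          simp only [Admissible, List.length_cons, List.length_append] at *; omega) hz)
        (fun z hz => ?_) (continuousOn_const.mul (h _ _ ha (by simp)).2) hz
      have h2 := h.hasLineDerivAt_real ha hz
      exact HasDerivAt.const_mul Complex.I h2
  | cons i is ih =>
    intro js ha z hz
    refine HasLineDerivAt.of_swap isOpen_tubeDomain
      (fun z hz => ih js ha.of_cons_left z hz)
      (fun z hz => h.hasLineDerivAt_param (i := i) (by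
        simp only [Admissible, List.length_cons, List.length_append] at *; omega) hz)
      (fun z hz => ?_) (continuousOn_const.mul (h _ _ ha (by simp; omega)).2) hz
    have h2 := h.hasLineDerivAt_param ha hz
    exact HasDerivAt.const_mul Complex.I h2

end Growth

end ModelCalculus

end Saddlepoint

namespace Saddlepoint

/-! ### Joint differentiability in `(s, φ, θ)` -/

section ModelRegularity

variable {m p : ℕ} {Θ : Set (Vec p)} {μ : Vec p → Measure (Vec m)}

theorem MgfSmooth.hasLineDerivAt_real' (h : MgfSmooth Θ μ) {j : Fin m} {is : List (Fin p)}
    {js : List (Fin m)} (hi : is.length ≤ 1) (ha : Admissible is (j :: js))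
    {z : Vec m × Vec m × Vec p} (hz : z ∈ tubeDomain Θ μ) :
    HasLineDerivAt ℝ (mgfDeriv μ is js) (mgfDeriv μ is (j :: js) z) z
      (EuclideanSpace.single j 1, 0, 0) := by
  match is, hi with
  | [], _ => exact h.hasLineDerivAt_real ha hz
  | [i], _ => exact h.hasLineDerivAt_real_param ha hz

/-- The coordinate basis of the space of triples `(s, φ, θ)`. -/
noncomputable def tubeBasis (m p : ℕ) :
    Module.Basis (Fin m ⊕ Fin m ⊕ Fin p) ℝ (Vec m × Vec m × Vec p) :=
  (EuclideanSpace.basisFun (Fin m) ℝ).toBasis.prod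
    ((EuclideanSpace.basisFun (Fin m) ℝ).toBasis.prod (EuclideanSpace.basisFun (Fin p) ℝ).toBasis)

/-- The coordinate derivatives of `mgfDeriv μ is js`. -/
noncomputable def mgfDerivPartial (μ : Vec p → Measure (Vec m)) (is : List (Fin p))
    (js : List (Fin m)) : Fin m ⊕ Fin m ⊕ Fin p → Vec m × Vec m × Vec p → ℂ :=
  Sum.elim (fun j => mgfDeriv μ is (j :: js)) (Sum.elim
    (fun j z => Complex.I * mgfDeriv μ is (js ++ [j]) z) (fun i => mgfDeriv μ (i :: is) js))

/-- All coordinate derivatives of `mgfDeriv μ is js` are covered by the growth bound. -/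
def AdmissibleSucc (is : List (Fin p)) (js : List (Fin m)) : Prop :=
  (is.length = 0 ∧ js.length ≤ 5) ∨ (is.length = 1 ∧ js.length ≤ 2)

theorem MgfSmooth.hasLineDerivAt_basis (h : MgfSmooth Θ μ) {is : List (Fin p)} {js : List (Fin m)}
    (ha : AdmissibleSucc is js) (k : Fin m ⊕ Fin m ⊕ Fin p) {z : Vec m × Vec m × Vec p}
    (hz : z ∈ tubeDomain Θ μ) :
    HasLineDerivAt ℝ (mgfDeriv μ is js) (mgfDerivPartial μ is js k z) z (tubeBasis m p k) := by
  simp only [AdmissibleSucc] at ha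
  rcases k with j | j | i
  · have := h.hasLineDerivAt_real' (j := j) (is := is) (js := js) (by omega) (by
      simp only [Admissible, List.length_cons]; omega) hz
    have e : tubeBasis m p (Sum.inl j) = (EuclideanSpace.single j 1, 0, 0) := by
      simp [tubeBasis]
      rfl
    rw [e]
    exact this
  · have := h.hasLineDerivAt_imaginary j is js (by
      simp only [Admissible, List.length_append, List.length_cons, List.length_nil]; omega) z hz
    simpa [tubeBasis, mgfDerivPartial] using this
  · have := h.hasLineDerivAt_param (i := i) (is := is) (js := js) (by
      simp only [Admissible, List.length_cons]; omega) hz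
    simpa [tubeBasis, mgfDerivPartial] using this

theorem MgfSmooth.continuousOn_mgfDerivPartial (h : MgfSmooth Θ μ) {is : List (Fin p)}
    {js : List (Fin m)} (ha : AdmissibleSucc is js) (k : Fin m ⊕ Fin m ⊕ Fin p) :
    ContinuousOn (mgfDerivPartial μ is js k) (tubeDomain Θ μ) := by
  simp only [AdmissibleSucc] at ha
  rcases k with j | j | i
  · exact (h is (j :: js) (by simp only [Admissible, List.length_cons]; omega)
      (by simp only [List.length_cons]; omega)).2
  · exact continuousOn_const.mul (h is (js ++ [j])
      (by simp only [Admissible, List.length_append, List.length_cons, List.length_nil]; omega)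
      (by simp only [List.length_append, List.length_cons]; omega)).2
  · exact (h (i :: is) js (by simp only [Admissible, List.length_cons]; omega)
      (by simp only [List.length_cons]; omega)).2

theorem MgfSmooth.exists_hasFDerivAt (h : MgfSmooth Θ μ) {is : List (Fin p)} {js : List (Fin m)}
    (ha : AdmissibleSucc is js) {z : Vec m × Vec m × Vec p} (hz : z ∈ tubeDomain Θ μ) :
    ∃ L : (Vec m × Vec m × Vec p) →L[ℝ] ℂ, HasFDerivAt (mgfDeriv μ is js) L z ∧
      ∀ c ψ u, L (c, ψ, u) = ∑ j, (c j : ℂ) * mgfDeriv μ is (j :: js) z +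
        (∑ j, (ψ j : ℂ) * (Complex.I * mgfDeriv μ is (js ++ [j]) z) +
        ∑ i, (u i : ℂ) * mgfDeriv μ (i :: is) js z) := by
  refine ⟨_, hasFDerivAt_of_continuousOn_lineDeriv_basis (tubeBasis m p) isOpen_tubeDomain
    (fun k z hz => h.hasLineDerivAt_basis ha k hz)
    (fun k => h.continuousOn_mgfDerivPartial ha k) hz, fun c ψ u => ?_⟩
  simp [Fintype.sum_sum_type, tubeBasis, mgfDerivPartial]

theorem MgfSmooth.continuousOn (h : MgfSmooth Θ μ) {is : List (Fin p)} {js : List (Fin m)}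
    (ha : Admissible is js) : ContinuousOn (mgfDeriv μ is js) (tubeDomain Θ μ) := by
  by_cases hl : 1 ≤ is.length + js.length
  · exact (h is js ha hl).2
  · intro z hz
    obtain ⟨L, hL, -⟩ := h.exists_hasFDerivAt (is := is) (js := js)
      (by simp only [AdmissibleSucc]; omega) hz
    exact hL.continuousAt.continuousWithinAt

theorem MgfSmooth.contDiffOn_one (h : MgfSmooth Θ μ) {is : List (Fin p)} {js : List (Fin m)}
    (ha : AdmissibleSucc is js) : ContDiffOn ℝ 1 (mgfDeriv μ is js) (tubeDomain Θ μ) := by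
  have := contDiffOn_succ_of_lineDeriv_basis (tubeBasis m p) isOpen_tubeDomain 0
    (fun k z hz => h.hasLineDerivAt_basis ha k hz)
    (fun k => contDiffOn_zero.2 (h.continuousOn_mgfDerivPartial ha k))
  simpa using this

/-- The means and covariances must be `C²`, and they involve moments up to order two. For these, one
derivative in any coordinate leads to indices still covered by `AdmissibleSucc`. -/
theorem MgfSmooth.contDiffOn_two (h : MgfSmooth Θ μ) {js : List (Fin m)} (hj : js.length ≤ 2) :
    ContDiffOn ℝ 2 (mgfDeriv μ ([] : List (Fin p)) js) (tubeDomain Θ μ) := by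
  have := contDiffOn_succ_of_lineDeriv_basis (tubeBasis m p) (isOpen_tubeDomain (Θ := Θ) (μ := μ)) 1
    (fun k z hz => h.hasLineDerivAt_basis (is := []) (js := js)
      (Or.inl ⟨rfl, hj.trans (by norm_num)⟩) k hz) (fun k => ?_)
  · simpa [one_add_one_eq_two] using this
  · rcases k with j | j | i
    · exact h.contDiffOn_one (Or.inl ⟨rfl, by rw [List.length_cons]; omega⟩)
    · exact contDiffOn_const.mul (h.contDiffOn_one (Or.inl ⟨rfl, by
        rw [List.length_append, List.length_singleton]; omega⟩))
    · exact h.contDiffOn_one (Or.inr ⟨rfl, hj⟩)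

/-- Differentiating in `φ` alone requires one more `s`-derivative but no further `θ`-derivative, so
this reaches index lists that `exists_hasFDerivAt` does not. -/
theorem MgfSmooth.hasDerivAt_imaginary_line (h : MgfSmooth Θ μ) {is : List (Fin p)}
    {js : List (Fin m)} (ha : ∀ j, Admissible is (js ++ [j])) {s : Vec m} {θ : Vec p}
    (hz : (s, θ) ∈ interior (modelDomain Θ μ)) (φ : Vec m) (t : ℝ) :
    HasDerivAt (fun t : ℝ => mgfDeriv μ is js (s, t • φ, θ))
      (Complex.I * ∑ j, (φ j : ℂ) * mgfDeriv μ is (js ++ [j]) (s, t • φ, θ)) t := by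
  have hm : ∀ ψ, (s, ψ, θ) ∈ tubeDomain Θ μ := fun ψ => hz
  have hF := hasFDerivAt_of_continuousOn_lineDeriv_basis
    (EuclideanSpace.basisFun (Fin m) ℝ).toBasis (f := fun ψ => mgfDeriv μ is js (s, ψ, θ))
    (f' := fun j ψ => Complex.I * mgfDeriv μ is (js ++ [j]) (s, ψ, θ)) isOpen_univ
    (fun j ψ _ => ?_) (fun j => ?_) (Set.mem_univ (t • φ))
  · have h1 : HasDerivAt (fun t : ℝ => t • φ) ((1 : ℝ) • φ) t := (hasDerivAt_id t).smul_const φ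
    refine (hF.comp_hasDerivAt t h1).congr_deriv ?_
    simp only [one_smul, _root_.sum_apply, Finset.mul_sum]
    refine Finset.sum_congr rfl fun j _ => ?_
    simp
    ring
  · have := h.hasLineDerivAt_imaginary j is js (ha j) _ (hm ψ)
    rw [HasLineDerivAt] at this ⊢
    simpa using this
  · have hc := h.continuousOn (ha j)
    have h2 : Continuous fun ψ : Vec m => (s, ψ, θ) := by fun_prop
    exact continuousOn_const.mul (hc.comp h2.continuousOn fun ψ _ => hm ψ)

theorem im_eq_zero_of_hasLineDerivAt {E : Type*} [NormedAddCommGroup E] [NormedSpace ℝ E]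
    {f : E → ℂ} {f' : ℂ} {z v : E} (h : HasLineDerivAt ℝ f f' z v)
    (h0 : ∀ᶠ t : ℝ in 𝓝 0, (f (z + t • v)).im = 0) : f'.im = 0 := by
  have h1 : HasDerivAt (fun t : ℝ => (f (z + t • v)).im) f'.im 0 :=
    (Complex.imCLM.hasFDerivAt.comp_hasDerivAt (0 : ℝ) h :)
  exact h1.unique ((hasDerivAt_const (0 : ℝ) (0 : ℝ)).congr_of_eventuallyEq h0)

theorem modelMgf_zero (s : Vec m) (θ : Vec p) : modelMgf μ (s, 0, θ) = (mgf (μ θ) s : ℝ) := by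
  simp only [modelMgf, complexMgf, mgf, inner_zero_left, Complex.ofReal_zero, zero_mul, add_zero,
    ← Complex.ofReal_exp]
  exact integral_ofReal

/-- At `φ = 0` the function `M₀` is real, and all these derivatives are taken along directions that
keep `φ = 0`. -/
theorem MgfSmooth.mgfDeriv_im (h : MgfSmooth Θ μ) : ∀ (is : List (Fin p)) (js : List (Fin m)),
    Admissible is js → ∀ s θ, (s, θ) ∈ interior (modelDomain Θ μ) →
      (mgfDeriv μ is js (s, 0, θ)).im = 0 := by
  have hev : ∀ {s : Vec m} {θ : Vec p}, (s, θ) ∈ interior (modelDomain Θ μ) → ∀ c u,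
      ∀ᶠ t : ℝ in 𝓝 0, (s + t • c, θ + t • u) ∈ interior (modelDomain Θ μ) := by
    intro s θ hz c u
    have hc : Continuous fun t : ℝ => (s + t • c, θ + t • u) := by fun_prop
    exact (isOpen_interior.preimage hc).mem_nhds (by simpa using hz)
  intro is
  induction is with
  | nil =>
    intro js
    induction js with
    | nil =>
      intro _ s θ _
      rw [mgfDeriv, directions]
      simp [iterLineDeriv, modelMgf_zero]
    | cons j js ih =>
      intro ha s θ hz
      refine im_eq_zero_of_hasLineDerivAt (h.hasLineDerivAt_real ha (z := (s, 0, θ)) hz) ?_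
      filter_upwards [hev hz (EuclideanSpace.single j 1) 0] with t ht
      have := ih ha.of_cons_right _ _ ht
      simpa using this
  | cons i is ih =>
    intro js ha s θ hz
    refine im_eq_zero_of_hasLineDerivAt (h.hasLineDerivAt_param ha (z := (s, 0, θ)) hz) ?_
    filter_upwards [hev hz 0 (EuclideanSpace.single i 1)] with t ht
    have := ih js ha.of_cons_left _ _ ht
    simpa using this

end ModelRegularity

end Saddlepoint

namespace Saddlepoint

/-! ### Centred moments and Taylor expansion -/

section MomentShift

variable {m : ℕ}

/-- If `X js` is the moment of `∏ xⱼ`, then `momentShift φ b X js` is that of `(φ x - b) ∏ xⱼ`. -/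
noncomputable def momentShift (φ : Vec m) (b : ℝ) (X : List (Fin m) → ℂ) : List (Fin m) → ℂ :=
  fun js => ∑ j, (φ j : ℂ) * X (js ++ [j]) - b * X js

variable {φ : Vec m} {b : ℝ} {N : ℕ}

theorem momentShift_combination (c d : ℂ) (X Y : List (Fin m) → ℂ) :
    momentShift φ b (fun js => c * (Y js + d * X js)) =
      fun js => c * (momentShift φ b Y js + d * momentShift φ b X js) := by
  funext js
  have h : ∑ j, (φ j : ℂ) * (c * (Y (js ++ [j]) + d * X (js ++ [j]))) =
      c * (∑ j, (φ j : ℂ) * Y (js ++ [j])) + c * d * ∑ j, (φ j : ℂ) * X (js ++ [j]) := by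
    rw [Finset.mul_sum, Finset.mul_sum, ← Finset.sum_add_distrib]
    exact Finset.sum_congr rfl fun j _ => by ring
  simp only [momentShift, h]
  ring

theorem momentShift_iterate_combination (c d : ℂ) (k : ℕ) : ∀ X Y : List (Fin m) → ℂ,
    (momentShift φ b)^[k] (fun js => c * (Y js + d * X js)) =
      fun js => c * ((momentShift φ b)^[k] Y js + d * (momentShift φ b)^[k] X js) := by
  induction k with
  | zero => exact fun X Y => rfl
  | succ k ih =>
    intro X Y
    simp only [Function.iterate_succ_apply, momentShift_combination, ih]

theorem momentShift_smul (t : ℝ) (X : List (Fin m) → ℂ) :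
    momentShift (t • φ) (t * b) X = fun js => (t : ℂ) * momentShift φ b X js := by
  funext js
  simp only [momentShift, PiLp.smul_apply, smul_eq_mul, Complex.ofReal_mul, mul_sub, Finset.mul_sum,
    mul_assoc]

theorem momentShift_const_mul (c : ℂ) (X : List (Fin m) → ℂ) :
    momentShift φ b (fun js => c * X js) = fun js => c * momentShift φ b X js := by
  have := momentShift_combination (φ := φ) (b := b) c 0 X X
  simpa using this

theorem hasDerivAt_momentShift_iterate {X : ℝ → List (Fin m) → ℂ} {X' : List (Fin m) → ℂ} {t : ℝ}
    (h : ∀ js : List (Fin m), js.length ≤ N → HasDerivAt (fun t => X t js) (X' js) t) (k : ℕ) :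
    ∀ js : List (Fin m), js.length + k ≤ N →
      HasDerivAt (fun t => (momentShift φ b)^[k] (X t) js) ((momentShift φ b)^[k] X' js) t := by
  induction k with
  | zero => exact fun js hj => h js hj
  | succ k ih =>
    intro js hj
    simp only [Function.iterate_succ_apply']
    refine (HasDerivAt.fun_sum fun j _ => ?_).sub ((ih js (by omega)).const_mul _)
    exact (ih _ (by rw [List.length_append, List.length_singleton]; omega)).const_mul _

/-- Each differentiation in `t` brings down `i (φ x - b)`, that is, `i` times one application of
`momentShift`. The index lists grow at each step, hence the budget `N`. -/
theorem hasDerivAt_twist_momentShift {X : ℝ → List (Fin m) → ℂ} {t : ℝ}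
    (h : ∀ js : List (Fin m), js.length ≤ N →
      HasDerivAt (fun t => X t js) (Complex.I * ∑ j, (φ j : ℂ) * X t (js ++ [j])) t) (k : ℕ)
    (js : List (Fin m)) (hj : js.length + k ≤ N) :
    HasDerivAt (fun t : ℝ => Complex.exp (-(t * b : ℝ) * Complex.I) * (momentShift φ b)^[k] (X t) js)
      (Complex.I * (Complex.exp (-(t * b : ℝ) * Complex.I) *
        (momentShift φ b)^[k + 1] (X t) js)) t := by
  have h1 := hasDerivAt_momentShift_iterate (φ := φ) (b := b) (N := N) (X := X)
    (X' := fun js => Complex.I * (momentShift φ b (X t) js + b * X t js)) (t := t)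
    (fun js hj => (h js hj).congr_deriv (by simp only [momentShift]; ring)) k js hj
  rw [momentShift_iterate_combination, ← Function.iterate_succ_apply] at h1
  have h2 : HasDerivAt (fun t : ℝ => -((t * b : ℝ) : ℂ) * Complex.I) (-(b : ℂ) * Complex.I) t := by
    have h3 : HasDerivAt (fun t : ℝ => (t : ℂ)) 1 t := Complex.ofRealCLM.hasDerivAt
    have h4 := ((h3.mul_const (b : ℂ)).neg).mul_const Complex.I
    rw [one_mul] at h4
    refine h4.congr_of_eventuallyEq (Eventually.of_forall fun t => ?_)
    simp
  refine (h2.cexp.mul h1).congr_deriv ?_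
  ring

theorem norm_momentShift_iterate_le {X : List (Fin m) → ℂ} {B : ℝ}
    (h : ∀ js : List (Fin m), js.length ≤ N → ‖X js‖ ≤ B) (k : ℕ) :
    ∀ js : List (Fin m), js.length + k ≤ N →
      ‖(momentShift φ b)^[k] X js‖ ≤ (∑ j, |φ j| + |b|) ^ k * B := by
  induction k with
  | zero => exact fun js hj => by simpa using h js hj
  | succ k ih =>
    intro js hj
    rw [Function.iterate_succ_apply']
    have h1 := ih js (by omega)
    have h2 : ∀ j, ‖(momentShift φ b)^[k] X (js ++ [j])‖ ≤ (∑ j, |φ j| + |b|) ^ k * B :=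
      fun j => ih _ (by rw [List.length_append, List.length_singleton]; omega)
    calc ‖momentShift φ b ((momentShift φ b)^[k] X) js‖
        ≤ ∑ j, |φ j| * ((∑ j, |φ j| + |b|) ^ k * B) + |b| * ((∑ j, |φ j| + |b|) ^ k * B) := by
          refine (norm_sub_le _ _).trans (add_le_add ((norm_sum_le _ _).trans
            (Finset.sum_le_sum fun j _ => ?_)) ?_)
          · rw [norm_mul, Complex.norm_real, Real.norm_eq_abs]
            exact mul_le_mul_of_nonneg_left (h2 j) (abs_nonneg _)
          · rw [norm_mul, Complex.norm_real, Real.norm_eq_abs]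
            exact mul_le_mul_of_nonneg_left h1 (abs_nonneg _)
      _ = (∑ j, |φ j| + |b|) ^ (k + 1) * B := by
          rw [← Finset.sum_mul]; ring

theorem momentShift_iterate_im {X : List (Fin m) → ℂ}
    (h : ∀ js : List (Fin m), js.length ≤ N → (X js).im = 0) (k : ℕ) :
    ∀ js : List (Fin m), js.length + k ≤ N → ((momentShift φ b)^[k] X js).im = 0 := by
  induction k with
  | zero => exact fun js hj => h js hj
  | succ k ih =>
    intro js hj
    rw [Function.iterate_succ_apply']
    have h1 := ih js (by omega)
    have h2 : ∀ j, ((momentShift φ b)^[k] X (js ++ [j])).im = 0 :=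
      fun j => ih _ (by rw [List.length_append, List.length_singleton]; omega)
    simp [momentShift, h1, h2]

/-- Fourth order Taylor expansion of `exp(- i b) X 1 []` for a family with the derivatives of a
moment generating function at an imaginary argument. -/
theorem abs_twist_sub_taylor_le {X : ℝ → List (Fin m) → ℂ} {B : ℝ}
    (h : ∀ t, ∀ js : List (Fin m), js.length ≤ 3 →
      HasDerivAt (fun t => X t js) (Complex.I * ∑ j, (φ j : ℂ) * X t (js ++ [j])) t)
    (him : ∀ js : List (Fin m), js.length ≤ 3 → (X 0 js).im = 0)
    (hB : ∀ t ∈ Set.Icc (0 : ℝ) 1, ∀ js : List (Fin m), js.length ≤ 4 → ‖X t js‖ ≤ B) :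
    |(Complex.exp (-(b : ℂ) * Complex.I) * X 1 []).re -
        ((X 0 []).re - ((momentShift φ b)^[2] (X 0) []).re / 2)| ≤ (∑ j, |φ j| + |b|) ^ 4 * B ∧
      |(Complex.exp (-(b : ℂ) * Complex.I) * X 1 []).im - (momentShift φ b (X 0) []).re| ≤
        (∑ j, |φ j| + |b|) ^ 3 * (1 + (∑ j, |φ j| + |b|)) * B := by
  set ℓ := ∑ j, |φ j| + |b| with hℓ
  -- `f k` is the `k`-th derivative of the twisted function. At `t = 0` it is `i^k` times a real
  -- number, so the even orders make up the real part of the Taylor polynomial and the odd orders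
  -- the imaginary part.
  set f : ℕ → ℝ → ℂ := fun k t => Complex.I ^ k *
    (Complex.exp (-(t * b : ℝ) * Complex.I) * (momentShift φ b)^[k] (X t) []) with hf
  have hd : ∀ k ≤ 3, ∀ t, HasDerivAt (f k) (f (k + 1) t) t := fun k hk t =>
    ((hasDerivAt_twist_momentShift (h t) k [] (by simpa using hk)).const_mul
      (Complex.I ^ k)).congr_deriv (by simp only [hf]; ring)
  have hle : ∀ k ≤ 4, ∀ t ∈ Set.Icc (0 : ℝ) 1, ‖f k t‖ ≤ ℓ ^ k * B := by
    intro k hk t ht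
    have h1 := norm_momentShift_iterate_le (φ := φ) (b := b) (hB t ht) k [] (by simpa using hk)
    simp only [hf, norm_mul, norm_pow, Complex.norm_I, one_pow, one_mul]
    rw [← Complex.ofReal_neg, Complex.norm_exp_ofReal_mul_I, one_mul]
    exact h1
  have hT := norm_sub_taylor_le (hd 0 (by omega)) (hd 1 (by omega)) (hd 2 (by omega))
    (hd 3 le_rfl) (hle 4 le_rfl)
  have h0 : ∀ k ≤ 3, (momentShift φ b)^[k] (X 0) [] =
      (((momentShift φ b)^[k] (X 0) []).re : ℂ) := fun k hk =>
    Complex.ext rfl (momentShift_iterate_im him k [] (by simpa using hk))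
  set r : ℕ → ℝ := fun k => ((momentShift φ b)^[k] (X 0) []).re with hr
  have hf0 : ∀ k ≤ 3, f k 0 = Complex.I ^ k * (r k : ℂ) := fun k hk => by
    simp only [hf, hr]
    rw [← h0 k hk]
    simp
  have hf1 : f 0 1 = Complex.exp (-(b : ℂ) * Complex.I) * X 1 [] := by
    simp [hf]
  have h3 : |r 3| ≤ ℓ ^ 3 * B := by
    have := hle 3 (by omega) 0 (by simp)
    rw [hf0 3 le_rfl, norm_mul, norm_pow, Complex.norm_I, one_pow, one_mul, Complex.norm_real] at this
    exact this
  rw [hf0 0 (by omega), hf0 1 (by omega), hf0 2 (by omega), hf0 3 le_rfl, hf1] at hT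
  have e3 : Complex.I ^ 3 = -Complex.I := by rw [pow_succ, Complex.I_sq]; ring
  rw [pow_zero, one_mul, pow_one, Complex.I_sq, e3] at hT
  have hre := (Complex.abs_re_le_norm _).trans hT
  have him' := (Complex.abs_im_le_norm _).trans hT
  constructor
  · have e : ((r 0 : ℂ) + Complex.I * r 1 + (1 / 2 : ℝ) • (-1 * (r 2 : ℂ)) +
        (1 / 6 : ℝ) • (-Complex.I * (r 3 : ℂ))).re = r 0 - r 2 / 2 := by
      simp; ring
    rw [Complex.sub_re, e] at hre
    exact hre
  · have e : ((r 0 : ℂ) + Complex.I * r 1 + (1 / 2 : ℝ) • (-1 * (r 2 : ℂ)) +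
        (1 / 6 : ℝ) • (-Complex.I * (r 3 : ℂ))).im = r 1 - r 3 / 6 := by
      simp; ring
    rw [Complex.sub_im, e] at him'
    set w := (Complex.exp (-(b : ℂ) * Complex.I) * X 1 []).im
    have e1 : w - r 1 = (w - (r 1 - r 3 / 6)) - r 3 / 6 := by ring
    have e2 : |w - r 1| ≤ ℓ ^ 4 * B + ℓ ^ 3 * B := by
      rw [e1]
      refine (abs_sub _ _).trans (add_le_add him' ?_)
      rw [abs_div, abs_of_pos (by norm_num : (0 : ℝ) < 6)]
      have := abs_nonneg (r 3)
      linarith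
    refine e2.trans (le_of_eq (by ring))

/-- Both sides equal `1` at `x = 0`, so their right derivatives there, `-α` and `-δ d`, are ordered
in the same way. -/
theorem le_of_taylor_le_rpow {δ d α C : ℝ}
    (h : ∀ x ∈ Set.Icc (0 : ℝ) 1, 1 - α * x - C * x ^ 2 ≤ (1 + d * x) ^ (-δ)) : δ * d ≤ α := by
  have h1 : HasDerivAt (fun x : ℝ => (1 + d * x) ^ (-δ) - (1 - α * x - C * x ^ 2)) (α - δ * d) 0 := by
    have e1 : HasDerivAt (fun x : ℝ => 1 + d * x) d 0 := by
      simpa using ((hasDerivAt_id (0 : ℝ)).const_mul d).const_add 1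
    have e2 := e1.rpow_const (p := -δ) (Or.inl (by simp))
    have e3 : HasDerivAt (fun x : ℝ => 1 - α * x - C * x ^ 2) (-α) 0 := by
      have := (((hasDerivAt_id (0 : ℝ)).const_mul α).const_sub 1).sub
        (((hasDerivAt_id (0 : ℝ)).pow 2).const_mul C)
      exact HasDerivAt.congr_deriv this (by simp)
    refine (e2.sub e3).congr_deriv ?_
    simp
    ring
  have h2 := (hasDerivAt_iff_tendsto_slope.1 h1).mono_left
    (nhdsWithin_mono (0 : ℝ) (fun x (hx : x ∈ Set.Ioi (0 : ℝ)) => hx.ne'))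
  have h3 : 0 ≤ α - δ * d := by
    refine ge_of_tendsto h2 ?_
    filter_upwards [Ioo_mem_nhdsGT (zero_lt_one' ℝ)] with x hx
    have := h x ⟨hx.1.le, hx.2.le⟩
    rw [slope_def_field]
    refine div_nonneg ?_ (by linarith [hx.1])
    simp
    linarith
  linarith

end MomentShift

end Saddlepoint

namespace Saddlepoint

/-! ### The tilted law and its characteristic function -/

section TiltedLaw

variable {m p : ℕ} {Θ : Set (Vec p)} {μ : Vec p → Measure (Vec m)}

/-- The partial derivatives of `M₀(s; θ)` at a real argument. -/
noncomputable def mgfPartial (μ : Vec p → Measure (Vec m)) (is : List (Fin p))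
    (js : List (Fin m)) (z : Vec m × Vec p) : ℝ :=
  (mgfDeriv μ is js (z.1, 0, z.2)).re

/-- The mean of the law `μ θ` tilted by `s`, which is `K₀'(s; θ)`. -/
noncomputable def tiltedMean (μ : Vec p → Measure (Vec m)) (z : Vec m × Vec p) : Vec m :=
  WithLp.toLp 2 fun j => mgfPartial μ [] [j] z / mgfPartial μ [] [] z

/-- The covariance matrix of the law `μ θ` tilted by `s`, which is `K₀''(s; θ)`. -/
noncomputable def tiltedCov (μ : Vec p → Measure (Vec m)) (z : Vec m × Vec p) :
    Matrix (Fin m) (Fin m) ℝ :=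
  Matrix.of fun i j => mgfPartial μ [] [i, j] z / mgfPartial μ [] [] z -
    tiltedMean μ z i * tiltedMean μ z j

/-- The quadratic form of `tiltedCov`. -/
noncomputable def tiltedCovForm (μ : Vec p → Measure (Vec m)) (z : Vec m × Vec p) (φ : Vec m) : ℝ :=
  ∑ i, ∑ j, φ i * φ j * tiltedCov μ z i j

/-- The centred characteristic function of the law `μ θ` tilted by `s`. -/
noncomputable def tiltedChar (μ : Vec p → Measure (Vec m)) (z : Vec m × Vec p) (φ : Vec m) : ℂ :=
  Complex.exp (-(inner ℝ φ (tiltedMean μ z) : ℝ) * Complex.I) *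
    (((mgfPartial μ [] [] z)⁻¹ : ℝ) * mgfDeriv μ [] [] (z.1, φ, z.2))

theorem mgfPartial_nil (z : Vec m × Vec p) : mgfPartial μ [] [] z = mgf (μ z.2) z.1 := by
  change (modelMgf μ (z.1, 0, z.2)).re = _
  rw [modelMgf_zero, Complex.ofReal_re]

theorem mgf_pos {ν : Measure (Vec m)} [IsProbabilityMeasure ν] {s : Vec m}
    (hs : s ∈ mgfDomain ν) : 0 < mgf ν s :=
  integral_exp_pos hs

theorem mgfPartial_nil_pos (hμ : ∀ θ ∈ Θ, IsProbabilityMeasure (μ θ)) {z : Vec m × Vec p}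
    (hz : z ∈ interior (modelDomain Θ μ)) : 0 < mgfPartial μ [] [] z := by
  obtain ⟨h1, h2⟩ := interior_subset hz
  have := hμ _ h1
  rw [mgfPartial_nil]
  exact mgf_pos h2

theorem MgfSmooth.mgfDeriv_zero (h : MgfSmooth Θ μ) {is : List (Fin p)} {js : List (Fin m)}
    (ha : Admissible is js) {z : Vec m × Vec p} (hz : z ∈ interior (modelDomain Θ μ)) :
    mgfDeriv μ is js (z.1, 0, z.2) = (mgfPartial μ is js z : ℂ) :=
  Complex.ext rfl (h.mgfDeriv_im is js ha _ _ hz)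

theorem MgfSmooth.mgfPartial_swap (h : MgfSmooth Θ μ) (i j : Fin m) {z : Vec m × Vec p}
    (hz : z ∈ interior (modelDomain Θ μ)) :
    mgfPartial μ [] [i, j] z = mgfPartial μ [] [j, i] z := by
  have ha : ∀ i j : Fin m, Admissible ([] : List (Fin p)) [i, j] := fun i j => by simp [Admissible]
  have h1 := HasLineDerivAt.of_swap (isOpen_tubeDomain (Θ := Θ) (μ := μ))
    (fun z hz => h.hasLineDerivAt_real (j := i) (js := []) (by simp [Admissible]) hz)
    (fun z hz => h.hasLineDerivAt_real (j := j) (js := []) (by simp [Admissible]) hz)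
    (fun z hz => h.hasLineDerivAt_real (ha j i) hz) (h.continuousOn (ha j i))
    (z := (z.1, 0, z.2)) hz
  have h2 := h.hasLineDerivAt_real (ha i j) (z := (z.1, 0, z.2)) hz
  rw [mgfPartial, mgfPartial, HasDerivAt.unique h2 h1]

/-- Bounds on `M₀` and its derivatives at `(s, θ)`. -/
structure MgfBounds (μ : Vec p → Measure (Vec m)) (δ B : ℝ) (κ : ℕ) (z : Vec m × Vec p) :
    Prop where
  decay : ∀ φ, ‖((mgfPartial μ [] [] z)⁻¹ : ℝ) * mgfDeriv μ [] [] (z.1, φ, z.2)‖ ≤ bracketDecay δ φ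
  growth : ∀ is js, Admissible is js → ∀ φ, ‖mgfDeriv μ is js (z.1, φ, z.2)‖ ≤ B * (1 + ‖φ‖) ^ κ
  inv_le : (mgfPartial μ [] [] z)⁻¹ ≤ B
  mean_le : ‖tiltedMean μ z‖ ≤ B

theorem sum_abs_add_abs_inner_le (φ y : Vec m) {B : ℝ} (hy : ‖y‖ ≤ B) :
    ∑ j, |φ j| + |inner ℝ φ y| ≤ (m + B) * ‖φ‖ := by
  have h1 : ∑ j, |φ j| ≤ m * ‖φ‖ := by
    calc ∑ j, |φ j| ≤ ∑ _j : Fin m, ‖φ‖ := Finset.sum_le_sum fun j _ => by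
          simpa using PiLp.norm_apply_le φ j
      _ = m * ‖φ‖ := by simp
  have h2 : |inner ℝ φ y| ≤ ‖φ‖ * B := (abs_real_inner_le_norm φ y).trans (by gcongr)
  linarith

theorem MgfSmooth.hasDerivAt_tilted (h : MgfSmooth Θ μ) {z : Vec m × Vec p}
    (hz : z ∈ interior (modelDomain Θ μ)) (φ : Vec m) (c : ℂ) (t : ℝ) {js : List (Fin m)}
    (hj : js.length ≤ 5) :
    HasDerivAt (fun t : ℝ => c * mgfDeriv μ [] js (z.1, t • φ, z.2))
      (Complex.I * ∑ j, (φ j : ℂ) * (c * mgfDeriv μ [] (js ++ [j]) (z.1, t • φ, z.2))) t := by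
  refine ((h.hasDerivAt_imaginary_line (is := []) (js := js) (fun j => ?_) hz φ t).const_mul
    c).congr_deriv ?_
  · simp only [Admissible, List.length_nil, List.length_append, List.length_singleton]; omega
  · rw [mul_left_comm, Finset.mul_sum]
    congr 1
    exact Finset.sum_congr rfl fun j _ => by ring

theorem inner_tiltedMean (z : Vec m × Vec p) (φ : Vec m) :
    inner ℝ φ (tiltedMean μ z) = ∑ j, φ j * tiltedMean μ z j := by
  simp [PiLp.inner_apply, mul_comm]

/-- Centring at the tilted mean removes the first moment; hence `tiltedChar` has no linear term. -/
theorem MgfSmooth.momentShift_one (h : MgfSmooth Θ μ) {z : Vec m × Vec p}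
    (hz : z ∈ interior (modelDomain Θ μ)) (hM : 0 < mgfPartial μ [] [] z) (φ : Vec m) :
    momentShift φ (inner ℝ φ (tiltedMean μ z)) (fun js => ((mgfPartial μ [] [] z)⁻¹ : ℝ) *
      mgfDeriv μ [] js (z.1, 0, z.2)) [] = 0 := by
  simp only [momentShift, inner_tiltedMean]
  rw [h.mgfDeriv_zero (by simp [Admissible]) hz]
  have e : ∀ j : Fin m, mgfDeriv μ [] ([] ++ [j]) (z.1, 0, z.2) = (mgfPartial μ [] [j] z : ℂ) :=
    fun j => h.mgfDeriv_zero (by simp [Admissible]) hz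
  simp only [e, tiltedMean]
  rw [← Complex.ofReal_mul, inv_mul_cancel₀ hM.ne', Complex.ofReal_one, mul_one, Complex.ofReal_sum,
    sub_eq_zero]
  refine Finset.sum_congr rfl fun j _ => ?_
  push_cast
  ring

/-- The first centred moment being zero, the second is the tilted variance of `φ x`. -/
theorem MgfSmooth.momentShift_two (h : MgfSmooth Θ μ) {z : Vec m × Vec p}
    (hz : z ∈ interior (modelDomain Θ μ)) (hM : 0 < mgfPartial μ [] [] z) (φ : Vec m) :
    (momentShift φ (inner ℝ φ (tiltedMean μ z)))^[2] (fun js => ((mgfPartial μ [] [] z)⁻¹ : ℝ) *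
      mgfDeriv μ [] js (z.1, 0, z.2)) [] = (tiltedCovForm μ z φ : ℂ) := by
  have h1 := h.momentShift_one hz hM φ
  rw [Function.iterate_succ_apply, Function.iterate_one, momentShift, h1, mul_zero, sub_zero]
  have e : ∀ i j : Fin m, mgfDeriv μ [] ([] ++ [i] ++ [j]) (z.1, 0, z.2) =
      (mgfPartial μ [] [i, j] z : ℂ) := fun i j => h.mgfDeriv_zero (by simp [Admissible]) hz
  have e' : ∀ j : Fin m, mgfDeriv μ [] ([] ++ [j]) (z.1, 0, z.2) = (mgfPartial μ [] [j] z : ℂ) :=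
    fun j => h.mgfDeriv_zero (by simp [Admissible]) hz
  simp only [momentShift, e, e', inner_tiltedMean, tiltedCovForm, tiltedCov, Matrix.of_apply]
  refine Eq.trans (Finset.sum_congr rfl fun i _ => ?_) (Complex.ofReal_sum _ _).symm
  have : ∀ i, mgfPartial μ [] [i] z = mgfPartial μ [] [] z * tiltedMean μ z i := fun i => by
    simp only [tiltedMean]; field_simp
  rw [this]
  have hM' : (mgfPartial μ [] [] z : ℂ) ≠ 0 := by exact_mod_cast hM.ne'
  push_cast
  rw [mul_sub, Finset.sum_mul, Finset.mul_sum, Finset.mul_sum, ← Finset.sum_sub_distrib]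
  refine Finset.sum_congr rfl fun j _ => ?_
  field_simp

theorem tiltedCovForm_smul (z : Vec m × Vec p) (t : ℝ) (φ : Vec m) :
    tiltedCovForm μ z (t • φ) = t ^ 2 * tiltedCovForm μ z φ := by
  simp only [tiltedCovForm, PiLp.smul_apply, smul_eq_mul, Finset.mul_sum]
  exact Finset.sum_congr rfl fun i _ => Finset.sum_congr rfl fun j _ => by ring

theorem continuous_tiltedCovForm (z : Vec m × Vec p) : Continuous (tiltedCovForm μ z) := by
  unfold tiltedCovForm
  fun_prop

variable {δ B : ℝ} {κ : ℕ}

/-- This is `abs_twist_sub_taylor_le` with vanishing first centred moment. The factors `m + B + 1`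
come from bounding `∑ |φⱼ|` and the inner product of `φ` with the tilted mean by multiples of `‖φ‖`.
-/
theorem MgfSmooth.abs_tiltedChar_sub_le (h : MgfSmooth Θ μ) {z : Vec m × Vec p}
    (hz : z ∈ interior (modelDomain Θ μ)) (hM : 0 < mgfPartial μ [] [] z) (hB : 0 ≤ B)
    (hb : MgfBounds μ δ B κ z) (φ : Vec m) :
    |(tiltedChar μ z φ).re - (1 - tiltedCovForm μ z φ / 2)| ≤
        (m + B + 1) ^ 4 * B ^ 2 * ‖φ‖ ^ 4 * (1 + ‖φ‖) ^ (κ + 1) ∧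
      |(tiltedChar μ z φ).im| ≤ (m + B + 1) ^ 4 * B ^ 2 * ‖φ‖ ^ 3 * (1 + ‖φ‖) ^ (κ + 1) ∧
      |tiltedCovForm μ z φ| ≤ (m + B + 1) ^ 4 * B ^ 2 * ‖φ‖ ^ 2 := by
  set q := (mgfPartial μ [] [] z)⁻¹ with hq
  have hq0 : 0 < q := inv_pos.2 hM
  have hl := sum_abs_add_abs_inner_le φ (tiltedMean μ z) hb.mean_le
  set ℓ := ∑ j, |φ j| + |inner ℝ φ (tiltedMean μ z)| with hℓ
  have hℓ0 : 0 ≤ ℓ := by positivity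
  have hl' : ℓ ≤ (m + B + 1) * ‖φ‖ := hl.trans (mul_le_mul_of_nonneg_right (by linarith) (norm_nonneg φ))
  have hg : ∀ ψ : Vec m, ∀ js : List (Fin m), js.length ≤ 4 →
      ‖(q : ℂ) * mgfDeriv μ [] js (z.1, ψ, z.2)‖ ≤ B ^ 2 * (1 + ‖ψ‖) ^ κ := by
    intro ψ js hj
    rw [norm_mul, Complex.norm_real, Real.norm_of_nonneg hq0.le]
    calc q * ‖mgfDeriv μ [] js (z.1, ψ, z.2)‖ ≤ B * (B * (1 + ‖ψ‖) ^ κ) :=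
          mul_le_mul hb.inv_le (hb.growth [] js (by simp only [Admissible, List.length_nil]; omega) ψ)
            (norm_nonneg _) hB
      _ = _ := by ring
  have hT := abs_twist_sub_taylor_le (φ := φ) (b := inner ℝ φ (tiltedMean μ z))
    (X := fun t js => (q : ℂ) * mgfDeriv μ [] js (z.1, t • φ, z.2)) (B := B ^ 2 * (1 + ‖φ‖) ^ κ)
    (fun t js hj => h.hasDerivAt_tilted hz φ q t (hj.trans (by norm_num)))
    (fun js hj => by
      rw [zero_smul, h.mgfDeriv_zero (by simp only [Admissible, List.length_nil]; omega) hz,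
        ← Complex.ofReal_mul, Complex.ofReal_im])
    (fun t ht js hj => (hg (t • φ) js hj).trans (by
      rw [norm_smul, Real.norm_of_nonneg ht.1]
      gcongr
      · have := mul_nonneg ht.1 (norm_nonneg φ)
        linarith
      · exact mul_le_of_le_one_left (norm_nonneg _) ht.2))
  simp only [zero_smul, one_smul] at hT
  rw [h.momentShift_one hz hM, h.momentShift_two hz hM,
    h.mgfDeriv_zero (by simp [Admissible]) hz, ← Complex.ofReal_mul, hq,
    inv_mul_cancel₀ hM.ne'] at hT
  obtain ⟨h1, h2⟩ := hT
  simp only [Complex.ofReal_re, Complex.zero_re, sub_zero] at h1 h2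
  have hone : 1 ≤ 1 + ‖φ‖ := by linarith [norm_nonneg φ]
  have hD : 1 ≤ (m : ℝ) + B + 1 := by have : (0 : ℝ) ≤ m := by positivity
                                      linarith
  refine ⟨h1.trans ?_, h2.trans ?_, ?_⟩
  · calc ℓ ^ 4 * (B ^ 2 * (1 + ‖φ‖) ^ κ)
        ≤ ((m + B + 1) * ‖φ‖) ^ 4 * (B ^ 2 * (1 + ‖φ‖) ^ (κ + 1)) := by
          gcongr
          omega
      _ = _ := by ring
  · calc ℓ ^ 3 * (1 + ℓ) * (B ^ 2 * (1 + ‖φ‖) ^ κ)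
        ≤ ((m + B + 1) * ‖φ‖) ^ 3 * ((m + B + 1) * (1 + ‖φ‖)) * (B ^ 2 * (1 + ‖φ‖) ^ κ) := by
          gcongr
          linarith
      _ = _ := by ring
  · have h3 := norm_momentShift_iterate_le (φ := φ) (b := inner ℝ φ (tiltedMean μ z)) (N := 4)
      (X := fun js => (q : ℂ) * mgfDeriv μ [] js (z.1, 0, z.2)) (B := B ^ 2)
      (fun js hj => by simpa using hg 0 js hj) 2 [] (by simp)
    rw [hq, h.momentShift_two hz hM, Complex.norm_real, Real.norm_eq_abs] at h3
    refine h3.trans ?_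
    calc ℓ ^ 2 * B ^ 2 ≤ ((m + B + 1) * ‖φ‖) ^ 2 * B ^ 2 := by gcongr
      _ = (m + B + 1) ^ 2 * B ^ 2 * ‖φ‖ ^ 2 := by ring
      _ ≤ _ := by
        gcongr
        norm_num

/-- Along `√x • φ` the real part of the tilted characteristic function is at least `1 - x a / 2 - C
x²`, while the decay bound caps it by `(1 + δ x |φ|²)^(-δ)`. Comparing slopes at `x = 0` shows that
decay alone makes the covariance nondegenerate, with a constant depending on `δ` only. -/
theorem MgfSmooth.le_tiltedCovForm (h : MgfSmooth Θ μ) {z : Vec m × Vec p}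
    (hz : z ∈ interior (modelDomain Θ μ)) (hM : 0 < mgfPartial μ [] [] z) (hB : 0 ≤ B)
    (hb : MgfBounds μ δ B κ z) (φ : Vec m) :
    δ ^ 2 * ‖φ‖ ^ 2 ≤ tiltedCovForm μ z φ / 2 := by
  have := le_of_taylor_le_rpow (δ := δ) (d := δ * ‖φ‖ ^ 2) (α := tiltedCovForm μ z φ / 2)
    (C := (m + B + 1) ^ 4 * B ^ 2 * ‖φ‖ ^ 4 * (1 + ‖φ‖) ^ (κ + 1)) (fun x hx => ?_)
  · linarith [this, (by ring : δ ^ 2 * ‖φ‖ ^ 2 = δ * (δ * ‖φ‖ ^ 2))]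
  · have h1 := (h.abs_tiltedChar_sub_le hz hM hB hb (√x • φ)).1
    have h2 : ‖tiltedChar μ z (√x • φ)‖ ≤ bracketDecay δ (√x • φ) := by
      rw [tiltedChar, norm_mul, ← Complex.ofReal_neg, Complex.norm_exp_ofReal_mul_I, one_mul]
      exact hb.decay _
    have h3 := (Complex.re_le_norm _).trans h2
    have hs : √x ≤ 1 := Real.sqrt_le_one.2 hx.2
    have hs2 : √x ^ 2 = x := Real.sq_sqrt hx.1
    rw [tiltedCovForm_smul, norm_smul, Real.norm_of_nonneg (Real.sqrt_nonneg x), hs2] at h1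
    rw [bracketDecay, norm_smul, Real.norm_of_nonneg (Real.sqrt_nonneg x), mul_pow, hs2] at h3
    have h4 : (m + B + 1) ^ 4 * B ^ 2 * (√x * ‖φ‖) ^ 4 * (1 + √x * ‖φ‖) ^ (κ + 1) ≤
        (m + B + 1) ^ 4 * B ^ 2 * (√x * ‖φ‖) ^ 4 * (1 + ‖φ‖) ^ (κ + 1) := by
      gcongr
      exact mul_le_of_le_one_left (norm_nonneg _) hs
    have h5 : (√x * ‖φ‖) ^ 4 = x ^ 2 * ‖φ‖ ^ 4 := by
      rw [mul_pow, show √x ^ 4 = (√x ^ 2) ^ 2 by ring, hs2]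
    rw [h5] at h1 h4
    rw [abs_le] at h1
    have h6 : δ * (x * ‖φ‖ ^ 2) = δ * ‖φ‖ ^ 2 * x := by ring
    rw [h6] at h3
    linarith [h1.1]

theorem MgfSmooth.laplacePair (h : MgfSmooth Θ μ) {z : Vec m × Vec p}
    (hz : z ∈ interior (modelDomain Θ μ)) (hM : 0 < mgfPartial μ [] [] z) (hB : 0 ≤ B) (hδ : 0 < δ)
    (hb : MgfBounds μ δ B κ z) :
    LaplacePair δ ((m + B + 1) ^ 4 * B ^ 2) (κ + 1) (tiltedChar μ z) (tiltedCovForm μ z) where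
  cont := by
    have h1 : Continuous fun φ : Vec m => mgfDeriv μ [] [] (z.1, φ, z.2) := by
      have h2 : Continuous fun ψ : Vec m => (z.1, ψ, z.2) := by fun_prop
      have h3 := (h.continuousOn (is := []) (js := []) (by simp [Admissible])).comp
        h2.continuousOn (s := Set.univ) (fun ψ _ => hz)
      exact continuousOn_univ.1 h3
    unfold tiltedChar
    fun_prop
  cont_form := continuous_tiltedCovForm z
  norm_le φ := by
    rw [tiltedChar, norm_mul, ← Complex.ofReal_neg, Complex.norm_exp_ofReal_mul_I, one_mul]
    exact hb.decay _
  exp_le φ := exp_neg_le_bracketDecay hδ φ (h.le_tiltedCovForm hz hM hB hb φ)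
  re_le φ := (h.abs_tiltedChar_sub_le hz hM hB hb φ).1
  im_le φ := (h.abs_tiltedChar_sub_le hz hM hB hb φ).2.1
  form_nonneg φ := by
    have h1 := h.le_tiltedCovForm hz hM hB hb φ
    have : 0 ≤ δ ^ 2 * ‖φ‖ ^ 2 := by positivity
    linarith
  form_le φ := (le_abs_self _).trans (h.abs_tiltedChar_sub_le hz hM hB hb φ).2.2
  form_smul := tiltedCovForm_smul z

end TiltedLaw

end Saddlepoint

/-! ### Second derivatives along lines -/

section SecondLineDeriv

variable {E F : Type*} [NormedAddCommGroup E] [NormedSpace ℝ E] [NormedAddCommGroup F]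
  [NormedSpace ℝ F]

theorem ContDiffAt.hasFDerivAt_fderiv {f : E → F} {z : E} (h : ContDiffAt ℝ 2 f z) :
    HasFDerivAt (fderiv ℝ f) (fderiv ℝ (fderiv ℝ f) z) z :=
  ((h.fderiv_right (m := 1) (by norm_num)).differentiableAt (by norm_num)).hasFDerivAt

theorem ContDiffAt.eventually_lineDeriv_eq {f : E → F} {z : E} (h : ContDiffAt ℝ 2 f z) (v : E) :
    (fun w => lineDeriv ℝ f w v) =ᶠ[𝓝 z] fun w => fderiv ℝ f w v := by
  filter_upwards [h.eventually (by simp)] with w hw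
  exact (hw.differentiableAt (by norm_num)).lineDeriv_eq_fderiv

theorem ContDiffAt.hasLineDerivAt_fderiv {f : E → F} {z : E} (h : ContDiffAt ℝ 2 f z) (v w : E) :
    HasLineDerivAt ℝ (fun z => fderiv ℝ f z v) (fderiv ℝ (fderiv ℝ f) z w v) z w := by
  have := h.hasFDerivAt_fderiv.clm_apply (hasFDerivAt_const v z)
  have h2 := this.hasLineDerivAt w
  simpa using h2

theorem ContDiffAt.lineDeriv_lineDeriv {f : E → F} {z : E} (h : ContDiffAt ℝ 2 f z) (v w : E) :
    lineDeriv ℝ (fun z => lineDeriv ℝ f z v) z w = fderiv ℝ (fderiv ℝ f) z w v := by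
  have hc : Continuous fun t : ℝ => z + t • w := by fun_prop
  have h1 : (fun t : ℝ => lineDeriv ℝ f (z + t • w) v) =ᶠ[𝓝 0]
      fun t : ℝ => fderiv ℝ f (z + t • w) v :=
    (hc.tendsto' 0 z (by simp)).eventually (h.eventually_lineDeriv_eq v)
  rw [lineDeriv, h1.deriv_eq]
  exact (h.hasLineDerivAt_fderiv v w).deriv

end SecondLineDeriv

namespace Saddlepoint

/-! ### The cumulant generating function and the saddlepoint map -/

section CumulantGeneratingFunction

variable {m p : ℕ} {Θ : Set (Vec p)} {μ : Vec p → Measure (Vec m)}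

/-- The cumulant generating function `K₀(s; θ)`. -/
noncomputable def modelCgf (μ : Vec p → Measure (Vec m)) (z : Vec m × Vec p) : ℝ :=
  cgf (μ z.2) z.1

theorem modelCgf_eq_log : modelCgf μ = fun z => Real.log (mgfPartial μ [] [] z) := by
  funext z
  rw [modelCgf, cgf, mgfPartial_nil]

theorem MgfSmooth.contDiffAt_mgfPartial (h : MgfSmooth Θ μ) {js : List (Fin m)}
    (hj : js.length ≤ 2) {z : Vec m × Vec p} (hz : z ∈ interior (modelDomain Θ μ)) :
    ContDiffAt ℝ 2 (mgfPartial μ [] js) z := by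
  have h1 : ContDiffAt ℝ 2 (mgfDeriv μ [] js) (z.1, 0, z.2) :=
    (h.contDiffOn_two hj).contDiffAt (isOpen_tubeDomain.mem_nhds hz)
  have h2 : ContDiffAt ℝ 2 (fun z : Vec m × Vec p => (z.1, (0 : Vec m), z.2)) z := by fun_prop
  exact (Complex.reCLM.contDiff.contDiffAt).comp z (h1.comp z h2)

theorem MgfSmooth.exists_hasFDerivAt_mgfPartial (h : MgfSmooth Θ μ) {is : List (Fin p)}
    {js : List (Fin m)} (ha : AdmissibleSucc is js) {z : Vec m × Vec p}
    (hz : z ∈ interior (modelDomain Θ μ)) :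
    ∃ L : (Vec m × Vec p) →L[ℝ] ℝ, HasFDerivAt (mgfPartial μ is js) L z ∧
      ∀ c u, L (c, u) = ∑ j, c j * mgfPartial μ is (j :: js) z +
        ∑ i, u i * mgfPartial μ (i :: is) js z := by
  obtain ⟨L, hL, hv⟩ := h.exists_hasFDerivAt ha (z := (z.1, 0, z.2)) hz
  have h2 : HasFDerivAt (fun z : Vec m × Vec p => (z.1, (0 : Vec m), z.2))
      ((ContinuousLinearMap.fst ℝ (Vec m) (Vec p)).prod
        ((0 : (Vec m × Vec p) →L[ℝ] Vec m).prod (ContinuousLinearMap.snd ℝ (Vec m) (Vec p)))) z :=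
    hasFDerivAt_fst.prodMk ((hasFDerivAt_const _ _).prodMk hasFDerivAt_snd)
  refine ⟨_, Complex.reCLM.hasFDerivAt.comp z (HasFDerivAt.comp z hL h2), fun c u => ?_⟩
  simp only [ContinuousLinearMap.comp_apply, ContinuousLinearMap.prod_apply,
    ContinuousLinearMap.coe_fst', ContinuousLinearMap.coe_snd', _root_.zero_apply, hv]
  simp [mgfPartial]

theorem MgfSmooth.contDiffAt_modelCgf (h : MgfSmooth Θ μ) (hμ : ∀ θ ∈ Θ, IsProbabilityMeasure (μ θ))
    {z : Vec m × Vec p} (hz : z ∈ interior (modelDomain Θ μ)) : ContDiffAt ℝ 2 (modelCgf μ) z := by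
  rw [modelCgf_eq_log]
  exact (h.contDiffAt_mgfPartial (by simp) hz).log (mgfPartial_nil_pos hμ hz).ne'

theorem MgfSmooth.contDiffAt_tiltedMean (h : MgfSmooth Θ μ)
    (hμ : ∀ θ ∈ Θ, IsProbabilityMeasure (μ θ)) {z : Vec m × Vec p}
    (hz : z ∈ interior (modelDomain Θ μ)) : ContDiffAt ℝ 2 (tiltedMean μ) z := by
  rw [contDiffAt_euclidean]
  exact fun j => (h.contDiffAt_mgfPartial (by simp) hz).div (h.contDiffAt_mgfPartial (by simp) hz)
    (mgfPartial_nil_pos hμ hz).ne'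

theorem MgfSmooth.contDiffAt_tiltedCov (h : MgfSmooth Θ μ)
    (hμ : ∀ θ ∈ Θ, IsProbabilityMeasure (μ θ)) {z : Vec m × Vec p}
    (hz : z ∈ interior (modelDomain Θ μ)) (i j : Fin m) :
    ContDiffAt ℝ 2 (fun z => tiltedCov μ z i j) z := by
  have h1 := contDiffAt_euclidean.1 (h.contDiffAt_tiltedMean hμ hz)
  exact ((h.contDiffAt_mgfPartial (by simp) hz).div (h.contDiffAt_mgfPartial (by simp) hz)
    (mgfPartial_nil_pos hμ hz).ne').sub ((h1 i).mul (h1 j))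

theorem MgfSmooth.fderiv_modelCgf (h : MgfSmooth Θ μ)
    (hμ : ∀ θ ∈ Θ, IsProbabilityMeasure (μ θ)) {z : Vec m × Vec p}
    (hz : z ∈ interior (modelDomain Θ μ)) (c : Vec m) :
    fderiv ℝ (modelCgf μ) z (c, 0) = inner ℝ c (tiltedMean μ z) := by
  obtain ⟨L, hL, hv⟩ := h.exists_hasFDerivAt_mgfPartial (is := []) (js := [])
    (by simp [AdmissibleSucc]) hz
  have h1 := hL.log (mgfPartial_nil_pos hμ hz).ne'
  rw [modelCgf_eq_log, h1.fderiv, inner_tiltedMean]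
  simp only [_root_.smul_apply, hv, smul_eq_mul]
  simp only [PiLp.zero_apply, zero_mul, Finset.sum_const_zero, add_zero, Finset.mul_sum, tiltedMean]
  exact Finset.sum_congr rfl fun j _ => by ring

theorem MgfSmooth.hasGradientAt_cgf (h : MgfSmooth Θ μ)
    (hμ : ∀ θ ∈ Θ, IsProbabilityMeasure (μ θ)) {s : Vec m} {θ : Vec p}
    (hz : (s, θ) ∈ interior (modelDomain Θ μ)) :
    HasGradientAt (cgf (μ θ)) (tiltedMean μ (s, θ)) s := by
  have h1 := ((h.contDiffAt_modelCgf hμ hz).differentiableAt (by norm_num)).hasFDerivAt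
  have h2 : HasFDerivAt (fun s : Vec m => (s, θ)) (ContinuousLinearMap.inl ℝ (Vec m) (Vec p)) s :=
    hasFDerivAt_prodMk_left s θ
  have h3 := HasFDerivAt.comp (g := modelCgf μ) (f := fun s : Vec m => (s, θ)) s h1 h2
  have h4 : HasFDerivAt (cgf (μ θ)) _ s := h3
  rw [hasGradientAt_iff_hasFDerivAt]
  refine h4.congr_fderiv (ContinuousLinearMap.ext fun c => ?_)
  simp only [ContinuousLinearMap.comp_apply, ContinuousLinearMap.inl_apply,
    h.fderiv_modelCgf hμ hz, InnerProductSpace.toDual_apply_apply]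
  exact real_inner_comm _ _

/-- Obtained by differentiating `fderiv_modelCgf`, which holds on an open set: the mean is the
`s`-gradient of `K₀`. It lets facts about the mean be read off the second derivative of `K₀`, and
conversely. -/
theorem MgfSmooth.fderiv_tiltedMean (h : MgfSmooth Θ μ)
    (hμ : ∀ θ ∈ Θ, IsProbabilityMeasure (μ θ)) {z : Vec m × Vec p}
    (hz : z ∈ interior (modelDomain Θ μ)) (w : Vec m × Vec p) (c : Vec m) :
    inner ℝ c (fderiv ℝ (tiltedMean μ) z w) = fderiv ℝ (fderiv ℝ (modelCgf μ)) z w (c, 0) := by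
  have h1 := (h.contDiffAt_modelCgf hμ hz).hasLineDerivAt_fderiv (c, 0) w
  have h2 := ((innerSL ℝ c).hasFDerivAt.comp z ((h.contDiffAt_tiltedMean hμ hz).differentiableAt
    (by norm_num)).hasFDerivAt).hasLineDerivAt w
  have hc : Continuous fun t : ℝ => z + t • w := by fun_prop
  have h3 : (fun t : ℝ => inner ℝ c (tiltedMean μ (z + t • w))) =ᶠ[𝓝 0]
      fun t : ℝ => fderiv ℝ (modelCgf μ) (z + t • w) (c, 0) := by
    filter_upwards [(hc.tendsto' 0 z (by simp)).eventually (isOpen_interior.mem_nhds hz)] with t ht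
    rw [h.fderiv_modelCgf hμ ht]
  have h4 := HasDerivAt.unique (HasDerivAt.congr_of_eventuallyEq h1 h3) h2
  rw [h4]
  rfl

theorem MgfSmooth.fderiv_fderiv_modelCgf (h : MgfSmooth Θ μ)
    (hμ : ∀ θ ∈ Θ, IsProbabilityMeasure (μ θ)) {z : Vec m × Vec p}
    (hz : z ∈ interior (modelDomain Θ μ)) (i j : Fin m) :
    fderiv ℝ (fderiv ℝ (modelCgf μ)) z (EuclideanSpace.single i 1, 0)
      (EuclideanSpace.single j 1, 0) = tiltedCov μ z i j := by
  rw [← h.fderiv_tiltedMean hμ hz, EuclideanSpace.inner_single_left]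
  obtain ⟨L₀, hL₀, hv₀⟩ := h.exists_hasFDerivAt_mgfPartial (is := []) (js := [])
    (by simp [AdmissibleSucc]) hz
  obtain ⟨L₁, hL₁, hv₁⟩ := h.exists_hasFDerivAt_mgfPartial (is := []) (js := [j])
    (by simp [AdmissibleSucc]) hz
  have hM := (mgfPartial_nil_pos hμ hz).ne'
  have h1 := HasDerivAt.fun_div (hL₁.hasLineDerivAt (EuclideanSpace.single i 1, (0 : Vec p)))
    (hL₀.hasLineDerivAt (EuclideanSpace.single i 1, (0 : Vec p))) (by simpa using hM)
  have h2 := ((EuclideanSpace.proj (𝕜 := ℝ) j).hasFDerivAt.comp z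
    ((h.contDiffAt_tiltedMean hμ hz).differentiableAt (by norm_num)).hasFDerivAt).hasLineDerivAt
    (EuclideanSpace.single i 1, (0 : Vec p))
  have h4 := HasDerivAt.unique h2 h1
  simp only [ContinuousLinearMap.comp_apply, PiLp.proj_apply] at h4
  rw [h4]
  simp [hv₀, hv₁, tiltedCov, tiltedMean]
  field_simp

/-- With its companion for the second variable, this turns the nested partial derivatives of the
statement into entries of one second derivative on the product space. -/
theorem lineDeriv_fst_slice {F : Vec m × Vec p → ℝ} (s v : Vec m) (θ : Vec p) :
    lineDeriv ℝ (fun s => F (s, θ)) s v = lineDeriv ℝ F (s, θ) (v, 0) := by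
  simp [lineDeriv]

theorem lineDeriv_snd_slice {F : Vec m × Vec p → ℝ} (s : Vec m) (θ v : Vec p) :
    lineDeriv ℝ (fun θ => F (s, θ)) θ v = lineDeriv ℝ F (s, θ) (0, v) := by
  simp [lineDeriv]

theorem MgfSmooth.hessian_cgf (h : MgfSmooth Θ μ) (hμ : ∀ θ ∈ Θ, IsProbabilityMeasure (μ θ))
    {s : Vec m} {θ : Vec p} (hz : (s, θ) ∈ interior (modelDomain Θ μ)) :
    hessian (cgf (μ θ)) s = tiltedCov μ (s, θ) := by
  ext i j
  rw [← h.fderiv_fderiv_modelCgf hμ hz, ← (h.contDiffAt_modelCgf hμ hz).lineDeriv_lineDeriv,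
    ← lineDeriv_fst_slice]
  simp only [hessian, Matrix.of_apply, partialDeriv, ← lineDeriv_fst_slice]
  rfl

theorem MgfSmooth.mixedHessian_apply (h : MgfSmooth Θ μ)
    (hμ : ∀ θ ∈ Θ, IsProbabilityMeasure (μ θ)) {s : Vec m} {θ : Vec p}
    (hz : (s, θ) ∈ interior (modelDomain Θ μ)) (i : Fin m) (j : Fin p) :
    mixedHessian μ s θ i j = fderiv ℝ (fderiv ℝ (modelCgf μ)) (s, θ)
      (EuclideanSpace.single i 1, 0) (0, EuclideanSpace.single j 1) := by
  rw [← (h.contDiffAt_modelCgf hμ hz).lineDeriv_lineDeriv, ← lineDeriv_fst_slice]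
  simp only [mixedHessian, Matrix.of_apply, partialDeriv, ← lineDeriv_snd_slice]
  rfl

theorem MgfSmooth.hessian_param_apply (h : MgfSmooth Θ μ)
    (hμ : ∀ θ ∈ Θ, IsProbabilityMeasure (μ θ)) {s : Vec m} {θ : Vec p}
    (hz : (s, θ) ∈ interior (modelDomain Θ μ)) (i j : Fin p) :
    hessian (fun θ => cgf (μ θ) s) θ i j = fderiv ℝ (fderiv ℝ (modelCgf μ)) (s, θ)
      (0, EuclideanSpace.single i 1) (0, EuclideanSpace.single j 1) := by
  rw [← (h.contDiffAt_modelCgf hμ hz).lineDeriv_lineDeriv, ← lineDeriv_snd_slice]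
  simp only [hessian, Matrix.of_apply, partialDeriv, ← lineDeriv_snd_slice]
  rfl

theorem MgfSmooth.fderiv_tiltedMean_inner_self (h : MgfSmooth Θ μ)
    (hμ : ∀ θ ∈ Θ, IsProbabilityMeasure (μ θ)) {z : Vec m × Vec p}
    (hz : z ∈ interior (modelDomain Θ μ)) (c : Vec m) :
    inner ℝ c (fderiv ℝ (tiltedMean μ) z (c, 0)) = tiltedCovForm μ z c := by
  rw [h.fderiv_tiltedMean hμ hz]
  have hc : (c, (0 : Vec p)) = ∑ i, c i • (EuclideanSpace.single i (1 : ℝ), (0 : Vec p)) := by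
    have e := (EuclideanSpace.basisFun (Fin m) ℝ).sum_repr c
    simp only [EuclideanSpace.basisFun_repr, EuclideanSpace.basisFun_apply] at e
    refine Prod.ext ?_ ?_
    · rw [Prod.fst_sum]; simpa using e.symm
    · rw [Prod.snd_sum]; simp
  rw [hc]
  simp only [map_sum, map_smul, _root_.sum_apply, _root_.smul_apply,
    h.fderiv_fderiv_modelCgf hμ hz, smul_eq_mul, tiltedCovForm, Finset.mul_sum]
  rw [Finset.sum_comm]
  exact Finset.sum_congr rfl fun i _ => Finset.sum_congr rfl fun j _ => by ring

/-- The bounds on `M₀` hold locally uniformly. -/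
theorem exists_eventually_mgfBounds (hμ : ∀ θ ∈ Θ, IsProbabilityMeasure (μ θ))
    (hdecay : DecayBound Θ μ) (hgrowth : GrowthBound Θ μ) {z₀ : Vec m × Vec p}
    (hz₀ : z₀ ∈ interior (modelDomain Θ μ)) :
    ∃ (δ B : ℝ) (κ : ℕ), 0 < δ ∧ 1 ≤ B ∧ ∀ᶠ z in 𝓝 z₀, MgfBounds μ δ B κ z := by
  have h := hgrowth.mgfSmooth
  obtain ⟨δ, hδc, hδ⟩ := hdecay
  obtain ⟨γ, hγc, hγ, hG⟩ := hgrowth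
  have hO := (isOpen_interior (s := modelDomain Θ μ)).mem_nhds hz₀
  set N : ℕ := ⌈γ z₀ + 1⌉₊ with hN
  have hM0 := mgfPartial_nil_pos hμ hz₀
  set M₀ := mgfPartial μ [] [] z₀ with hM₀
  have cM : ContinuousAt (mgfPartial μ [] []) z₀ :=
    (h.contDiffAt_mgfPartial (by simp) hz₀).continuousAt
  have cm : ContinuousAt (fun z => ‖tiltedMean μ z‖) z₀ :=
    (h.contDiffAt_tiltedMean hμ hz₀).continuousAt.norm
  have cI : ContinuousAt (fun z => (mgfPartial μ [] [] z)⁻¹) z₀ := cM.inv₀ hM0.ne'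
  -- Halving `δ z₀` and raising the other values at `z₀` by one leaves room for a neighbourhood; the
  -- sum bounds `γ`, `M₀`, `M₀⁻¹` and the norm of the mean at once, and `N` bounds the growth
  -- exponent.
  refine ⟨δ z₀ / 2, N + M₀⁻¹ + ‖tiltedMean μ z₀‖ + M₀ + 3, N, half_pos (hδ z₀ hz₀).1, ?_, ?_⟩
  · have : 0 ≤ M₀⁻¹ := (inv_pos.2 hM0).le
    have : 0 ≤ ‖tiltedMean μ z₀‖ := norm_nonneg _
    have : (0 : ℝ) ≤ N := by positivity
    linarith
  filter_upwards [hO, (hδc.continuousAt hO).eventually (lt_mem_nhds (half_lt_self (hδ z₀ hz₀).1)),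
    (hγc.continuousAt hO).eventually (gt_mem_nhds (lt_add_one (γ z₀))),
    cM.eventually (gt_mem_nhds (lt_add_one _)), cm.eventually (gt_mem_nhds (lt_add_one _)),
    cI.eventually (gt_mem_nhds (lt_add_one _))] with z hz h1 h2 h3 h4 h5
  have hM := mgfPartial_nil_pos hμ hz
  have i0 : 0 ≤ M₀⁻¹ := (inv_pos.2 hM0).le
  have i1 : 0 ≤ ‖tiltedMean μ z₀‖ := norm_nonneg _
  have i2 : (0 : ℝ) ≤ N := by positivity
  have hd : ∀ φ, ‖((mgfPartial μ [] [] z)⁻¹ : ℝ) * mgfDeriv μ [] [] (z.1, φ, z.2)‖ ≤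
      bracketDecay (δ z₀ / 2) φ := by
    intro φ
    have e1 := (hδ z hz).2 φ
    refine le_trans (le_of_eq ?_) (e1.trans (bracketDecay_anti (half_pos (hδ z₀ hz₀).1) h1.le φ))
    rw [mgfPartial_nil, div_eq_inv_mul, Complex.ofReal_inv]
    rfl
  refine ⟨hd, fun is js ha φ => ?_, by linarith, by linarith⟩
  have hone : 1 ≤ 1 + ‖φ‖ := by linarith [norm_nonneg φ]
  have hp : 1 ≤ (1 + ‖φ‖) ^ N := one_le_pow₀ hone
  by_cases hl : 1 ≤ is.length + js.length
  · have e1 := ((hG is js (by simp only [Admissible] at ha; omega)).1 z.1 φ z.2 hz).2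
    have hγN : γ z ≤ N := h2.le.trans (Nat.le_ceil _)
    refine e1.trans ?_
    rw [← Real.rpow_natCast]
    have : γ (z.1, z.2) = γ z := rfl
    rw [this]
    have e2 : (1 + ‖φ‖) ^ γ z ≤ (1 + ‖φ‖) ^ (N : ℝ) := Real.rpow_le_rpow_of_exponent_le hone hγN
    refine mul_le_mul (by linarith) e2 (by positivity) (by linarith)
  -- Order zero lies outside the growth bound; there the decay bound gives `|M₀(s + iφ)| ≤ M₀(s)`.
  · have e0 : is = [] ∧ js = [] := by
      simp only [← List.length_eq_zero_iff]; omega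
    rw [e0.1, e0.2]
    have e1 := (hd φ).trans (bracketDecay_le_one (half_pos (hδ z₀ hz₀).1) φ)
    rw [norm_mul, Complex.norm_real, Real.norm_of_nonneg (inv_pos.2 hM).le, inv_mul_le_iff₀ hM,
      mul_one] at e1
    refine e1.trans ?_
    calc mgfPartial μ [] [] z ≤ (N + M₀⁻¹ + ‖tiltedMean μ z₀‖ + M₀ + 3) * 1 := by linarith
      _ ≤ _ := by gcongr

theorem tiltedCovForm_pos (hμ : ∀ θ ∈ Θ, IsProbabilityMeasure (μ θ))
    (hdecay : DecayBound Θ μ) (hgrowth : GrowthBound Θ μ) {z : Vec m × Vec p}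
    (hz : z ∈ interior (modelDomain Θ μ)) {φ : Vec m} (hφ : φ ≠ 0) : 0 < tiltedCovForm μ z φ := by
  obtain ⟨δ, B, κ, hδ, hB, hev⟩ := exists_eventually_mgfBounds hμ hdecay hgrowth hz
  have h1 := hgrowth.mgfSmooth.le_tiltedCovForm hz (mgfPartial_nil_pos hμ hz) (zero_le_one.trans hB)
    hev.self_of_nhds φ
  have h2 : 0 < δ ^ 2 * ‖φ‖ ^ 2 := by
    have := norm_pos_iff.2 hφ
    positivity
  linarith

theorem tiltedCovForm_eq (z : Vec m × Vec p) (φ : Vec m) :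
    tiltedCovForm μ z φ = φ.ofLp ⬝ᵥ (tiltedCov μ z).mulVec φ.ofLp := by
  simp only [tiltedCovForm, dotProduct, Matrix.mulVec, Finset.mul_sum]
  exact Finset.sum_congr rfl fun i _ => Finset.sum_congr rfl fun j _ => by ring

theorem posDef_tiltedCov (hμ : ∀ θ ∈ Θ, IsProbabilityMeasure (μ θ))
    (hdecay : DecayBound Θ μ) (hgrowth : GrowthBound Θ μ) {z : Vec m × Vec p}
    (hz : z ∈ interior (modelDomain Θ μ)) : (tiltedCov μ z).PosDef := by
  refine Matrix.PosDef.of_dotProduct_mulVec_pos ?_ fun x hx => ?_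
  · ext i j
    simp only [Matrix.conjTranspose_apply, star_trivial, tiltedCov, Matrix.of_apply]
    rw [hgrowth.mgfSmooth.mgfPartial_swap i j hz, mul_comm]
  · have := tiltedCovForm_pos hμ hdecay hgrowth hz (φ := WithLp.toLp 2 x) (by simpa using hx)
    rw [tiltedCovForm_eq] at this
    simpa using this

/-- The saddlepoint as a function of `(θ, y)`. -/
theorem exists_saddlepoint_map (hμ : ∀ θ ∈ Θ, IsProbabilityMeasure (μ θ))
    (hdecay : DecayBound Θ μ) (hgrowth : GrowthBound Θ μ) {s₀ : Vec m} {θ₀ : Vec p}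
    (hz₀ : (s₀, θ₀) ∈ interior (modelDomain Θ μ)) :
    ∃ σ : Vec p × Vec m → Vec m, σ (θ₀, tiltedMean μ (s₀, θ₀)) = s₀ ∧
      ∀ᶠ z in 𝓝 (θ₀, tiltedMean μ (s₀, θ₀)), ContDiffAt ℝ 2 σ z ∧
        (σ z, z.1) ∈ interior (modelDomain Θ μ) ∧ tiltedMean μ (σ z, z.1) = z.2 := by
  have h := hgrowth.mgfSmooth
  -- The saddlepoint is the first component of the local inverse of `(s, θ) ↦ (K₀'(s; θ), θ)`. A
  -- vector in the kernel of the derivative has zero `θ`-component, and then `K₀''` annihilates its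
  -- `s`-component, which must vanish by positivity.
  set Φ : Vec m × Vec p → Vec m × Vec p := fun z => (tiltedMean μ z, z.2) with hΦ
  have hΦc : ContDiffAt ℝ 2 Φ (s₀, θ₀) := (h.contDiffAt_tiltedMean hμ hz₀).prodMk contDiffAt_snd
  have hm := ((h.contDiffAt_tiltedMean hμ hz₀).differentiableAt (by norm_num)).hasFDerivAt
  set L : (Vec m × Vec p) →L[ℝ] (Vec m × Vec p) :=
    (fderiv ℝ (tiltedMean μ) (s₀, θ₀)).prod (ContinuousLinearMap.snd ℝ (Vec m) (Vec p)) with hL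
  have hΦd : HasFDerivAt Φ L (s₀, θ₀) := hm.prodMk hasFDerivAt_snd
  have hinj : Function.Injective (L : (Vec m × Vec p) →ₗ[ℝ] (Vec m × Vec p)) := by
    rw [injective_iff_map_eq_zero]
    rintro ⟨c, u⟩ hcu
    have h1 : fderiv ℝ (tiltedMean μ) (s₀, θ₀) (c, u) = 0 := congrArg Prod.fst hcu
    have h2 : u = 0 := congrArg Prod.snd hcu
    subst h2
    have h3 := h.fderiv_tiltedMean_inner_self hμ hz₀ c
    rw [h1, inner_zero_right] at h3
    by_contra hne
    have hc : c ≠ 0 := fun hc => hne (by rw [hc]; rfl)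
    exact absurd h3 (tiltedCovForm_pos hμ hdecay hgrowth hz₀ hc).ne
  set e : (Vec m × Vec p) ≃L[ℝ] (Vec m × Vec p) :=
    (LinearEquiv.ofInjectiveEndo _ hinj).toContinuousLinearEquiv with he
  have heL : (e : (Vec m × Vec p) →L[ℝ] (Vec m × Vec p)) = L := by
    ext x <;> rfl
  have hΦd' : HasFDerivAt Φ (e : (Vec m × Vec p) →L[ℝ] (Vec m × Vec p)) (s₀, θ₀) := by
    rw [heL]; exact hΦd
  set Ψ := hΦc.localInverse hΦd' (by norm_num) with hΨ
  have hΨc : ContDiffAt ℝ 2 Ψ (Φ (s₀, θ₀)) := hΦc.to_localInverse hΦd' (by norm_num)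
  have hΨ0 : Ψ (Φ (s₀, θ₀)) = (s₀, θ₀) := hΦc.localInverse_apply_image hΦd' (by norm_num)
  have hright : ∀ᶠ w in 𝓝 (Φ (s₀, θ₀)), Φ (Ψ w) = w :=
    (hΦc.hasStrictFDerivAt' hΦd' (by norm_num)).eventually_right_inverse
  have hmem : ∀ᶠ w in 𝓝 (Φ (s₀, θ₀)), Ψ w ∈ interior (modelDomain Θ μ) := by
    refine hΨc.continuousAt.eventually ?_
    rw [hΨ0]
    exact isOpen_interior.mem_nhds hz₀
  have hsw : ContinuousAt (Prod.swap : Vec p × Vec m → Vec m × Vec p)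
      (θ₀, tiltedMean μ (s₀, θ₀)) := continuous_swap.continuousAt
  refine ⟨fun z => (Ψ z.swap).1, congrArg Prod.fst hΨ0, ?_⟩
  filter_upwards [hsw.eventually (hΨc.eventually (by simp)), hsw.eventually hright,
    hsw.eventually hmem] with z h1 h2 h3
  have h4 : (Ψ z.swap).2 = z.1 := congrArg Prod.snd h2
  have h5 : tiltedMean μ (Ψ z.swap) = z.2 := congrArg Prod.fst h2
  have h6 : ((Ψ z.swap).1, z.1) = Ψ z.swap := by rw [← h4]
  refine ⟨?_, by rwa [h6], by rw [h6, h5]⟩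
  have hs : ContDiffAt ℝ 2 (Prod.swap : Vec p × Vec m → Vec m × Vec p) z :=
    contDiffAt_snd.prodMk contDiffAt_fst
  exact contDiffAt_fst.comp z (h1.comp z hs)

end CumulantGeneratingFunction

end Saddlepoint

theorem LaplacePair.mono {V : Type*} [NormedAddCommGroup V] [InnerProductSpace ℝ V]
    [FiniteDimensional ℝ V] [MeasurableSpace V] [BorelSpace V] {δ C C' : ℝ} {κ : ℕ} {ρ : V → ℂ}
    {a : V → ℝ} (h : LaplacePair δ C κ ρ a) (hC : C ≤ C') : LaplacePair δ C' κ ρ a where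
  cont := h.cont
  cont_form := h.cont_form
  norm_le := h.norm_le
  exp_le := h.exp_le
  re_le φ := (h.re_le φ).trans (by gcongr)
  im_le φ := (h.im_le φ).trans (by gcongr)
  form_nonneg := h.form_nonneg
  form_le φ := (h.form_le φ).trans (by gcongr)
  form_smul := h.form_smul

namespace Saddlepoint

/-! ### Derivatives at imaginary arguments -/

section ImaginaryDerivative

variable {m : ℕ} {φ : Vec m} {t : ℝ} {js : List (Fin m)}

/-- `X t js` has the derivative in `t` of a partial derivative of a moment generating function at
the imaginary argument `t φ`. -/
def HasImagDerivAt (φ : Vec m) (X : ℝ → List (Fin m) → ℂ) (js : List (Fin m)) (t : ℝ) : Prop :=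
  HasDerivAt (fun t => X t js) (Complex.I * ∑ j, (φ j : ℂ) * X t (js ++ [j])) t

theorem HasImagDerivAt.add {X Y : ℝ → List (Fin m) → ℂ} (hX : HasImagDerivAt φ X js t)
    (hY : HasImagDerivAt φ Y js t) : HasImagDerivAt φ (fun t js => X t js + Y t js) js t := by
  refine (HasDerivAt.add hX hY).congr_deriv ?_
  simp only [mul_add, Finset.sum_add_distrib]

theorem HasImagDerivAt.const_mul {X : ℝ → List (Fin m) → ℂ} (c : ℂ) (hX : HasImagDerivAt φ X js t) :
    HasImagDerivAt φ (fun t js => c * X t js) js t := by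
  refine (HasDerivAt.const_mul c hX).congr_deriv ?_
  rw [mul_left_comm, Finset.mul_sum]
  congr 1
  exact Finset.sum_congr rfl fun j _ => by ring

theorem HasImagDerivAt.sum {ι : Type*} [Fintype ι] {X : ι → ℝ → List (Fin m) → ℂ}
    (hX : ∀ i, HasImagDerivAt φ (X i) js t) : HasImagDerivAt φ (fun t js => ∑ i, X i t js) js t := by
  refine (HasDerivAt.fun_sum fun i _ => hX i).congr_deriv ?_
  simp only [Finset.mul_sum]
  rw [Finset.sum_comm]

end ImaginaryDerivative

/-! ### Derivatives along the saddlepoint as the parameter varies -/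

section ParameterDerivatives

variable {m p : ℕ} {Θ : Set (Vec p)} {μ : Vec p → Measure (Vec m)}

/-- The derivative of `mgfDeriv μ is js` at `w` in the direction `(c, 0, u)`. -/
noncomputable def mgfDirDeriv (μ : Vec p → Measure (Vec m)) (c : Vec m) (u : Vec p)
    (is : List (Fin p)) (w : Vec m × Vec m × Vec p) (js : List (Fin m)) : ℂ :=
  ∑ j, (c j : ℂ) * mgfDeriv μ is (j :: js) w + ∑ i, (u i : ℂ) * mgfDeriv μ (i :: is) js w

/-- The second derivative of `mgfDeriv μ [] js` along a curve with velocity `(c, 0, u)` and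
acceleration `(c', 0, 0)`. -/
noncomputable def mgfDirDeriv₂ (μ : Vec p → Measure (Vec m)) (c c' : Vec m) (u : Vec p)
    (w : Vec m × Vec m × Vec p) (js : List (Fin m)) : ℂ :=
  ∑ j, (c' j : ℂ) * mgfDeriv μ [] (j :: js) w + (∑ j, (c j : ℂ) * mgfDirDeriv μ c u [] w (j :: js) +
    ∑ i, (u i : ℂ) * mgfDirDeriv μ c u [i] w js)

theorem MgfSmooth.hasImagDerivAt (h : MgfSmooth Θ μ) {is : List (Fin p)} {js : List (Fin m)}
    (ha : ∀ j : Fin m, Admissible is (js ++ [j])) {s : Vec m} {θ : Vec p}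
    (hz : (s, θ) ∈ interior (modelDomain Θ μ)) (φ : Vec m) (t : ℝ) :
    HasImagDerivAt φ (fun t js => mgfDeriv μ is js (s, t • φ, θ)) js t :=
  h.hasDerivAt_imaginary_line ha hz φ t

theorem MgfSmooth.hasImagDerivAt_mgfDirDeriv (h : MgfSmooth Θ μ) {is : List (Fin p)}
    {js : List (Fin m)} (ha : (is.length = 0 ∧ js.length ≤ 4) ∨ (is.length = 1 ∧ js.length ≤ 1))
    {s : Vec m} {θ : Vec p} (hz : (s, θ) ∈ interior (modelDomain Θ μ)) (c : Vec m) (u : Vec p)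
    (φ : Vec m) (t : ℝ) :
    HasImagDerivAt φ (fun t js => mgfDirDeriv μ c u is (s, t • φ, θ) js) js t := by
  refine (HasImagDerivAt.sum fun j => ?_).add (HasImagDerivAt.sum fun i => ?_)
  · have := h.hasImagDerivAt (is := is) (js := j :: js) (fun a => by
      simp only [Admissible, List.length_append, List.length_cons, List.length_nil]; omega) hz φ t
    exact HasImagDerivAt.const_mul _ (X := fun t js => mgfDeriv μ is (j :: js) (s, t • φ, θ)) this
  · have := h.hasImagDerivAt (is := i :: is) (js := js) (fun a => by
      simp only [Admissible, List.length_append, List.length_cons, List.length_nil]; omega) hz φ t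
    exact HasImagDerivAt.const_mul _ this

theorem MgfSmooth.hasImagDerivAt_mgfDirDeriv₂ (h : MgfSmooth Θ μ)
    {s : Vec m} {θ : Vec p} (hz : (s, θ) ∈ interior (modelDomain Θ μ)) (c c' : Vec m) (u : Vec p)
    (φ : Vec m) (t : ℝ) :
    HasImagDerivAt φ (fun t js => mgfDirDeriv₂ μ c c' u (s, t • φ, θ) js) [] t := by
  refine (HasImagDerivAt.sum fun j => ?_).add
    ((HasImagDerivAt.sum fun j => ?_).add (HasImagDerivAt.sum fun i => ?_))
  · have := h.hasImagDerivAt (is := []) (js := [j]) (fun a => by simp [Admissible]) hz φ t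
    exact HasImagDerivAt.const_mul _ (X := fun t js => mgfDeriv μ [] (j :: js) (s, t • φ, θ)) this
  · have := h.hasImagDerivAt_mgfDirDeriv (is := []) (js := [j]) (by simp) hz c u φ t
    exact HasImagDerivAt.const_mul _ (X := fun t js => mgfDirDeriv μ c u [] (s, t • φ, θ) (j :: js))
      this
  · have := h.hasImagDerivAt_mgfDirDeriv (is := [i]) (js := []) (by simp) hz c u φ t
    exact HasImagDerivAt.const_mul _ this

theorem norm_sum_mul_le {d : ℕ} (c : Vec d) (f : Fin d → ℂ) {A R : ℝ} (hc : ‖c‖ ≤ A)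
    (hf : ∀ j, ‖f j‖ ≤ R) : ‖∑ j, (c j : ℂ) * f j‖ ≤ d * A * R := by
  have hA : 0 ≤ A := (norm_nonneg c).trans hc
  calc ‖∑ j, (c j : ℂ) * f j‖ ≤ ∑ _j : Fin d, A * R := by
        refine (norm_sum_le _ _).trans (Finset.sum_le_sum fun j _ => ?_)
        rw [norm_mul, Complex.norm_real]
        exact mul_le_mul ((PiLp.norm_apply_le c j).trans hc) (hf j) (norm_nonneg _) hA
    _ = d * A * R := by simp [mul_assoc]

variable {δ B : ℝ} {κ : ℕ}

theorem MgfBounds.norm_mgfDirDeriv_le {s : Vec m} {θ : Vec p} (hb : MgfBounds μ δ B κ (s, θ))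
    (hB : 1 ≤ B) {c : Vec m} {u : Vec p} (hc : ‖c‖ ≤ B) (hu : ‖u‖ ≤ 1) {is : List (Fin p)}
    {js : List (Fin m)} (ha : AdmissibleSucc is js) (ψ : Vec m) :
    ‖mgfDirDeriv μ c u is (s, ψ, θ) js‖ ≤ (m * B + p + 1) * (B * (1 + ‖ψ‖) ^ κ) := by
  simp only [AdmissibleSucc] at ha
  have h1 := norm_sum_mul_le c (fun j => mgfDeriv μ is (j :: js) (s, ψ, θ)) hc
    (fun j => hb.growth is (j :: js) (by simp only [Admissible, List.length_cons]; omega) ψ)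
  have h2 := norm_sum_mul_le u (fun i => mgfDeriv μ (i :: is) js (s, ψ, θ)) hu
    (fun i => hb.growth (i :: is) js (by simp only [Admissible, List.length_cons]; omega) ψ)
  refine (norm_add_le _ _).trans ((add_le_add h1 h2).trans ?_)
  have : 0 ≤ B * (1 + ‖ψ‖) ^ κ := by positivity
  linarith

theorem MgfBounds.norm_mgfDirDeriv₂_le {s : Vec m} {θ : Vec p} (hb : MgfBounds μ δ B κ (s, θ))
    (hB : 1 ≤ B) {c c' : Vec m} {u : Vec p} (hc : ‖c‖ ≤ B) (hc' : ‖c'‖ ≤ B) (hu : ‖u‖ ≤ 1)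
    {js : List (Fin m)} (hj : js.length ≤ 1) (ψ : Vec m) :
    ‖mgfDirDeriv₂ μ c c' u (s, ψ, θ) js‖ ≤ 2 * (m * B + p + 1) ^ 2 * (B * (1 + ‖ψ‖) ^ κ) := by
  set E : ℝ := m * B + p + 1 with hE
  set R := B * (1 + ‖ψ‖) ^ κ with hR
  have hR0 : 0 ≤ R := by positivity
  have hE1 : 1 ≤ E := by
    have : 0 ≤ (m : ℝ) * B + p := by positivity
    linarith
  have h1 := norm_sum_mul_le c' (fun j => mgfDeriv μ [] (j :: js) (s, ψ, θ)) hc'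
    (fun j => hb.growth [] (j :: js) (by
      simp only [Admissible, List.length_cons, List.length_nil]; omega) ψ)
  have h2 := norm_sum_mul_le c (fun j => mgfDirDeriv μ c u [] (s, ψ, θ) (j :: js)) hc
    (fun j => hb.norm_mgfDirDeriv_le hB hc hu (Or.inl ⟨rfl, by rw [List.length_cons]; omega⟩) ψ)
  have h3 := norm_sum_mul_le u (fun i => mgfDirDeriv μ c u [i] (s, ψ, θ) js) hu
    (fun i => hb.norm_mgfDirDeriv_le hB hc hu (Or.inr ⟨rfl, by omega⟩) ψ)
  refine (norm_add_le _ _).trans ((add_le_add h1 ((norm_add_le _ _).trans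
    (add_le_add h2 h3))).trans ?_)
  rw [← hE, ← hR]
  have e1 : (m : ℝ) * B * R ≤ E * R := by
    refine mul_le_mul_of_nonneg_right ?_ hR0
    have : (0 : ℝ) ≤ p := by positivity
    linarith
  have e2 : E * R ≤ E ^ 2 * R := mul_le_mul_of_nonneg_right (by nlinarith) hR0
  have e3 : (m : ℝ) * B * (E * R) + p * 1 * (E * R) ≤ E ^ 2 * R := by
    have : 0 ≤ E * R := by positivity
    calc (m : ℝ) * B * (E * R) + p * 1 * (E * R) ≤ (m * B + p + 1) * (E * R) := by linarith
      _ = E ^ 2 * R := by rw [← hE]; ring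
  linarith

theorem MgfSmooth.mgfDirDeriv_im (h : MgfSmooth Θ μ) {s : Vec m} {θ : Vec p}
    (hz : (s, θ) ∈ interior (modelDomain Θ μ)) (c : Vec m) (u : Vec p) {js : List (Fin m)}
    (hj : js.length ≤ 3) : (mgfDirDeriv μ c u [] (s, 0, θ) js).im = 0 := by
  have h1 : ∀ j, (mgfDeriv μ [] (j :: js) (s, 0, θ)).im = 0 := fun j =>
    h.mgfDeriv_im _ _ (by simp only [Admissible, List.length_cons, List.length_nil]; omega) _ _ hz
  have h2 : ∀ i, (mgfDeriv μ [i] js (s, 0, θ)).im = 0 := fun j =>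
    h.mgfDeriv_im _ _ (by simp only [Admissible, List.length_cons, List.length_nil]; omega) _ _ hz
  simp [mgfDirDeriv, h1, h2]

theorem MgfSmooth.continuous_mgfDeriv (h : MgfSmooth Θ μ) {is : List (Fin p)} {js : List (Fin m)}
    (ha : Admissible is js) {s : Vec m} {θ : Vec p} (hz : (s, θ) ∈ interior (modelDomain Θ μ)) :
    Continuous fun ψ => mgfDeriv μ is js (s, ψ, θ) := by
  have h2 : Continuous fun ψ : Vec m => (s, ψ, θ) := by fun_prop
  exact continuousOn_univ.1 ((h.continuousOn ha).comp h2.continuousOn (s := Set.univ)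
    (fun ψ _ => hz))

theorem MgfSmooth.continuous_mgfDirDeriv (h : MgfSmooth Θ μ) {is : List (Fin p)}
    {js : List (Fin m)} (ha : AdmissibleSucc is js) {s : Vec m} {θ : Vec p}
    (hz : (s, θ) ∈ interior (modelDomain Θ μ)) (c : Vec m) (u : Vec p) :
    Continuous fun ψ => mgfDirDeriv μ c u is (s, ψ, θ) js := by
  simp only [AdmissibleSucc] at ha
  unfold mgfDirDeriv
  refine (continuous_finsetSum _ fun j _ => ?_).add (continuous_finsetSum _ fun i _ => ?_)
  · exact continuous_const.mul (h.continuous_mgfDeriv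
      (by simp only [Admissible, List.length_cons]; omega) hz)
  · exact continuous_const.mul (h.continuous_mgfDeriv
      (by simp only [Admissible, List.length_cons]; omega) hz)

theorem MgfSmooth.continuous_mgfDirDeriv₂ (h : MgfSmooth Θ μ) {s : Vec m} {θ : Vec p}
    (hz : (s, θ) ∈ interior (modelDomain Θ μ)) (c c' : Vec m) (u : Vec p) :
    Continuous fun ψ => mgfDirDeriv₂ μ c c' u (s, ψ, θ) [] := by
  unfold mgfDirDeriv₂
  refine (continuous_finsetSum _ fun j _ => ?_).add ((continuous_finsetSum _ fun j _ => ?_).add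
    (continuous_finsetSum _ fun i _ => ?_))
  · exact continuous_const.mul (h.continuous_mgfDeriv (by simp [Admissible]) hz)
  · exact continuous_const.mul (h.continuous_mgfDirDeriv (by simp [AdmissibleSucc]) hz c u)
  · exact continuous_const.mul (h.continuous_mgfDirDeriv (by simp [AdmissibleSucc]) hz c u)

variable {σ : Vec p × Vec m → Vec m} {z v : Vec p × Vec m}

theorem hasDerivAt_fderiv_line {E F : Type*} [NormedAddCommGroup E] [NormedSpace ℝ E]
    [NormedAddCommGroup F] [NormedSpace ℝ F] {f : E → F} {z v : E} (hf : ContDiffAt ℝ 2 f z) :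
    HasDerivAt (fun t : ℝ => fderiv ℝ f (z + t • v) v) (fderiv ℝ (fderiv ℝ f) z v v) 0 :=
  hf.hasLineDerivAt_fderiv v v

theorem MgfSmooth.hasDerivAt_mgfDeriv_line (h : MgfSmooth Θ μ) (hσ : ContDiffAt ℝ 2 σ z)
    (hz : (σ z, z.1) ∈ interior (modelDomain Θ μ)) {is : List (Fin p)} {js : List (Fin m)}
    (ha : AdmissibleSucc is js) (ψ : Vec m) :
    HasDerivAt (fun t : ℝ => mgfDeriv μ is js (σ (z + t • v), ψ, (z + t • v).1))
      (mgfDirDeriv μ (fderiv ℝ σ z v) v.1 is (σ z, ψ, z.1) js) 0 := by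
  obtain ⟨L, hL, hv⟩ := h.exists_hasFDerivAt ha (z := (σ z, ψ, z.1)) hz
  have h1 := (hσ.differentiableAt (by norm_num)).hasFDerivAt
  have h2 : HasFDerivAt (fun z => (σ z, ψ, z.1)) _ z :=
    h1.prodMk ((hasFDerivAt_const ψ z).prodMk hasFDerivAt_fst)
  have h3 := HasFDerivAt.hasLineDerivAt (HasFDerivAt.comp z hL h2) v
  refine HasDerivAt.congr_deriv h3 ?_
  simp only [ContinuousLinearMap.comp_apply, ContinuousLinearMap.prod_apply,
    ContinuousLinearMap.coe_fst', hv, _root_.zero_apply]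
  simp [mgfDirDeriv]

theorem hasDerivAt_coord_ofReal {d : ℕ} {f : ℝ → Vec d} {f' : Vec d} {t : ℝ}
    (hf : HasDerivAt f f' t) (j : Fin d) :
    HasDerivAt (fun t => ((f t j : ℝ) : ℂ)) (f' j : ℂ) t := by
  have h1 := (EuclideanSpace.proj (𝕜 := ℝ) j).hasFDerivAt.comp_hasDerivAt t hf
  exact (Complex.ofRealCLM.hasFDerivAt.comp_hasDerivAt t h1 :)

theorem MgfSmooth.hasDerivAt_mgfDirDeriv_line (h : MgfSmooth Θ μ) (hσ : ContDiffAt ℝ 2 σ z)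
    (hz : (σ z, z.1) ∈ interior (modelDomain Θ μ)) (ψ : Vec m) :
    HasDerivAt (fun t : ℝ => mgfDirDeriv μ (fderiv ℝ σ (z + t • v) v) v.1 []
        (σ (z + t • v), ψ, (z + t • v).1) [])
      (mgfDirDeriv₂ μ (fderiv ℝ σ z v) (fderiv ℝ (fderiv ℝ σ) z v v) v.1 (σ z, ψ, z.1) []) 0 := by
  have h1 := hasDerivAt_fderiv_line (v := v) hσ
  have h2 : ∀ j, HasDerivAt (fun t : ℝ => ((fderiv ℝ σ (z + t • v) v j : ℝ) : ℂ) *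
      mgfDeriv μ [] [j] (σ (z + t • v), ψ, (z + t • v).1)) _ 0 := fun j =>
    (hasDerivAt_coord_ofReal h1 j).mul (h.hasDerivAt_mgfDeriv_line (v := v) hσ hz (is := [])
      (js := [j]) (by simp [AdmissibleSucc]) ψ)
  have h3 : ∀ i, HasDerivAt (fun t : ℝ => (v.1 i : ℂ) *
      mgfDeriv μ [i] [] (σ (z + t • v), ψ, (z + t • v).1)) _ 0 := fun i =>
    (h.hasDerivAt_mgfDeriv_line (v := v) hσ hz (is := [i]) (js := []) (by simp [AdmissibleSucc])
      ψ).const_mul (v.1 i : ℂ)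
  refine ((HasDerivAt.fun_sum fun j _ => h2 j).add
    (HasDerivAt.fun_sum fun i _ => h3 i)).congr_deriv ?_
  simp only [zero_smul, add_zero, Finset.sum_add_distrib, mgfDirDeriv₂, add_assoc]

end ParameterDerivatives

end Saddlepoint

namespace Saddlepoint

/-! ### The laws tilted by the saddlepoint form a Laplace family -/

section Chart

variable {m p : ℕ} {Θ : Set (Vec p)} {μ : Vec p → Measure (Vec m)}
  {σ : Vec p × Vec m → Vec m} {W : Set (Vec p × Vec m)} {δ B : ℝ} {κ : ℕ} {z v : Vec p × Vec m}

/-- The reciprocal of the moment generating function at the saddlepoint. -/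
noncomputable def invMgf (μ : Vec p → Measure (Vec m)) (σ : Vec p × Vec m → Vec m)
    (z : Vec p × Vec m) : ℝ :=
  (mgfPartial μ [] [] (σ z, z.1))⁻¹

/-- `σ (θ, y)` is the saddlepoint for `(θ, y) ∈ W`, with uniform bounds. -/
structure IsSaddlepointChart (Θ : Set (Vec p)) (μ : Vec p → Measure (Vec m))
    (σ : Vec p × Vec m → Vec m) (W : Set (Vec p × Vec m)) (δ B : ℝ) (κ : ℕ) : Prop where
  isOpen : IsOpen W
  contDiffAt : ∀ z ∈ W, ContDiffAt ℝ 2 σ z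
  mem : ∀ z ∈ W, (σ z, z.1) ∈ interior (modelDomain Θ μ)
  mean_eq : ∀ z ∈ W, tiltedMean μ (σ z, z.1) = z.2
  bounds : ∀ z ∈ W, MgfBounds μ δ B κ (σ z, z.1)
  deriv_le : ∀ z ∈ W, ∀ v : Vec p × Vec m, ‖v.1‖ ≤ 1 → v.2 = 0 →
    ‖fderiv ℝ σ z v‖ ≤ B ∧ ‖fderiv ℝ (fderiv ℝ σ) z v v‖ ≤ B ∧
      |fderiv ℝ (invMgf μ σ) z v| ≤ B ∧ |fderiv ℝ (fderiv ℝ (invMgf μ σ)) z v v| ≤ B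

theorem MgfBounds.mono {z : Vec m × Vec p} {B' : ℝ} (h : MgfBounds μ δ B κ z) (hB : B ≤ B') :
    MgfBounds μ δ B' κ z where
  decay := h.decay
  growth is js ha φ := (h.growth is js ha φ).trans (by gcongr)
  inv_le := h.inv_le.trans hB
  mean_le := h.mean_le.trans hB

theorem contDiffAt_invMgf (h : MgfSmooth Θ μ) (hμ : ∀ θ ∈ Θ, IsProbabilityMeasure (μ θ))
    (hσ : ContDiffAt ℝ 2 σ z) (hz : (σ z, z.1) ∈ interior (modelDomain Θ μ)) :
    ContDiffAt ℝ 2 (invMgf μ σ) z := by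
  have h1 : ContDiffAt ℝ 2 (fun z : Vec p × Vec m => (σ z, z.1)) z := hσ.prodMk contDiffAt_fst
  have h2 : ContDiffAt ℝ 2 (fun z : Vec p × Vec m => mgfPartial μ [] [] (σ z, z.1)) z :=
    ContDiffAt.comp (f := fun z : Vec p × Vec m => (σ z, z.1)) z
      (h.contDiffAt_mgfPartial (js := []) (by simp) hz) h1
  exact h2.inv (mgfPartial_nil_pos hμ hz).ne'

theorem _root_.ContDiffAt.eventually_fderiv_le {E F : Type*} [NormedAddCommGroup E] [NormedSpace ℝ E]
    [NormedAddCommGroup F] [NormedSpace ℝ F] {f : E → F} {z₀ : E} (hf : ContDiffAt ℝ 2 f z₀) :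
    ∃ B, ∀ᶠ z in 𝓝 z₀, ∀ v, ‖v‖ ≤ 1 →
      ‖fderiv ℝ f z v‖ ≤ B ∧ ‖fderiv ℝ (fderiv ℝ f) z v v‖ ≤ B := by
  have h1 : ContDiffAt ℝ 1 (fderiv ℝ f) z₀ := hf.fderiv_right (by norm_num)
  have h2 : ContDiffAt ℝ 0 (fderiv ℝ (fderiv ℝ f)) z₀ := h1.fderiv_right (by norm_num)
  have h3 : ContinuousAt (fun z => ‖fderiv ℝ (fderiv ℝ f) z‖) z₀ :=
    (continuous_norm (E := E →L[ℝ] E →L[ℝ] F)).continuousAt.comp h2.continuousAt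
  refine ⟨max (‖fderiv ℝ f z₀‖ + 1) (‖fderiv ℝ (fderiv ℝ f) z₀‖ + 1), ?_⟩
  filter_upwards [h1.continuousAt.norm.eventually (gt_mem_nhds (lt_add_one _)),
    h3.eventually (gt_mem_nhds (lt_add_one _))] with z e1 e2 v hv
  constructor
  · exact ((fderiv ℝ f z).unit_le_opNorm v hv).trans (e1.le.trans (le_max_left _ _))
  · exact (((fderiv ℝ (fderiv ℝ f) z v).unit_le_opNorm v hv).trans
      ((fderiv ℝ (fderiv ℝ f) z).unit_le_opNorm v hv)).trans (e2.le.trans (le_max_right _ _))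

theorem exists_isSaddlepointChart (hμ : ∀ θ ∈ Θ, IsProbabilityMeasure (μ θ))
    (hdecay : DecayBound Θ μ) (hgrowth : GrowthBound Θ μ) {s₀ : Vec m} {θ₀ : Vec p}
    (hz₀ : (s₀, θ₀) ∈ interior (modelDomain Θ μ)) :
    ∃ (σ : Vec p × Vec m → Vec m) (W : Set (Vec p × Vec m)) (δ B : ℝ) (κ : ℕ),
      0 < δ ∧ 1 ≤ B ∧ σ (θ₀, tiltedMean μ (s₀, θ₀)) = s₀ ∧ (θ₀, tiltedMean μ (s₀, θ₀)) ∈ W ∧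
        IsSaddlepointChart Θ μ σ W δ B κ := by
  obtain ⟨σ, hσ₀, hσ⟩ := exists_saddlepoint_map hμ hdecay hgrowth hz₀
  obtain ⟨δ, B₀, κ, hδ, hB₀, hb⟩ := exists_eventually_mgfBounds hμ hdecay hgrowth hz₀
  obtain ⟨c0, m0, -⟩ := hσ.self_of_nhds
  obtain ⟨B₁, h1⟩ := c0.eventually_fderiv_le
  obtain ⟨B₂, h2⟩ := (contDiffAt_invMgf hgrowth.mgfSmooth hμ c0 m0).eventually_fderiv_le
  have hc : ContinuousAt (fun z : Vec p × Vec m => (σ z, z.1)) (θ₀, tiltedMean μ (s₀, θ₀)) :=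
    c0.continuousAt.prodMk continuousAt_fst
  have h3 : ∀ᶠ z in 𝓝 (θ₀, tiltedMean μ (s₀, θ₀)), MgfBounds μ δ B₀ κ (σ z, z.1) := by
    refine hc.eventually ?_
    simp only [hσ₀]
    exact hb
  obtain ⟨W, hW, hWo, hzW⟩ := eventually_nhds_iff.1 (hσ.and (h1.and (h2.and h3)))
  refine ⟨σ, W, δ, max B₀ (max B₁ B₂), κ, hδ, hB₀.trans (le_max_left _ _), hσ₀, hzW, hWo,
    fun z hz => (hW z hz).1.1, fun z hz => (hW z hz).1.2.1, fun z hz => (hW z hz).1.2.2,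
    fun z hz => (hW z hz).2.2.2.mono (le_max_left _ _), fun z hz v hv1 hv2 => ?_⟩
  have hv : ‖v‖ ≤ 1 := by
    rw [Prod.norm_def, hv2, norm_zero]
    exact max_le hv1 zero_le_one
  obtain ⟨e1, e2⟩ := (hW z hz).2.1 v hv
  obtain ⟨e3, e4⟩ := (hW z hz).2.2.1 v hv
  have l1 : B₁ ≤ max B₀ (max B₁ B₂) := (le_max_left _ _).trans (le_max_right _ _)
  have l2 : B₂ ≤ max B₀ (max B₁ B₂) := (le_max_right _ _).trans (le_max_right _ _)
  exact ⟨e1.trans l1, e2.trans l1, e3.trans l2, e4.trans l2⟩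

/-- The moments of the law tilted by the saddlepoint. -/
noncomputable def chartMoment (μ : Vec p → Measure (Vec m)) (σ : Vec p × Vec m → Vec m)
    (z : Vec p × Vec m) (ψ : Vec m) (js : List (Fin m)) : ℂ :=
  (invMgf μ σ z : ℂ) * mgfDeriv μ [] js (σ z, ψ, z.1)

/-- The derivative of `chartMoment` in the parameter. -/
noncomputable def chartMoment₁ (μ : Vec p → Measure (Vec m)) (σ : Vec p × Vec m → Vec m)
    (z v : Vec p × Vec m) (ψ : Vec m) (js : List (Fin m)) : ℂ :=
  (fderiv ℝ (invMgf μ σ) z v : ℂ) * mgfDeriv μ [] js (σ z, ψ, z.1) +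
    (invMgf μ σ z : ℂ) * mgfDirDeriv μ (fderiv ℝ σ z v) v.1 [] (σ z, ψ, z.1) js

/-- The second derivative of `chartMoment` in the parameter. -/
noncomputable def chartMoment₂ (μ : Vec p → Measure (Vec m)) (σ : Vec p × Vec m → Vec m)
    (z v : Vec p × Vec m) (ψ : Vec m) (js : List (Fin m)) : ℂ :=
  (fderiv ℝ (fderiv ℝ (invMgf μ σ)) z v v : ℂ) * mgfDeriv μ [] js (σ z, ψ, z.1) +
    (2 * (fderiv ℝ (invMgf μ σ) z v : ℂ) *
        mgfDirDeriv μ (fderiv ℝ σ z v) v.1 [] (σ z, ψ, z.1) js +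
      (invMgf μ σ z : ℂ) * mgfDirDeriv₂ μ (fderiv ℝ σ z v) (fderiv ℝ (fderiv ℝ σ) z v v) v.1
        (σ z, ψ, z.1) js)

namespace IsSaddlepointChart

theorem eventually_mem (hC : IsSaddlepointChart Θ μ σ W δ B κ) (hz : z ∈ W) (v : Vec p × Vec m) :
    ∀ᶠ t : ℝ in 𝓝 0, z + t • v ∈ W := by
  have hc : Continuous fun t : ℝ => z + t • v := by fun_prop
  exact (hc.tendsto' 0 z (by simp)).eventually (hC.isOpen.mem_nhds hz)

theorem hasDerivAt_chartMoment (hC : IsSaddlepointChart Θ μ σ W δ B κ) (h : MgfSmooth Θ μ)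
    (hμ : ∀ θ ∈ Θ, IsProbabilityMeasure (μ θ)) (hz : z ∈ W) (ψ : Vec m) {js : List (Fin m)}
    (hj : js.length ≤ 5) :
    HasDerivAt (fun t : ℝ => chartMoment μ σ (z + t • v) ψ js) (chartMoment₁ μ σ z v ψ js) 0 := by
  have h1 : HasDerivAt (fun t : ℝ => (invMgf μ σ (z + t • v) : ℂ)) (fderiv ℝ (invMgf μ σ) z v : ℂ)
      0 := by
    have := ((contDiffAt_invMgf h hμ (hC.contDiffAt z hz) (hC.mem z hz)).differentiableAt
      (by norm_num)).hasFDerivAt.hasLineDerivAt v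
    exact (Complex.ofRealCLM.hasFDerivAt.comp_hasDerivAt (0 : ℝ) this :)
  refine (h1.mul (h.hasDerivAt_mgfDeriv_line (hC.contDiffAt z hz) (hC.mem z hz) (is := [])
    (js := js) (Or.inl ⟨rfl, hj⟩) ψ)).congr_deriv ?_
  simp only [zero_smul, add_zero, chartMoment₁]

theorem hasDerivAt_chartMoment₁ (hC : IsSaddlepointChart Θ μ σ W δ B κ) (h : MgfSmooth Θ μ)
    (hμ : ∀ θ ∈ Θ, IsProbabilityMeasure (μ θ)) (hz : z ∈ W) (ψ : Vec m) :
    HasDerivAt (fun t : ℝ => chartMoment₁ μ σ (z + t • v) v ψ []) (chartMoment₂ μ σ z v ψ []) 0 := by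
  have hq := contDiffAt_invMgf h hμ (hC.contDiffAt z hz) (hC.mem z hz)
  have h1 : HasDerivAt (fun t : ℝ => (invMgf μ σ (z + t • v) : ℂ)) (fderiv ℝ (invMgf μ σ) z v : ℂ)
      0 := by
    have := (hq.differentiableAt (by norm_num)).hasFDerivAt.hasLineDerivAt v
    exact (Complex.ofRealCLM.hasFDerivAt.comp_hasDerivAt (0 : ℝ) this :)
  have h2 : HasDerivAt (fun t : ℝ => (fderiv ℝ (invMgf μ σ) (z + t • v) v : ℂ))
      (fderiv ℝ (fderiv ℝ (invMgf μ σ)) z v v : ℂ) 0 :=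
    (Complex.ofRealCLM.hasFDerivAt.comp_hasDerivAt (0 : ℝ) (hasDerivAt_fderiv_line (v := v) hq) :)
  have h3 := h.hasDerivAt_mgfDeriv_line (v := v) (hC.contDiffAt z hz) (hC.mem z hz) (is := [])
    (js := []) (by simp [AdmissibleSucc]) ψ
  have h4 := h.hasDerivAt_mgfDirDeriv_line (v := v) (hC.contDiffAt z hz) (hC.mem z hz) ψ
  refine ((h2.mul h3).add (h1.mul h4)).congr_deriv ?_
  simp only [zero_smul, add_zero, chartMoment₂]
  ring

theorem invMgf_pos (hC : IsSaddlepointChart Θ μ σ W δ B κ)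
    (hμ : ∀ θ ∈ Θ, IsProbabilityMeasure (μ θ)) (hz : z ∈ W) : 0 < invMgf μ σ z :=
  inv_pos.2 (mgfPartial_nil_pos hμ (hC.mem z hz))

theorem norm_chartMoment₁_le (hC : IsSaddlepointChart Θ μ σ W δ B κ) (hB : 1 ≤ B)
    (hμ : ∀ θ ∈ Θ, IsProbabilityMeasure (μ θ)) (hz : z ∈ W) (hv : ‖v.1‖ ≤ 1) (hv' : v.2 = 0)
    {js : List (Fin m)} (hj : js.length ≤ 4) (ψ : Vec m) :
    ‖chartMoment₁ μ σ z v ψ js‖ ≤ 5 * (m * B + p + 1) ^ 2 * B ^ 2 * (1 + ‖ψ‖) ^ κ := by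
  obtain ⟨d1, -, d3, -⟩ := hC.deriv_le z hz v hv hv'
  have hb := hC.bounds z hz
  have e1 := hb.growth [] js (by simp only [Admissible, List.length_nil]; omega) ψ
  have e2 := hb.norm_mgfDirDeriv_le hB d1 hv (is := []) (js := js)
    (Or.inl ⟨rfl, by omega⟩) ψ
  have hq := (hC.invMgf_pos hμ hz).le
  have hE : 1 ≤ (m : ℝ) * B + p + 1 := by
    have : 0 ≤ (m : ℝ) * B + p := by positivity
    linarith
  set E : ℝ := m * B + p + 1
  set P : ℝ := (1 + ‖ψ‖) ^ κ
  have hP : 0 ≤ P := by positivity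
  calc ‖chartMoment₁ μ σ z v ψ js‖ ≤ B * (B * P) + B * (E * (B * P)) := by
        refine (norm_add_le _ _).trans (add_le_add ?_ ?_)
        · rw [norm_mul, Complex.norm_real, Real.norm_eq_abs]
          gcongr
        · rw [norm_mul, Complex.norm_real, Real.norm_of_nonneg hq]
          gcongr
          exact hb.inv_le
    _ = (1 + E) * (B ^ 2 * P) := by ring
    _ ≤ (5 * E ^ 2) * (B ^ 2 * P) := by
        gcongr
        nlinarith
    _ = _ := by ring

theorem norm_chartMoment₂_le (hC : IsSaddlepointChart Θ μ σ W δ B κ) (hB : 1 ≤ B)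
    (hμ : ∀ θ ∈ Θ, IsProbabilityMeasure (μ θ)) (hz : z ∈ W) (hv : ‖v.1‖ ≤ 1) (hv' : v.2 = 0)
    {js : List (Fin m)} (hj : js.length ≤ 1) (ψ : Vec m) :
    ‖chartMoment₂ μ σ z v ψ js‖ ≤ 5 * (m * B + p + 1) ^ 2 * B ^ 2 * (1 + ‖ψ‖) ^ κ := by
  obtain ⟨d1, d2, d3, d4⟩ := hC.deriv_le z hz v hv hv'
  have hb := hC.bounds z hz
  have e1 := hb.growth [] js (by simp only [Admissible, List.length_nil]; omega) ψ
  have e2 := hb.norm_mgfDirDeriv_le hB d1 hv (is := []) (js := js)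
    (Or.inl ⟨rfl, by omega⟩) ψ
  have e3 := hb.norm_mgfDirDeriv₂_le hB d1 d2 hv hj ψ
  have hq := (hC.invMgf_pos hμ hz).le
  have hE : 1 ≤ (m : ℝ) * B + p + 1 := by
    have : 0 ≤ (m : ℝ) * B + p := by positivity
    linarith
  set E : ℝ := m * B + p + 1
  set P : ℝ := (1 + ‖ψ‖) ^ κ
  have hP : 0 ≤ P := by positivity
  calc ‖chartMoment₂ μ σ z v ψ js‖ ≤ B * (B * P) + (2 * B * (E * (B * P)) +
        B * (2 * E ^ 2 * (B * P))) := by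
        refine (norm_add_le _ _).trans (add_le_add ?_ ((norm_add_le _ _).trans (add_le_add ?_ ?_)))
        · rw [norm_mul, Complex.norm_real, Real.norm_eq_abs]
          gcongr
        · rw [norm_mul, norm_mul, Complex.norm_two, Complex.norm_real, Real.norm_eq_abs]
          gcongr
        · rw [norm_mul, Complex.norm_real, Real.norm_of_nonneg hq]
          gcongr
          exact hb.inv_le
    _ = (1 + 2 * E + 2 * E ^ 2) * (B ^ 2 * P) := by ring
    _ ≤ (5 * E ^ 2) * (B ^ 2 * P) := by
        gcongr
        nlinarith
    _ = _ := by ring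

theorem hasImagDerivAt_chartMoment₁ (hC : IsSaddlepointChart Θ μ σ W δ B κ) (h : MgfSmooth Θ μ)
    (hz : z ∈ W) (v : Vec p × Vec m) (φ : Vec m) (t : ℝ) {js : List (Fin m)} (hj : js.length ≤ 4) :
    HasImagDerivAt φ (fun t js => chartMoment₁ μ σ z v (t • φ) js) js t :=
  ((h.hasImagDerivAt (is := []) (js := js) (fun a => by
    simp only [Admissible, List.length_append, List.length_cons, List.length_nil]; omega)
    (hC.mem z hz) φ t).const_mul _).add
    ((h.hasImagDerivAt_mgfDirDeriv (Or.inl ⟨rfl, hj⟩) (hC.mem z hz) _ _ φ t).const_mul _)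

theorem hasImagDerivAt_chartMoment₂ (hC : IsSaddlepointChart Θ μ σ W δ B κ) (h : MgfSmooth Θ μ)
    (hz : z ∈ W) (v : Vec p × Vec m) (φ : Vec m) (t : ℝ) :
    HasImagDerivAt φ (fun t js => chartMoment₂ μ σ z v (t • φ) js) [] t :=
  ((h.hasImagDerivAt (is := []) (js := []) (fun a => by simp [Admissible])
    (hC.mem z hz) φ t).const_mul _).add
    (((h.hasImagDerivAt_mgfDirDeriv (Or.inl ⟨rfl, by simp⟩) (hC.mem z hz) _ _ φ t).const_mul
      _).add ((h.hasImagDerivAt_mgfDirDeriv₂ (hC.mem z hz) _ _ _ φ t).const_mul _))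

theorem chartMoment_zero_nil (hC : IsSaddlepointChart Θ μ σ W δ B κ) (h : MgfSmooth Θ μ)
    (hμ : ∀ θ ∈ Θ, IsProbabilityMeasure (μ θ)) (hz : z ∈ W) : chartMoment μ σ z 0 [] = 1 := by
  rw [chartMoment, h.mgfDeriv_zero (by simp [Admissible]) (hC.mem z hz), ← Complex.ofReal_mul,
    invMgf, inv_mul_cancel₀ (mgfPartial_nil_pos hμ (hC.mem z hz)).ne', Complex.ofReal_one]

theorem momentShift_chartMoment (hC : IsSaddlepointChart Θ μ σ W δ B κ) (h : MgfSmooth Θ μ)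
    (hμ : ∀ θ ∈ Θ, IsProbabilityMeasure (μ θ)) (hz : z ∈ W) (φ : Vec m) :
    momentShift φ (inner ℝ φ z.2) (chartMoment μ σ z 0) [] = 0 := by
  have := h.momentShift_one (hC.mem z hz) (mgfPartial_nil_pos hμ (hC.mem z hz)) φ
  rw [hC.mean_eq z hz] at this
  exact this

theorem momentShift_two_chartMoment (hC : IsSaddlepointChart Θ μ σ W δ B κ) (h : MgfSmooth Θ μ)
    (hμ : ∀ θ ∈ Θ, IsProbabilityMeasure (μ θ)) (hz : z ∈ W) (φ : Vec m) :
    (momentShift φ (inner ℝ φ z.2))^[2] (chartMoment μ σ z 0) [] =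
      (tiltedCovForm μ (σ z, z.1) φ : ℂ) := by
  have := h.momentShift_two (hC.mem z hz) (mgfPartial_nil_pos hμ (hC.mem z hz)) φ
  rw [hC.mean_eq z hz] at this
  exact this

/-- The tilted laws have total mass one throughout `W`, so the derivative of the mass vanishes. -/
theorem chartMoment₁_zero_nil (hC : IsSaddlepointChart Θ μ σ W δ B κ) (h : MgfSmooth Θ μ)
    (hμ : ∀ θ ∈ Θ, IsProbabilityMeasure (μ θ)) (hz : z ∈ W) (v : Vec p × Vec m) :
    chartMoment₁ μ σ z v 0 [] = 0 := by
  refine (hC.hasDerivAt_chartMoment h hμ hz (v := v) 0 (js := []) (by simp)).unique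
    ((hasDerivAt_const (0 : ℝ) (1 : ℂ)).congr_of_eventuallyEq ?_)
  filter_upwards [hC.eventually_mem hz v] with t ht
  exact hC.chartMoment_zero_nil h hμ ht

theorem chartMoment₂_zero_nil (hC : IsSaddlepointChart Θ μ σ W δ B κ) (h : MgfSmooth Θ μ)
    (hμ : ∀ θ ∈ Θ, IsProbabilityMeasure (μ θ)) (hz : z ∈ W) (v : Vec p × Vec m) :
    chartMoment₂ μ σ z v 0 [] = 0 := by
  refine (hC.hasDerivAt_chartMoment₁ h hμ hz (v := v) 0).unique
    ((hasDerivAt_const (0 : ℝ) (0 : ℂ)).congr_of_eventuallyEq ?_)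
  filter_upwards [hC.eventually_mem hz v] with t ht
  exact hC.chartMoment₁_zero_nil h hμ ht v

theorem hasDerivAt_momentShift_chartMoment (hC : IsSaddlepointChart Θ μ σ W δ B κ)
    (h : MgfSmooth Θ μ) (hμ : ∀ θ ∈ Θ, IsProbabilityMeasure (μ θ)) (hz : z ∈ W) (φ : Vec m) (b : ℝ)
    {k : ℕ} (hk : k ≤ 5) :
    HasDerivAt (fun t : ℝ => (momentShift φ b)^[k] (chartMoment μ σ (z + t • v) 0) [])
      ((momentShift φ b)^[k] (chartMoment₁ μ σ z v 0) []) 0 :=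
  hasDerivAt_momentShift_iterate (N := 5)
    (fun _ hj => hC.hasDerivAt_chartMoment h hμ hz 0 hj) k [] (by simpa using hk)

/-- A direction with `v.2 = 0` keeps `y` fixed, and `y` is the mean of every tilted law on the line.
The vanishing first centred moment can thus be differentiated with constant centring, and `ρ₁` has
no linear term. -/
theorem momentShift_chartMoment₁ (hC : IsSaddlepointChart Θ μ σ W δ B κ) (h : MgfSmooth Θ μ)
    (hμ : ∀ θ ∈ Θ, IsProbabilityMeasure (μ θ)) (hz : z ∈ W) (hv : v.2 = 0) (φ : Vec m) :
    momentShift φ (inner ℝ φ z.2) (chartMoment₁ μ σ z v 0) [] = 0 := by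
  refine (hC.hasDerivAt_momentShift_chartMoment h hμ hz (v := v) φ (inner ℝ φ z.2) (k := 1)
    (by norm_num)).unique ((hasDerivAt_const (0 : ℝ) (0 : ℂ)).congr_of_eventuallyEq ?_)
  filter_upwards [hC.eventually_mem hz v] with t ht
  have := hC.momentShift_chartMoment h hμ ht φ
  simpa [hv] using this

/-- The derivative of `tiltedCovForm` in the parameter. -/
noncomputable def _root_.Saddlepoint.chartForm₁ (μ : Vec p → Measure (Vec m))
    (σ : Vec p × Vec m → Vec m) (z v : Vec p × Vec m) (φ : Vec m) : ℝ :=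
  ((momentShift φ (inner ℝ φ z.2))^[2] (chartMoment₁ μ σ z v 0) []).re

/-- The centring in `chartForm₁` is frozen at `y`, which is legitimate because `y` is constant along
the direction `v`. -/
theorem hasLineDerivAt_form (hC : IsSaddlepointChart Θ μ σ W δ B κ) (h : MgfSmooth Θ μ)
    (hμ : ∀ θ ∈ Θ, IsProbabilityMeasure (μ θ)) (hz : z ∈ W) (hv : v.2 = 0) (φ : Vec m) :
    HasLineDerivAt ℝ (fun z => tiltedCovForm μ (σ z, z.1) φ) (chartForm₁ μ σ z v φ) z v := by
  have h1 := hC.hasDerivAt_momentShift_chartMoment h hμ hz (v := v) φ (inner ℝ φ z.2) (k := 2)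
    (by norm_num)
  have h2 : HasDerivAt (fun t : ℝ => ((momentShift φ (inner ℝ φ z.2))^[2]
      (chartMoment μ σ (z + t • v) 0) []).re) (chartForm₁ μ σ z v φ) 0 :=
    (Complex.reCLM.hasFDerivAt.comp_hasDerivAt (0 : ℝ) h1 :)
  refine HasDerivAt.congr_of_eventuallyEq h2 ?_
  filter_upwards [hC.eventually_mem hz v] with t ht
  have := hC.momentShift_two_chartMoment h hμ ht φ
  have e : (z + t • v).2 = z.2 := by simp [hv]
  rw [e] at this
  rw [this, Complex.ofReal_re]

/-- The same Taylor expansion as for `ρ`, applied to the differentiated moments: their mass and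
first centred moment vanish, so the expansion starts with the quadratic form `chartForm₁`. -/
theorem laplaceDeriv (hC : IsSaddlepointChart Θ μ σ W δ B κ) (hB : 1 ≤ B) (h : MgfSmooth Θ μ)
    (hμ : ∀ θ ∈ Θ, IsProbabilityMeasure (μ θ)) (hz : z ∈ W) (hv : ‖v.1‖ ≤ 1) (hv' : v.2 = 0) :
    LaplaceDeriv ((m + B + 1) ^ 4 * (5 * (m * B + p + 1) ^ 2 * B ^ 2)) (κ + 1)
      (fun φ => Complex.exp (-(inner ℝ φ z.2 : ℝ) * Complex.I) * chartMoment₁ μ σ z v φ [])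
      (chartForm₁ μ σ z v) := by
  set A : ℝ := 5 * (m * B + p + 1) ^ 2 * B ^ 2 with hA
  have hA0 : 0 ≤ A := by positivity
  have hy : ‖z.2‖ ≤ B := by
    rw [← hC.mean_eq z hz]
    exact (hC.bounds z hz).mean_le
  have hT := fun φ : Vec m => abs_twist_sub_taylor_le (φ := φ) (b := inner ℝ φ z.2)
    (X := fun t js => chartMoment₁ μ σ z v (t • φ) js) (B := A * (1 + ‖φ‖) ^ κ)
    (fun t js hj => hC.hasImagDerivAt_chartMoment₁ h hz v φ t (hj.trans (by norm_num)))
    (fun js hj => by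
      have e1 := h.mgfDirDeriv_im (hC.mem z hz) (fderiv ℝ σ z v) v.1 hj
      have e2 := h.mgfDeriv_im [] js (by simp only [Admissible, List.length_nil]; omega) _ _
        (hC.mem z hz)
      simp [chartMoment₁, e1, e2])
    (fun t ht js hj => (hC.norm_chartMoment₁_le hB hμ hz hv hv' hj (t • φ)).trans (by
      rw [norm_smul, Real.norm_of_nonneg ht.1]
      gcongr
      · have := mul_nonneg ht.1 (norm_nonneg φ)
        linarith
      · exact mul_le_of_le_one_left (norm_nonneg _) ht.2))
  have hone : ∀ φ : Vec m, 1 ≤ 1 + ‖φ‖ := fun φ => by linarith [norm_nonneg φ]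
  have hD : 1 ≤ (m : ℝ) + B + 1 := by
    have : (0 : ℝ) ≤ m := by positivity
    linarith
  have hl : ∀ φ : Vec m, ∑ j, |φ j| + |inner ℝ φ z.2| ≤ (m + B + 1) * ‖φ‖ := fun φ =>
    (sum_abs_add_abs_inner_le φ z.2 hy).trans
      (mul_le_mul_of_nonneg_right (by linarith) (norm_nonneg φ))
  have hl0 : ∀ φ : Vec m, 0 ≤ ∑ j, |φ j| + |inner ℝ φ z.2| := fun φ => by positivity
  refine ⟨?_, ?_, fun φ => ?_, fun φ => ?_, fun φ => ?_, fun t φ => ?_⟩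
  · have c1 := h.continuous_mgfDeriv (is := []) (js := []) (by simp [Admissible]) (hC.mem z hz)
    have c2 := h.continuous_mgfDirDeriv (is := []) (js := []) (by simp [AdmissibleSucc])
      (hC.mem z hz) (fderiv ℝ σ z v) v.1
    unfold chartMoment₁
    fun_prop
  · unfold chartForm₁
    simp only [Function.iterate_succ, Function.iterate_zero, Function.comp_apply, id_eq,
      momentShift]
    fun_prop
  · have h1 := (hT φ).1
    simp only [zero_smul, one_smul, hC.chartMoment₁_zero_nil h hμ hz, Complex.zero_re] at h1
    have e : ∀ x y : ℝ, x - (0 - y / 2) = x + y / 2 := fun x y => by ring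
    rw [e] at h1
    refine h1.trans ?_
    calc (∑ j, |φ j| + |inner ℝ φ z.2|) ^ 4 * (A * (1 + ‖φ‖) ^ κ)
        ≤ ((m + B + 1) * ‖φ‖) ^ 4 * (A * (1 + ‖φ‖) ^ (κ + 1)) := by
          have := hl0 φ
          have := hone φ
          gcongr
          · exact hl φ
          · omega
      _ = _ := by ring
  · have h1 := (hT φ).2
    simp only [zero_smul, one_smul, hC.momentShift_chartMoment₁ h hμ hz hv', Complex.zero_re,
      sub_zero] at h1
    refine h1.trans ?_
    have e2 : 1 + (∑ j, |φ j| + |inner ℝ φ z.2|) ≤ (m + B + 1) * (1 + ‖φ‖) := by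
      linarith [hl φ]
    calc (∑ j, |φ j| + |inner ℝ φ z.2|) ^ 3 * (1 + (∑ j, |φ j| + |inner ℝ φ z.2|)) *
          (A * (1 + ‖φ‖) ^ κ)
        ≤ ((m + B + 1) * ‖φ‖) ^ 3 * ((m + B + 1) * (1 + ‖φ‖)) * (A * (1 + ‖φ‖) ^ κ) := by
          have := hl0 φ
          gcongr
          exact hl φ
      _ = _ := by ring
  · have h3 := norm_momentShift_iterate_le (φ := φ) (b := inner ℝ φ z.2) (N := 4)
      (X := chartMoment₁ μ σ z v 0) (B := A)
      (fun js hj => by simpa using hC.norm_chartMoment₁_le hB hμ hz hv hv' hj 0) 2 [] (by simp)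
    refine ((Complex.abs_re_le_norm _).trans h3).trans ?_
    calc (∑ j, |φ j| + |inner ℝ φ z.2|) ^ 2 * A ≤ ((m + B + 1) * ‖φ‖) ^ 2 * A := by
          have := hl0 φ
          gcongr
          exact hl φ
      _ = (m + B + 1) ^ 2 * A * ‖φ‖ ^ 2 := by ring
      _ ≤ _ := by
        gcongr
        norm_num
  · simp only [chartForm₁, Function.iterate_succ, Function.iterate_zero, Function.comp_apply, id_eq,
      real_inner_smul_left, momentShift_smul, momentShift_const_mul]
    rw [← mul_assoc, ← Complex.ofReal_mul, Complex.re_ofReal_mul, pow_two]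

/-- The second derivative vanishes at `φ = 0`, again by normalisation, and one derivative along `t
φ` gives the factor `‖φ‖`. This first order is all that the `O(√n)` bound requires. -/
theorem norm_second_le (hC : IsSaddlepointChart Θ μ σ W δ B κ) (hB : 1 ≤ B) (h : MgfSmooth Θ μ)
    (hμ : ∀ θ ∈ Θ, IsProbabilityMeasure (μ θ)) (hz : z ∈ W) (hv : ‖v.1‖ ≤ 1) (hv' : v.2 = 0)
    (φ : Vec m) :
    ‖Complex.exp (-(inner ℝ φ z.2 : ℝ) * Complex.I) * chartMoment₂ μ σ z v φ []‖ ≤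
      (m + B + 1) * (5 * (m * B + p + 1) ^ 2 * B ^ 2) * ‖φ‖ * (1 + ‖φ‖) ^ κ := by
  set A : ℝ := 5 * (m * B + p + 1) ^ 2 * B ^ 2 with hA
  have hA0 : 0 ≤ A := by positivity
  have hy : ‖z.2‖ ≤ B := by
    rw [← hC.mean_eq z hz]
    exact (hC.bounds z hz).mean_le
  have hl : ∑ j, |φ j| + |inner ℝ φ z.2| ≤ (m + B + 1) * ‖φ‖ :=
    (sum_abs_add_abs_inner_le φ z.2 hy).trans
      (mul_le_mul_of_nonneg_right (by linarith) (norm_nonneg φ))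
  have hd : ∀ t, HasDerivAt (fun t : ℝ => Complex.exp (-(t * inner ℝ φ z.2 : ℝ) * Complex.I) *
      chartMoment₂ μ σ z v (t • φ) []) (Complex.I * (Complex.exp
        (-(t * inner ℝ φ z.2 : ℝ) * Complex.I) *
        momentShift φ (inner ℝ φ z.2) (chartMoment₂ μ σ z v (t • φ)) [])) t := fun t =>
    hasDerivAt_twist_momentShift (φ := φ) (b := inner ℝ φ z.2) (N := 0)
      (X := fun t => chartMoment₂ μ σ z v (t • φ)) (t := t) (fun js hj => by
        rw [Nat.le_zero, List.length_eq_zero_iff] at hj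
        subst hj
        exact hC.hasImagDerivAt_chartMoment₂ h hz v φ t) 0 [] (by simp)
  have hle : ∀ t ∈ Set.Icc (0 : ℝ) 1, ‖Complex.I * (Complex.exp
        (-(t * inner ℝ φ z.2 : ℝ) * Complex.I) *
        momentShift φ (inner ℝ φ z.2) (chartMoment₂ μ σ z v (t • φ)) [])‖ ≤
      (m + B + 1) * A * ‖φ‖ * (1 + ‖φ‖) ^ κ := by
    intro t ht
    rw [norm_mul, norm_mul, Complex.norm_I, one_mul, ← Complex.ofReal_neg,
      Complex.norm_exp_ofReal_mul_I, one_mul]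
    have h3 := norm_momentShift_iterate_le (φ := φ) (b := inner ℝ φ z.2) (N := 1)
      (X := chartMoment₂ μ σ z v (t • φ)) (B := A * (1 + ‖φ‖) ^ κ)
      (fun js hj => (hC.norm_chartMoment₂_le hB hμ hz hv hv' hj (t • φ)).trans (by
        rw [norm_smul, Real.norm_of_nonneg ht.1]
        gcongr
        · have := mul_nonneg ht.1 (norm_nonneg φ)
          linarith
        · exact mul_le_of_le_one_left (norm_nonneg _) ht.2)) 1 [] (by simp)
    rw [pow_one] at h3
    refine h3.trans ?_
    calc (∑ j, |φ j| + |inner ℝ φ z.2|) * (A * (1 + ‖φ‖) ^ κ)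
        ≤ ((m + B + 1) * ‖φ‖) * (A * (1 + ‖φ‖) ^ κ) := by gcongr
      _ = _ := by ring
  have := (convex_Icc (0 : ℝ) 1).norm_image_sub_le_of_norm_hasDerivWithin_le
    (fun x _ => (hd x).hasDerivWithinAt) hle (Set.left_mem_Icc.2 zero_le_one)
    (Set.right_mem_Icc.2 zero_le_one)
  simpa [hC.chartMoment₂_zero_nil h hμ hz] using this

theorem hasLineDerivAt_twist {X : Vec p × Vec m → ℂ} {X' : ℂ} (φ : Vec m)
    (hX : HasDerivAt (fun t : ℝ => X (z + t • v)) X' 0) (hv : v.2 = 0) :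
    HasLineDerivAt ℝ (fun z => Complex.exp (-(inner ℝ φ z.2 : ℝ) * Complex.I) * X z)
      (Complex.exp (-(inner ℝ φ z.2 : ℝ) * Complex.I) * X') z v := by
  refine (hX.const_mul (Complex.exp (-(inner ℝ φ z.2 : ℝ) * Complex.I))).congr_of_eventuallyEq
    (Eventually.of_forall fun t => ?_)
  simp [hv]

theorem laplaceFamily (hC : IsSaddlepointChart Θ μ σ W δ B κ) (hB : 1 ≤ B) (hδ : 0 < δ)
    (h : MgfSmooth Θ μ) (hμ : ∀ θ ∈ Θ, IsProbabilityMeasure (μ θ)) :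
    LaplaceFamily W {v | ‖v.1‖ ≤ 1 ∧ v.2 = 0} δ
      ((m + B + 1) ^ 4 * (5 * (m * B + p + 1) ^ 2 * B ^ 2)) (κ + 1)
      (fun z => tiltedChar μ (σ z, z.1))
      (fun z v φ => Complex.exp (-(inner ℝ φ z.2 : ℝ) * Complex.I) * chartMoment₁ μ σ z v φ [])
      (fun z v φ => Complex.exp (-(inner ℝ φ z.2 : ℝ) * Complex.I) * chartMoment₂ μ σ z v φ [])
      (fun z => tiltedCovForm μ (σ z, z.1)) (chartForm₁ μ σ) where
  pair z hz := by
    have hE : 1 ≤ (m : ℝ) * B + p + 1 := by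
      have : 0 ≤ (m : ℝ) * B + p := by positivity
      linarith
    refine (h.laplacePair (hC.mem z hz) (mgfPartial_nil_pos hμ (hC.mem z hz))
      (zero_le_one.trans hB) hδ (hC.bounds z hz)).mono ?_
    gcongr
    refine le_mul_of_one_le_left (by positivity) ?_
    nlinarith
  deriv z hz v hv := hC.laplaceDeriv hB h hμ hz hv.1 hv.2
  cont_second z hz v hv := by
    have c1 := h.continuous_mgfDeriv (is := []) (js := []) (by simp [Admissible]) (hC.mem z hz)
    have c2 := h.continuous_mgfDirDeriv (is := []) (js := []) (by simp [AdmissibleSucc])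
      (hC.mem z hz) (fderiv ℝ σ z v) v.1
    have c3 := h.continuous_mgfDirDeriv₂ (hC.mem z hz) (fderiv ℝ σ z v)
      (fderiv ℝ (fderiv ℝ σ) z v v) v.1
    unfold chartMoment₂
    fun_prop
  second_le z hz v hv φ := by
    refine (hC.norm_second_le hB h hμ hz hv.1 hv.2 φ).trans ?_
    have hD : 1 ≤ (m : ℝ) + B + 1 := by
      have : (0 : ℝ) ≤ m := by positivity
      linarith
    have hone : 1 ≤ 1 + ‖φ‖ := by linarith [norm_nonneg φ]
    gcongr
    · exact le_self_pow₀ hD (by norm_num)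
    · omega
  contAt z hz φ := by
    have hc : ContinuousAt (fun z : Vec p × Vec m => (σ z, z.1)) z :=
      (hC.contDiffAt z hz).continuousAt.prodMk continuousAt_fst
    have c1 : ContinuousAt (fun z : Vec p × Vec m => mgfDeriv μ [] [] (σ z, φ, z.1)) z := by
      have h1 := (h.continuousOn (is := []) (js := []) (by simp [Admissible])).continuousAt
        (isOpen_tubeDomain.mem_nhds (show (σ z, φ, z.1) ∈ tubeDomain Θ μ from hC.mem z hz))
      exact ContinuousAt.comp (f := fun z : Vec p × Vec m => (σ z, φ, z.1)) h1
        ((hC.contDiffAt z hz).continuousAt.prodMk (continuousAt_const.prodMk continuousAt_fst))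
    have c2 : ContinuousAt (fun z : Vec p × Vec m => tiltedMean μ (σ z, z.1)) z :=
      ContinuousAt.comp (f := fun z : Vec p × Vec m => (σ z, z.1))
        (h.contDiffAt_tiltedMean hμ (hC.mem z hz)).continuousAt hc
    have c3 : ContinuousAt (fun z : Vec p × Vec m => (mgfPartial μ [] [] (σ z, z.1))⁻¹) z :=
      (contDiffAt_invMgf h hμ (hC.contDiffAt z hz) (hC.mem z hz)).continuousAt
    unfold tiltedChar
    fun_prop
  line z hz v hv φ := by
    refine HasDerivAt.congr_of_eventuallyEq (hasLineDerivAt_twist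
      (X := fun z => chartMoment μ σ z φ []) φ
      (hC.hasDerivAt_chartMoment h hμ hz (v := v) φ (js := []) (by simp)) hv.2) ?_
    filter_upwards [hC.eventually_mem hz v] with t ht
    rw [tiltedChar, hC.mean_eq _ ht]
    rfl
  line_deriv z hz v hv φ :=
    hasLineDerivAt_twist (X := fun z => chartMoment₁ μ σ z v φ []) φ
      (hC.hasDerivAt_chartMoment₁ h hμ hz (v := v) φ) hv.2
  line_form z hz v hv φ := hC.hasLineDerivAt_form h hμ hz hv.2 φ

end IsSaddlepointChart

end Chart

end Saddlepoint

namespace Saddlepoint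

/-! ### Sums of independent copies -/

section SumLaw

variable {m : ℕ} {ν : Measure (Vec m)} [IsProbabilityMeasure ν] {n : ℕ}

theorem measurable_vec_sum : Measurable fun w : Fin n → Vec m => ∑ i, w i := by
  fun_prop

instance isProbabilityMeasure_sumLaw : IsProbabilityMeasure (sumLaw ν n) :=
  Measure.isProbabilityMeasure_map measurable_vec_sum.aemeasurable

theorem complexMgf_sumLaw (s φ : Vec m) :
    complexMgf (sumLaw ν n) s φ = complexMgf ν s φ ^ n := by
  have h := integral_fintype_prod_eq_pow (ι := Fin n) (μ := ν) (fun x : Vec m => Complex.exp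
    ((inner ℝ s x : ℝ) + (inner ℝ φ x : ℝ) * Complex.I))
  rw [Fintype.card_fin] at h
  rw [complexMgf, sumLaw, integral_map measurable_vec_sum.aemeasurable
    (Continuous.aestronglyMeasurable (by fun_prop)), complexMgf, ← h]
  refine integral_congr_ae (Eventually.of_forall fun w => ?_)
  simp only [← Complex.exp_sum, inner_sum, Complex.ofReal_sum, Finset.sum_mul,
    Finset.sum_add_distrib]

theorem mgf_sumLaw (s : Vec m) : mgf (sumLaw ν n) s = mgf ν s ^ n := by
  have h := integral_fintype_prod_eq_pow (ι := Fin n) (μ := ν)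
    (fun x : Vec m => Real.exp (inner ℝ s x))
  rw [Fintype.card_fin] at h
  rw [mgf, sumLaw, integral_map measurable_vec_sum.aemeasurable
    (Continuous.aestronglyMeasurable (by fun_prop)), mgf, ← h]
  refine integral_congr_ae (Eventually.of_forall fun w => ?_)
  simp only [← Real.exp_sum, inner_sum]

theorem mgfDomain_subset_sumLaw : mgfDomain ν ⊆ mgfDomain (sumLaw ν n) := by
  intro s hs
  have h := Integrable.fintype_prod (ι := Fin n) (μ := fun _ => ν)
    (f := fun _ (x : Vec m) => Real.exp (inner ℝ s x)) (fun _ => hs)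
  rw [mgfDomain, Set.mem_ofPred_eq, sumLaw,
    integrable_map_measure (Continuous.aestronglyMeasurable (by fun_prop))
      measurable_vec_sum.aemeasurable]
  refine h.congr (Eventually.of_forall fun w => ?_)
  simp only [Function.comp, ← Real.exp_sum, inner_sum]

theorem cgf_sumLaw : cgf (sumLaw ν n) = fun s => (n : ℝ) * cgf ν s := by
  funext s
  rw [cgf, mgf_sumLaw, Real.log_pow, cgf]

theorem partialDeriv_const_mul {d : ℕ} (i : Fin d) (c : ℝ) (f : Vec d → ℝ) :
    partialDeriv i (fun x => c * f x) = fun x => c * partialDeriv i f x := by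
  funext x
  simp only [partialDeriv, lineDeriv]
  exact deriv_const_mul_field c

theorem hessian_cgf_sumLaw (s : Vec m) :
    hessian (cgf (sumLaw ν n)) s = (n : ℝ) • hessian (cgf ν) s := by
  ext i j
  simp only [hessian, Matrix.of_apply, Matrix.smul_apply, smul_eq_mul, cgf_sumLaw]
  rw [partialDeriv_const_mul, partialDeriv_const_mul]

theorem isSaddlepoint_sumLaw {s y : Vec m} (hs : s ∈ mgfDomain ν) (h : HasGradientAt (cgf ν) y s) :
    IsSaddlepoint (sumLaw ν n) ((n : ℝ) • y) s := by
  refine ⟨mgfDomain_subset_sumLaw hs, ?_⟩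
  rw [hasGradientAt_iff_hasFDerivAt] at h
  rw [hasGradientWithinAt_iff_hasFDerivWithinAt, cgf_sumLaw]
  exact ((h.const_mul (n : ℝ)).congr_fderiv (by simp)).hasFDerivWithinAt

end SumLaw

/-! ### Uniqueness of the saddlepoint -/

section Uniqueness

/-- Secant slopes from `0` are nondecreasing and tend to zero at `0`, hence are nonnegative.
One-sided derivatives are needed because a saddlepoint may lie on the boundary of the domain. -/
theorem ConvexOn.le_of_hasDerivWithinAt_zero {f : ℝ → ℝ} (hf : ConvexOn ℝ (Set.Icc 0 1) f)
    (h0 : HasDerivWithinAt f 0 (Set.Icc 0 1) 0) {b : ℝ} (hb : b ∈ Set.Ioc (0 : ℝ) 1) :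
    f 0 ≤ f b := by
  have h1 := (hasDerivWithinAt_iff_tendsto_slope.1 h0).mono_left
    (nhdsWithin_mono (0 : ℝ) (s := Set.Ioo 0 1) (fun x hx => ⟨⟨hx.1.le, hx.2.le⟩, hx.1.ne'⟩))
  have h2 : (𝓝[Set.Ioo (0 : ℝ) 1] 0).NeBot := by
    rw [nhdsWithin_Ioo_eq_nhdsGT zero_lt_one]; infer_instance
  have h3 : 0 ≤ (f b - f 0) / (b - 0) := by
    refine le_of_tendsto h1 ?_
    have h4 : Set.Ioo (0 : ℝ) b ∈ 𝓝[Set.Ioo (0 : ℝ) 1] 0 := by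
      rw [nhdsWithin_Ioo_eq_nhdsGT zero_lt_one]
      exact Ioo_mem_nhdsGT hb.1
    filter_upwards [h4] with x hx
    rw [slope_def_field]
    exact hf.secant_mono (by simp) ⟨hx.1.le, hx.2.le.trans hb.2⟩ ⟨hb.1.le, hb.2⟩ hx.1.ne' hb.1.ne'
      hx.2.le
  rw [sub_zero] at h3
  have := mul_nonneg h3 hb.1.le
  rw [div_mul_cancel₀ _ hb.1.ne'] at this
  linarith

theorem ConvexOn.le_half_of_hasDerivWithinAt_zero {N : ℝ → ℝ} (hNconv : ConvexOn ℝ (Set.Icc 0 1) N)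
    (hd1 : HasDerivWithinAt N 0 (Set.Icc 0 1) 1) : N 1 ≤ N (1 / 2) := by
  have hr : ConvexOn ℝ (Set.Icc (0 : ℝ) 1) fun t => N (1 - t) := by
    refine ⟨convex_Icc 0 1, fun a ha b hb u v hu hv huv => ?_⟩
    have h1 := hNconv.2 (show 1 - a ∈ Set.Icc (0 : ℝ) 1 from ⟨by linarith [ha.2], by linarith [ha.1]⟩)
      (show 1 - b ∈ Set.Icc (0 : ℝ) 1 from ⟨by linarith [hb.2], by linarith [hb.1]⟩) hu hv huv
    refine le_trans (le_of_eq ?_) h1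
    have e : 1 - (u • a + v • b) = u • (1 - a) + v • (1 - b) := by
      simp only [smul_eq_mul]
      linear_combination -huv
    exact congrArg N e
  have hd1' : HasDerivWithinAt (fun t => N (1 - t)) 0 (Set.Icc 0 1) 0 := by
    have h1 : HasDerivWithinAt (fun t : ℝ => 1 - t) (-1) (Set.Icc 0 1) 0 := by
      simpa using ((hasDerivAt_id (0 : ℝ)).const_sub 1).hasDerivWithinAt
    have h2 := HasDerivWithinAt.scomp (h := fun t : ℝ => 1 - t) (t' := Set.Icc 0 1) (0 : ℝ)
      (by simpa using hd1) h1 (fun t ht => ⟨by linarith [ht.2], by linarith [ht.1]⟩)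
    exact HasDerivWithinAt.congr_deriv h2 (by simp)
  have := ConvexOn.le_of_hasDerivWithinAt_zero hr hd1' (b := 1 / 2) (by norm_num)
  norm_num at this ⊢
  exact this

variable {m : ℕ} {ν : Measure (Vec m)} [IsProbabilityMeasure ν]

theorem exp_inner_convex (s d X : Vec m) (c : ℝ) :
    ConvexOn ℝ (Set.Icc (0 : ℝ) 1) fun t => Real.exp (inner ℝ (s + t • d) X - t * c) := by
  have h := (convexOn_exp.comp_linearMap (LinearMap.toSpanSingleton ℝ ℝ (inner ℝ d X - c))).smul
    (Real.exp_pos (inner ℝ s X)).le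
  refine (h.subset (Set.subset_univ _) (convex_Icc 0 1)).congr fun t _ => ?_
  simp only [LinearMap.toSpanSingleton_apply, Function.comp, smul_eq_mul, ← Real.exp_add,
    inner_add_left, real_inner_smul_left]
  congr 1
  ring

/-- With `d = s₂ - s₁`, the convex function `N(t) = E exp((s₁ + t d) X - t d x)` has zero derivative
at both ends of `[0, 1]`, so `N(0)` and `N(1)` are at most `N(1/2)`. But `N(0) + N(1) - 2 N(1/2)` is
the integral of a nonnegative square, which must vanish almost everywhere, and this forces `d X = d
x`. -/
theorem ae_eq_of_isSaddlepoint {x s₁ s₂ : Vec m} (h₁ : IsSaddlepoint ν x s₁)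
    (h₂ : IsSaddlepoint ν x s₂) : ∀ᵐ X ∂ν, inner ℝ (s₂ - s₁) X = inner ℝ (s₂ - s₁) x := by
  set d := s₂ - s₁ with hd
  set c : ℝ := inner ℝ d x with hc
  have hs : s₁ + (1 : ℝ) • d = s₂ := by rw [hd]; simp
  set E : ℝ → Vec m → ℝ := fun t X => Real.exp (inner ℝ (s₁ + t • d) X - t * c) with hE
  have hEc : ∀ t, Continuous (E t) := fun t => by simp only [hE]; fun_prop
  have hE0 : Integrable (E 0) ν := by
    refine h₁.1.congr (Eventually.of_forall fun X => ?_)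
    simp [hE]
  have hE1 : Integrable (E 1) ν := by
    refine (h₂.1.mul_const (Real.exp (-c))).congr (Eventually.of_forall fun X => ?_)
    simp only [hE, hs, ← Real.exp_add]
    congr 1
    ring
  have hEle : ∀ t ∈ Set.Icc (0 : ℝ) 1, ∀ X, E t X ≤ (1 - t) * E 0 X + t * E 1 X := by
    intro t ht X
    have := (exp_inner_convex s₁ d X c).2 (by simp : (0 : ℝ) ∈ Set.Icc (0 : ℝ) 1)
      (by simp : (1 : ℝ) ∈ Set.Icc (0 : ℝ) 1) (by linarith [ht.2] : 0 ≤ 1 - t) ht.1 (by ring)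
    simpa [hE] using this
  have hEi : ∀ t ∈ Set.Icc (0 : ℝ) 1, Integrable (E t) ν := by
    intro t ht
    refine ((hE0.const_mul (1 - t)).add (hE1.const_mul t)).mono' (hEc t).aestronglyMeasurable
      (Eventually.of_forall fun X => ?_)
    rw [Real.norm_of_nonneg (Real.exp_pos _).le]
    exact hEle t ht X
  set N : ℝ → ℝ := fun t => ∫ X, E t X ∂ν with hN
  have hNconv : ConvexOn ℝ (Set.Icc 0 1) N := by
    refine ⟨convex_Icc 0 1, fun a ha b hb u v hu hv huv => ?_⟩
    have hm := convex_Icc (0 : ℝ) 1 ha hb hu hv huv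
    simp only [hN, smul_eq_mul]
    rw [← integral_const_mul, ← integral_const_mul,
      ← integral_add ((hEi a ha).const_mul u) ((hEi b hb).const_mul v)]
    refine integral_mono (hEi _ hm) (((hEi a ha).const_mul u).add ((hEi b hb).const_mul v))
      fun X => ?_
    exact (exp_inner_convex s₁ d X c).2 ha hb hu hv huv
  have hdom : ∀ t ∈ Set.Icc (0 : ℝ) 1, s₁ + t • d ∈ mgfDomain ν := by
    intro t ht
    refine ((hEi t ht).mul_const (Real.exp (t * c))).congr (Eventually.of_forall fun X => ?_)
    simp only [hE, ← Real.exp_add]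
    congr 1
    ring
  have hNeq : ∀ t ∈ Set.Icc (0 : ℝ) 1, N t = Real.exp (cgf ν (s₁ + t • d) - t * c) := by
    intro t ht
    have h1 : N t = mgf ν (s₁ + t • d) * Real.exp (-(t * c)) := by
      simp only [hN, mgf, hE]
      rw [← integral_mul_const]
      simp only [← Real.exp_add, sub_eq_add_neg]
    rw [h1, sub_eq_add_neg, Real.exp_add, cgf, Real.exp_log (mgf_pos (hdom t ht))]
  have hder : ∀ t ∈ Set.Icc (0 : ℝ) 1, IsSaddlepoint ν x (s₁ + t • d) →
      HasDerivWithinAt N 0 (Set.Icc 0 1) t := by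
    intro t ht h
    have h1 : HasDerivWithinAt (fun t : ℝ => s₁ + t • d) d (Set.Icc 0 1) t := by
      simpa using (((hasDerivAt_id t).smul_const d).const_add s₁).hasDerivWithinAt
    have h2 := HasFDerivWithinAt.comp_hasDerivWithinAt t h.2.hasFDerivWithinAt h1
      (fun t ht => hdom t ht)
    have h3 : HasDerivWithinAt (fun t : ℝ => t * c) c (Set.Icc 0 1) t := by
      simpa using ((hasDerivAt_id t).mul_const c).hasDerivWithinAt
    have h4 := (h2.sub h3).exp
    have h5 := h4.congr (f₁ := N) (fun t ht => hNeq t ht) (hNeq t ht)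
    refine h5.congr_deriv ?_
    rw [InnerProductSpace.toDual_apply_apply, real_inner_comm, ← hc]
    simp
  have hd0 := hder 0 (by simp) (by simpa using h₁)
  have hd1 := hder 1 (by simp) (by rw [hs]; exact h₂)
  have h0h : N 0 ≤ N (1 / 2) := ConvexOn.le_of_hasDerivWithinAt_zero hNconv hd0 (by norm_num)
  have h1h : N 1 ≤ N (1 / 2) := ConvexOn.le_half_of_hasDerivWithinAt_zero hNconv hd1
  -- the integrand of `N 0 + N 1 - 2 * N (1 / 2)` is a perfect square
  have hsq : ∀ X, E 0 X + E 1 X - 2 * E (1 / 2) X =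
      Real.exp (inner ℝ s₁ X) * (1 - Real.exp ((inner ℝ d X - c) / 2)) ^ 2 := by
    intro X
    simp only [hE, inner_add_left, real_inner_smul_left]
    have e1 : inner ℝ s₁ X + 0 * inner ℝ d X - 0 * c = inner ℝ s₁ X := by ring
    have e2 : inner ℝ s₁ X + 1 * inner ℝ d X - 1 * c = inner ℝ s₁ X +
      ((inner ℝ d X - c) / 2 + (inner ℝ d X - c) / 2) := by ring
    have e3 : inner ℝ s₁ X + 1 / 2 * inner ℝ d X - 1 / 2 * c = inner ℝ s₁ X +
      (inner ℝ d X - c) / 2 := by ring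
    rw [e1, e2, e3, Real.exp_add, Real.exp_add, Real.exp_add]
    ring
  have hint : Integrable (fun X => E 0 X + E 1 X - 2 * E (1 / 2) X) ν :=
    (hE0.add hE1).sub ((hEi (1 / 2) (by norm_num)).const_mul 2)
  have hval : ∫ X, (E 0 X + E 1 X - 2 * E (1 / 2) X) ∂ν = N 0 + N 1 - 2 * N (1 / 2) := by
    have h01 : Integrable (fun X => E 0 X + E 1 X) ν := hE0.add hE1
    rw [integral_sub h01 ((hEi (1 / 2) (by norm_num)).const_mul 2),
      integral_add hE0 hE1, integral_const_mul]
  have hnn : 0 ≤ fun X => E 0 X + E 1 X - 2 * E (1 / 2) X := fun X => by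
    simp only [Pi.zero_apply, hsq]
    positivity
  have hz : ∫ X, (E 0 X + E 1 X - 2 * E (1 / 2) X) ∂ν = 0 :=
    le_antisymm (by rw [hval]; linarith) (integral_nonneg hnn)
  have hae := (integral_eq_zero_iff_of_nonneg hnn hint).1 hz
  filter_upwards [hae] with X hX
  simp only [Pi.zero_apply, hsq] at hX
  have h1 := (mul_eq_zero.1 hX).resolve_left (Real.exp_pos _).ne'
  have h2 : Real.exp ((inner ℝ d X - c) / 2) = 1 := by
    have := pow_eq_zero_iff (two_ne_zero) |>.1 h1
    linarith
  have h3 := Real.exp_eq_one_iff _ |>.1 h2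
  linarith

/-- Two distinct saddlepoints would concentrate the law on a hyperplane, a Lebesgue null set,
contradicting absolute continuity. -/
theorem IsSaddlepoint.eq_of_density {x s₁ s₂ : Vec m} {f : Vec m → ℝ} (hf : IsContDensity ν f)
    (h₁ : IsSaddlepoint ν x s₁) (h₂ : IsSaddlepoint ν x s₂) : s₂ = s₁ := by
  by_contra hne
  have hd : s₂ - s₁ ≠ 0 := sub_ne_zero.2 hne
  have h := ae_eq_of_isSaddlepoint h₁ h₂
  have hac : ν ≪ volume := by
    rw [hf.2.2]
    exact withDensity_absolutelyContinuous _ _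
  have hzero : volume {X : Vec m | inner ℝ (s₂ - s₁) X = inner ℝ (s₂ - s₁) x} = 0 := by
    have h1 := Measure.addHaar_affineSubspace (volume : Measure (Vec m))
      (AffineSubspace.mk' x (LinearMap.ker (innerₛₗ ℝ (s₂ - s₁)))) (fun htop => ?_)
    · refine measure_mono_null (fun X hX => ?_) h1
      rw [SetLike.mem_coe, AffineSubspace.mem_mk', LinearMap.mem_ker, vsub_eq_sub, map_sub]
      simp only [innerₛₗ_apply_apply]
      rw [Set.mem_ofPred_eq] at hX
      rw [hX, sub_self]
    · have h2 : x + (s₂ - s₁) ∈ AffineSubspace.mk' x (LinearMap.ker (innerₛₗ ℝ (s₂ - s₁))) := by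
        rw [htop]; exact AffineSubspace.mem_top _ _ _
      rw [AffineSubspace.mem_mk', LinearMap.mem_ker, vsub_eq_sub, add_sub_cancel_left] at h2
      exact hd (inner_self_eq_zero.1 h2)
  have h1 : ν {X : Vec m | inner ℝ (s₂ - s₁) X = inner ℝ (s₂ - s₁) x} = 0 := hac hzero
  have h2 : ν Set.univ = 0 := by
    have h3 := ae_iff.1 h
    have h4 : (Set.univ : Set (Vec m)) = {X : Vec m | inner ℝ (s₂ - s₁) X = inner ℝ (s₂ - s₁) x} ∪
        {X : Vec m | ¬ inner ℝ (s₂ - s₁) X = inner ℝ (s₂ - s₁) x} := by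
      ext X
      simp [em]
    rw [h4]
    exact measure_union_null h1 h3
  rw [measure_univ] at h2
  exact one_ne_zero h2

end Uniqueness

end Saddlepoint

/-! ### Gaussian integrals -/

section GaussianIntegral

open scoped MatrixOrder in
-- The linear substitution by the positive square root of `A` reduces the integral to the standard
-- Gaussian; its determinant is a square root of `det A`.
theorem integral_exp_neg_half_posDef {m : ℕ} {A : Matrix (Fin m) (Fin m) ℝ} (hA : A.PosDef) :
    ∫ φ : EuclideanSpace ℝ (Fin m), Real.exp (-(φ.ofLp ⬝ᵥ A.mulVec φ.ofLp / 2)) =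
      √(2 * Real.pi) ^ m / √A.det := by
  set S := CFC.sqrt A with hS
  have hA0 : 0 ≤ A := Matrix.nonneg_iff_posSemidef.2 hA.posSemidef
  have hSS : S * S = A := CFC.sqrt_mul_sqrt_self A hA0
  have hSh : S.IsHermitian := (Matrix.nonneg_iff_posSemidef.1 (CFC.sqrt_nonneg A)).isHermitian
  have hdet : S.det ^ 2 = A.det := by rw [← hSS, Matrix.det_mul, pow_two]
  have hdet0 : S.det ≠ 0 := by
    intro h0
    rw [h0] at hdet
    have := hA.det_pos
    rw [← hdet] at this
    simp at this
  set T : EuclideanSpace ℝ (Fin m) →ₗ[ℝ] EuclideanSpace ℝ (Fin m) := Matrix.toEuclideanLin S with hT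
  have hTdet : LinearMap.det T = S.det := by
    rw [hT, Matrix.toEuclideanLin, Matrix.toLpLin_eq_toLin]
    exact LinearMap.det_toLin _ S
  have hTn : ∀ φ, ‖T φ‖ ^ 2 = φ.ofLp ⬝ᵥ A.mulVec φ.ofLp := by
    intro φ
    rw [EuclideanSpace.real_norm_sq_eq, ← hSS, ← Matrix.mulVec_mulVec, Matrix.dotProduct_mulVec,
      ← Matrix.mulVec_transpose]
    have : S.transpose = S := by
      have := hSh.eq
      rwa [Matrix.conjTranspose_eq_transpose_of_trivial] at this
    rw [this]
    simp only [dotProduct, hT, pow_two]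
    rfl
  have hmap := Measure.map_linearMap_addHaar_eq_smul_addHaar
    (volume : Measure (EuclideanSpace ℝ (Fin m))) (f := T) (by rw [hTdet]; exact hdet0)
  have hTc : Continuous T := T.continuous_of_finiteDimensional
  have h1 : ∫ v, Real.exp (-(1 / 2 : ℝ) * ‖v‖ ^ 2) ∂(Measure.map T volume) =
      ∫ φ : EuclideanSpace ℝ (Fin m), Real.exp (-(φ.ofLp ⬝ᵥ A.mulVec φ.ofLp / 2)) := by
    rw [integral_map hTc.measurable.aemeasurable (Continuous.aestronglyMeasurable (by fun_prop))]
    refine integral_congr_ae (Eventually.of_forall fun φ => ?_)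
    simp only [hTn]
    congr 1
    ring
  rw [← h1, hmap, integral_smul_measure, GaussianFourier.integral_rexp_neg_mul_sq_norm (by norm_num),
    hTdet, ENNReal.toReal_ofReal (abs_nonneg _), abs_inv, finrank_euclideanSpace_fin, smul_eq_mul,
    ← hdet, Real.sqrt_sq_eq_abs, div_eq_inv_mul, Real.sqrt_eq_rpow, ← Real.rpow_natCast,
    ← Real.rpow_mul (by positivity)]
  rw [mul_comm]
  congr 2
  · ring
  · ring

end GaussianIntegral

namespace Saddlepoint

/-! ### Densities by inversion of a tilted law -/

section Density

variable {m : ℕ} {ν : Measure (Vec m)} [IsProbabilityMeasure ν]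

theorem charFun_tilted (s φ : Vec m) :
    charFun (ν.tilted fun x => inner ℝ s x) φ = ((mgf ν s)⁻¹ : ℝ) * complexMgf ν s φ := by
  rw [charFun_apply, integral_tilted, complexMgf, ← integral_const_mul]
  refine integral_congr_ae (Eventually.of_forall fun x => ?_)
  simp only [Complex.real_smul, Complex.exp_add, mgf, div_eq_inv_mul, real_inner_comm φ x]
  push_cast
  ring

/-- Fourier inversion for the law tilted by `s`. -/
theorem exists_isContDensity {s : Vec m} (hs : s ∈ mgfDomain ν)
    (hχ : Integrable fun φ => complexMgf ν s φ) :
    ∃ f, IsContDensity ν f ∧ ∀ x, f x = Real.exp (-inner ℝ s x) * ((2 * Real.pi) ^ m)⁻¹ *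
      (∫ φ, Complex.exp (-(inner ℝ φ x : ℝ) * Complex.I) * complexMgf ν s φ).re := by
  have hM := mgf_pos hs
  have hprob : IsProbabilityMeasure (ν.tilted fun x => inner ℝ s x) :=
    isProbabilityMeasure_tilted hs
  obtain ⟨f, hf, hf0, hfν, hfx⟩ := exists_density_of_integrable_charFun
    (ν.tilted fun x => inner ℝ s x) 
    ((hχ.const_mul _).congr (Eventually.of_forall fun φ => (charFun_tilted s φ).symm))
  refine ⟨fun x => f x * (mgf ν s * Real.exp (-inner ℝ s x)), ⟨by fun_prop, fun x =>
    mul_nonneg (hf0 x) (mul_pos hM (Real.exp_pos _)).le, ?_⟩, fun x => ?_⟩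
  -- Tilting back by `-s` turns the density of the tilted law into one for `ν`.
  · have h1 := tilted_neg_same (μ := ν) (f := fun x => inner ℝ s x) hs
    have h2 : ∫ x, Real.exp ((-fun x => inner ℝ s x) x) ∂(ν.tilted fun x => inner ℝ s x) =
        (mgf ν s)⁻¹ := by
      rw [integral_exp_tilted]
      simp [mgf]
    conv_lhs => rw [← h1, Measure.tilted, h2, hfν]
    rw [← withDensity_mul _ (by fun_prop) (by fun_prop)]
    congr 1
    funext x
    rw [Pi.mul_apply, ← ENNReal.ofReal_mul (hf0 x)]
    congr 2
    rw [Pi.neg_apply, div_inv_eq_mul, mul_comm (mgf ν s)]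
  · dsimp only
    rw [hfx, finrank_euclideanSpace_fin]
    have h3 : ∫ φ, Complex.exp (-(inner ℝ φ x : ℝ) * Complex.I) *
        charFun (ν.tilted fun x => inner ℝ s x) φ = ((mgf ν s)⁻¹ : ℝ) *
        ∫ φ, Complex.exp (-(inner ℝ φ x : ℝ) * Complex.I) * complexMgf ν s φ := by
      rw [← integral_const_mul]
      refine integral_congr_ae (Eventually.of_forall fun φ => ?_)
      simp only [charFun_tilted]
      ring
    rw [h3, Complex.re_ofReal_mul]
    generalize (∫ φ, Complex.exp (-(inner ℝ φ x : ℝ) * Complex.I) * complexMgf ν s φ).re = r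
    field_simp

end Density

/-! ### Both likelihoods in terms of the tilted law -/

section Likelihood

variable {m p : ℕ} {Θ : Set (Vec p)} {μ : Vec p → Measure (Vec m)}
  {σ : Vec p × Vec m → Vec m} {W : Set (Vec p × Vec m)} {δ B : ℝ} {κ : ℕ} {z : Vec p × Vec m}

/-- The exponential rate `K₀(ŝ; θ) - ŝ y` of the likelihood. -/
noncomputable def chartRate (μ : Vec p → Measure (Vec m)) (σ : Vec p × Vec m → Vec m)
    (z : Vec p × Vec m) : ℝ :=
  modelCgf μ (σ z, z.1) - inner ℝ (σ z) z.2

theorem saddlepoint_eq {ν : Measure (Vec m)} {x s : Vec m} (hs : IsSaddlepoint ν x s)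
    (hu : ∀ s', IsSaddlepoint ν x s' → s' = s) : saddlepoint ν x = s := by
  have h : ∃ s, IsSaddlepoint ν x s := ⟨s, hs⟩
  rw [saddlepoint, dif_pos h]
  exact hu _ h.choose_spec

namespace IsSaddlepointChart

theorem isSaddlepoint (hC : IsSaddlepointChart Θ μ σ W δ B κ) (h : MgfSmooth Θ μ)
    (hμ : ∀ θ ∈ Θ, IsProbabilityMeasure (μ θ)) (hz : z ∈ W) (n : ℕ) :
    IsSaddlepoint (sumLaw (μ z.1) n) ((n : ℝ) • z.2) (σ z) := by
  obtain ⟨h1, h2⟩ := interior_subset (hC.mem z hz)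
  have := hμ _ h1
  refine isSaddlepoint_sumLaw h2 ?_
  have h3 := h.hasGradientAt_cgf hμ (hC.mem z hz)
  rwa [hC.mean_eq z hz] at h3

theorem hessian_sumLaw (hC : IsSaddlepointChart Θ μ σ W δ B κ) (h : MgfSmooth Θ μ)
    (hμ : ∀ θ ∈ Θ, IsProbabilityMeasure (μ θ)) (hz : z ∈ W) (n : ℕ) :
    hessian (cgf (sumLaw (μ z.1) n)) (σ z) = (n : ℝ) • tiltedCov μ (σ z, z.1) := by
  have := hμ _ (interior_subset (hC.mem z hz)).1
  rw [hessian_cgf_sumLaw, h.hessian_cgf hμ (hC.mem z hz)]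

/-- Independence makes the generating function an `n`-th power, and the oscillating factor at `x =
ny` splits into `n` equal factors, each centring one summand at its tilted mean `y`. -/
theorem twist_complexMgf_sumLaw (hC : IsSaddlepointChart Θ μ σ W δ B κ)
    (hμ : ∀ θ ∈ Θ, IsProbabilityMeasure (μ θ)) (hz : z ∈ W) (n : ℕ) (φ : Vec m) :
    Complex.exp (-(inner ℝ φ ((n : ℝ) • z.2) : ℝ) * Complex.I) *
      complexMgf (sumLaw (μ z.1) n) (σ z) φ =
      (mgfPartial μ [] [] (σ z, z.1) ^ n : ℝ) * tiltedChar μ (σ z, z.1) φ ^ n := by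
  have := hμ _ (interior_subset (hC.mem z hz)).1
  have hM := (mgfPartial_nil_pos hμ (hC.mem z hz)).ne'
  have hM' : (mgfPartial μ [] [] (σ z, z.1) : ℂ) ≠ 0 := by exact_mod_cast hM
  rw [complexMgf_sumLaw, tiltedChar, hC.mean_eq z hz, real_inner_smul_right]
  have e1 : Complex.exp (-((n * inner ℝ φ z.2 : ℝ) : ℂ) * Complex.I) =
      Complex.exp (-(inner ℝ φ z.2 : ℝ) * Complex.I) ^ n := by
    rw [← Complex.exp_nat_mul]
    congr 1
    push_cast
    ring
  have e2 : mgfDeriv μ [] [] (σ z, φ, z.1) = complexMgf (μ z.1) (σ z) φ := rfl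
  rw [e1, e2, mul_pow, mul_pow]
  push_cast
  rw [inv_pow]
  field_simp

/-- Fourier inversion is carried out at the tilt `ŝ`, where the oscillating factor is absorbed by
the centring and the integrand becomes a constant times `ρⁿ`. -/
theorem exists_isContDensity (hC : IsSaddlepointChart Θ μ σ W δ B κ)
    (hμ : ∀ θ ∈ Θ, IsProbabilityMeasure (μ θ)) (hz : z ∈ W) {n : ℕ} (hn : 0 < n)
    (hi : Integrable fun φ => tiltedChar μ (σ z, z.1) φ ^ n) :
    ∃ f, IsContDensity (sumLaw (μ z.1) n) f ∧ f ((n : ℝ) • z.2) =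
      Real.exp (n * chartRate μ σ z) * (((2 * Real.pi) ^ m)⁻¹ * (√(n : ℝ) ^ m)⁻¹) *
        laplaceInt n (tiltedChar μ (σ z, z.1)) := by
  obtain ⟨h1, h2⟩ := interior_subset (hC.mem z hz)
  have := hμ _ h1
  have hM := mgfPartial_nil_pos hμ (hC.mem z hz)
  have hχ : Integrable fun φ => complexMgf (sumLaw (μ z.1) n) (σ z) φ := by
    refine ((hi.const_mul ((mgfPartial μ [] [] (σ z, z.1) ^ n : ℝ) : ℂ)).bdd_mul (c := 1)
      (f := fun φ => Complex.exp ((inner ℝ φ ((n : ℝ) • z.2) : ℝ) * Complex.I))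
      (Continuous.aestronglyMeasurable (by fun_prop))
      (Eventually.of_forall fun φ => (Complex.norm_exp_ofReal_mul_I _).le)).congr
      (Eventually.of_forall fun φ => ?_)
    simp only
    rw [← hC.twist_complexMgf_sumLaw hμ hz, ← mul_assoc, ← Complex.exp_add]
    simp
  obtain ⟨f, hf, hfx⟩ := Saddlepoint.exists_isContDensity (mgfDomain_subset_sumLaw h2) hχ
  refine ⟨f, hf, ?_⟩
  rw [hfx]
  simp only [hC.twist_complexMgf_sumLaw hμ hz]
  rw [integral_const_mul, Complex.re_ofReal_mul]
  have h3 : (∫ φ, tiltedChar μ (σ z, z.1) φ ^ n).re =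
      ∫ φ, (tiltedChar μ (σ z, z.1) φ ^ n).re := (integral_re hi).symm
  have h4 : Real.exp (-inner ℝ (σ z) ((n : ℝ) • z.2)) * mgfPartial μ [] [] (σ z, z.1) ^ n =
      Real.exp (n * chartRate μ σ z) := by
    rw [chartRate, modelCgf_eq_log, mul_sub, sub_eq_add_neg, Real.exp_add, ← Real.log_pow,
      Real.exp_log (pow_pos hM n), real_inner_smul_right, mul_comm]
  have hs : √(n : ℝ) ^ m ≠ 0 := (pow_pos (Real.sqrt_pos.2 (by exact_mod_cast hn)) m).ne'
  rw [h3, laplaceInt, finrank_euclideanSpace_fin, ← h4]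
  field_simp

theorem likelihood_eq (hC : IsSaddlepointChart Θ μ σ W δ B κ)
    (hμ : ∀ θ ∈ Θ, IsProbabilityMeasure (μ θ)) (hz : z ∈ W) {n : ℕ} (hn : 0 < n)
    (hi : Integrable fun φ => tiltedChar μ (σ z, z.1) φ ^ n) :
    likelihood μ n ((n : ℝ) • z.2) z.1 =
      Real.exp (n * chartRate μ σ z) * (((2 * Real.pi) ^ m)⁻¹ * (√(n : ℝ) ^ m)⁻¹) *
        laplaceInt n (tiltedChar μ (σ z, z.1)) := by
  obtain ⟨f, hf, hfx⟩ := hC.exists_isContDensity hμ hz hn hi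
  rw [likelihood, hf.eq_contDensity, hfx]

theorem eq_of_isSaddlepoint (hC : IsSaddlepointChart Θ μ σ W δ B κ) (h : MgfSmooth Θ μ)
    (hμ : ∀ θ ∈ Θ, IsProbabilityMeasure (μ θ)) (hz : z ∈ W) {n : ℕ} (hn : 0 < n)
    (hi : Integrable fun φ => tiltedChar μ (σ z, z.1) φ ^ n) {s : Vec m}
    (hs : IsSaddlepoint (sumLaw (μ z.1) n) ((n : ℝ) • z.2) s) : s = σ z := by
  have := hμ _ (interior_subset (hC.mem z hz)).1
  obtain ⟨f, hf, -⟩ := hC.exists_isContDensity hμ hz hn hi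
  exact (hC.isSaddlepoint h hμ hz n).eq_of_density hf hs

theorem gaussInt_eq (hC : IsSaddlepointChart Θ μ σ W δ B κ)
    (hμ : ∀ θ ∈ Θ, IsProbabilityMeasure (μ θ)) (hdecay : DecayBound Θ μ) (hgrowth : GrowthBound Θ μ)
    (hz : z ∈ W) :
    gaussInt (tiltedCovForm μ (σ z, z.1)) =
      √(2 * Real.pi) ^ m / √(tiltedCov μ (σ z, z.1)).det := by
  rw [← integral_exp_neg_half_posDef (posDef_tiltedCov hμ hdecay hgrowth (hC.mem z hz)), gaussInt]
  simp only [tiltedCovForm_eq]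

/-- Integrability of `ρⁿ` gives a density, hence uniqueness of the saddlepoint, which identifies the
value chosen in the definition with `σ z`. The Gaussian integral then replaces the determinant, with
matching powers of `2π` and `n`. -/
theorem saddlepointLikelihood_eq (hC : IsSaddlepointChart Θ μ σ W δ B κ)
    (hμ : ∀ θ ∈ Θ, IsProbabilityMeasure (μ θ)) (hdecay : DecayBound Θ μ) (hgrowth : GrowthBound Θ μ)
    (hz : z ∈ W) {n : ℕ} (hn : 0 < n) (hi : Integrable fun φ => tiltedChar μ (σ z, z.1) φ ^ n) :
    saddlepointLikelihood μ n ((n : ℝ) • z.2) z.1 =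
      Real.exp (n * chartRate μ σ z) * (((2 * Real.pi) ^ m)⁻¹ * (√(n : ℝ) ^ m)⁻¹) *
        gaussInt (tiltedCovForm μ (σ z, z.1)) := by
  have h := hgrowth.mgfSmooth
  have := hμ _ (interior_subset (hC.mem z hz)).1
  have hpos := (posDef_tiltedCov hμ hdecay hgrowth (hC.mem z hz)).det_pos
  have hn0 : (0 : ℝ) < n := by exact_mod_cast hn
  rw [saddlepointLikelihood, saddlepointDensity, saddlepoint_eq (hC.isSaddlepoint h hμ hz n)
    fun s' hs' => hC.eq_of_isSaddlepoint h hμ hz hn hi hs', hC.hessian_sumLaw h hμ hz,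
    hC.gaussInt_eq hμ hdecay hgrowth hz, smul_smul, Matrix.det_smul, Fintype.card_fin,
    Real.sqrt_mul (by positivity), mul_pow, Real.sqrt_mul (by positivity)]
  have e1 : cgf (sumLaw (μ z.1) n) (σ z) - inner ℝ (σ z) ((n : ℝ) • z.2) = n * chartRate μ σ z := by
    rw [cgf_sumLaw, chartRate, modelCgf, real_inner_smul_right]
    ring
  have hsq : ∀ x : ℝ, 0 ≤ x → √(x ^ m) = √x ^ m := fun x hx => by
    rw [Real.sqrt_eq_iff_eq_sq (by positivity) (by positivity), ← pow_mul, mul_comm, pow_mul,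
      Real.sq_sqrt hx]
  rw [e1, hsq _ (by positivity), hsq _ hn0.le]
  have e2 : (2 * Real.pi) ^ m = √(2 * Real.pi) ^ m * √(2 * Real.pi) ^ m := by
    rw [← mul_pow, Real.mul_self_sqrt (by positivity)]
  have p1 : 0 < √(2 * Real.pi) ^ m := by positivity
  have p2 : 0 < √(n : ℝ) ^ m := by positivity
  have p3 : 0 < √(tiltedCov μ (σ z, z.1)).det := Real.sqrt_pos.2 hpos
  rw [e2]
  field_simp

end IsSaddlepointChart

end Likelihood

end Saddlepoint

/-! ### Perturbations of strictly concave functions -/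

section Perturbation

/-- Compactness of the unit sphere gives a uniform negative bound at `z₀`; continuity of the second
derivative keeps half of it nearby. -/
theorem ContDiffAt.exists_eventually_fderiv_fderiv_le_neg {Z E : Type*} [NormedAddCommGroup Z]
    [NormedSpace ℝ Z] [NormedAddCommGroup E] [NormedSpace ℝ E] [ProperSpace E] {g : Z → ℝ} {z₀ : Z}
    (hg : ContDiffAt ℝ 2 g z₀) (L : E →L[ℝ] Z) (hL : ∀ u, ‖L u‖ ≤ ‖u‖)
    (h : ∀ u, ‖u‖ = 1 → fderiv ℝ (fderiv ℝ g) z₀ (L u) (L u) < 0) :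
    ∃ κ > 0, ∀ᶠ z in 𝓝 z₀, ∀ u, ‖u‖ = 1 → fderiv ℝ (fderiv ℝ g) z (L u) (L u) ≤ -κ := by
  obtain ⟨κ, hκ, hle⟩ : ∃ κ > 0, ∀ u, ‖u‖ = 1 →
      fderiv ℝ (fderiv ℝ g) z₀ (L u) (L u) ≤ -κ := by
    -- The sphere is empty when `E` is trivial, as happens for `p = 0`.
    rcases (Metric.sphere (0 : E) 1).eq_empty_or_nonempty with he | hne
    · refine ⟨1, one_pos, fun u hu => ?_⟩
      have : u ∈ Metric.sphere (0 : E) 1 := by simpa using hu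
      simp [he] at this
    · obtain ⟨u, hu, hmax⟩ := (isCompact_sphere (0 : E) 1).exists_isMaxOn hne
        (f := fun u => fderiv ℝ (fderiv ℝ g) z₀ (L u) (L u)) (by fun_prop)
      refine ⟨-fderiv ℝ (fderiv ℝ g) z₀ (L u) (L u), ?_, fun w hw => ?_⟩
      · have := h u (by simpa using hu)
        linarith
      · rw [neg_neg]
        exact hmax (show w ∈ Metric.sphere (0 : E) 1 by simpa using hw)
  have hc : ContinuousAt (fderiv ℝ (fderiv ℝ g)) z₀ :=
    (((hg.fderiv_right (m := 1) (by norm_num)).fderiv_right (m := 0) (by norm_num))).continuousAt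
  refine ⟨κ / 2, by positivity, ?_⟩
  have hn : ContinuousAt
      (fun z => ‖fderiv ℝ (fderiv ℝ g) z - fderiv ℝ (fderiv ℝ g) z₀‖) z₀ :=
    (continuous_norm (E := Z →L[ℝ] Z →L[ℝ] ℝ)).continuousAt.comp (hc.sub continuousAt_const)
  filter_upwards [hn.eventually (gt_mem_nhds (show _ < κ / 2 by
    dsimp only
    rw [sub_self]
    exact (norm_zero (E := Z →L[ℝ] Z →L[ℝ] ℝ)).trans_lt (by positivity)))] with z hz u hu
  have h1 : ‖(fderiv ℝ (fderiv ℝ g) z - fderiv ℝ (fderiv ℝ g) z₀) (L u) (L u)‖ ≤ κ / 2 := by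
    have hLu : ‖L u‖ ≤ 1 := (hL u).trans hu.le
    exact (ContinuousLinearMap.unit_le_opNorm _ _ hLu).trans
      ((ContinuousLinearMap.unit_le_opNorm _ _ hLu).trans hz.le)
  have h2 := (le_abs_self _).trans h1
  have h3 := hle u hu
  simp only [_root_.sub_apply] at h2
  linarith

variable {E F : Type*} [NormedAddCommGroup E] [NormedSpace ℝ E] [NormedAddCommGroup F]
  [NormedSpace ℝ F]

theorem HasLineDerivAt.slice {f : E × F → ℝ} {f' : ℝ} {x u : E} {y : F}
    (h : HasLineDerivAt ℝ f f' (x, y) (u, 0)) : HasLineDerivAt ℝ (fun x => f (x, y)) f' x u := by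
  refine HasDerivAt.congr_of_eventuallyEq h (Eventually.of_forall fun t => ?_)
  simp

/-- Half of the concavity `2 * κ` is spent on the second derivative of the perturbation. -/
theorem StronglyConcaveOnBall.add_div {f ℓ : E → ℝ} {g₁ ℓ₁ : E → E → ℝ} {x₀ : E} {r κ A n : ℝ}
    (h : StronglyConcaveOnBall f g₁ x₀ r (2 * κ)) (hn : 0 < n)
    (hℓ : ∀ x ∈ Metric.ball x₀ r, ∀ u, ‖u‖ = 1 → HasLineDerivAt ℝ ℓ (ℓ₁ x u) x u ∧
      ∃ c₂, |c₂| ≤ A ∧ HasLineDerivAt ℝ (fun x => ℓ₁ x u) c₂ x u) (hA : A / n ≤ κ) :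
    StronglyConcaveOnBall (fun x => f x + ℓ x / n) (fun x u => g₁ x u + ℓ₁ x u / n) x₀ r κ where
  hasLineDerivAt x hx u hu :=
    HasDerivAt.fun_add (h.hasLineDerivAt x hx u hu) ((hℓ x hx u hu).1.div_const n)
  second x hx u hu := by
    obtain ⟨c, hc, hd⟩ := h.second x hx u hu
    obtain ⟨c₂, hc₂, hd₂⟩ := (hℓ x hx u hu).2
    refine ⟨c + c₂ / n, ?_, HasDerivAt.fun_add hd (hd₂.div_const n)⟩
    have : c₂ / n ≤ A / n := by
      gcongr
      exact (le_abs_self _).trans hc₂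
    linarith

/-- A function with nondegenerate maximum in the first variable is uniformly strongly concave. -/
theorem ContDiffAt.exists_stronglyConcaveOnBall [ProperSpace E] {g : E × F → ℝ} {x₀ : E} {y₀ : F}
    (hg : ContDiffAt ℝ 2 g (x₀, y₀)) (h1 : ∀ u : E, fderiv ℝ g (x₀, y₀) (u, 0) = 0)
    (h2 : ∀ u : E, ‖u‖ = 1 → fderiv ℝ (fderiv ℝ g) (x₀, y₀) (u, 0) (u, 0) < 0)
    {P : E × F → Prop} (hP : ∀ᶠ z in 𝓝 (x₀, y₀), P z) :
    ∃ r κ : ℝ, 0 < r ∧ 0 < κ ∧ ∃ V : Set F, IsOpen V ∧ y₀ ∈ V ∧ ∀ y ∈ V,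
      (∀ x ∈ Metric.ball x₀ r, P (x, y)) ∧
      ContinuousOn (fun x => g (x, y)) (Metric.ball x₀ r) ∧
      StronglyConcaveOnBall (fun x => g (x, y)) (fun x u => fderiv ℝ g (x, y) (u, 0)) x₀ r
        (2 * κ) ∧
      ∀ u, ‖u‖ = 1 → |fderiv ℝ g (x₀, y) (u, 0)| ≤ κ * r / 8 := by
  obtain ⟨κ, hκ, he⟩ := hg.exists_eventually_fderiv_fderiv_le_neg
    (ContinuousLinearMap.inl ℝ E F) (fun u => by simp) h2
  obtain ⟨r, hr, hball⟩ := Metric.eventually_nhds_iff.1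
    (hP.and (he.and (hg.eventually (by simp))))
  have hc : ContinuousAt (fderiv ℝ g) (x₀, y₀) :=
    (hg.fderiv_right (m := 1) (by norm_num)).continuousAt
  obtain ⟨r', hr', hball'⟩ := Metric.eventually_nhds_iff.1
    (Metric.continuousAt_iff'.1 hc (κ / 2 * r / 8) (by positivity))
  have hmem : ∀ y ∈ Metric.ball y₀ (min r r'), ∀ x ∈ Metric.ball x₀ r,
      Dist.dist (x, y) (x₀, y₀) < r := fun y hy x hx => by
    rw [Prod.dist_eq]
    exact max_lt hx (lt_of_lt_of_le hy (min_le_left _ _))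
  refine ⟨r, κ / 2, hr, by positivity, Metric.ball y₀ (min r r'), Metric.isOpen_ball,
    Metric.mem_ball_self (lt_min hr hr'), fun y hy => ⟨fun x hx => (hball (hmem y hy x hx)).1, ?_,
    ⟨fun x hx u _ => ?_, fun x hx u hu => ?_⟩, fun u hu => ?_⟩⟩
  · intro x hx
    have := (hball (hmem y hy x hx)).2.2.continuousAt
    exact (ContinuousAt.comp (f := fun x => (x, y)) this
      (continuousAt_id.prodMk continuousAt_const)).continuousWithinAt
  · exact (((hball (hmem y hy x hx)).2.2.differentiableAt
      (by norm_num)).hasFDerivAt.hasLineDerivAt _).slice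
  · refine ⟨_, ?_, HasLineDerivAt.slice (f := fun z => fderiv ℝ g z (u, 0))
      ((hball (hmem y hy x hx)).2.2.hasLineDerivAt_fderiv (u, 0) (u, 0))⟩
    have := (hball (hmem y hy x hx)).2.1 u hu
    simp only [ContinuousLinearMap.inl_apply] at this
    linarith
  · have h3 : Dist.dist (x₀, y) (x₀, y₀) < r' := by
      rw [Prod.dist_eq, dist_self]
      exact max_lt hr' (lt_of_lt_of_le hy (min_le_right _ _))
    have h4 := hball' h3
    rw [dist_eq_norm] at h4
    have h5 := (ContinuousLinearMap.unit_le_opNorm (fderiv ℝ g (x₀, y) - fderiv ℝ g (x₀, y₀))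
      ((u, 0) : E × F) (by simp [Prod.norm_def, hu])).trans h4.le
    simpa [h1] using h5

theorem HasLineDerivAt.log_div {f f₁ : E → ℝ} {c₂ : ℝ} {x u : E}
    (h : HasLineDerivAt ℝ f (f₁ x) x u) (h₁ : HasLineDerivAt ℝ f₁ c₂ x u) (hf : f x ≠ 0) :
    HasLineDerivAt ℝ (fun x => Real.log (f x)) (f₁ x / f x) x u ∧
      HasLineDerivAt ℝ (fun x => f₁ x / f x) (c₂ / f x - (f₁ x / f x) ^ 2) x u := by
  have e : x + (0 : ℝ) • u = x := by simp
  constructor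
  · have := HasDerivAt.log h (by rwa [e])
    exact HasDerivAt.congr_deriv this (by rw [e])
  · have := HasDerivAt.fun_div h₁ h (by rwa [e])
    refine HasDerivAt.congr_deriv this ?_
    simp only [e]
    field_simp

/-- Since `U` is open, the formula is needed on `U` only, and `t ↦ c exp (n t)` is strictly
increasing. -/
theorem isLocalMax_iff_of_eq_mul_exp {f L : E → ℝ} {U : Set E} {c n : ℝ} (hU : IsOpen U)
    (hc : 0 < c) (hn : 0 < n) (h : ∀ x ∈ U, L x = c * Real.exp (n * f x)) {x : E} (hx : x ∈ U) :
    IsLocalMax L x ↔ IsLocalMax f x := by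
  refine eventually_congr ?_
  filter_upwards [hU.mem_nhds hx] with y hy
  rw [h y hy, h x hx, mul_le_mul_iff_right₀ hc, Real.exp_le_exp, mul_le_mul_iff_right₀ hn]

end Perturbation

/-! ### The Hessian of the likelihood rate -/

theorem ContinuousLinearMap.apply_apply_eq_dotProduct {a b : ℕ} {E : Type*} [NormedAddCommGroup E]
    [NormedSpace ℝ E] (Q : E →L[ℝ] E →L[ℝ] ℝ) (L₁ : EuclideanSpace ℝ (Fin a) →L[ℝ] E)
    (L₂ : EuclideanSpace ℝ (Fin b) →L[ℝ] E) (x : EuclideanSpace ℝ (Fin a))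
    (y : EuclideanSpace ℝ (Fin b)) :
    Q (L₁ x) (L₂ y) = x.ofLp ⬝ᵥ (Matrix.of fun i j =>
      Q (L₁ (EuclideanSpace.single i 1)) (L₂ (EuclideanSpace.single j 1))).mulVec y.ofLp := by
  have e : ∀ {d : ℕ} (c : EuclideanSpace ℝ (Fin d)),
      c = ∑ i, c i • EuclideanSpace.single i (1 : ℝ) := fun {d} c => by
    have e := (EuclideanSpace.basisFun (Fin d) ℝ).sum_repr c
    simp only [EuclideanSpace.basisFun_repr, EuclideanSpace.basisFun_apply] at e
    exact e.symm
  conv_lhs => rw [e x, e y]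
  simp only [map_sum, map_smul, _root_.sum_apply, _root_.smul_apply, smul_eq_mul, dotProduct,
    Matrix.mulVec, Matrix.of_apply, Finset.mul_sum]
  rw [Finset.sum_comm]
  exact Finset.sum_congr rfl fun i _ => Finset.sum_congr rfl fun j _ => by ring

namespace Saddlepoint

section RateHessian

variable {m p : ℕ} {Θ : Set (Vec p)} {μ : Vec p → Measure (Vec m)}

/-- The Schur complement as the value of the Hessian on the vectors on which it has no component
in the first factor. -/
theorem MgfSmooth.fderiv_fderiv_modelCgf_eq_rateHessian (h : MgfSmooth Θ μ)
    (hμ : ∀ θ ∈ Θ, IsProbabilityMeasure (μ θ)) {s : Vec m} {θ : Vec p}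
    (hz : (s, θ) ∈ interior (modelDomain Θ μ)) (hA : (tiltedCov μ (s, θ)).PosDef) {c : Vec m}
    {u : Vec p}
    (hc : ∀ c' : Vec m, fderiv ℝ (fderiv ℝ (modelCgf μ)) (s, θ) (c, u) (c', 0) = 0) :
    fderiv ℝ (fderiv ℝ (modelCgf μ)) (s, θ) (c, u) (0, u) =
      u.ofLp ⬝ᵥ (rateHessian μ s θ).mulVec u.ofLp := by
  set Q := fderiv ℝ (fderiv ℝ (modelCgf μ)) (s, θ) with hQ
  set A := tiltedCov μ (s, θ) with hAdef
  set M := mixedHessian μ s θ with hM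
  have hsymm : ∀ v w, Q v w = Q w v :=
    ((h.contDiffAt_modelCgf hμ hz).isSymmSndFDerivAt (by simp))
  have q1 : ∀ c' c'' : Vec m, Q (c', 0) (c'', 0) = c'.ofLp ⬝ᵥ A.mulVec c''.ofLp := fun c' c'' => by
    have := Q.apply_apply_eq_dotProduct (ContinuousLinearMap.inl ℝ (Vec m) (Vec p))
      (ContinuousLinearMap.inl ℝ (Vec m) (Vec p)) c' c''
    simp only [ContinuousLinearMap.inl_apply] at this
    rw [this]
    congr 2
    ext i j
    exact h.fderiv_fderiv_modelCgf hμ hz i j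
  have q2 : ∀ (c' : Vec m) (u' : Vec p), Q (c', 0) (0, u') = c'.ofLp ⬝ᵥ M.mulVec u'.ofLp :=
    fun c' u' => by
    have := Q.apply_apply_eq_dotProduct (ContinuousLinearMap.inl ℝ (Vec m) (Vec p))
      (ContinuousLinearMap.inr ℝ (Vec m) (Vec p)) c' u'
    simp only [ContinuousLinearMap.inl_apply, ContinuousLinearMap.inr_apply] at this
    rw [this]
    congr 2
    ext i j
    exact (h.mixedHessian_apply hμ hz i j).symm
  have q3 : Q (0, u) (0, u) =
      u.ofLp ⬝ᵥ (hessian (fun θ' => cgf (μ θ') s) θ).mulVec u.ofLp := by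
    have := Q.apply_apply_eq_dotProduct (ContinuousLinearMap.inr ℝ (Vec m) (Vec p))
      (ContinuousLinearMap.inr ℝ (Vec m) (Vec p)) u u
    simp only [ContinuousLinearMap.inr_apply] at this
    rw [this]
    congr 2
    ext i j
    exact (h.hessian_param_apply hμ hz i j).symm
  have hsplit : ∀ w, Q (c, u) w = Q (c, 0) w + Q (0, u) w := fun w => by
    have : (c, u) = (c, (0 : Vec p)) + ((0 : Vec m), u) := by simp
    rw [this, map_add, _root_.add_apply]
  -- The hypothesis on `(c, u)` is the stationarity equation `A c = -M u`. Solving it for `c` and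
  -- substituting produces the Schur complement.
  have hlin : A.mulVec c.ofLp = -M.mulVec u.ofLp := by
    refine eq_neg_of_add_eq_zero_left (dotProduct_eq_zero _ fun w => ?_)
    have := hc (WithLp.toLp 2 w)
    rw [hsplit, hsymm (c, 0), hsymm (0, u), q1, q2] at this
    rw [dotProduct_comm, dotProduct_add]
    exact this
  have hunit : IsUnit A.det := hA.det_pos.ne'.isUnit
  have hc' : c.ofLp = -(A⁻¹.mulVec (M.mulVec u.ofLp)) := by
    rw [← Matrix.mulVec_neg, ← hlin, Matrix.mulVec_mulVec, Matrix.nonsing_inv_mul _ hunit,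
      Matrix.one_mulVec]
  rw [hsplit, q2, q3, rateHessian, h.hessian_cgf hμ hz, ← hM, ← hAdef, Matrix.sub_mulVec,
    dotProduct_sub, hc', neg_dotProduct, ← Matrix.mulVec_mulVec, ← Matrix.mulVec_mulVec,
    Matrix.dotProduct_mulVec u.ofLp M.transpose, Matrix.vecMul_transpose,
    dotProduct_comm (A⁻¹.mulVec _)]
  ring

end RateHessian

/-! ### Derivatives of the exponential rate -/

section ChartRate

variable {m p : ℕ} {Θ : Set (Vec p)} {μ : Vec p → Measure (Vec m)}
  {σ : Vec p × Vec m → Vec m} {W : Set (Vec p × Vec m)} {δ B : ℝ} {κ : ℕ} {z : Vec p × Vec m}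

namespace IsSaddlepointChart

theorem contDiffAt_chartRate (hC : IsSaddlepointChart Θ μ σ W δ B κ) (h : MgfSmooth Θ μ)
    (hμ : ∀ θ ∈ Θ, IsProbabilityMeasure (μ θ)) (hz : z ∈ W) : ContDiffAt ℝ 2 (chartRate μ σ) z := by
  have h1 := hC.contDiffAt z hz
  exact (ContDiffAt.comp (g := modelCgf μ) (f := fun z : Vec p × Vec m => (σ z, z.1)) z
    (h.contDiffAt_modelCgf hμ (hC.mem z hz)) (h1.prodMk contDiffAt_fst)).sub
      (h1.inner ℝ contDiffAt_snd)

theorem hasLineDerivAt_comp_graph (hC : IsSaddlepointChart Θ μ σ W δ B κ) (hz : z ∈ W) (u : Vec p)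
    {G : Vec m × Vec p → ℝ} (hG : DifferentiableAt ℝ G (σ z, z.1)) :
    HasLineDerivAt ℝ (fun z : Vec p × Vec m => G (σ z, z.1))
      (fderiv ℝ G (σ z, z.1) (fderiv ℝ σ z (u, 0), u)) z (u, 0) :=
  (hG.hasFDerivAt.comp z (((hC.contDiffAt z hz).differentiableAt (by norm_num)).hasFDerivAt.prodMk
    (hasFDerivAt_fst (p := z)))).hasLineDerivAt (u, 0)

/-- The envelope theorem. -/
theorem fderiv_chartRate (hC : IsSaddlepointChart Θ μ σ W δ B κ) (h : MgfSmooth Θ μ)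
    (hμ : ∀ θ ∈ Θ, IsProbabilityMeasure (μ θ)) (hz : z ∈ W) (u : Vec p) :
    fderiv ℝ (chartRate μ σ) z (u, 0) = fderiv ℝ (modelCgf μ) (σ z, z.1) (0, u) := by
  have hd := (h.contDiffAt_modelCgf hμ (hC.mem z hz)).differentiableAt (by norm_num)
  have h1 := hC.hasLineDerivAt_comp_graph hz u hd
  have h2 := ((((hC.contDiffAt z hz).differentiableAt (by norm_num)).hasFDerivAt).inner ℝ
    (hasFDerivAt_snd (p := z))).hasLineDerivAt (u, 0)
  have h3 := ((hC.contDiffAt_chartRate h hμ hz).differentiableAt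
    (by norm_num)).hasFDerivAt.hasLineDerivAt (u, 0)
  rw [HasDerivAt.unique h3 (HasDerivAt.sub h1 h2)]
  have hsplit : (fderiv ℝ σ z (u, 0), u) = (fderiv ℝ σ z (u, 0), (0 : Vec p)) + (0, u) := by simp
  -- The variation of the saddlepoint cancels because `∂K₀/∂s = y` there.
  rw [hsplit, map_add, h.fderiv_modelCgf hμ (hC.mem z hz), hC.mean_eq z hz]
  simp [fderivInnerCLM_apply]

/-- Differentiating the envelope identity pairs `(0, u)` with the tangent vector `(∂ŝ, u)`. The mean
stays equal to `y` along this tangent, so it is annihilated by the second derivative of `K₀` paired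
with any `(c', 0)`; this is the condition under which the Schur complement appears. -/
theorem fderiv_fderiv_chartRate (hC : IsSaddlepointChart Θ μ σ W δ B κ) (h : MgfSmooth Θ μ)
    (hμ : ∀ θ ∈ Θ, IsProbabilityMeasure (μ θ)) (hdecay : DecayBound Θ μ) (hgrowth : GrowthBound Θ μ)
    (hz : z ∈ W) (u : Vec p) :
    fderiv ℝ (fderiv ℝ (chartRate μ σ)) z (u, 0) (u, 0) =
      u.ofLp ⬝ᵥ (rateHessian μ (σ z) z.1).mulVec u.ofLp := by
  have hm := hC.mem z hz
  have hK := h.contDiffAt_modelCgf hμ hm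
  have h1 := (hC.contDiffAt_chartRate h hμ hz).hasLineDerivAt_fderiv (u, 0) (u, 0)
  have h2 : HasLineDerivAt ℝ (fun z : Vec p × Vec m => fderiv ℝ (modelCgf μ) (σ z, z.1) (0, u))
      (fderiv ℝ (fderiv ℝ (modelCgf μ)) (σ z, z.1) (fderiv ℝ σ z (u, 0), u) (0, u)) z (u, 0) := by
    have hG := hK.hasFDerivAt_fderiv.clm_apply (hasFDerivAt_const ((0 : Vec m), u) (σ z, z.1))
    have := hC.hasLineDerivAt_comp_graph hz u (G := fun w => fderiv ℝ (modelCgf μ) w (0, u))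
      hG.differentiableAt
    rw [hG.fderiv] at this
    simpa using this
  have h3 : HasDerivAt (fun t : ℝ => fderiv ℝ (chartRate μ σ) (z + t • (u, (0 : Vec m))) (u, 0))
      (fderiv ℝ (fderiv ℝ (modelCgf μ)) (σ z, z.1) (fderiv ℝ σ z (u, 0), u) (0, u)) 0 := by
    refine HasDerivAt.congr_of_eventuallyEq h2 ?_
    filter_upwards [hC.eventually_mem hz (u, 0)] with t ht
    exact hC.fderiv_chartRate h hμ ht u
  rw [HasDerivAt.unique h1 h3]
  refine h.fderiv_fderiv_modelCgf_eq_rateHessian hμ hm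
    (posDef_tiltedCov hμ hdecay hgrowth hm) fun c' => ?_
  rw [← h.fderiv_tiltedMean hμ hm]
  have h4 := (((h.contDiffAt_tiltedMean hμ hm).differentiableAt (by norm_num)).hasFDerivAt.comp z
    (((hC.contDiffAt z hz).differentiableAt (by norm_num)).hasFDerivAt.prodMk
    (hasFDerivAt_fst (p := z)))).hasLineDerivAt (u, 0)
  have h5 : HasDerivAt (fun t : ℝ => tiltedMean μ (σ (z + t • (u, (0 : Vec m))),
      (z + t • (u, (0 : Vec m))).1)) (0 : Vec m) 0 := by
    refine (hasDerivAt_const (0 : ℝ) z.2).congr_of_eventuallyEq ?_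
    filter_upwards [hC.eventually_mem hz (u, 0)] with t ht
    rw [hC.mean_eq _ ht]
    simp
  have h6 := HasDerivAt.unique h4 h5
  simp only [ContinuousLinearMap.comp_apply, ContinuousLinearMap.prod_apply,
    ContinuousLinearMap.coe_fst'] at h6
  rw [h6, inner_zero_right]

theorem contDiffAt_gaussInt (hC : IsSaddlepointChart Θ μ σ W δ B κ)
    (hμ : ∀ θ ∈ Θ, IsProbabilityMeasure (μ θ)) (hdecay : DecayBound Θ μ) (hgrowth : GrowthBound Θ μ)
    (hz : z ∈ W) : ContDiffAt ℝ 2 (fun z => gaussInt (tiltedCovForm μ (σ z, z.1))) z := by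
  have hm := hC.mem z hz
  have hpos := (posDef_tiltedCov hμ hdecay hgrowth hm).det_pos
  have h1 : ContDiffAt ℝ 2 (fun w => (tiltedCov μ w).det) (σ z, z.1) := by
    simp only [Matrix.det_apply]
    refine ContDiffAt.sum fun τ _ => ContDiffAt.const_smul _ (contDiffAt_prod fun i _ => ?_)
    exact hgrowth.mgfSmooth.contDiffAt_tiltedCov hμ hm _ _
  have h2 : ContDiffAt ℝ 2 (fun z : Vec p × Vec m => (tiltedCov μ (σ z, z.1)).det) z :=
    ContDiffAt.comp (f := fun z : Vec p × Vec m => (σ z, z.1)) z h1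
      ((hC.contDiffAt z hz).prodMk contDiffAt_fst)
  refine ((contDiffAt_const (c := √(2 * Real.pi) ^ m)).div (h2.sqrt hpos.ne')
    (Real.sqrt_pos.2 hpos).ne').congr_of_eventuallyEq ?_
  filter_upwards [hC.isOpen.mem_nhds hz] with w hw
  exact hC.gaussInt_eq hμ hdecay hgrowth hw

end IsSaddlepointChart

end ChartRate

end Saddlepoint

/-! ### Maximisers of two families of functions with the same leading term -/

section LogPerturbation

/-- Here `I` and `G` stand for the Laplace and Gaussian integrals, `I₁` and `G₁` for their
derivatives, `c₂` for the derivative of `I₁`. The conclusions control the first and second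
derivatives of `log I` and the difference of the logarithmic derivatives. -/
theorem abs_div_le_of_close {c C n I I₁ G G₁ c₂ : ℝ} (hc : 0 < c) (hC : 0 ≤ C) (hn : 1 ≤ n)
    (hCn : C / n ≤ c / 2) (hG : c ≤ G) (hG₁ : |G₁| ≤ C) (hI : |I - G| ≤ C / n)
    (hI₁ : |I₁ - G₁| ≤ C / n) (hc₂ : |c₂| ≤ C * √n) :
    c / 2 ≤ I ∧ |I₁ / I| ≤ 4 * C / c ∧
      |c₂ / I - (I₁ / I) ^ 2| ≤ (2 * C / c + (4 * C / c) ^ 2) * √n ∧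
      |I₁ / I - G₁ / G| ≤ (2 * C / c + 2 * C ^ 2 / c ^ 2) / n := by
  have hn0 : 0 < n := by linarith
  have hIc : c / 2 ≤ I := by linarith [(abs_le.1 hI).1]
  have hI0 : 0 < I := by linarith
  have hG0 : 0 < G := by linarith
  have hCn' : C / n ≤ C := div_le_self hC hn
  have hI₁' : |I₁| ≤ 2 * C := by
    have := abs_add_le (I₁ - G₁) G₁
    rw [sub_add_cancel] at this
    linarith
  have hs : 1 ≤ √n := Real.one_le_sqrt.2 hn
  have hq : |I₁ / I| ≤ 4 * C / c := by
    rw [abs_div, abs_of_pos hI0]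
    calc |I₁| / I ≤ 2 * C / (c / 2) := by gcongr
      _ = 4 * C / c := by field_simp; ring
  refine ⟨hIc, hq, ?_, ?_⟩
  · have h1 : |c₂ / I| ≤ 2 * C / c * √n := by
      rw [abs_div, abs_of_pos hI0]
      calc |c₂| / I ≤ C * √n / (c / 2) := by gcongr
        _ = 2 * C / c * √n := by field_simp
    have h2 : |(I₁ / I) ^ 2| ≤ (4 * C / c) ^ 2 * √n := by
      rw [abs_pow]
      calc |I₁ / I| ^ 2 ≤ (4 * C / c) ^ 2 := by gcongr
        _ ≤ (4 * C / c) ^ 2 * √n := le_mul_of_one_le_right (by positivity) hs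
    calc |c₂ / I - (I₁ / I) ^ 2| ≤ |c₂ / I| + |(I₁ / I) ^ 2| := abs_sub _ _
      _ ≤ _ := by linarith
  · have e : I₁ / I - G₁ / G = (I₁ - G₁) / I + G₁ * (G - I) / (I * G) := by
      field_simp
      ring
    rw [e]
    have h1 : |(I₁ - G₁) / I| ≤ 2 * C / c / n := by
      rw [abs_div, abs_of_pos hI0]
      calc |I₁ - G₁| / I ≤ C / n / (c / 2) := by gcongr
        _ = 2 * C / c / n := by field_simp
    have h2 : |G₁ * (G - I) / (I * G)| ≤ 2 * C ^ 2 / c ^ 2 / n := by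
      rw [abs_div, abs_mul, abs_of_pos (mul_pos hI0 hG0), abs_sub_comm]
      calc |G₁| * |I - G| / (I * G) ≤ C * (C / n) / (c / 2 * c) := by gcongr
        _ = 2 * C ^ 2 / c ^ 2 / n := by field_simp
    rw [add_div]
    exact (abs_add_le _ _).trans (add_le_add h1 h2)

variable {E F : Type*} [NormedAddCommGroup E] [NormedSpace ℝ E] [ProperSpace E]
  [NormedAddCommGroup F] [NormedSpace ℝ F]

/-- Both functions are `O(1/√n)` perturbations, in second derivative, of the same strongly concave
function. Their gradients differ by `1/n` times a difference of logarithmic derivatives which is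
itself `O(1/n)`. -/
theorem exists_isLocalMax_add_log_div {g G : E × F → ℝ} {I : ℕ → E × F → ℝ}
    {G₁ : E × F → E → ℝ} {I₁ : ℕ → E × F → E → ℝ} {x₀ : E} {y₀ : F} {c C : ℝ} {N : ℕ}
    (hc : 0 < c) (hC : 0 ≤ C) (hg : ContDiffAt ℝ 2 g (x₀, y₀))
    (h1 : ∀ u : E, fderiv ℝ g (x₀, y₀) (u, 0) = 0)
    (h2 : ∀ u : E, ‖u‖ = 1 → fderiv ℝ (fderiv ℝ g) (x₀, y₀) (u, 0) (u, 0) < 0)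
    (hG : ContDiffAt ℝ 2 G (x₀, y₀)) {W : Set (E × F)} (hW : W ∈ 𝓝 (x₀, y₀))
    (h : ∀ z ∈ W, c ≤ G z ∧
      (∀ u, ‖u‖ = 1 → HasLineDerivAt ℝ G (G₁ z u) z (u, 0) ∧ |G₁ z u| ≤ C) ∧
      ∀ n : ℕ, N ≤ n → |I n z - G z| ≤ C / n ∧ ContinuousAt (I n) z ∧
        ∀ u, ‖u‖ = 1 → HasLineDerivAt ℝ (I n) (I₁ n z u) z (u, 0) ∧ |I₁ n z u - G₁ z u| ≤ C / n ∧
          ∃ c₂, |c₂| ≤ C * √(n : ℝ) ∧ HasLineDerivAt ℝ (fun z => I₁ n z u) c₂ z (u, 0)) :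
    ∃ (n₀ : ℕ) (r D : ℝ) (V : Set F), N ≤ n₀ ∧ 1 ≤ n₀ ∧ 0 < r ∧ IsOpen V ∧ y₀ ∈ V ∧
      ∀ n : ℕ, n₀ ≤ n → ∀ y ∈ V,
        (∀ x ∈ Metric.ball x₀ r, (x, y) ∈ W ∧ 0 < I n (x, y) ∧ 0 < G (x, y)) ∧
        ∃ x₁ ∈ Metric.ball x₀ r, ∃ x₂ ∈ Metric.ball x₀ r,
          (IsLocalMax (fun x => g (x, y) + Real.log (G (x, y)) / n) x₁ ∧
            ∀ x ∈ Metric.ball x₀ r,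
              IsLocalMax (fun x => g (x, y) + Real.log (G (x, y)) / n) x → x = x₁) ∧
          (IsLocalMax (fun x => g (x, y) + Real.log (I n (x, y)) / n) x₂ ∧
            ∀ x ∈ Metric.ball x₀ r,
              IsLocalMax (fun x => g (x, y) + Real.log (I n (x, y)) / n) x → x = x₂) ∧
          ‖x₁ - x₂‖ ≤ D / (n : ℝ) ^ 2 := by
  have hG0 : ∀ z ∈ W, 0 < G z := fun z hz => hc.trans_le (h z hz).1
  have hlog : ContDiffAt ℝ 2 (fun z => Real.log (G z)) (x₀, y₀) :=
    hG.log (hG0 _ (mem_of_mem_nhds hW)).ne'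
  obtain ⟨B, hB⟩ := hlog.eventually_fderiv_le
  obtain ⟨r, κ, hr, hκ, V, hV, hyV, hgV⟩ := hg.exists_stronglyConcaveOnBall h1 h2
    (P := fun z => z ∈ W ∧ ContDiffAt ℝ 2 (fun z => Real.log (G z)) z ∧ ∀ v, ‖v‖ ≤ 1 →
      ‖fderiv ℝ (fun z => Real.log (G z)) z v‖ ≤ B ∧
      ‖fderiv ℝ (fderiv ℝ fun z => Real.log (G z)) z v v‖ ≤ B)
    ((show ∀ᶠ z in 𝓝 (x₀, y₀), z ∈ W from hW).and ((hlog.eventually (by simp)).and hB))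
  -- `A` bounds the first derivatives of both logarithms, and `A √n` their second derivatives.
  set A := (2 * C / c + (4 * C / c) ^ 2) + 4 * C / c + |B| with hA
  have hA0 : 0 ≤ A := by positivity
  have hlim : Tendsto (fun n : ℕ => A * √(n : ℝ) / n) atTop (𝓝 0) := by
    have h3 : Tendsto (fun n : ℕ => A * (√(n : ℝ))⁻¹) atTop (𝓝 (A * 0)) :=
      ((tendsto_inv_atTop_zero.comp Real.tendsto_sqrt_atTop).comp
        tendsto_natCast_atTop_atTop).const_mul A
    rw [mul_zero] at h3
    refine h3.congr fun n => ?_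
    rw [mul_div_assoc, Real.sqrt_div_self]
  have hlim' : Tendsto (fun n : ℕ => C / (n : ℝ)) atTop (𝓝 0) :=
    tendsto_const_div_atTop_nhds_zero_nat C
  obtain ⟨n₁, hn₁⟩ := eventually_atTop.1 (((hlim.eventually (gt_mem_nhds hκ)).and
    (hlim.eventually (gt_mem_nhds (show 0 < κ * r / 8 by positivity)))).and
    (hlim'.eventually (gt_mem_nhds (show 0 < c / 2 by positivity))))
  refine ⟨max n₁ (max N 1), r, (2 * C / c + 2 * C ^ 2 / c ^ 2) / κ, V,
    (le_max_left _ _).trans (le_max_right _ _), (le_max_right _ _).trans (le_max_right _ _),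
    hr, hV, hyV, fun n hn y hy => ?_⟩
  obtain ⟨⟨l1, l2⟩, l3⟩ := hn₁ n ((le_max_left _ _).trans hn)
  have hNn : N ≤ n := (le_max_left _ _).trans ((le_max_right _ _).trans hn)
  have hn1 : (1 : ℝ) ≤ n := by
    exact_mod_cast ((le_max_right N 1).trans (le_max_right _ _)).trans hn
  have hn0 : (0 : ℝ) < n := by linarith
  have hs : 1 ≤ √(n : ℝ) := Real.one_le_sqrt.2 hn1
  obtain ⟨hP, hgc, hconc, hcrit⟩ := hgV y hy
  have hx₀ : x₀ ∈ Metric.ball x₀ r := Metric.mem_ball_self hr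
  have hunit : ∀ u : E, ‖u‖ = 1 → ‖((u, 0) : E × F)‖ ≤ 1 := fun u hu => by
    simp [Prod.norm_def, hu]
  have key : ∀ x ∈ Metric.ball x₀ r, ∀ u, ‖u‖ = 1 → ∃ c₂,
      HasLineDerivAt ℝ (fun z => I₁ n z u) c₂ (x, y) (u, 0) ∧ c / 2 ≤ I n (x, y) ∧
        |I₁ n (x, y) u / I n (x, y)| ≤ 4 * C / c ∧
        |c₂ / I n (x, y) - (I₁ n (x, y) u / I n (x, y)) ^ 2| ≤
          (2 * C / c + (4 * C / c) ^ 2) * √(n : ℝ) ∧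
        |I₁ n (x, y) u / I n (x, y) - G₁ (x, y) u / G (x, y)| ≤
          (2 * C / c + 2 * C ^ 2 / c ^ 2) / n := fun x hx u hu => by
    obtain ⟨k1, k2, k3⟩ := h _ (hP x hx).1
    obtain ⟨k4, -, k5⟩ := k3 n hNn
    obtain ⟨-, k6, c₂, k7, k8⟩ := k5 u hu
    exact ⟨c₂, k8, abs_div_le_of_close hc hC hn1 l3.le k1 (k2 u hu).2 k4 k6 k7⟩
  have hIpos : ∀ x ∈ Metric.ball x₀ r, 0 < I n (x, y) := fun x hx => by
    have k1 := (h _ (hP x hx).1).1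
    have k4 := ((h _ (hP x hx).1).2.2 n hNn).1
    linarith [(abs_le.1 k4).1]
  have hsmall : A / n ≤ κ * r / 8 := by
    refine le_trans ?_ l2.le
    gcongr
    exact le_mul_of_one_le_right hA0 hs
  have hAC : 4 * C / c ≤ A := by
    have : 0 ≤ 2 * C / c + (4 * C / c) ^ 2 := by positivity
    have := abs_nonneg B
    simp only [hA]; linarith
  have hAB : B ≤ A := by
    have : 0 ≤ 2 * C / c + (4 * C / c) ^ 2 + 4 * C / c := by positivity
    have := le_abs_self B
    simp only [hA]; linarith
  have hAS : 2 * C / c + (4 * C / c) ^ 2 ≤ A := by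
    have : 0 ≤ 4 * C / c := by positivity
    have := abs_nonneg B
    simp only [hA]; linarith
  have hI : StronglyConcaveOnBall (fun x => g (x, y) + Real.log (I n (x, y)) / n)
      (fun x u => fderiv ℝ g (x, y) (u, 0) + I₁ n (x, y) u / I n (x, y) / n) x₀ r κ := by
    refine hconc.add_div (ℓ := fun x => Real.log (I n (x, y)))
      (ℓ₁ := fun x u => I₁ n (x, y) u / I n (x, y)) (A := A * √(n : ℝ)) hn0 (fun x hx u hu => ?_)
      l1.le
    obtain ⟨c₂, m1, m2, -, m3, -⟩ := key x hx u hu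
    obtain ⟨d1, d2⟩ := HasLineDerivAt.log_div (f := fun x => I n (x, y))
      (f₁ := fun x => I₁ n (x, y) u)
      (((h _ (hP x hx).1).2.2 n hNn).2.2 u hu).1.slice
      (HasLineDerivAt.slice (f := fun z => I₁ n z u) m1) (hIpos x hx).ne'
    refine ⟨d1, _, m3.trans ?_, d2⟩
    gcongr
  have hGc : StronglyConcaveOnBall (fun x => g (x, y) + Real.log (G (x, y)) / n)
      (fun x u => fderiv ℝ g (x, y) (u, 0) + fderiv ℝ (fun z => Real.log (G z)) (x, y) (u, 0) / n)
      x₀ r κ := by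
    refine hconc.add_div (ℓ := fun x => Real.log (G (x, y)))
      (ℓ₁ := fun x u => fderiv ℝ (fun z => Real.log (G z)) (x, y) (u, 0)) (A := A * √(n : ℝ)) hn0
      (fun x hx u hu => ?_) l1.le
    obtain ⟨-, k1, k2⟩ := hP x hx
    refine ⟨((k1.differentiableAt (by norm_num)).hasFDerivAt.hasLineDerivAt _).slice, _, ?_,
      HasLineDerivAt.slice (f := fun z => fderiv ℝ (fun z => Real.log (G z)) z (u, 0))
        (k1.hasLineDerivAt_fderiv (u, 0) (u, 0))⟩
    have := (k2 (u, 0) (hunit u hu)).2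
    rw [Real.norm_eq_abs] at this
    exact (this.trans hAB).trans (le_mul_of_one_le_right hA0 hs)
  have hslice : ContinuousOn (fun x : E => (x, y)) (Metric.ball x₀ r) := by fun_prop
  have hIcont : ContinuousOn (fun x => g (x, y) + Real.log (I n (x, y)) / n)
      (Metric.ball x₀ r) := by
    refine hgc.add (ContinuousOn.div_const (ContinuousOn.log (fun x hx => ?_)
      fun x hx => (hIpos x hx).ne') _)
    exact (ContinuousAt.comp (f := fun x => (x, y)) ((h _ (hP x hx).1).2.2 n hNn).2.1
      (continuousAt_id.prodMk continuousAt_const)).continuousWithinAt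
  have hGcont : ContinuousOn (fun x => g (x, y) + Real.log (G (x, y)) / n)
      (Metric.ball x₀ r) := by
    refine hgc.add (ContinuousOn.div_const (fun x hx => ?_) _)
    exact (ContinuousAt.comp (f := fun x => (x, y)) (hP x hx).2.1.continuousAt
      (continuousAt_id.prodMk continuousAt_const)).continuousWithinAt
  have hstart : ∀ {a b : ℝ}, |a| ≤ κ * r / 8 → |b| ≤ A → |a + b / n| ≤ κ * r / 4 :=
    fun {a b} ha hb => by
    have e1 : |b / n| ≤ A / n := by
      rw [abs_div, abs_of_pos hn0]
      gcongr
    have := abs_add_le a (b / n)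
    linarith
  obtain ⟨x₁, hx₁, hm₁, hu₁⟩ := hGc.exists_unique_isLocalMax hr hκ hGcont fun u hu =>
    hstart (hcrit u hu) (((hP x₀ hx₀).2.2 (u, 0) (hunit u hu)).1.trans hAB)
  obtain ⟨x₂, hx₂, hm₂, hu₂⟩ := hI.exists_unique_isLocalMax hr hκ hIcont fun u hu => by
    obtain ⟨c₂, -, -, m2, -⟩ := key x₀ hx₀ u hu
    exact hstart (hcrit u hu) (m2.trans hAC)
  refine ⟨fun x hx => ⟨(hP x hx).1, hIpos x hx, hG0 _ (hP x hx).1⟩, x₁, hx₁, x₂, hx₂, ⟨hm₁, hu₁⟩,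
    ⟨hm₂, hu₂⟩, ?_⟩
  -- One factor `1/n` comes from the closeness of the logarithmic derivatives, the other from the
  -- division of the logarithms by `n`.
  refine (hGc.norm_sub_le (ε := (2 * C / c + 2 * C ^ 2 / c ^ 2) / n / n) hκ (by positivity) hI
    (fun x hx u hu => ?_) hx₁ hx₂ hm₁ hm₂).trans_eq (by field_simp)
  obtain ⟨c₂, -, -, -, -, m4⟩ := key x hx u hu
  have k1 := ((h _ (hP x hx).1).2.1 u hu).1
  have hpos := hG0 _ (hP x hx).1
  have k2 : HasDerivAt (fun t : ℝ => Real.log (G ((x, y) + t • (u, (0 : F)))))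
      (G₁ (x, y) u / G (x, y)) 0 := by
    have := HasDerivAt.log k1 (by simpa using hpos.ne')
    simpa using this
  have k3 : fderiv ℝ (fun z => Real.log (G z)) (x, y) (u, 0) = G₁ (x, y) u / G (x, y) :=
    HasDerivAt.unique (((hP x hx).2.1.differentiableAt
      (by norm_num)).hasFDerivAt.hasLineDerivAt (u, (0 : F))) k2
  rw [k3, add_sub_add_left_eq_sub, ← sub_div, abs_div, abs_of_pos hn0, abs_sub_comm]
  gcongr

end LogPerturbation

/-! ### The theorem -/

open Saddlepoint in
theorem mainTheorem3 {m p : ℕ}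
    (Θ : Set (Saddlepoint.Vec p)) (hΘ : IsOpen Θ)
    (μ : Saddlepoint.Vec p → Measure (Saddlepoint.Vec m))
    (hμ : ∀ θ ∈ Θ, IsProbabilityMeasure (μ θ))
    (hdecay : Saddlepoint.DecayBound Θ μ)
    (hgrowth : Saddlepoint.GrowthBound Θ μ)
    (s₀ : Saddlepoint.Vec m) (θ₀ : Saddlepoint.Vec p) (y₀ : Saddlepoint.Vec m)
    (hs₀ : (s₀, θ₀) ∈ interior (Saddlepoint.modelDomain Θ μ))
    (hy₀ : HasGradientAt (Saddlepoint.cgf (μ θ₀)) y₀ s₀)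
    (hcrit : HasGradientAt (fun θ => Saddlepoint.cgf (μ θ) s₀) 0 θ₀)
    (hH : (-Saddlepoint.rateHessian μ s₀ θ₀).PosDef) :
    ∃ (n₀ : ℕ) (U : Set (Saddlepoint.Vec p)) (V : Set (Saddlepoint.Vec m)) (C : ℝ),
      IsOpen U ∧ θ₀ ∈ U ∧ U ⊆ Θ ∧ IsOpen V ∧ y₀ ∈ V ∧
      ∀ n : ℕ, n₀ ≤ n → ∀ y ∈ V,
        -- both likelihoods are well defined throughout `U`
        (∀ θ ∈ U,
          (∃ f, Saddlepoint.IsContDensity (Saddlepoint.sumLaw (μ θ) n) f) ∧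
          (∃ s, Saddlepoint.IsSaddlepoint (Saddlepoint.sumLaw (μ θ) n) ((n : ℝ) • y) s ∧
            (s, θ) ∈ interior (Saddlepoint.modelDomain Θ μ) ∧
            (Saddlepoint.hessian
              (Saddlepoint.cgf (Saddlepoint.sumLaw (μ θ) n)) s).PosDef ∧
            ∀ s', Saddlepoint.IsSaddlepoint (Saddlepoint.sumLaw (μ θ) n) ((n : ℝ) • y) s' →
              s' = s)) ∧
        -- they have unique local maximisers in `U`, at distance at most `C / n ^ 2`
        ∃ θsp ∈ U, ∃ θml ∈ U,
          (IsLocalMax (Saddlepoint.saddlepointLikelihood μ n ((n : ℝ) • y)) θsp ∧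
            ∀ θ ∈ U, IsLocalMax (Saddlepoint.saddlepointLikelihood μ n ((n : ℝ) • y)) θ →
              θ = θsp) ∧
          (IsLocalMax (Saddlepoint.likelihood μ n ((n : ℝ) • y)) θml ∧
            ∀ θ ∈ U, IsLocalMax (Saddlepoint.likelihood μ n ((n : ℝ) • y)) θ →
              θ = θml) ∧
          ‖θsp - θml‖ ≤ C / (n : ℝ) ^ 2 := by
  have h := hgrowth.mgfSmooth
  obtain ⟨σ, W, δ, B, κ, hδ, hB, hσ₀, hz₀, hC⟩ := exists_isSaddlepointChart hμ hdecay hgrowth hs₀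
  -- The chart is centred at the tilted mean, which is `y₀` by uniqueness of the gradient.
  have hmean : tiltedMean μ (s₀, θ₀) = y₀ := (h.hasGradientAt_cgf hμ hs₀).unique hy₀
  rw [hmean] at hσ₀ hz₀
  have hfam := hC.laplaceFamily hB hδ h hμ
  obtain ⟨N, C', c, hN, hC', hc, hbounds⟩ :=
    hfam.exists_bounds hC.isOpen hδ (by positivity)
  -- `N'` makes `ρⁿ` integrable, so that the density exists and the saddlepoint is unique.
  obtain ⟨N', _, -, -, hw⟩ := exists_laplaceWeight_bounds (V := Vec m) hδ 0 0
  have hS : ∀ u : Vec p, ‖u‖ = 1 → ((u, 0) : Vec p × Vec m) ∈ {v : Vec p × Vec m |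
      ‖v.1‖ ≤ 1 ∧ v.2 = 0} := fun u hu => ⟨hu.le, rfl⟩
  obtain ⟨n₀, r, D, V, -, hn₀, hr, hV, hyV, hmain⟩ := exists_isLocalMax_add_log_div
    (g := chartRate μ σ) (G := fun z => gaussInt (tiltedCovForm μ (σ z, z.1)))
    (I := fun n z => laplaceInt n (tiltedChar μ (σ z, z.1))) (x₀ := θ₀) (y₀ := y₀) (N := N) hc hC'
    (hC.contDiffAt_chartRate h hμ hz₀) (fun u => by
      rw [hC.fderiv_chartRate h hμ hz₀]
      simp only [hσ₀]
      have h1 := ((h.contDiffAt_modelCgf hμ hs₀).differentiableAt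
        (by norm_num)).hasFDerivAt.hasLineDerivAt (0, u)
      have h2 : HasDerivAt (fun t : ℝ => modelCgf μ ((s₀, θ₀) + t • ((0 : Vec m), u))) 0 0 := by
        have h3 := hcrit.hasFDerivAt.hasLineDerivAt u
        refine (HasDerivAt.congr_of_eventuallyEq h3 (Eventually.of_forall fun t => ?_)).congr_deriv
          (by simp)
        simp [modelCgf]
      exact HasDerivAt.unique h1 h2)
    (fun u hu => by
      rw [hC.fderiv_fderiv_chartRate h hμ hdecay hgrowth hz₀]
      simp only [hσ₀]
      have h1 := hH.dotProduct_mulVec_pos (x := u.ofLp) (by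
        intro h0
        have : u = 0 := by ext i; simpa using congrFun h0 i
        simp [this] at hu)
      simp only [star_trivial, Matrix.neg_mulVec, dotProduct_neg] at h1
      linarith)
    (hC.contDiffAt_gaussInt hμ hdecay hgrowth hz₀) (hC.isOpen.mem_nhds hz₀)
    (fun z hz => ⟨(hbounds z hz).1, fun u hu => (hbounds z hz).2.1 _ (hS u hu), fun n hn =>
      ⟨((hbounds z hz).2.2 n hn).1, ((hbounds z hz).2.2 n hn).2.1, fun u hu =>
        ((hbounds z hz).2.2 n hn).2.2 _ (hS u hu)⟩⟩)
  refine ⟨max n₀ N', Metric.ball θ₀ r, V, D, Metric.isOpen_ball, Metric.mem_ball_self hr,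
    fun θ hθ => ?_, hV, hyV, fun n hn y hy => ?_⟩
  · have hW := ((hmain n₀ le_rfl y₀ hyV).1 θ hθ).1
    exact (interior_subset (hC.mem _ hW)).1
  obtain ⟨hU, θ₁, hθ₁, θ₂, hθ₂, ⟨hm₁, hu₁⟩, ⟨hm₂, hu₂⟩, hdist⟩ :=
    hmain n ((le_max_left _ _).trans hn) y hy
  have hnpos : 0 < n := lt_of_lt_of_le hn₀ ((le_max_left _ _).trans hn)
  have hn0 : (0 : ℝ) < n := by exact_mod_cast hnpos
  have hi : ∀ z ∈ W, Integrable fun φ => tiltedChar μ (σ z, z.1) φ ^ n := fun z hz =>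
    ((hw n ((le_max_right _ _).trans hn) 0 le_rfl).1).mono'
      ((hfam.pair z hz).cont.pow n).aestronglyMeasurable
      (Eventually.of_forall fun φ => (hfam.pair z hz).norm_pow_le_weight hδ 0 n φ)
  -- The common prefactor does not depend on `θ`, so it moves no maximiser.
  set k : ℝ := ((2 * Real.pi) ^ m)⁻¹ * (√(n : ℝ) ^ m)⁻¹ with hk
  have hk0 : 0 < k := by positivity
  have hexp : ∀ {a b : ℝ}, 0 < b →
      Real.exp (n * a) * k * b = k * Real.exp (n * (a + Real.log b / n)) := fun {a b} hb => by
    rw [mul_add, mul_div_cancel₀ _ hn0.ne', Real.exp_add, Real.exp_log hb]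
    ring
  have hsp : ∀ {θ}, θ ∈ Metric.ball θ₀ r →
      (IsLocalMax (saddlepointLikelihood μ n ((n : ℝ) • y)) θ ↔ IsLocalMax (fun θ =>
        chartRate μ σ (θ, y) + Real.log (gaussInt (tiltedCovForm μ (σ (θ, y), θ))) / n) θ) :=
    isLocalMax_iff_of_eq_mul_exp Metric.isOpen_ball hk0 hn0 fun θ hθ => by
      obtain ⟨k1, -, k2⟩ := hU θ hθ
      rw [← hexp k2]
      exact hC.saddlepointLikelihood_eq hμ hdecay hgrowth k1 hnpos (hi _ k1)
  have hml : ∀ {θ}, θ ∈ Metric.ball θ₀ r →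
      (IsLocalMax (likelihood μ n ((n : ℝ) • y)) θ ↔ IsLocalMax (fun θ =>
        chartRate μ σ (θ, y) + Real.log (laplaceInt n (tiltedChar μ (σ (θ, y), θ))) / n) θ) :=
    isLocalMax_iff_of_eq_mul_exp Metric.isOpen_ball hk0 hn0 fun θ hθ => by
      obtain ⟨k1, k2, -⟩ := hU θ hθ
      rw [← hexp k2]
      exact hC.likelihood_eq hμ k1 hnpos (hi _ k1)
  refine ⟨fun θ hθ => ?_, θ₁, hθ₁, θ₂, hθ₂,
    ⟨(hsp hθ₁).2 hm₁, fun θ hθ hmax => hu₁ θ hθ ((hsp hθ).1 hmax)⟩,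
    ⟨(hml hθ₂).2 hm₂, fun θ hθ hmax => hu₂ θ hθ ((hml hθ).1 hmax)⟩, hdist⟩
  have hW := (hU θ hθ).1
  obtain ⟨f, hf, -⟩ := hC.exists_isContDensity hμ hW hnpos (hi _ hW)
  refine ⟨⟨f, hf⟩, σ (θ, y), hC.isSaddlepoint h hμ hW n, hC.mem _ hW, ?_, fun s' hs' =>
    hC.eq_of_isSaddlepoint h hμ hW hnpos (hi _ hW) hs'⟩
  have := hC.hessian_sumLaw h hμ hW n
  rw [this]
  exact (posDef_tiltedCov hμ hdecay hgrowth (hC.mem _ hW)).smul hn0
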